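/- **Setting.** Let $a>0$, $0<\alpha\neq 1$, $\rho(x)=\alpha^2$ for $0\le x<a$ and $\rho(x)=1$ for $x\ge a$. Let $q:[0,\infty)\to\mathbb R$ be measurable with $\int_0^\infty(1+x)|q(x)|\,dx<\infty$, and let $\alpha_j,\beta_j$ $(j=0,1,2)$ be real numbers with $\delta_1=\alpha_0\beta_1-\alpha_1\beta_0\le 0$, $\delta_2=\alpha_0\beta_2-\alpha_2\beta_0\le 0$, $\delta_3=\alpha_1\beta_2-\alpha_2\beta_1\ge 0$. Consider $$-y''+q(x)y=\lambda^2\rho(x)y\quad (x\ge 0),\qquad B(\lambda)y'(0)+A(\lambda)y(0)=0,$$ with $B(\lambda)=\beta_0+i\beta_1\lambda+\beta_2\lambda^2$ and $A(\lambda)=\alpha_0+i\alpha_1\lambda+\alpha_2\lambda^2$. Put $\tau=\frac{\alpha-1}{\alpha+1}$, $\mu^{\pm}(x)=\pm x\sqrt{\rho(x)}+a(1\mp\sqrt{\rho(x)})$ and $$e_0(x,\lambda)=\tfrac12\Big(1+\tfrac1{\sqrt{\rho(x)}}\Big)e^{i\lambda\mu^+(x)}+\tfrac12\Big(1-\tfrac1{\sqrt{\rho(x)}}\Big)e^{i\lambda\mu^-(x)}.$$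 For $\operatorname{Im}\lambda\ge0$ let $e(x,\lambda)$ be the Jost solution, i.e. the solution of the differential equation with $e^{-i\lambda x}e(x,\lambda)\to1$ as $x\to\infty$, and let $K$ be the kernel of its representation $$e(x,\lambda)=e_0(x,\lambda)+\int_{\mu^+(x)}^\infty K(x,t)e^{i\lambda t}\,dt\qquad(x\ge0,\ \operatorname{Im}\lambda\ge0),\qquad K(x,\cdot)\in L_1(\mu^+(x),\infty),$$ where $K(x,t)$ is read as $0$ for $t\le\mu^+(x)$. Let $E(\lambda)=B(\lambda)e'(0,\lambda)+A(\lambda)e(0,\lambda)$ and, for real $\lambda$, $$S(\lambda)=\frac{B(\lambda)\overline{e'(0,\lambda)}+A(\lambda)\overline{e(0,\lambda)}}{E(\lambda)},\qquad S_0(\lambda)=\begin{cases}\overline{e_0(0,\lambda)}/e_0(0,\lambda)=e^{-2i\lambda a}\dfrac{1+\tau e^{-2i\lambda\alpha a}}{e^{-2i\lambda\alpha a}+\tau},&\beta_2=0,\\[2mm] \overline{e_0'(0,\lambda)}/e_0'(0,\lambda)=-e^{-2i\lambda a}\dfrac{1-\tau e^{-2i\lambda\alpha a}}{e^{-2i\lambda\alpha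 a}-\tau},&\beta_2\ne0.\end{cases}$$ Let $\lambda_1,\lambda_2,\dots$ be the numbers $\lambda_k>0$ with $E(i\lambda_k)=0$. Assume that $\beta_0-\beta_1\lambda_k-\beta_2\lambda_k^2\neq0$ for each of them, and let $$m_k^{-2}=\int_0^\infty|e(x,i\lambda_k)|^2\rho(x)\,dx-\frac{|e(0,i\lambda_k)|^2\,(\delta_1+2\delta_2\lambda_k-\delta_3\lambda_k^2)}{2\lambda_k(\beta_0-\beta_1\lambda_k-\beta_2\lambda_k^2)^2}.$$ **Theorem.** There are only finitely many numbers $\lambda_k$, say $k=1,\dots,n$; the integral in $m_k^{-2}$ converges and $m_k^{-2}>0$; the function $S_0-S$ is essentially bounded on $\mathbb R$; and its Fourier transform $$F_{0s}(x)=\frac1{2\pi}\int_{-\infty}^{\infty}\big[S_0(\lambda)-S(\lambda)\big]e^{i\lambda x}\,d\lambda ,$$ taken in the sense of distributions, is on the half-line $x>2\mu^+(0)$ a locally integrable function. Put $$F_0(x)=F_{0s}(x)+\sum_{k=1}^n m_k^2e^{-\lambda_kx},\qquad F(x,y)=F_s(x,y)+\sum_{k=1}^n m_k^2\,e_0(x,i\lambda_k)e^{-\lambda_ky},$$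 $$F_s(x,y)=\tfrac12\Big(1+\tfrac1{\sqrt{\rho(x)}}\Big)F_{0s}(y+\mu^+(x))+\tfrac12\Big(1-\tfrac1{\sqrt{\rho(x)}}\Big)F_{0s}(y+\mu^-(x)).$$ Then, for every $x\ge0$ and almost every $y>\mu^+(x)$, the integral below converges absolutely and $$F(x,y)+K(x,y)+\int_{\mu^+(x)}^\infty K(x,t)F_0(t+y)\,dt-\tau K(x,2a-y)=0.$$ -/

import Mathlib

open MeasureTheory Set Filter Topology
open scoped ContDiff ComplexConjugate

noncomputable section

/-- The data of the boundary value problem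
`-y'' + q(x) y = λ² ρ(x) y` on `[0, ∞)`, with `ρ = α²` on `[0, a)` and `ρ = 1` on `[a, ∞)`, and
`(β₀ + i β₁ λ + β₂ λ²) y'(0) + (α₀ + i α₁ λ + α₂ λ²) y(0) = 0`. -/
structure SLProblem where
  a : ℝ
  α : ℝ
  q : ℝ → ℝ
  α₀ : ℝ
  α₁ : ℝ
  α₂ : ℝ
  β₀ : ℝ
  β₁ : ℝ
  β₂ : ℝ

namespace SLProblem

variable (P : SLProblem)

def δ₁ : ℝ := P.α₀ * P.β₁ - P.α₁ * P.β₀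

def δ₂ : ℝ := P.α₀ * P.β₂ - P.α₂ * P.β₀

def δ₃ : ℝ := P.α₁ * P.β₂ - P.α₂ * P.β₁

/-- The standing assumptions on the data. -/
structure Admissible : Prop where
  a_pos : 0 < P.a
  α_pos : 0 < P.α
  α_ne_one : P.α ≠ 1
  q_integrable : IntegrableOn (fun x => (1 + x) * P.q x) (Ioi 0)
  δ₁_nonpos : P.δ₁ ≤ 0
  δ₂_nonpos : P.δ₂ ≤ 0
  δ₃_nonneg : 0 ≤ P.δ₃

def ρ (x : ℝ) : ℝ := if x < P.a then P.α ^ 2 else 1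

def τ : ℝ := (P.α - 1) / (P.α + 1)

/-- `μ⁺(x) = x √ρ(x) + a (1 - √ρ(x))`. -/
def μp (x : ℝ) : ℝ := x * √(P.ρ x) + P.a * (1 - √(P.ρ x))

/-- `μ⁻(x) = -x √ρ(x) + a (1 + √ρ(x))`. -/
def μm (x : ℝ) : ℝ := -x * √(P.ρ x) + P.a * (1 + √(P.ρ x))

/-- The Jost solution for `q = 0`. -/
def e₀ (x : ℝ) (z : ℂ) : ℂ :=
  ((1 / 2 * (1 + 1 / √(P.ρ x)) : ℝ) : ℂ) * Complex.exp (Complex.I * z * (P.μp x : ℂ)) +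
  ((1 / 2 * (1 - 1 / √(P.ρ x)) : ℝ) : ℂ) * Complex.exp (Complex.I * z * (P.μm x : ℂ))

/-- `y` solves `-y'' + q y = z² ρ y` on `[0, ∞)` in the Carathéodory sense: `y` is differentiable,
and `y'` is an absolutely continuous function whose derivative is a.e. `(q - z² ρ) y`
(written as an integral equation). Derivatives at `0` are one-sided. -/
structure IsSolution (z : ℂ) (y : ℝ → ℂ) : Prop where
  differentiableOn : DifferentiableOn ℝ y (Ici 0)
  eqn : ∀ x : ℝ, 0 ≤ x → derivWithin y (Ici 0) x = derivWithin y (Ici 0) 0 +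
    ∫ t in (0 : ℝ)..x, ((P.q t : ℂ) - z ^ 2 * (P.ρ t : ℂ)) * y t

/-- `e(·, z)` is the Jost solution for every `z` in the closed upper half-plane: the solution
with `e(x, z) e^{-izx} → 1` as `x → ∞`. -/
structure IsJostSolution (e : ℝ → ℂ → ℂ) : Prop where
  isSolution : ∀ z : ℂ, 0 ≤ z.im → P.IsSolution z (fun x => e x z)
  asymptotic : ∀ z : ℂ, 0 ≤ z.im →
    Tendsto (fun x : ℝ => Complex.exp (-(Complex.I * z * (x : ℂ))) * e x z) atTop (𝓝 1)

/-- `K` is the kernel of the representation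
`e(x, z) = e₀(x, z) + ∫_{μ⁺(x)}^∞ K(x, t) e^{izt} dt` with `K(x, ·) ∈ L₁(μ⁺(x), ∞)`. -/
structure IsJostKernel (e : ℝ → ℂ → ℂ) (K : ℝ → ℝ → ℂ) : Prop where
  integrable : ∀ x : ℝ, 0 ≤ x → IntegrableOn (K x) (Ioi (P.μp x))
  representation : ∀ x : ℝ, 0 ≤ x → ∀ z : ℂ, 0 ≤ z.im →
    e x z = P.e₀ x z + ∫ t in Ioi (P.μp x), K x t * Complex.exp (Complex.I * z * (t : ℂ))

/-- `β₀ + i β₁ z + β₂ z²`. -/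
def bcβ (z : ℂ) : ℂ := (P.β₀ : ℂ) + Complex.I * (P.β₁ : ℂ) * z + (P.β₂ : ℂ) * z ^ 2

/-- `α₀ + i α₁ z + α₂ z²`. -/
def bcα (z : ℂ) : ℂ := (P.α₀ : ℂ) + Complex.I * (P.α₁ : ℂ) * z + (P.α₂ : ℂ) * z ^ 2

/-- `E(z)`; here `e` is the Jost solution. -/
def E (e : ℝ → ℂ → ℂ) (z : ℂ) : ℂ :=
  P.bcβ z * derivWithin (fun x => e x z) (Ici 0) 0 + P.bcα z * e 0 z

/-- The scattering function `S(l)`, for real `l`. -/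
def S (e : ℝ → ℂ → ℂ) (l : ℝ) : ℂ :=
  (P.bcβ l * conj (derivWithin (fun x => e x l) (Ici 0) 0) + P.bcα l * conj (e 0 l)) / P.E e l

/-- `S₀(l)`: it is `conj e₀(0, l) / e₀(0, l)` if `β₂ = 0`, and
`conj e₀'(0, l) / e₀'(0, l)` if `β₂ ≠ 0`, in closed form. -/
def S₀ (l : ℝ) : ℂ :=
  if P.β₂ = 0 then
    Complex.exp (-(2 * Complex.I * l * P.a)) *
      ((1 + P.τ * Complex.exp (-(2 * Complex.I * l * P.α * P.a))) /
        (Complex.exp (-(2 * Complex.I * l * P.α * P.a)) + P.τ))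
  else
    -(Complex.exp (-(2 * Complex.I * l * P.a)) *
      ((1 - P.τ * Complex.exp (-(2 * Complex.I * l * P.α * P.a))) /
        (Complex.exp (-(2 * Complex.I * l * P.α * P.a)) - P.τ)))

/-- The numbers `λ_k > 0` for which `i λ_k` is a zero of `E`. -/
def eigenvalues (e : ℝ → ℂ → ℂ) : Set ℝ := {κ | 0 < κ ∧ P.E e (Complex.I * κ) = 0}

/-- The number `m_k⁻²` that belongs to `λ_k = κ`. -/
def normInvSq (e : ℝ → ℂ → ℂ) (κ : ℝ) : ℝ :=
  (∫ x in Ioi (0 : ℝ), ‖e x (Complex.I * κ)‖ ^ 2 * P.ρ x) -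
    ‖e 0 (Complex.I * κ)‖ ^ 2 * (P.δ₁ + 2 * P.δ₂ * κ - P.δ₃ * κ ^ 2) /
      (2 * κ * (P.β₀ - P.β₁ * κ - P.β₂ * κ ^ 2) ^ 2)

/-- The number `m_k²`, the square of the normalizing number. -/
def normSq (e : ℝ → ℂ → ℂ) (κ : ℝ) : ℝ := (P.normInvSq e κ)⁻¹

/-- On the open set `U` the function `f` is
`f(x) = (1 / 2π) ∫_{-∞}^{∞} g(l) e^{ilx} dl`, in the sense of distributions. -/
def _root_.IsInverseFourierOn (g : ℝ → ℂ) (U : Set ℝ) (f : ℝ → ℂ) : Prop :=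
  LocallyIntegrableOn f U ∧
  ∀ φ : ℝ → ℂ, ContDiff ℝ ∞ φ → HasCompactSupport φ → tsupport φ ⊆ U →
    ∫ x, f x * φ x =
      ((1 / (2 * Real.pi) : ℝ) : ℂ) *
        ∫ l : ℝ, g l * ∫ x : ℝ, φ x * Complex.exp (Complex.I * l * x)

/-- `F_{0s}(x) = (1 / 2π) ∫ (S₀(l) - S(l)) e^{ilx} dl` on the half-line `x > 2 μ⁺(0)`, which
contains every argument at which the main equation uses it. -/
def IsF₀s (e : ℝ → ℂ → ℂ) (F₀s : ℝ → ℂ) : Prop :=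
  IsInverseFourierOn (fun l => P.S₀ l - P.S e l) (Ioi (2 * P.μp 0)) F₀s

/-- `F₀(x) = F_{0s}(x) + ∑ m_k² e^{-λ_k x}`. -/
def F₀ (e : ℝ → ℂ → ℂ) (F₀s : ℝ → ℂ) (x : ℝ) : ℂ :=
  F₀s x + ∑ᶠ κ ∈ P.eigenvalues e, ((P.normSq e κ * Real.exp (-(κ * x)) : ℝ) : ℂ)

def Fs (F₀s : ℝ → ℂ) (x y : ℝ) : ℂ :=
  ((1 / 2 * (1 + 1 / √(P.ρ x)) : ℝ) : ℂ) * F₀s (y + P.μp x) +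
  ((1 / 2 * (1 - 1 / √(P.ρ x)) : ℝ) : ℂ) * F₀s (y + P.μm x)

/-- `F(x, y) = F_s(x, y) + ∑ m_k² e₀(x, i λ_k) e^{-λ_k y}`. -/
def F (e : ℝ → ℂ → ℂ) (F₀s : ℝ → ℂ) (x y : ℝ) : ℂ :=
  P.Fs F₀s x y + ∑ᶠ κ ∈ P.eigenvalues e,
    (P.normSq e κ : ℂ) * P.e₀ x (Complex.I * κ) * (Real.exp (-(κ * y)) : ℂ)

end SLProblem

end

/-! Write w(x, λ) = e(x, -λ) - S(λ) e(x, λ) for real λ, where e(x, -λ) is the conjugate of e(x, λ).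
If φ is the solution with φ(0) = B and φ'(0) = -A, the Wronskian 2iλ of e(·, λ) and e(·, -λ) gives w
= 2iλφ/E. The main equation is this identity seen through the Fourier transform in two ways.

Contour side. Multiply w by the Fourier-Laplace transform of a test function ψ supported in (μ⁺(x),
∞) and move the line of integration upwards. In the upper half-plane φ/E grows like exp(Im z μ⁺(x))
and the transform of ψ decays like exp(-Im z μ⁺(x)) / (1 + |z|²), so only the poles iλ_k remain.
Lagrange's identity evaluates the derivative of E at iλ_k and produces m_k² in the residues
(`IsJostKernel.tendsto_E_div`, `IsJostKernel.contour`).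

Nothing is assumed about other zeros of E or about its zeros on the real axis. The sign conditions
on δ₁, δ₂, δ₃ and Lagrange's identity give a lower bound for |Re z| |E| (`IsJostSolution.lower_E`).
It shows that off the imaginary axis E vanishes only at common zeros of A and B, where φ vanishes
too, and that |Re z| |zφ/E| = O(|z|) on bounded sets. After the poles are subtracted, a maximum
principle turns this into boundedness (`norm_le_of_abs_re_mul_le`, `integral_boundary_eq_zero`). The
same relations give |S| ≤ 1, m_k⁻² > 0 and, by comparing two small eigenvalues, finiteness.

Fourier side. Insert the kernel representation of e. The leading part of S at infinity is `Sap r`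
for some r in [-1, 1]. It splits as τ exp(-2iaλ) + `Hp r`, where `Hp r` is holomorphic in the upper
half-plane and contributes nothing against ψ (`Admissible.Sap_eq`, `IsJostKernel.hasInt_Hp_mul`).
The exponential produces the term τ K(x, 2a - y). The rest `Sap r` - S is O(1/λ) at infinity, hence
square integrable, and its inverse transform f gives the terms with F_{0s}. The function S₀ of the
statement is `Sap` with r = ±1, so replacing it by the true leading part changes F_{0s} by nothing
on the half-line x > 2μ⁺(0) (`IsLeading.exists_isF₀s`).

Equality of the two sides for all ψ is the main equation almost everywhere
(`IsJostKernel.weak_equation`, `IsJostKernel.ae_equation`). -/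

noncomputable section

/-! ### Calculus of primitives, and Gronwall's inequality with an integrable weight -/

/-- `f` is a primitive of the integrable function `g` on `[s, t]`. -/
def IsPrim (f g : ℝ → ℂ) (s t : ℝ) : Prop :=
  IntervalIntegrable g volume s t ∧ ∀ x ∈ Icc s t, f x = f s + ∫ r in s..x, g r

namespace IsPrim

variable {f g f₁ g₁ f₂ g₂ : ℝ → ℂ} {s t : ℝ}

lemma intInt (h : IsPrim f g s t) {x y : ℝ} (hx : x ∈ Icc s t) (hy : y ∈ Icc s t) :
    IntervalIntegrable g volume x y := by
  apply h.1.mono_set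
  rw [uIcc_of_le (hx.1.trans hx.2)]
  exact uIcc_subset_Icc hx hy

lemma sub_eq (h : IsPrim f g s t) {x y : ℝ} (hx : x ∈ Icc s t) (hy : y ∈ Icc s t) :
    f y - f x = ∫ r in x..y, g r := by
  have hs : s ∈ Icc s t := ⟨le_rfl, hx.1.trans hx.2⟩
  rw [h.2 x hx, h.2 y hy, add_sub_add_left_eq_sub,
    intervalIntegral.integral_interval_sub_left (h.intInt hs hy) (h.intInt hs hx)]

lemma mono (h : IsPrim f g s t) {u v : ℝ} (hu : u ∈ Icc s t) (hv : v ∈ Icc s t) :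
    IsPrim f g u v := by
  refine ⟨h.intInt hu hv, fun x hx => ?_⟩
  rw [← h.sub_eq hu ⟨hu.1.trans hx.1, hx.2.trans hv.2⟩]; ring

lemma continuousOn (h : IsPrim f g s t) : ContinuousOn f (Icc s t) := by
  rcases lt_or_ge t s with hst | hst
  · rw [Icc_eq_empty (not_le.2 hst)]; exact continuousOn_empty _
  have h1 := intervalIntegral.continuousOn_primitive_interval
    (μ := volume) (f := g) (a := s) (b := t) (by
      rw [uIcc_of_le hst, integrableOn_Icc_iff_integrableOn_Ioc]
      exact (intervalIntegrable_iff_integrableOn_Ioc_of_le hst).1 h.1)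
  rw [uIcc_of_le hst] at h1
  exact (continuousOn_const.add h1).congr (fun x hx => h.2 x hx)

lemma intInt_left (hst : s ≤ t) (h : IsPrim f g s t) : IntervalIntegrable f volume s t := by
  have := h.continuousOn
  rw [← uIcc_of_le hst] at this
  exact this.intervalIntegrable

lemma of_sub (hg : IntervalIntegrable g volume s t)
    (h : ∀ x ∈ Icc s t, f x - f s = ∫ r in s..x, g r) : IsPrim f g s t :=
  ⟨hg, fun x hx => by rw [← h x hx]; ring⟩

lemma add (h₁ : IsPrim f₁ g₁ s t) (h₂ : IsPrim f₂ g₂ s t) :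
    IsPrim (fun x => f₁ x + f₂ x) (fun x => g₁ x + g₂ x) s t := by
  refine ⟨h₁.1.add h₂.1, fun x hx => ?_⟩
  have hs : s ∈ Icc s t := ⟨le_rfl, hx.1.trans hx.2⟩
  rw [intervalIntegral.integral_add (h₁.intInt hs hx) (h₂.intInt hs hx)]
  simp only [h₁.2 x hx, h₂.2 x hx]; ring

lemma const_mul (h : IsPrim f g s t) (c : ℂ) :
    IsPrim (fun x => c * f x) (fun x => c * g x) s t := by
  refine ⟨h.1.const_mul c, fun x hx => ?_⟩
  rw [intervalIntegral.integral_const_mul]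
  simp only [h.2 x hx]; ring

lemma sub (h₁ : IsPrim f₁ g₁ s t) (h₂ : IsPrim f₂ g₂ s t) :
    IsPrim (fun x => f₁ x - f₂ x) (fun x => g₁ x - g₂ x) s t := by
  have := h₁.add (h₂.const_mul (-1))
  simpa [sub_eq_add_neg] using this

lemma congr_left (h : IsPrim f g s t) (hff : ∀ x ∈ Icc s t, f x = f₁ x) : IsPrim f₁ g s t :=
  ⟨h.1, fun x hx => by
    rw [← hff x hx, ← hff s ⟨le_rfl, hx.1.trans hx.2⟩]; exact h.2 x hx⟩

lemma congr_right (hst : s ≤ t) (h : IsPrim f g s t) (hgg : ∀ᵐ x, x ∈ Ioc s t → g x = g₁ x) :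
    IsPrim f g₁ s t := by
  have h2 : ∀ x ∈ Icc s t, ∀ᵐ r, r ∈ uIoc s x → g r = g₁ r := fun x hx => by
    filter_upwards [hgg] with r hr hr'
    rw [uIoc_of_le hx.1] at hr'
    exact hr ⟨hr'.1, hr'.2.trans hx.2⟩
  refine ⟨h.1.congr_ae ?_, fun x hx => ?_⟩
  · exact (ae_restrict_iff' measurableSet_uIoc).2 (h2 t ⟨hst, le_rfl⟩)
  · rw [← intervalIntegral.integral_congr_ae (h2 x hx)]; exact h.2 x hx

lemma of_hasDerivAt (h : ∀ x, HasDerivAt f (g x) x) (hg : Continuous g) :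
    IsPrim f g s t := by
  refine .of_sub (hg.intervalIntegrable _ _) fun x _ => ?_
  rw [intervalIntegral.integral_eq_sub_of_hasDerivAt (fun y _ => h y) (hg.intervalIntegrable _ _)]

/-- Increments of `f` are dominated by increments of the primitive of ‖g‖, which is absolutely
continuous. -/
lemma absCont (hst : s ≤ t) (h : IsPrim f g s t) : AbsolutelyContinuousOnInterval f s t := by
  have h1 := h.1.norm.absolutelyContinuousOnInterval_intervalIntegral (c := s) left_mem_uIcc
  refine squeeze_zero' (.of_forall fun _ => Finset.sum_nonneg fun _ _ => dist_nonneg) ?_ h1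
  have : ∀ᶠ E in AbsolutelyContinuousOnInterval.totalLengthFilter ⊓
      𝓟 (AbsolutelyContinuousOnInterval.disjWithin s t),
      E ∈ AbsolutelyContinuousOnInterval.disjWithin s t :=
    eventually_inf_principal.mpr (by simp)
  filter_upwards [this] with E hE
  refine Finset.sum_le_sum fun i hi => ?_
  have hh := hE.1 i hi
  rw [uIcc_of_le hst] at hh
  have hs : s ∈ Icc s t := ⟨le_rfl, hst⟩
  rw [dist_comm, dist_eq_norm, h.sub_eq hh.1 hh.2, dist_comm, Real.dist_eq,
    intervalIntegral.integral_interval_sub_left (h.intInt hs hh.2).norm (h.intInt hs hh.1).norm]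
  exact intervalIntegral.norm_integral_le_abs_integral_norm

lemma ae_hasDerivAt (hst : s ≤ t) (h : IsPrim f g s t) :
    ∀ᵐ x, x ∈ Ioo s t → HasDerivAt f (g x) x := by
  filter_upwards [h.1.ae_hasDerivAt_integral] with x hx hxs
  have hx1 : x ∈ uIcc s t := by rw [uIcc_of_le hst]; exact Ioo_subset_Icc_self hxs
  refine ((hx hx1 s left_mem_uIcc).const_add (f s)).congr_of_eventuallyEq ?_
  filter_upwards [Ioo_mem_nhds hxs.1 hxs.2] with y hy
  exact h.2 y (Ioo_subset_Icc_self hy)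

/-- The product minus the integral of its expected derivative is absolutely continuous with zero
derivative almost everywhere, hence constant. This product rule replaces classical differentiation
throughout: q is merely integrable, so second derivatives exist only almost everywhere. -/
lemma mul (hst : s ≤ t) (h₁ : IsPrim f₁ g₁ s t) (h₂ : IsPrim f₂ g₂ s t) :
    IsPrim (fun x => f₁ x * f₂ x) (fun x => g₁ x * f₂ x + f₁ x * g₂ x) s t := by
  have hI : IntervalIntegrable (fun x => g₁ x * f₂ x + f₁ x * g₂ x) volume s t := by
    have c1 := h₁.continuousOn
    have c2 := h₂.continuousOn
    rw [← uIcc_of_le hst] at c1 c2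
    exact (h₁.1.mul_continuousOn c2).add (h₂.1.continuousOn_mul c1)
  have hP : IsPrim (fun x => ∫ r in s..x, (g₁ r * f₂ r + f₁ r * g₂ r)) _ s t :=
    ⟨hI, fun x _ => by simp⟩
  have hac : AbsolutelyContinuousOnInterval (fun x => f₁ x * f₂ x -
      ∫ r in s..x, (g₁ r * f₂ r + f₁ r * g₂ r)) s t :=
    ((h₁.absCont hst).smul (h₂.absCont hst)).sub (hP.absCont hst)
  have hz : ∀ᵐ x, x ∈ uIcc s t → HasDerivAt (fun x => f₁ x * f₂ x -
      ∫ r in s..x, (g₁ r * f₂ r + f₁ r * g₂ r)) 0 x := by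
    have e1 : ∀ᵐ x : ℝ, x ≠ s := by simp [ae_iff, measure_singleton]
    have e2 : ∀ᵐ x : ℝ, x ≠ t := by simp [ae_iff, measure_singleton]
    filter_upwards [h₁.ae_hasDerivAt hst, h₂.ae_hasDerivAt hst, hP.ae_hasDerivAt hst, e1, e2]
      with x a1 a2 a3 n1 n2 hx
    rw [uIcc_of_le hst] at hx
    have hx' : x ∈ Ioo s t := ⟨lt_of_le_of_ne hx.1 n1.symm, lt_of_le_of_ne hx.2 n2⟩
    exact (((a1 hx').mul (a2 hx')).sub (a3 hx')).congr_deriv (sub_self _)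
  obtain ⟨C, hC⟩ := hac.const_of_ae_hasDerivAt_zero hz
  rw [uIcc_of_le hst] at hC
  refine .of_sub hI fun x hx => ?_
  have a := hC x hx
  have b := hC s ⟨le_rfl, hst⟩
  simp only [intervalIntegral.integral_same, sub_zero] at a b
  rw [b, ← a]; ring

lemma reflect (h : IsPrim f g s t) :
    IsPrim (fun x => f (-x)) (fun x => -g (-x)) (-t) (-s) := by
  have key : ∀ x y, ∫ r in x..y, -g (-r) = ∫ r in -x..-y, g r := fun x y => by
    rw [intervalIntegral.integral_neg, intervalIntegral.integral_comp_neg,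
      intervalIntegral.integral_symm, neg_neg]
  refine ⟨?_, fun x hx => ?_⟩
  · have := (h.1.symm.comp_sub_left (c := 0)).neg
    simp only [zero_sub] at this
    exact this
  · rw [key, ← h.sub_eq ⟨by linarith [hx.1, hx.2], by simp⟩
      ⟨by linarith [hx.2], by linarith [hx.1]⟩, neg_neg]
    ring_nf

end IsPrim

/-- Approximate w in L¹ up to ε/2 by a continuous function bounded by C. The exponential is at most
1 on the error, and its integral against C is at most C/Λ. -/
lemma exists_exp_weight {w : ℝ → ℝ} {s t : ℝ} (hst : s ≤ t) (hw : IntervalIntegrable w volume s t)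
    {ε : ℝ} (hε : 0 < ε) :
    ∃ Λ : ℝ, 0 ≤ Λ ∧ ∀ x ∈ Icc s t, ∫ r in s..x, |w r| * Real.exp (-(Λ * (x - r))) ≤ ε := by
  have hi : Integrable ((Ioc s t).indicator w) :=
    (integrable_indicator_iff measurableSet_Ioc).2
      ((intervalIntegrable_iff_integrableOn_Ioc_of_le hst).1 hw)
  obtain ⟨g, hgs, hgi, hgc, hgI⟩ := hi.exists_hasCompactSupport_integral_sub_le (half_pos hε)
  obtain ⟨C, hC⟩ := hgs.exists_bound_of_continuous hgc
  have hC0 : 0 ≤ C := (norm_nonneg _).trans (hC 0)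
  -- This choice gives C/Λ ≤ ε/2; the summand 1 keeps Λ positive when C = 0.
  refine ⟨2 * C / ε + 1, by positivity, fun x hx => ?_⟩
  set Λ := 2 * C / ε + 1
  have hΛ : 0 < Λ := by positivity
  have hexp : Continuous fun r => Real.exp (-(Λ * (x - r))) := by fun_prop
  have hsub : Integrable fun r => ‖(Ioc s t).indicator w r - g r‖ := (hi.sub hgI).norm
  have i1 : IntervalIntegrable (fun r => |w r| * Real.exp (-(Λ * (x - r)))) volume s x := by
    refine (hw.mono_set ?_).abs.mul_continuousOn hexp.continuousOn
    rw [uIcc_of_le hst, uIcc_of_le hx.1]; exact Icc_subset_Icc_right hx.2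
  have i2 : IntervalIntegrable (fun r => ‖(Ioc s t).indicator w r - g r‖ +
      C * Real.exp (-(Λ * (x - r)))) volume s x :=
    hsub.intervalIntegrable.add ((hexp.const_mul C).intervalIntegrable _ _ |>.congr
      (by intro _ _; rfl))
  have h1 : ∫ r in s..x, |w r| * Real.exp (-(Λ * (x - r))) ≤
      ∫ r in s..x, (‖(Ioc s t).indicator w r - g r‖ + C * Real.exp (-(Λ * (x - r)))) := by
    refine intervalIntegral.integral_mono_on_of_le_Ioo hx.1 i1 i2 fun r hr => ?_
    have hr' : r ∈ Ioc s t := ⟨hr.1, hr.2.le.trans hx.2⟩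
    have e1 : Real.exp (-(Λ * (x - r))) ≤ 1 :=
      Real.exp_le_one_iff.2 (by have := mul_nonneg hΛ.le (sub_nonneg.2 hr.2.le); linarith)
    have e0 := Real.exp_pos (-(Λ * (x - r)))
    rw [indicator_of_mem hr']
    have h3 : |w r| ≤ ‖w r - g r‖ + C := by
      have := norm_sub_norm_le (w r) (g r)
      have := hC r
      rw [Real.norm_eq_abs (w r)] at *
      linarith
    have := norm_nonneg (w r - g r)
    nlinarith
  have h2 : ∫ r in s..x, ‖(Ioc s t).indicator w r - g r‖ ≤ ε / 2 := by
    rw [intervalIntegral.integral_of_le hx.1]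
    exact (setIntegral_le_integral hsub (.of_forall fun _ => norm_nonneg _)).trans hgi
  have h3 : ∫ r in s..x, C * Real.exp (-(Λ * (x - r))) ≤ ε / 2 := by
    have hd : ∀ r, HasDerivAt (fun r => C / Λ * Real.exp (-(Λ * (x - r))))
        (C * Real.exp (-(Λ * (x - r)))) r := fun r => by
      have : HasDerivAt (fun r => -(Λ * (x - r))) Λ r := by
        exact (((hasDerivAt_id r).const_sub x).const_mul Λ).neg.congr_deriv (by simp)
      refine (this.exp.const_mul (C / Λ)).congr_deriv ?_
      field_simp
    rw [intervalIntegral.integral_eq_sub_of_hasDerivAt (fun r _ => hd r)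
      ((hexp.const_mul C).intervalIntegrable _ _ |>.congr (by intro _ _; rfl))]
    have e0 := Real.exp_pos (-(Λ * (x - s)))
    have : C / Λ ≤ ε / 2 := by
      rw [div_le_iff₀ hΛ]
      have : ε / 2 * Λ = C + ε / 2 := by simp only [Λ]; field_simp
      linarith
    have hCL : 0 ≤ C / Λ := by positivity
    simp only [sub_self, mul_zero, neg_zero, Real.exp_zero, mul_one]
    nlinarith
  rw [intervalIntegral.integral_add hsub.intervalIntegrable
    ((hexp.const_mul C).intervalIntegrable _ _ |>.congr (by intro _ _; rfl))] at h1
  linarith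

/-- Gronwall's inequality with an integrable weight. -/
lemma exists_gronwall {w : ℝ → ℝ} {s t : ℝ} (hst : s ≤ t) (hw : IntervalIntegrable w volume s t) :
    ∃ G : ℝ, 0 ≤ G ∧ ∀ (u : ℝ → ℝ) (C : ℝ), 0 ≤ C → ContinuousOn u (Icc s t) →
      (∀ x ∈ Icc s t, 0 ≤ u x) → (∀ x ∈ Icc s t, u x ≤ C + ∫ r in s..x, |w r| * u r) →
      ∀ x ∈ Icc s t, u x ≤ G * C := by
  -- In the sup norm weighted by exp(-Λ(x - s)) the integral term costs at most half of the maximum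
  -- and is absorbed.
  obtain ⟨Λ, hΛ, hw2⟩ := exists_exp_weight hst hw (ε := 1 / 2) (by norm_num)
  refine ⟨2 * Real.exp (Λ * (t - s)), by positivity, fun u C hC hu hu0 hle x hx => ?_⟩
  have hcont : ContinuousOn (fun x => Real.exp (-(Λ * (x - s))) * u x) (Icc s t) :=
    ContinuousOn.mul (by fun_prop) hu
  obtain ⟨y, hy, hmax⟩ := isCompact_Icc.exists_isMaxOn ⟨x, hx⟩ hcont
  set k := Real.exp (-(Λ * (y - s))) * u y with hk
  have hk0 : 0 ≤ k := mul_nonneg (Real.exp_pos _).le (hu0 y hy)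
  have hub : ∀ r ∈ Icc s t, u r ≤ Real.exp (Λ * (r - s)) * k := fun r hr => by
    have : Real.exp (-(Λ * (r - s))) * u r ≤ k := hmax hr
    rw [Real.exp_neg, inv_mul_le_iff₀ (Real.exp_pos _)] at this
    exact this
  have hsy : uIcc s y ⊆ uIcc s t := by
    rw [uIcc_of_le hst, uIcc_of_le hy.1]; exact Icc_subset_Icc_right hy.2
  have hwy := (hw.mono_set hsy).abs
  have i1 : IntervalIntegrable (fun r => |w r| * u r) volume s y :=
    hwy.mul_continuousOn (hu.mono (by rw [← uIcc_of_le hst]; exact hsy))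
  have i2 : IntervalIntegrable (fun r => Real.exp (Λ * (y - s)) * k *
      (|w r| * Real.exp (-(Λ * (y - r))))) volume s y :=
    (hwy.mul_continuousOn (Continuous.continuousOn (by fun_prop))).const_mul _
  have h1 : ∫ r in s..y, |w r| * u r ≤ ∫ r in s..y, Real.exp (Λ * (y - s)) * k *
      (|w r| * Real.exp (-(Λ * (y - r)))) := by
    refine intervalIntegral.integral_mono_on hy.1 i1 i2 fun r hr => ?_
    have := hub r ⟨hr.1, hr.2.trans hy.2⟩
    have e : Real.exp (Λ * (r - s)) = Real.exp (Λ * (y - s)) * Real.exp (-(Λ * (y - r))) := by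
      rw [← Real.exp_add]; ring_nf
    calc |w r| * u r ≤ |w r| * (Real.exp (Λ * (r - s)) * k) := by gcongr
      _ = _ := by rw [e]; ring
  rw [intervalIntegral.integral_const_mul] at h1
  have h2 := hw2 y hy
  have h3 := hle y hy
  have hkk : u y = Real.exp (Λ * (y - s)) * k := by
    rw [hk, Real.exp_neg, ← mul_assoc, mul_inv_cancel₀ (Real.exp_pos _).ne', one_mul]
  have hE : 1 ≤ Real.exp (Λ * (y - s)) :=
    Real.one_le_exp (mul_nonneg hΛ (sub_nonneg.2 hy.1))
  have hk2 : k ≤ 2 * C := by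
    have h4 : Real.exp (Λ * (y - s)) * k ≤ C + Real.exp (Λ * (y - s)) * k * (1 / 2) := by
      rw [← hkk]
      refine h3.trans (add_le_add le_rfl (h1.trans ?_))
      rw [← hkk] at h1 ⊢
      exact mul_le_mul_of_nonneg_left h2 (hu0 y hy)
    nlinarith
  calc u x ≤ Real.exp (Λ * (x - s)) * k := hub x hx
    _ ≤ Real.exp (Λ * (t - s)) * (2 * C) := by
      gcongr; exact hx.2
    _ = _ := by ring

end

/-! ### Estimates for y'' = (q - z²θ²) y that are uniform in large z -/

noncomputable section

lemma isPrim_exp (c : ℂ) (x₀ s t : ℝ) :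
    IsPrim (fun x => Complex.exp (c * ((x - x₀ : ℝ) : ℂ)))
      (fun x => c * Complex.exp (c * ((x - x₀ : ℝ) : ℂ))) s t := by
  refine .of_hasDerivAt (fun x => ?_) (by fun_prop)
  have h1 : HasDerivAt (fun x : ℝ => ((x - x₀ : ℝ) : ℂ)) ((1 : ℝ) : ℂ) x :=
    ((hasDerivAt_id x).sub_const x₀).ofReal_comp
  refine ((h1.const_mul c).cexp).congr_deriv ?_
  push_cast; ring

lemma norm_exp_I_mul (z : ℂ) (x : ℝ) :
    ‖Complex.exp (Complex.I * z * (x : ℂ))‖ = Real.exp (-(z.im * x)) := by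
  rw [Complex.norm_exp]; simp

lemma norm_exp_I_mul' (z : ℂ) (θ x : ℝ) :
    ‖Complex.exp (Complex.I * z * θ * (x : ℂ))‖ = Real.exp (-(z.im * θ * x)) := by
  rw [Complex.norm_exp]; simp

lemma norm_exp_neg_I_mul' (z : ℂ) (θ x : ℝ) :
    ‖Complex.exp (-(Complex.I * z * θ) * (x : ℂ))‖ = Real.exp (z.im * θ * x) := by
  rw [Complex.norm_exp]; simp

section Propagation

variable {s t θ : ℝ} {z : ℂ} {y y' F : ℝ → ℂ}

/-- `e^{-izθ(x-s)} (y' + izθ y)` for `y'' = F - z²θ² y`. -/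
lemma isPrim_out (hst : s ≤ t) (hy : IsPrim y y' s t)
    (hy' : IsPrim y' (fun x => F x - z ^ 2 * (θ : ℂ) ^ 2 * y x) s t) :
    IsPrim (fun x => Complex.exp (-(Complex.I * z * θ) * ((x - s : ℝ) : ℂ)) *
        (y' x + Complex.I * z * θ * y x))
      (fun x => Complex.exp (-(Complex.I * z * θ) * ((x - s : ℝ) : ℂ)) * F x) s t := by
  refine ((isPrim_exp (-(Complex.I * z * θ)) s s t).mul hst
    (hy'.add (hy.const_mul (Complex.I * z * θ)))).congr_right hst (.of_forall fun x _ => ?_)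
  linear_combination (-(Complex.exp (-(Complex.I * z * θ) * ((x - s : ℝ) : ℂ)) * z ^ 2 * θ ^ 2 *
    y x)) * Complex.I_sq

/-- The operator d²/dx² + z²θ² factors into (d/dx - izθ)(d/dx + izθ). `isPrim_out` and this lemma
solve the two first-order problems by integrating factors. -/
lemma isPrim_in (hst : s ≤ t) (hy : IsPrim y y' s t)
    (hy' : IsPrim y' (fun x => F x - z ^ 2 * (θ : ℂ) ^ 2 * y x) s t) :
    IsPrim (fun x => Complex.exp ((Complex.I * z * θ) * ((x - s : ℝ) : ℂ)) *
        (y' x - Complex.I * z * θ * y x))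
      (fun x => Complex.exp ((Complex.I * z * θ) * ((x - s : ℝ) : ℂ)) * F x) s t := by
  refine ((isPrim_exp ((Complex.I * z * θ)) s s t).mul hst
    (hy'.sub (hy.const_mul (Complex.I * z * θ)))).congr_right hst (.of_forall fun x _ => ?_)
  linear_combination (-(Complex.exp ((Complex.I * z * θ) * ((x - s : ℝ) : ℂ)) * z ^ 2 * θ ^ 2 *
    y x)) * Complex.I_sq

/-- One of the two combinations is damped and the other amplified by the integrating factor. A
common weight exp(-Im z θ (x - s)) covers both. -/
lemma norm_out_in_le (hst : s ≤ t) (hθ : 0 ≤ θ) (hz : 0 ≤ z.im) (hF : IntervalIntegrable F volume s t)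
    (hy : IsPrim y y' s t)
    (hy' : IsPrim y' (fun x => F x - z ^ 2 * (θ : ℂ) ^ 2 * y x) s t) {x : ℝ} (hx : x ∈ Icc s t) :
    Real.exp (-(z.im * θ * (x - s))) * ‖y' x + Complex.I * z * θ * y x‖ ≤
      ‖y' s + Complex.I * z * θ * y s‖ +
        ∫ r in s..x, Real.exp (-(z.im * θ * (r - s))) * ‖F r‖ ∧
    Real.exp (-(z.im * θ * (x - s))) * ‖y' x - Complex.I * z * θ * y x‖ ≤
      ‖y' s - Complex.I * z * θ * y s‖ +
        ∫ r in s..x, Real.exp (-(z.im * θ * (r - s))) * ‖F r‖ := by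
  have hs : s ∈ Icc s t := ⟨le_rfl, hst⟩
  have hsx : uIcc s x ⊆ uIcc s t := by
    rw [uIcc_of_le hst, uIcc_of_le hx.1]; exact Icc_subset_Icc_right hx.2
  have hFx := (hF.mono_set hsx).norm
  have hb : 0 ≤ z.im * θ := mul_nonneg hz hθ
  have hI : IntervalIntegrable (fun r => Real.exp (-(z.im * θ * (r - s))) * ‖F r‖) volume s x :=
    hFx.continuousOn_mul (Continuous.continuousOn (by fun_prop))
  constructor
  · have h1 := (isPrim_out hst hy hy').sub_eq hs hx
    simp only [sub_self, Complex.ofReal_zero, mul_zero, Complex.exp_zero, one_mul] at h1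
    rw [sub_eq_iff_eq_add] at h1
    have h2 := congrArg norm h1
    rw [norm_mul, norm_exp_neg_I_mul'] at h2
    -- For r ≤ x, exp(Im z θ (r - s)) is at most exp(2 Im z θ (x - s)) exp(-Im z θ (r - s)). One of
    -- the two factors exp(Im z θ (x - s)) later cancels against the left side.
    have h3 : ‖∫ r in s..x, Complex.exp (-(Complex.I * z * θ) * ((r - s : ℝ) : ℂ)) * F r‖ ≤
        ∫ r in s..x, Real.exp (z.im * θ * (x - s)) ^ 2 *
          (Real.exp (-(z.im * θ * (r - s))) * ‖F r‖) := by
      refine intervalIntegral.norm_integral_le_of_norm_le hx.1 (.of_forall fun r hr => ?_)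
        (hI.const_mul _)
      rw [norm_mul, norm_exp_neg_I_mul', ← mul_assoc]
      gcongr
      rw [sq, ← Real.exp_add, ← Real.exp_add, Real.exp_le_exp]
      nlinarith [hr.1, hr.2, mul_nonneg hb (sub_nonneg.2 hr.2)]
    rw [intervalIntegral.integral_const_mul] at h3
    have h4 : Real.exp (z.im * θ * (x - s)) * ‖y' x + Complex.I * z * θ * y x‖ ≤
        Real.exp (z.im * θ * (x - s)) ^ 2 * (‖y' s + Complex.I * z * θ * y s‖ +
        ∫ r in s..x, Real.exp (-(z.im * θ * (r - s))) * ‖F r‖) := by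
      rw [h2]
      refine (norm_add_le _ _).trans ?_
      have : (1 : ℝ) ≤ Real.exp (z.im * θ * (x - s)) ^ 2 :=
        one_le_pow₀ (Real.one_le_exp (mul_nonneg hb (sub_nonneg.2 hx.1)))
      nlinarith [norm_nonneg (y' s + Complex.I * z * θ * y s)]
    rw [Real.exp_neg, inv_mul_le_iff₀ (Real.exp_pos _)]
    rw [sq, mul_assoc (Real.exp _) (Real.exp _)] at h4
    exact le_of_mul_le_mul_left h4 (Real.exp_pos _)
  · have h1 := (isPrim_in hst hy hy').sub_eq hs hx
    simp only [sub_self, Complex.ofReal_zero, mul_zero, Complex.exp_zero, one_mul] at h1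
    rw [sub_eq_iff_eq_add] at h1
    have h2 := congrArg norm h1
    rw [norm_mul, norm_exp_I_mul'] at h2
    have h3 : ‖∫ r in s..x, Complex.exp ((Complex.I * z * θ) * ((r - s : ℝ) : ℂ)) * F r‖ ≤
        ∫ r in s..x, (Real.exp (-(z.im * θ * (r - s))) * ‖F r‖) := by
      refine intervalIntegral.norm_integral_le_of_norm_le hx.1 (.of_forall fun r hr => ?_) hI
      rw [norm_mul, norm_exp_I_mul']
    rw [h2]
    refine (norm_add_le _ _).trans ?_
    linarith

/-- Half the sum and half the difference of the two combinations are y' and izθy. -/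
lemma free_bound (hst : s ≤ t) (hθ : 0 ≤ θ) (hz : 0 ≤ z.im) (hF : IntervalIntegrable F volume s t)
    (hy : IsPrim y y' s t)
    (hy' : IsPrim y' (fun x => F x - z ^ 2 * (θ : ℂ) ^ 2 * y x) s t) {x : ℝ} (hx : x ∈ Icc s t) :
    Real.exp (-(z.im * θ * (x - s))) * ‖y' x‖ ≤ ‖y' s‖ + θ * ‖z‖ * ‖y s‖ +
        ∫ r in s..x, Real.exp (-(z.im * θ * (r - s))) * ‖F r‖ ∧
    Real.exp (-(z.im * θ * (x - s))) * (θ * ‖z‖ * ‖y x‖) ≤ ‖y' s‖ + θ * ‖z‖ * ‖y s‖ +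
        ∫ r in s..x, Real.exp (-(z.im * θ * (r - s))) * ‖F r‖ := by
  obtain ⟨h1, h2⟩ := norm_out_in_le hst hθ hz hF hy hy' hx
  have hn : ∀ r, ‖Complex.I * z * θ * y r‖ = θ * ‖z‖ * ‖y r‖ := fun r => by
    simp only [norm_mul, Complex.norm_I, one_mul, Complex.norm_real, Real.norm_eq_abs,
      abs_of_nonneg hθ]
    ring
  have a1 := norm_add_le (y' s) (Complex.I * z * θ * y s)
  have a2 := norm_sub_le (y' s) (Complex.I * z * θ * y s)
  rw [hn] at a1 a2
  have b1 : 2 * ‖y' x‖ ≤ ‖y' x + Complex.I * z * θ * y x‖ + ‖y' x - Complex.I * z * θ * y x‖ := by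
    refine le_trans (le_of_eq ?_) (norm_add_le _ _)
    rw [add_add_sub_cancel, ← two_mul, norm_mul]; simp
  have b2 : 2 * (θ * ‖z‖ * ‖y x‖) ≤
      ‖y' x + Complex.I * z * θ * y x‖ + ‖y' x - Complex.I * z * θ * y x‖ := by
    refine le_trans (le_of_eq ?_) (norm_sub_le _ _)
    rw [add_sub_sub_cancel, ← two_mul, norm_mul, hn]; simp
  have he := Real.exp_pos (-(z.im * θ * (x - s)))
  constructor
  · nlinarith [mul_le_mul_of_nonneg_left b1 he.le]
  · nlinarith [mul_le_mul_of_nonneg_left b2 he.le]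

/-- Forward propagation of solutions of `-y'' + q y = z² θ² y`, uniformly in large `z`. -/
lemma exists_propagation {q : ℝ → ℂ} (hst : s ≤ t) (hθ : 0 < θ)
    (hq : IntervalIntegrable q volume s t) :
    ∃ G : ℝ, 0 ≤ G ∧ ∀ z : ℂ, 0 ≤ z.im → 1 ≤ ‖z‖ → ∀ y y' : ℝ → ℂ, IsPrim y y' s t →
      IsPrim y' (fun x => (q x - z ^ 2 * (θ : ℂ) ^ 2) * y x) s t → ∀ x ∈ Icc s t,
      ‖z‖ * ‖y x‖ + ‖y' x‖ ≤
        G * Real.exp (z.im * θ * (x - s)) * (‖z‖ * ‖y s‖ + ‖y' s‖) := by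
  obtain ⟨G, hG, hgr⟩ := exists_gronwall hst (hq.norm.const_mul (1 / θ))
  set Q := ∫ r in s..t, ‖q r‖ with hQ
  have hQ0 : 0 ≤ Q := intervalIntegral.integral_nonneg hst fun _ _ => norm_nonneg _
  refine ⟨G * ((1 + θ) / θ) + ((1 + θ) + Q * (G * ((1 + θ) / θ))), by positivity, ?_⟩
  intro z hz hz1 y y' hy hy' x hx
  have hz0 : 0 < ‖z‖ := by linarith
  have hyc := hy.continuousOn
  have hF : IntervalIntegrable (fun x => q x * y x) volume s t := by
    rw [← uIcc_of_le hst] at hyc; exact hq.mul_continuousOn hyc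
  have hy2 : IsPrim y' (fun x => q x * y x - z ^ 2 * (θ : ℂ) ^ 2 * y x) s t :=
    hy'.congr_right hst (.of_forall fun x _ => by ring)
  set N := ‖z‖ * ‖y s‖ + ‖y' s‖ with hN
  have hN0 : 0 ≤ N := by positivity
  have hH : ‖y' s‖ + θ * ‖z‖ * ‖y s‖ ≤ (1 + θ) * N := by
    rw [hN]
    nlinarith [norm_nonneg (y' s), mul_nonneg hz0.le (norm_nonneg (y s))]
  -- The factor ‖z‖ puts y on the same scale as y'. Since ‖z‖ ≥ 1, the forcing q y is bounded by |q|
  -- u, so the Gronwall constant does not depend on z.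
  set u : ℝ → ℝ := fun r => ‖z‖ * (Real.exp (-(z.im * θ * (r - s))) * ‖y r‖) with hu
  have huc : ContinuousOn u (Icc s t) :=
    continuousOn_const.mul ((Continuous.continuousOn (by fun_prop)).mul hyc.norm)
  have hu0 : ∀ r, 0 ≤ u r := fun r => by positivity
  have hint : ∀ x ∈ Icc s t, ∫ r in s..x, Real.exp (-(z.im * θ * (r - s))) * ‖q r * y r‖ ≤
      ∫ r in s..x, ‖q r‖ * u r := fun x hx => by
    have hsx : uIcc s x ⊆ uIcc s t := by
      rw [uIcc_of_le hst, uIcc_of_le hx.1]; exact Icc_subset_Icc_right hx.2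
    refine intervalIntegral.integral_mono_on hx.1
      ((hF.mono_set hsx).norm.continuousOn_mul (Continuous.continuousOn (by fun_prop)))
      ((hq.mono_set hsx).norm.mul_continuousOn
        (huc.mono (by rw [← uIcc_of_le hst]; exact hsx))) fun r _ => ?_
    simp only [hu, norm_mul]
    have : 0 ≤ Real.exp (-(z.im * θ * (r - s))) * (‖q r‖ * ‖y r‖) := by positivity
    nlinarith
  have hmain : ∀ x ∈ Icc s t, u x ≤ G * ((1 + θ) / θ * N) := by
    refine hgr u _ (by positivity) huc (fun r _ => hu0 r) fun x hx => ?_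
    have h1 := (free_bound hst hθ.le hz hF hy hy2 hx).2
    have h2 := hint x hx
    have h3 : ∫ r in s..x, |1 / θ * ‖q r‖| * u r = 1 / θ * ∫ r in s..x, ‖q r‖ * u r := by
      rw [← intervalIntegral.integral_const_mul]
      refine intervalIntegral.integral_congr fun r _ => ?_
      rw [abs_of_nonneg (by positivity)]; ring
    rw [h3]
    have h4 : θ * u x ≤ (1 + θ) * N + ∫ r in s..x, ‖q r‖ * u r := by
      have : θ * u x = Real.exp (-(z.im * θ * (x - s))) * (θ * ‖z‖ * ‖y x‖) := by
        simp only [hu]; ring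
      rw [this]; linarith
    have : u x = 1 / θ * (θ * u x) := by field_simp
    rw [this]
    calc 1 / θ * (θ * u x) ≤ 1 / θ * ((1 + θ) * N + ∫ r in s..x, ‖q r‖ * u r) := by gcongr
      _ = _ := by ring
  have hd : Real.exp (-(z.im * θ * (x - s))) * ‖y' x‖ ≤
      (1 + θ) * N + Q * (G * ((1 + θ) / θ * N)) := by
    have h1 := (free_bound hst hθ.le hz hF hy hy2 hx).1
    have h2 := hint x hx
    have hsx : uIcc s x ⊆ uIcc s t := by
      rw [uIcc_of_le hst, uIcc_of_le hx.1]; exact Icc_subset_Icc_right hx.2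
    have h3 : ∫ r in s..x, ‖q r‖ * u r ≤ ∫ r in s..x, ‖q r‖ * (G * ((1 + θ) / θ * N)) := by
      refine intervalIntegral.integral_mono_on hx.1
        ((hq.mono_set hsx).norm.mul_continuousOn
          (huc.mono (by rw [← uIcc_of_le hst]; exact hsx))) ((hq.mono_set hsx).norm.mul_const _)
        fun r hr => ?_
      gcongr
      exact hmain r ⟨hr.1, hr.2.trans hx.2⟩
    rw [intervalIntegral.integral_mul_const] at h3
    have h4 : ∫ r in s..x, ‖q r‖ ≤ Q :=
      intervalIntegral.integral_mono_interval le_rfl hx.1 hx.2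
        (.of_forall fun _ => norm_nonneg _) hq.norm
    have h5 : 0 ≤ G * ((1 + θ) / θ * N) := by positivity
    nlinarith [mul_le_mul_of_nonneg_right h4 h5]
  have hyx := hmain x hx
  have key : Real.exp (-(z.im * θ * (x - s))) * (‖z‖ * ‖y x‖ + ‖y' x‖) ≤
      (G * ((1 + θ) / θ) + ((1 + θ) + Q * (G * ((1 + θ) / θ)))) * N := by
    simp only [hu] at hyx
    nlinarith
  rw [Real.exp_neg, inv_mul_le_iff₀ (Real.exp_pos _)] at key
  linarith

lemma exists_propagation_back {q : ℝ → ℂ} (hst : s ≤ t) (hθ : 0 < θ)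
    (hq : IntervalIntegrable q volume s t) :
    ∃ G : ℝ, 0 ≤ G ∧ ∀ z : ℂ, 0 ≤ z.im → 1 ≤ ‖z‖ → ∀ y y' : ℝ → ℂ, IsPrim y y' s t →
      IsPrim y' (fun x => (q x - z ^ 2 * (θ : ℂ) ^ 2) * y x) s t → ∀ x ∈ Icc s t,
      ‖z‖ * ‖y x‖ + ‖y' x‖ ≤
        G * Real.exp (z.im * θ * (t - x)) * (‖z‖ * ‖y t‖ + ‖y' t‖) := by
  have hq' : IntervalIntegrable (fun x => q (-x)) volume (-t) (-s) := by
    have := hq.symm.comp_sub_left (c := 0)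
    simpa only [zero_sub] using this
  obtain ⟨G, hG, h⟩ := exists_propagation (neg_le_neg hst) hθ hq'
  refine ⟨G, hG, fun z hz hz1 y y' hy hy' x hx => ?_⟩
  have hst' : -t ≤ -s := neg_le_neg hst
  have h1 : IsPrim (fun x => y (-x)) (fun x => -y' (-x)) (-t) (-s) := hy.reflect
  have h2 : IsPrim (fun x => -y' (-x)) (fun x => (q (-x) - z ^ 2 * (θ : ℂ) ^ 2) * y (-x))
      (-t) (-s) :=
    ((hy'.reflect.const_mul (-1)).congr_left (fun x _ => by ring)).congr_right hst'
      (.of_forall fun x _ => by ring)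
  have h3 := h z hz hz1 _ _ h1 h2 (-x) ⟨neg_le_neg hx.2, neg_le_neg hx.1⟩
  simp only [neg_neg, norm_neg] at h3
  rwa [show -x - -t = t - x by ring] at h3

/-- Reflection x ↦ -x of `free_bound`. The forcing is kept general because the difference of e and
its unperturbed counterpart solves the free equation with forcing q e. -/
lemma free_bound_back (hst : s ≤ t) (hθ : 0 ≤ θ) (hz : 0 ≤ z.im)
    (hF : IntervalIntegrable F volume s t) (hy : IsPrim y y' s t)
    (hy' : IsPrim y' (fun x => F x - z ^ 2 * (θ : ℂ) ^ 2 * y x) s t) :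
    Real.exp (-(z.im * θ * (t - s))) * ‖y' s‖ ≤ ‖y' t‖ + θ * ‖z‖ * ‖y t‖ +
        ∫ r in s..t, Real.exp (-(z.im * θ * (t - r))) * ‖F r‖ ∧
    Real.exp (-(z.im * θ * (t - s))) * (θ * ‖z‖ * ‖y s‖) ≤ ‖y' t‖ + θ * ‖z‖ * ‖y t‖ +
        ∫ r in s..t, Real.exp (-(z.im * θ * (t - r))) * ‖F r‖ := by
  have hF' : IntervalIntegrable (fun x => F (-x)) volume (-t) (-s) := by
    have := hF.symm.comp_sub_left (c := 0)
    simpa only [zero_sub] using this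
  have hst' : -t ≤ -s := neg_le_neg hst
  have h1 : IsPrim (fun x => y (-x)) (fun x => -y' (-x)) (-t) (-s) := hy.reflect
  have h2 : IsPrim (fun x => -y' (-x)) (fun x => F (-x) - z ^ 2 * (θ : ℂ) ^ 2 * y (-x))
      (-t) (-s) :=
    ((hy'.reflect.const_mul (-1)).congr_left (fun x _ => by ring)).congr_right hst'
      (.of_forall fun x _ => by ring)
  have h3 := free_bound hst' hθ hz hF' h1 h2 (x := -s) ⟨hst', le_rfl⟩
  have h4 : ∫ r in -t..-s, Real.exp (-(z.im * θ * (r - -t))) * ‖F (-r)‖ =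
      ∫ r in s..t, Real.exp (-(z.im * θ * (t - r))) * ‖F r‖ := by
    have := intervalIntegral.integral_comp_neg (a := -t) (b := -s)
      (fun r => Real.exp (-(z.im * θ * (t - r))) * ‖F r‖)
    rw [neg_neg, neg_neg] at this
    rw [← this]
    refine intervalIntegral.integral_congr fun r _ => ?_
    simp only [sub_neg_eq_add, add_comm]
  rw [h4] at h3
  simpa only [neg_neg, norm_neg, show -s - -t = t - s by ring] using h3

end Propagation

end

/-! ### The initial value problem through Volterra operators, and Wronskians -/

noncomputable section

section Resolvent

variable {E : Type*} [NormedAddCommGroup E] [NormedSpace ℂ E] [CompleteSpace E]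

lemma isUnit_one_sub_clm {T : E →L[ℂ] E} (h : ‖T‖ < 1) : IsUnit (1 - T) :=
  isUnit_one_sub_of_norm_lt_one h

/-- Inversion is holomorphic on the units of a Banach algebra. This is the source of the analytic
dependence of solutions on ζ = z². -/
lemma differentiable_inverse_apply (V₀ V₁ : E →L[ℂ] E) (hu : ∀ ζ : ℂ, IsUnit (1 - (V₀ - ζ • V₁)))
    (f : E) : Differentiable ℂ fun ζ : ℂ => Ring.inverse (1 - (V₀ - ζ • V₁)) f := fun ζ => by
  have h1 : DifferentiableAt ℂ (fun ζ : ℂ => 1 - (V₀ - ζ • V₁)) ζ :=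
    ((differentiableAt_id.smul_const V₁).const_sub V₀).const_sub 1
  have h2 : DifferentiableAt ℂ (Ring.inverse : (E →L[ℂ] E) → (E →L[ℂ] E))
      (1 - (V₀ - ζ • V₁)) := differentiableAt_inverse (hu ζ)
  exact (h2.comp ζ h1).clm_apply (differentiableAt_const f)

end Resolvent

section Fundamental

variable {b : ℝ} {w : ℝ → ℂ}

lemma IsPrim.integral (hw : IntervalIntegrable w volume 0 b) :
    IsPrim (fun x => ∫ t in (0 : ℝ)..x, w t) w 0 b :=
  ⟨hw, fun x _ => by simp⟩

/-- Integration by parts. It exposes the Volterra integral as two successive primitives. -/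
lemma integral_sub_mul_eq (hw : IntervalIntegrable w volume 0 b) {x : ℝ} (hx : x ∈ Icc 0 b) :
    ∫ t in (0 : ℝ)..x, ((x - t : ℝ) : ℂ) * w t = ∫ r in (0 : ℝ)..x, ∫ t in (0 : ℝ)..r, w t := by
  have h0 : (0 : ℝ) ∈ Icc 0 b := ⟨le_rfl, hx.1.trans hx.2⟩
  have h1 : IsPrim (fun t : ℝ => ((x - t : ℝ) : ℂ)) (fun _ => -1) 0 x :=
    .of_hasDerivAt (fun t => by
      have := ((hasDerivAt_id t).const_sub x).ofReal_comp
      simpa using this) continuous_const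
  have h2 := (IsPrim.integral hw).mono h0 hx
  have h3 := (h1.mul hx.1 h2).sub_eq (x := 0) (y := x) ⟨le_rfl, hx.1⟩ ⟨hx.1, le_rfl⟩
  have c1 := h1.continuousOn
  have c2 := h2.continuousOn
  rw [← uIcc_of_le hx.1] at c1 c2
  rw [intervalIntegral.integral_add (h1.1.mul_continuousOn c2) (h2.1.continuousOn_mul c1)] at h3
  simp only [sub_self, Complex.ofReal_zero, zero_mul, intervalIntegral.integral_same, mul_zero,
    neg_mul, one_mul, intervalIntegral.integral_neg] at h3
  linear_combination -h3

/-- A fixed point of f = A + B x + V f solves f'' = w f with initial values A and B. -/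
lemma exists_volterra (hb : 0 ≤ b) (hw : IntervalIntegrable w volume 0 b) :
    ∃ V : C(Icc 0 b, ℂ) →L[ℂ] C(Icc 0 b, ℂ), ∀ (f : C(Icc 0 b, ℂ)) (x : Icc 0 b),
      V f x = ∫ t in (0 : ℝ)..x, (((x : ℝ) - t : ℝ) : ℂ) * (w t * IccExtend hb f t) := by
  have hwf : ∀ f : C(Icc 0 b, ℂ),
      IntervalIntegrable (fun t => w t * IccExtend hb f t) volume 0 b := fun f =>
    hw.mul_continuousOn f.continuous.Icc_extend'.continuousOn
  have hsub : ∀ x ∈ Icc 0 b, uIcc 0 x ⊆ uIcc 0 b := fun x hx => by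
    rw [uIcc_of_le hb, uIcc_of_le hx.1]; exact Icc_subset_Icc_right hx.2
  have hI : ∀ (f : C(Icc 0 b, ℂ)) (x : ℝ), x ∈ Icc 0 b → IntervalIntegrable
      (fun t => ((x - t : ℝ) : ℂ) * (w t * IccExtend hb f t)) volume 0 x := fun f x hx =>
    ((hwf f).mono_set (hsub x hx)).continuousOn_mul (Continuous.continuousOn (by fun_prop))
  have hcont : ∀ f : C(Icc 0 b, ℂ), Continuous fun x : Icc 0 b =>
      ∫ t in (0 : ℝ)..x, (((x : ℝ) - t : ℝ) : ℂ) * (w t * IccExtend hb f t) := fun f => by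
    have h1 : ContinuousOn (fun x => ∫ r in (0 : ℝ)..x, ∫ t in (0 : ℝ)..r,
        w t * IccExtend hb f t) (Icc 0 b) := by
      exact (IsPrim.integral ((IsPrim.integral (hwf f)).intInt_left hb)).continuousOn
    refine (continuousOn_iff_continuous_domRestrict.1 h1).congr fun x => ?_
    exact (integral_sub_mul_eq (hwf f) x.2).symm
  refine ⟨LinearMap.mkContinuous
    { toFun := fun f => ⟨_, hcont f⟩
      map_add' := fun f g => ?_
      map_smul' := fun c f => ?_ } (∫ t in (0 : ℝ)..b, b * ‖w t‖) fun f => ?_, fun f x => rfl⟩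
  · ext x
    simp only [ContinuousMap.coe_mk, ContinuousMap.add_apply]
    rw [← intervalIntegral.integral_add (hI f x x.2) (hI g x x.2)]
    refine intervalIntegral.integral_congr fun t _ => ?_
    simp only [IccExtend, Function.comp_apply, ContinuousMap.add_apply]; ring
  · ext x
    simp only [ContinuousMap.coe_mk, ContinuousMap.smul_apply, RingHom.id_apply, smul_eq_mul]
    rw [← intervalIntegral.integral_const_mul]
    refine intervalIntegral.integral_congr fun t _ => ?_
    simp only [IccExtend, Function.comp_apply, ContinuousMap.smul_apply, smul_eq_mul]; ring
  · have hbw : IntervalIntegrable (fun t => b * ‖w t‖) volume 0 b := hw.norm.const_mul b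
    have h0 : 0 ≤ ∫ t in (0 : ℝ)..b, b * ‖w t‖ :=
      intervalIntegral.integral_nonneg hb fun _ _ => by positivity
    refine (ContinuousMap.norm_le _ (by positivity)).2 fun x => ?_
    refine (intervalIntegral.norm_integral_le_of_norm_le x.2.1 (.of_forall fun t ht => ?_)
      ((hbw.mono_set (hsub x x.2)).mul_const ‖f‖)).trans ?_
    · rw [norm_mul, norm_mul, ← mul_assoc]
      gcongr
      · rw [Complex.norm_real, Real.norm_eq_abs, abs_of_nonneg (sub_nonneg.2 ht.2)]
        linarith [x.2.2, ht.1]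
      · exact f.norm_coe_le_norm _
    · rw [intervalIntegral.integral_mul_const]
      gcongr
      exact intervalIntegral.integral_mono_interval le_rfl x.2.1 x.2.2
        (.of_forall fun _ => by simp only [Pi.zero_apply]; positivity) hbw

/-- Conjugating V by multiplication with exp(Λx) inserts the weight exp(-Λ(x - t)) into the kernel.
For Λ from `exists_exp_weight` the conjugated operator has norm at most 1/2, and the Neumann series
applies. -/
lemma isUnit_one_sub_volterra (hb : 0 ≤ b) (hw : IntervalIntegrable w volume 0 b)
    {V : C(Icc 0 b, ℂ) →L[ℂ] C(Icc 0 b, ℂ)} (hV : ∀ (f : C(Icc 0 b, ℂ)) (x : Icc 0 b),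
      V f x = ∫ t in (0 : ℝ)..x, (((x : ℝ) - t : ℝ) : ℂ) * (w t * IccExtend hb f t)) :
    IsUnit (1 - V) := by
  obtain ⟨Λ, hΛ, hle⟩ := exists_exp_weight hb (hw.norm.const_mul b) (ε := 1 / 2) (by norm_num)
  let m : C(Icc 0 b, ℂ) := ⟨fun x => Complex.exp ((Λ * (x : ℝ) : ℝ) : ℂ), by fun_prop⟩
  let m' : C(Icc 0 b, ℂ) := ⟨fun x => Complex.exp ((-(Λ * (x : ℝ)) : ℝ) : ℂ), by fun_prop⟩
  have hmm : m * m' = 1 := by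
    ext x; simp [m, m', ← Complex.exp_add]
  set M := ContinuousLinearMap.mul ℂ C(Icc 0 b, ℂ) m with hM
  set M' := ContinuousLinearMap.mul ℂ C(Icc 0 b, ℂ) m' with hM'
  have h1 : M * M' = 1 := by
    ext1 f; simp [hM, hM', ← mul_assoc, hmm]
  have h2 : M' * M = 1 := by
    ext1 f; simp [hM, hM', ← mul_assoc, mul_comm m' m, hmm]
  let U : (C(Icc 0 b, ℂ) →L[ℂ] C(Icc 0 b, ℂ))ˣ := ⟨M, M', h1, h2⟩
  have hT : ‖M' * V * M‖ ≤ 1 / 2 := by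
    refine ContinuousLinearMap.opNorm_le_bound _ (by norm_num) fun f => ?_
    refine (ContinuousMap.norm_le _ (by positivity)).2 fun x => ?_
    have e1 : (M' * V * M) f x = Complex.exp ((-(Λ * (x : ℝ)) : ℝ) : ℂ) * V (m * f) x := rfl
    have hsub : uIcc 0 (x : ℝ) ⊆ uIcc 0 b := by
      rw [uIcc_of_le hb, uIcc_of_le x.2.1]; exact Icc_subset_Icc_right x.2.2
    rw [e1, hV, ← intervalIntegral.integral_const_mul]
    refine (intervalIntegral.norm_integral_le_of_norm_le x.2.1 (.of_forall fun t ht => ?_)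
      (((((hw.norm.const_mul b).mono_set hsub).abs).mul_continuousOn
        (g := fun t => Real.exp (-(Λ * (x - t)))) (Continuous.continuousOn (by fun_prop))).mul_const
          ‖f‖)).trans ?_
    · have ht' : t ∈ Icc 0 b := ⟨ht.1.le, ht.2.trans x.2.2⟩
      rw [IccExtend_of_mem _ _ ht']
      simp only [norm_mul, ContinuousMap.mul_apply, m, ContinuousMap.coe_mk, Complex.norm_exp,
        Complex.ofReal_re, Complex.norm_real, Real.norm_eq_abs,
        abs_of_nonneg (sub_nonneg.2 ht.2)]
      have e2 : Real.exp (-(Λ * (x - t))) = Real.exp (-(Λ * x)) * Real.exp (Λ * t) := by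
        rw [← Real.exp_add]; ring_nf
      rw [e2]
      have e3 : (x : ℝ) - t ≤ b := by linarith [x.2.2, ht.1]
      have e4 := f.norm_coe_le_norm ⟨t, ht'⟩
      have e5 : ((x : ℝ) - t) * ‖f ⟨t, ht'⟩‖ ≤ b * ‖f‖ := by gcongr
      have e6 : 0 ≤ Real.exp (-(Λ * x)) * Real.exp (Λ * t) * ‖w t‖ := by positivity
      calc _ = Real.exp (-(Λ * x)) * Real.exp (Λ * t) * ‖w t‖ *
            (((x : ℝ) - t) * ‖f ⟨t, ht'⟩‖) := by ring
        _ ≤ Real.exp (-(Λ * x)) * Real.exp (Λ * t) * ‖w t‖ * (b * ‖f‖) := by gcongr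
        _ = _ := by rw [abs_of_nonneg (mul_nonneg hb (norm_nonneg _))]; ring
    · rw [intervalIntegral.integral_mul_const]
      gcongr
      exact hle x x.2
  have hu : IsUnit (1 - M' * V * M) :=
    isUnit_one_sub_clm (hT.trans_lt (by norm_num))
  have key : 1 - V = M * (1 - M' * V * M) * M' := by
    rw [mul_sub, sub_mul, mul_one, h1]
    have : M * (M' * V * M) * M' = (M * M') * V * (M * M') := by simp only [mul_assoc]
    rw [this, h1, one_mul, mul_one]
  rw [key]
  exact IsUnit.mul (IsUnit.mul ⟨U, rfl⟩ hu) ⟨U⁻¹, rfl⟩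

/-- Solvability of the initial value problem for `y'' = (w₀ - ζ w₁) y` on `[0, b]`, with analytic
dependence on `ζ`. -/
lemma exists_initial_value {w₀ w₁ : ℝ → ℂ} (hb : 0 < b) (h₀ : IntervalIntegrable w₀ volume 0 b)
    (h₁ : IntervalIntegrable w₁ volume 0 b) (A B : ℂ) :
    ∃ y y' : ℂ → ℝ → ℂ, (∀ ζ, IsPrim (y ζ) (y' ζ) 0 b ∧
      IsPrim (y' ζ) (fun x => (w₀ x - ζ * w₁ x) * y ζ x) 0 b ∧ y ζ 0 = A ∧ y' ζ 0 = B) ∧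
      (∀ x ∈ Icc 0 b, Differentiable ℂ fun ζ => y ζ x) ∧
      ∀ R : ℝ, ∃ C, ∀ ζ, ‖ζ‖ ≤ R → ∀ x ∈ Icc 0 b, ‖y ζ x‖ ≤ C := by
  obtain ⟨V₀, hV₀⟩ := exists_volterra hb.le h₀
  obtain ⟨V₁, hV₁⟩ := exists_volterra hb.le h₁
  have hw : ∀ ζ : ℂ, IntervalIntegrable (fun x => w₀ x - ζ * w₁ x) volume 0 b := fun ζ =>
    h₀.sub (h₁.const_mul ζ)
  have hsub : ∀ x ∈ Icc 0 b, uIcc 0 x ⊆ uIcc 0 b := fun x hx => by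
    rw [uIcc_of_le hb.le, uIcc_of_le hx.1]; exact Icc_subset_Icc_right hx.2
  have hV : ∀ (ζ : ℂ) (f : C(Icc 0 b, ℂ)) (x : Icc 0 b), (V₀ - ζ • V₁) f x =
      ∫ t in (0 : ℝ)..x, (((x : ℝ) - t : ℝ) : ℂ) *
        ((w₀ t - ζ * w₁ t) * IccExtend hb.le f t) := fun ζ f x => by
    have hI : ∀ {w : ℝ → ℂ}, IntervalIntegrable w volume 0 b → IntervalIntegrable
        (fun t => (((x : ℝ) - t : ℝ) : ℂ) * (w t * IccExtend hb.le f t)) volume 0 x := fun h =>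
      ((h.mono_set (hsub x x.2)).mul_continuousOn
        f.continuous.Icc_extend'.continuousOn).continuousOn_mul
        (Continuous.continuousOn (by fun_prop))
    have : (V₀ - ζ • V₁) f x = V₀ f x - ζ * V₁ f x := rfl
    rw [this, hV₀, hV₁, ← intervalIntegral.integral_const_mul,
      ← intervalIntegral.integral_sub (hI h₀) ((hI h₁).const_mul ζ)]
    refine intervalIntegral.integral_congr fun t _ => ?_
    ring
  have hu : ∀ ζ, IsUnit (1 - (V₀ - ζ • V₁)) := fun ζ =>
    isUnit_one_sub_volterra hb.le (hw ζ) (hV ζ)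
  let f : C(Icc 0 b, ℂ) := ⟨fun x => A + B * ((x : ℝ) : ℂ), by fun_prop⟩
  -- The solution of Y = f + (V₀ - ζ V₁) Y, where f carries the initial values.
  let Y : ℂ → C(Icc 0 b, ℂ) := fun ζ => Ring.inverse (1 - (V₀ - ζ • V₁)) f
  have hY : ∀ ζ x, Y ζ x = f x + (V₀ - ζ • V₁) (Y ζ) x := fun ζ x => by
    have h1 : (1 - (V₀ - ζ • V₁)) * Ring.inverse (1 - (V₀ - ζ • V₁)) = 1 :=
      Ring.mul_inverse_cancel _ (hu ζ)
    have h2 : (1 - (V₀ - ζ • V₁)) (Y ζ) = f := by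
      have := congrArg (fun L => L f) h1
      simpa using this
    rw [← h2]
    simp
  have hYd : Differentiable ℂ Y := differentiable_inverse_apply V₀ V₁ hu f
  have hYI : ∀ ζ, IntervalIntegrable
      (fun t => (w₀ t - ζ * w₁ t) * IccExtend hb.le (Y ζ) t) volume 0 b := fun ζ =>
    (hw ζ).mul_continuousOn (Y ζ).continuous.Icc_extend'.continuousOn
  refine ⟨fun ζ => IccExtend hb.le (Y ζ), fun ζ x => B + ∫ t in (0 : ℝ)..x,
    (w₀ t - ζ * w₁ t) * IccExtend hb.le (Y ζ) t, fun ζ => ⟨?_, ?_, ?_, ?_⟩, ?_, ?_⟩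
  · have hP : IsPrim (fun x => B + ∫ t in (0 : ℝ)..x,
      (w₀ t - ζ * w₁ t) * IccExtend hb.le (Y ζ) t) _ 0 b := ⟨hYI ζ, fun x _ => by simp⟩
    refine .of_sub (hP.intInt_left hb.le) fun x hx => ?_
    have h0 : (0 : ℝ) ∈ Icc 0 b := ⟨le_rfl, hb.le⟩
    have hc2 := (IsPrim.integral (hYI ζ)).intInt_left hb.le
    beta_reduce
    rw [IccExtend_of_mem _ _ hx, IccExtend_of_mem _ _ h0, hY, hY ζ ⟨0, h0⟩, hV, hV,
      integral_sub_mul_eq (hYI ζ) hx, intervalIntegral.integral_add (by simp)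
        (hc2.mono_set (hsub x hx))]
    simp [f]; ring
  · exact ⟨hYI ζ, fun x _ => by simp⟩
  · have h0 : (0 : ℝ) ∈ Icc 0 b := ⟨le_rfl, hb.le⟩
    beta_reduce
    rw [IccExtend_of_mem _ _ h0, hY, hV]; simp [f]
  · simp
  · intro x hx
    have : (fun ζ => IccExtend hb.le (Y ζ) x) = fun ζ =>
        ContinuousMap.evalCLM ℂ (⟨x, hx⟩ : Icc 0 b) (Y ζ) := by
      ext ζ; rw [IccExtend_of_mem _ _ hx]; rfl
    rw [this]
    exact (ContinuousLinearMap.differentiable _).comp hYd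
  · intro R
    obtain ⟨C, hC⟩ := (isCompact_closedBall (0 : ℂ) R).exists_bound_of_continuousOn
      hYd.continuous.continuousOn
    refine ⟨C, fun ζ hζ x hx => ?_⟩
    beta_reduce
    rw [IccExtend_of_mem _ _ hx]
    exact ((Y ζ).norm_coe_le_norm _).trans (hC ζ (by simpa using hζ))

end Fundamental

section Wronskian

variable {s t : ℝ} {V y y' u u' : ℝ → ℂ}

/-- Lagrange's identity. -/
lemma wronskian_sub {V W : ℝ → ℂ} (hst : s ≤ t) (hy : IsPrim y y' s t)
    (hy' : IsPrim y' (fun x => V x * y x) s t)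
    (hu : IsPrim u u' s t) (hu' : IsPrim u' (fun x => W x * u x) s t) {x : ℝ} (hx : x ∈ Icc s t) :
    (y' x * u x - y x * u' x) - (y' s * u s - y s * u' s) =
      ∫ r in s..x, (V r - W r) * y r * u r := by
  have h := (((hy'.mul hst hu).sub (hy.mul hst hu')).congr_right hst
    (.of_forall fun r _ => (by ring : _ = (V r - W r) * y r * u r))).sub_eq
    (x := s) (y := x) ⟨le_rfl, hst⟩ hx
  rw [← h]

lemma wronskian_const (hst : s ≤ t) (hy : IsPrim y y' s t)
    (hy' : IsPrim y' (fun x => V x * y x) s t)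
    (hu : IsPrim u u' s t) (hu' : IsPrim u' (fun x => V x * u x) s t) {x : ℝ} (hx : x ∈ Icc s t) :
    y' x * u x - y x * u' x = y' s * u s - y s * u' s := by
  have := wronskian_sub hst hy hy' hu hu' hx
  simpa [sub_eq_zero] using this

/-- Cramer's rule with three constant Wronskians; the one of σ and c equals 1. -/
lemma eq_combination {c c' σ σ' : ℝ → ℂ} (hst : s ≤ t) (hy : IsPrim y y' s t)
    (hy' : IsPrim y' (fun x => V x * y x) s t)
    (hc : IsPrim c c' s t) (hc' : IsPrim c' (fun x => V x * c x) s t)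
    (hσ : IsPrim σ σ' s t) (hσ' : IsPrim σ' (fun x => V x * σ x) s t)
    (c0 : c s = 1) (c0' : c' s = 0) (σ0 : σ s = 0) (σ0' : σ' s = 1) {x : ℝ} (hx : x ∈ Icc s t) :
    y x = y s * c x + y' s * σ x ∧ y' x = y s * c' x + y' s * σ' x := by
  have h1 := wronskian_const hst hy hy' hc hc' hx
  have h2 := wronskian_const hst hy hy' hσ hσ' hx
  have h3 := wronskian_const hst hσ hσ' hc hc' hx
  rw [c0, c0'] at h1
  rw [σ0, σ0'] at h2
  rw [c0, c0', σ0, σ0'] at h3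
  constructor
  · linear_combination (-y x) * h3 + σ x * h1 - c x * h2
  · linear_combination (-y' x) * h3 + σ' x * h1 - c' x * h2

end Wronskian

end

/-! ### Solutions with prescribed behaviour at infinity -/

noncomputable section

namespace SLProblem

variable {P : SLProblem}

/-- `y` solves the differential equation on `[0, ∞)` and `y'` is its derivative. -/
def Sol (P : SLProblem) (z : ℂ) (y y' : ℝ → ℂ) : Prop :=
  ∀ b, 0 ≤ b → IsPrim y y' 0 b ∧
    IsPrim y' (fun x => ((P.q x : ℂ) - z ^ 2 * (P.ρ x : ℂ)) * y x) 0 b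

lemma ρ_of_lt {x : ℝ} (h : x < P.a) : P.ρ x = P.α ^ 2 := if_pos h

lemma ρ_of_ge {x : ℝ} (h : P.a ≤ x) : P.ρ x = 1 := if_neg (not_lt.2 h)

lemma measurable_ρ : Measurable P.ρ :=
  Measurable.ite measurableSet_Iio measurable_const measurable_const

lemma Admissible.integrableOn_mul_q (hP : P.Admissible) :
    IntegrableOn (fun x => (1 + x) * |P.q x|) (Ioi 0) := by
  have : IntegrableOn (fun x => ‖(1 + x) * P.q x‖) (Ioi 0) := hP.q_integrable.norm
  refine this.congr_fun (fun x hx => ?_) measurableSet_Ioi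
  have hx' : (0 : ℝ) < x := hx
  simp only [norm_mul, Real.norm_eq_abs]
  rw [abs_of_pos (by linarith)]

lemma Admissible.integrableOn_q (hP : P.Admissible) : IntegrableOn P.q (Ioi 0) := by
  have h1 : IntegrableOn (fun x => (1 + x)⁻¹ * ((1 + x) * P.q x)) (Ioi 0) := by
    refine Integrable.bdd_mul (c := 1) hP.q_integrable
      (Measurable.aestronglyMeasurable (by fun_prop)) ?_
    refine (ae_restrict_iff' measurableSet_Ioi).2 (.of_forall fun x hx => ?_)
    have hx' : (0 : ℝ) < x := hx
    rw [norm_inv, Real.norm_eq_abs, abs_of_pos (by linarith)]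
    exact inv_le_one_of_one_le₀ (by linarith)
  refine h1.congr_fun (fun x hx => ?_) measurableSet_Ioi
  have hx' : (0 : ℝ) < x := hx
  simp only
  rw [inv_mul_cancel_left₀ (by linarith)]

lemma Admissible.intInt_q (hP : P.Admissible) {x y : ℝ} (hx : 0 ≤ x) (hy : 0 ≤ y) :
    IntervalIntegrable (fun r => (P.q r : ℂ)) volume x y := by
  rw [intervalIntegrable_iff]
  have : IntegrableOn (fun r => (P.q r : ℂ)) (Ioi 0) := hP.integrableOn_q.ofReal
  exact this.mono_set fun r hr => lt_of_le_of_lt (le_min hx hy) hr.1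

lemma intInt_ρ (P : SLProblem) (x y : ℝ) :
    IntervalIntegrable (fun r => (P.ρ r : ℂ)) volume x y := by
  rw [intervalIntegrable_iff]
  refine Measure.integrableOn_of_bounded (M := max (P.α ^ 2) 1) (by simp)
    (by have := measurable_ρ (P := P); fun_prop) (.of_forall fun r => ?_)
  rw [Complex.norm_real, Real.norm_eq_abs, ρ]
  split_ifs
  · rw [abs_of_nonneg (sq_nonneg _)]; exact le_max_left _ _
  · rw [abs_one]; exact le_max_right _ _

lemma Admissible.intInt_V (hP : P.Admissible) (z : ℂ) {x y : ℝ} (hx : 0 ≤ x) (hy : 0 ≤ y) :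
    IntervalIntegrable (fun r => (P.q r : ℂ) - z ^ 2 * (P.ρ r : ℂ)) volume x y :=
  (hP.intInt_q hx hy).sub ((intInt_ρ P x y).const_mul _)

/-- The derivative is a primitive, hence continuous, so the fundamental theorem of calculus makes y
a primitive of it. -/
lemma IsSolution.sol (hP : P.Admissible) {z : ℂ} {y : ℝ → ℂ} (h : P.IsSolution z y) :
    P.Sol z y (derivWithin y (Ici 0)) := by
  intro b hb
  have hyc : ContinuousOn y (Icc 0 b) := h.differentiableOn.continuousOn.mono Icc_subset_Ici_self
  have h2 : IsPrim (derivWithin y (Ici 0))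
      (fun x => ((P.q x : ℂ) - z ^ 2 * (P.ρ x : ℂ)) * y x) 0 b := by
    refine ⟨(hP.intInt_V z le_rfl hb).mul_continuousOn (by rwa [uIcc_of_le hb]), fun x hx => ?_⟩
    exact h.eqn x hx.1
  refine ⟨.of_sub (h2.intInt_left hb) fun x hx => ?_, h2⟩
  have h0 : (0 : ℝ) ∈ Icc 0 b := ⟨le_rfl, hb⟩
  rw [intervalIntegral.integral_eq_sub_of_hasDerivAt_of_le hx.1
    (hyc.mono (Icc_subset_Icc_right hx.2)) (fun r hr => ?_) ((h2.mono h0 hx).intInt_left hx.1)]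
  exact (h.differentiableOn r hr.1.le).hasDerivWithinAt.hasDerivAt (Ici_mem_nhds hr.1)

lemma Sol.continuousOn {z : ℂ} {y y' : ℝ → ℂ} (h : P.Sol z y y') : ContinuousOn y (Ici 0) := by
  intro x hx
  have h1 := (h (x + 1) (by have : (0 : ℝ) ≤ x := hx; linarith)).1.continuousOn x
    ⟨hx, by linarith⟩
  refine h1.mono_of_mem_nhdsWithin ?_
  rw [← Ici_inter_Iic]
  exact inter_mem_nhdsWithin _ (Iic_mem_nhds (by linarith))

lemma Sol.sub {z : ℂ} {y y' u u' : ℝ → ℂ} (hy : P.Sol z y y') (hu : P.Sol z u u') :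
    P.Sol z (fun x => y x - u x) (fun x => y' x - u' x) := fun b hb =>
  ⟨(hy b hb).1.sub (hu b hb).1, ((hy b hb).2.sub (hu b hb).2).congr_right hb
    (.of_forall fun x _ => by ring)⟩

lemma IsPrim_conj {f g : ℝ → ℂ} {s t : ℝ} (h : IsPrim f g s t) :
    IsPrim (fun x => conj (f x)) (fun x => conj (g x)) s t := by
  refine ⟨?_, fun x hx => ?_⟩
  · have := h.1
    rw [intervalIntegrable_iff] at this ⊢
    exact (Complex.conjCLE : ℂ →L[ℝ] ℂ).integrable_comp this
  · have := congrArg conj (h.2 x hx)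
    beta_reduce
    rw [this, map_add]
    congr 1
    rw [intervalIntegral, intervalIntegral, map_sub, ← integral_conj, ← integral_conj]

/-- q and ρ are real, and -conj z squares to the conjugate of z². The sign keeps the parameter in
the upper half-plane. -/
lemma Sol.conj {z : ℂ} {y y' : ℝ → ℂ} (hy : P.Sol z y y') :
    P.Sol (-conj z) (fun x => conj (y x)) (fun x => conj (y' x)) := fun b hb =>
  ⟨IsPrim_conj (hy b hb).1, (IsPrim_conj (hy b hb).2).congr_right hb
    (.of_forall fun x _ => by simp)⟩

lemma Sol.of_sq_eq {z w : ℂ} {y y' : ℝ → ℂ} (hy : P.Sol z y y') (h : w ^ 2 = z ^ 2) :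
    P.Sol w y y' := fun b hb => by rw [h]; exact hy b hb

section Jost

variable (hP : P.Admissible) {z : ℂ} {y y' : ℝ → ℂ}

/-- `e^{-izx} y(x)`. -/
def jm (z : ℂ) (y : ℝ → ℂ) (x : ℝ) : ℂ := Complex.exp (-(Complex.I * z * (x : ℂ))) * y x

/-- `e^{-izx} (y'(x) - iz y(x))`, the derivative of `jm z y`. -/
def jn (z : ℂ) (y y' : ℝ → ℂ) (x : ℝ) : ℂ :=
  Complex.exp (-(Complex.I * z * (x : ℂ))) * (y' x - Complex.I * z * y x)

lemma isPrim_exp_zero (c : ℂ) (s t : ℝ) :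
    IsPrim (fun x => Complex.exp (c * (x : ℂ))) (fun x => c * Complex.exp (c * (x : ℂ))) s t := by
  simpa using isPrim_exp c 0 s t

include hP

lemma Sol.prim_outer (h : P.Sol z y y') {s b : ℝ} (hs : P.a ≤ s) (hb : s ≤ b) :
    IsPrim y y' s b ∧ IsPrim y' (fun x => ((P.q x : ℂ) - z ^ 2) * y x) s b := by
  have h0 : 0 ≤ s := hP.a_pos.le.trans hs
  have hb0 := h0.trans hb
  have m1 : s ∈ Icc 0 b := ⟨h0, hb⟩
  have m2 : b ∈ Icc 0 b := ⟨hb0, le_rfl⟩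
  refine ⟨(h b hb0).1.mono m1 m2, ((h b hb0).2.mono m1 m2).congr_right hb
    (.of_forall fun x hx => ?_)⟩
  rw [ρ_of_ge (hs.trans hx.1.le)]; simp

lemma Sol.prim_inner (h : P.Sol z y y') :
    IsPrim y y' 0 P.a ∧
      IsPrim y' (fun x => ((P.q x : ℂ) - z ^ 2 * (P.α : ℂ) ^ 2) * y x) 0 P.a := by
  refine ⟨(h _ hP.a_pos.le).1, (h _ hP.a_pos.le).2.congr_right hP.a_pos.le ?_⟩
  have e2 : ∀ᵐ x : ℝ, x ≠ P.a := by simp [ae_iff, measure_singleton]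
  filter_upwards [e2] with x hx hxs
  rw [ρ_of_lt (lt_of_le_of_ne hxs.2 hx)]; simp

lemma Sol.prim_jm (h : P.Sol z y y') {s b : ℝ} (hs : P.a ≤ s) (hb : s ≤ b) :
    IsPrim (jm z y) (jn z y y') s b := by
  obtain ⟨h1, h2⟩ := h.prim_outer hP hs hb
  refine (((isPrim_exp_zero (-(Complex.I * z)) s b).mul hb h1).congr_left
    fun x _ => ?_).congr_right hb (.of_forall fun x _ => ?_)
  · rw [jm, neg_mul]
  · rw [jn, neg_mul (Complex.I * z) (x : ℂ)]; ring

/-- The exponential is the integrating factor of jn' = -2iz jn + q jm. -/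
lemma Sol.prim_jn_exp (h : P.Sol z y y') {s b : ℝ} (hs : P.a ≤ s) (hb : s ≤ b) :
    IsPrim (fun x => Complex.exp (2 * Complex.I * z * (x : ℂ)) * jn z y y' x)
      (fun x => Complex.exp (2 * Complex.I * z * (x : ℂ)) * ((P.q x : ℂ) * jm z y x)) s b := by
  obtain ⟨h1, h2⟩ := h.prim_outer hP hs hb
  have e : ∀ x : ℝ, Complex.exp (2 * Complex.I * z * (x : ℂ)) *
      Complex.exp (-(Complex.I * z * (x : ℂ))) = Complex.exp (Complex.I * z * (x : ℂ)) :=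
    fun x => by rw [← Complex.exp_add]; ring_nf
  refine (((isPrim_exp_zero (Complex.I * z) s b).mul hb (h2.sub
    (h1.const_mul (Complex.I * z)))).congr_left fun x _ => ?_).congr_right hb
    (.of_forall fun x _ => ?_)
  · rw [jn, ← mul_assoc, e]
  · rw [jm, mul_left_comm (P.q x : ℂ), ← mul_assoc, e]
    linear_combination (-(Complex.exp (Complex.I * z * (x : ℂ)) * z ^ 2 * y x)) * Complex.I_sq

lemma Sol.prim_jn_add (h : P.Sol z y y') {s b : ℝ} (hs : P.a ≤ s) (hb : s ≤ b) :
    IsPrim (fun x => jn z y y' x + 2 * Complex.I * z * jm z y x)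
      (fun x => (P.q x : ℂ) * jm z y x) s b := by
  obtain ⟨h1, h2⟩ := h.prim_outer hP hs hb
  refine (((isPrim_exp_zero (-(Complex.I * z)) s b).mul hb (h2.add
    (h1.const_mul (Complex.I * z)))).congr_left fun x _ => ?_).congr_right hb
    (.of_forall fun x _ => ?_)
  · rw [jn, jm, neg_mul (Complex.I * z) (x : ℂ)]; ring
  · rw [jm, neg_mul (Complex.I * z) (x : ℂ)]
    linear_combination (-(Complex.exp (-(Complex.I * z * (x : ℂ))) * z ^ 2 * y x)) * Complex.I_sq

lemma Sol.continuousOn_jm (h : P.Sol z y y') : ContinuousOn (jm z y) (Ici P.a) := by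
  have := h.continuousOn.mono (Ici_subset_Ici.2 hP.a_pos.le)
  unfold jm
  exact ContinuousOn.mul (Continuous.continuousOn (by fun_prop)) this

omit hP in
lemma exists_bound_of_tendsto {f : ℝ → ℂ} {s : ℝ} {c : ℂ} (hf : ContinuousOn f (Ici s))
    (hc : Tendsto f atTop (𝓝 c)) : ∃ M, ∀ x, s ≤ x → ‖f x‖ ≤ M := by
  obtain ⟨b, hb⟩ := eventually_atTop.1 (hc.norm.eventually (gt_mem_nhds (lt_add_one ‖c‖)))
  obtain ⟨M, hM⟩ := isCompact_Icc.exists_bound_of_continuousOn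
    (hf.mono (Icc_subset_Ici_self : Icc s b ⊆ _))
  refine ⟨max M (‖c‖ + 1), fun x hx => ?_⟩
  rcases le_total x b with h | h
  · exact (hM x ⟨hx, h⟩).trans (le_max_left _ _)
  · exact (hb x h).le.trans (le_max_right _ _)

lemma Sol.integrableOn_q_jm (h : P.Sol z y y') {c : ℂ} (hc : Tendsto (jm z y) atTop (𝓝 c))
    {s : ℝ} (hs : P.a ≤ s) :
    IntegrableOn (fun x => (P.q x : ℂ) * jm z y x) (Ioi s) := by
  have hcont := (h.continuousOn_jm hP).mono (Ici_subset_Ici.2 hs)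
  obtain ⟨M, hM⟩ := exists_bound_of_tendsto hcont hc
  have hq : IntegrableOn (fun r => (P.q r : ℂ)) (Ioi s) :=
    (hP.integrableOn_q.mono_set (Ioi_subset_Ioi (hP.a_pos.le.trans hs))).ofReal
  refine Integrable.mul_bdd (c := M) hq
    ((hcont.mono Ioi_subset_Ici_self).aestronglyMeasurable measurableSet_Ioi) ?_
  exact (ae_restrict_iff' measurableSet_Ioi).2 (.of_forall fun x hx => hM x (le_of_lt hx))

/-- By `prim_jn_add` and the integrability of q jm, jn has a limit. That limit is also the limit of
the increments of the convergent function jm over unit intervals, hence 0. -/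
lemma Sol.tendsto_jn (h : P.Sol z y y') {c : ℂ} (hc : Tendsto (jm z y) atTop (𝓝 c)) :
    Tendsto (jn z y y') atTop (𝓝 0) := by
  have hI := h.integrableOn_q_jm hP hc le_rfl
  have h1 : Tendsto (fun b => ∫ x in P.a..b, (P.q x : ℂ) * jm z y x) atTop
      (𝓝 (∫ x in Ioi P.a, (P.q x : ℂ) * jm z y x)) :=
    intervalIntegral_tendsto_integral_Ioi _ hI tendsto_id
  set L := ∫ x in Ioi P.a, (P.q x : ℂ) * jm z y x
  set k := jn z y y' P.a + 2 * Complex.I * z * jm z y P.a with hk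
  have h2 : Tendsto (jn z y y') atTop (𝓝 (k + L - 2 * Complex.I * z * c)) := by
    refine ((h1.const_add k).sub (hc.const_mul (2 * Complex.I * z))).congr' ?_
    filter_upwards [eventually_ge_atTop P.a] with b hb
    have := (h.prim_jn_add hP le_rfl hb).2 b ⟨hb, le_rfl⟩
    rw [hk, ← this]; ring
  set ν := k + L - 2 * Complex.I * z * c
  have h3 : Tendsto (fun b => jm z y (b + 1) - jm z y b) atTop (𝓝 (c - c)) :=
    (hc.comp (tendsto_atTop_add_const_right _ _ tendsto_id)).sub hc
  have h4 : Tendsto (fun b => jm z y (b + 1) - jm z y b) atTop (𝓝 ν) := by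
    rw [Metric.tendsto_atTop] at h2 ⊢
    intro ε hε
    obtain ⟨N, hN⟩ := h2 (ε / 2) (half_pos hε)
    refine ⟨max N P.a, fun b hb => ?_⟩
    have hba : P.a ≤ b := (le_max_right _ _).trans hb
    have hp := h.prim_jm hP hba (show b ≤ b + 1 by linarith)
    have hcn : IntervalIntegrable (jn z y y') volume b (b + 1) := hp.1
    rw [hp.sub_eq (x := b) (y := b + 1) ⟨le_rfl, by linarith⟩ ⟨by linarith, le_rfl⟩, dist_eq_norm]
    have : (∫ r in b..b + 1, jn z y y' r) - ν = ∫ r in b..b + 1, (jn z y y' r - ν) := by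
      rw [intervalIntegral.integral_sub hcn (by simp)]; simp
    rw [this]
    refine lt_of_le_of_lt (intervalIntegral.norm_integral_le_of_norm_le_const (C := ε / 2)
      fun r hr => ?_) (by simp; linarith)
    rw [uIoc_of_le (by linarith)] at hr
    rw [← dist_eq_norm]
    exact (hN r ((le_max_left _ _).trans (hb.trans hr.1.le))).le
  have h5 := tendsto_nhds_unique h4 h3
  rw [sub_self] at h5
  rwa [h5] at h2

/-- Integrating `prim_jn_exp` from x to infinity gives jn(x) = -∫ exp(2iz(r - x)) q jm, with an
exponential of modulus at most 1 because Im z ≥ 0. -/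
lemma Sol.norm_jn_le (h : P.Sol z y y') (hz : 0 ≤ z.im) {c : ℂ}
    (hc : Tendsto (jm z y) atTop (𝓝 c)) {x : ℝ} (hx : P.a ≤ x) :
    ‖jn z y y' x‖ ≤ ∫ r in Ioi x, |P.q r| * ‖jm z y r‖ := by
  have hI : IntegrableOn (fun r => ‖(P.q r : ℂ) * jm z y r‖) (Ioi x) :=
    (h.integrableOn_q_jm hP hc hx).norm
  have hJ : ∫ r in Ioi x, |P.q r| * ‖jm z y r‖ = ∫ r in Ioi x, ‖(P.q r : ℂ) * jm z y r‖ := by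
    refine integral_congr_ae (.of_forall fun r => ?_); simp
  rw [hJ]
  have h0 := (h.tendsto_jn hP hc).norm.add_const (∫ r in Ioi x, ‖(P.q r : ℂ) * jm z y r‖)
  rw [norm_zero, zero_add] at h0
  refine ge_of_tendsto h0 ?_
  filter_upwards [eventually_ge_atTop x] with b hb
  have hp := (h.prim_jn_exp hP hx hb).sub_eq (x := x) (y := b) ⟨le_rfl, hb⟩ ⟨hb, le_rfl⟩
  have hn : ∀ r : ℝ, ‖Complex.exp (2 * Complex.I * z * (r : ℂ))‖ = Real.exp (-(2 * z.im * r)) :=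
    fun r => by rw [Complex.norm_exp]; simp
  have hIb : IntervalIntegrable (fun r => ‖(P.q r : ℂ) * jm z y r‖) volume x b := by
    rw [intervalIntegrable_iff_integrableOn_Ioc_of_le hb]
    exact hI.mono_set Ioc_subset_Ioi_self
  have h3 : ‖∫ r in x..b, Complex.exp (2 * Complex.I * z * (r : ℂ)) * ((P.q r : ℂ) * jm z y r)‖ ≤
      Real.exp (-(2 * z.im * x)) * ∫ r in Ioi x, ‖(P.q r : ℂ) * jm z y r‖ := by
    refine (intervalIntegral.norm_integral_le_of_norm_le hb (.of_forall fun r hr => ?_)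
      (hIb.const_mul (Real.exp (-(2 * z.im * x))))).trans ?_
    · rw [norm_mul _ (_ * _), hn]
      gcongr
      exact hr.1.le
    · rw [intervalIntegral.integral_const_mul, intervalIntegral.integral_of_le hb]
      refine mul_le_mul_of_nonneg_left ?_ (Real.exp_pos _).le
      exact setIntegral_mono_set hI (.of_forall fun _ => norm_nonneg _)
        Ioc_subset_Ioi_self.eventuallyLE
  have h4 : Real.exp (-(2 * z.im * x)) * ‖jn z y y' x‖ ≤ Real.exp (-(2 * z.im * x)) *
      (‖jn z y y' b‖ + ∫ r in Ioi x, ‖(P.q r : ℂ) * jm z y r‖) := by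
    rw [← hn, ← norm_mul]
    rw [sub_eq_iff_eq_add, ← sub_eq_iff_eq_add'] at hp
    rw [← hp]
    refine (norm_sub_le _ _).trans ?_
    rw [mul_add, hn]
    gcongr
    rw [norm_mul, hn]
    gcongr
  exact le_of_mul_le_mul_left h4 (Real.exp_pos _)

/-- Compared with `norm_jn_le` this bound carries the factor z. The two together yield jm - c =
O(1/z). -/
lemma Sol.norm_jn_add_le (h : P.Sol z y y') {c : ℂ}
    (hc : Tendsto (jm z y) atTop (𝓝 c)) {x : ℝ} (hx : P.a ≤ x) :
    ‖jn z y y' x + 2 * Complex.I * z * (jm z y x - c)‖ ≤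
      ∫ r in Ioi x, |P.q r| * ‖jm z y r‖ := by
  have hI : IntegrableOn (fun r => ‖(P.q r : ℂ) * jm z y r‖) (Ioi x) :=
    (h.integrableOn_q_jm hP hc hx).norm
  have hJ : ∫ r in Ioi x, |P.q r| * ‖jm z y r‖ = ∫ r in Ioi x, ‖(P.q r : ℂ) * jm z y r‖ := by
    refine integral_congr_ae (.of_forall fun r => ?_); simp
  rw [hJ]
  have h0 : Tendsto (fun b => jn z y y' x + 2 * Complex.I * z * jm z y x -
      (jn z y y' b + 2 * Complex.I * z * jm z y b)) atTop
      (𝓝 (jn z y y' x + 2 * Complex.I * z * jm z y x - (0 + 2 * Complex.I * z * c))) :=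
    ((h.tendsto_jn hP hc).add (hc.const_mul _)).const_sub _
  have e : jn z y y' x + 2 * Complex.I * z * (jm z y x - c) =
    jn z y y' x + 2 * Complex.I * z * jm z y x - (0 + 2 * Complex.I * z * c) := by ring
  rw [e]
  refine le_of_tendsto h0.norm ?_
  filter_upwards [eventually_ge_atTop x] with b hb
  rw [norm_sub_rev, (h.prim_jn_add hP hx hb).sub_eq (x := x) (y := b) ⟨le_rfl, hb⟩ ⟨hb, le_rfl⟩,
    intervalIntegral.integral_of_le hb]
  exact (norm_integral_le_integral_norm _).trans (setIntegral_mono_set hI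
    (.of_forall fun _ => norm_nonneg _) Ioc_subset_Ioi_self.eventuallyLE)

/-- Integration by parts moves the weight s - x onto |q|. Here the first moment of q is spent. -/
lemma integral_tail_le {x b : ℝ} (hx : 0 ≤ x) (hb : x ≤ b) :
    IntervalIntegrable (fun s => ∫ r in Ioi s, |P.q r|) volume x b ∧
    ∫ s in x..b, (∫ r in Ioi s, |P.q r|) ≤ ∫ r in Ioi x, (1 + r) * |P.q r| := by
  have hq : IntegrableOn (fun r => |P.q r|) (Ioi x) :=
    (hP.integrableOn_q.mono_set (Ioi_subset_Ioi hx)).norm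
  have hqi : IntervalIntegrable (fun r => ((|P.q r| : ℝ) : ℂ)) volume x b := by
    rw [intervalIntegrable_iff_integrableOn_Ioc_of_le hb]
    exact (hq.mono_set Ioc_subset_Ioi_self).ofReal
  have hqi' : IntervalIntegrable (fun r => |P.q r|) volume x b := by
    rw [intervalIntegrable_iff_integrableOn_Ioc_of_le hb]
    exact hq.mono_set Ioc_subset_Ioi_self
  have hsplit : ∀ s, x ≤ s → s ≤ b → ∫ r in Ioi s, |P.q r| =
      (∫ r in Ioi x, |P.q r|) - ∫ r in x..s, |P.q r| := fun s hs hsb => by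
    rw [intervalIntegral.integral_of_le hs, eq_sub_iff_add_eq', ← setIntegral_union
      (Ioc_disjoint_Ioi le_rfl) measurableSet_Ioi (hq.mono_set Ioc_subset_Ioi_self)
      (hq.mono_set (Ioi_subset_Ioi hs)), Ioc_union_Ioi_eq_Ioi hs]
  have h1 : IsPrim (fun s => ((∫ r in Ioi s, |P.q r| : ℝ) : ℂ)) (fun r => -((|P.q r| : ℝ) : ℂ))
      x b := by
    refine .of_sub hqi.neg fun s hs => ?_
    rw [intervalIntegral.integral_neg, intervalIntegral.integral_ofReal, hsplit s hs.1 hs.2]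
    push_cast; ring
  have h2 : IsPrim (fun s : ℝ => ((s - x : ℝ) : ℂ)) (fun _ => 1) x b :=
    .of_hasDerivAt (fun t => by
      have := ((hasDerivAt_id t).sub_const x).ofReal_comp
      simpa using this) continuous_const
  have h3 := (h2.mul hb h1).sub_eq (x := x) (y := b) ⟨le_rfl, hb⟩ ⟨hb, le_rfl⟩
  have hTc := h1.intInt_left hb
  have hT : IntervalIntegrable (fun s => ∫ r in Ioi s, |P.q r|) volume x b := by
    rw [intervalIntegrable_iff] at hTc ⊢
    exact hTc.re
  refine ⟨hT, ?_⟩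
  have hM : IntervalIntegrable (fun r => (r - x) * |P.q r|) volume x b :=
    hqi'.continuousOn_mul (Continuous.continuousOn (by fun_prop))
  have h4 : ∫ s in x..b, (∫ r in Ioi s, |P.q r|) =
      (b - x) * (∫ r in Ioi b, |P.q r|) + ∫ r in x..b, (r - x) * |P.q r| := by
    have e : ∀ s : ℝ, (1 : ℂ) * ((∫ r in Ioi s, |P.q r| : ℝ) : ℂ) +
        ((s - x : ℝ) : ℂ) * -((|P.q s| : ℝ) : ℂ) =
        (((∫ r in Ioi s, |P.q r|) - (s - x) * |P.q s| : ℝ) : ℂ) := fun s => by push_cast; ring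
    simp only [e, sub_self, Complex.ofReal_zero, zero_mul, sub_zero] at h3
    rw [intervalIntegral.integral_ofReal, ← Complex.ofReal_mul] at h3
    have h3' := Complex.ofReal_injective h3
    rw [intervalIntegral.integral_sub hT hM] at h3'
    linarith
  have hw : IntegrableOn (fun r => (1 + r) * |P.q r|) (Ioi x) :=
    hP.integrableOn_mul_q.mono_set (Ioi_subset_Ioi hx)
  have h5 : (b - x) * (∫ r in Ioi b, |P.q r|) ≤ ∫ r in Ioi b, (1 + r) * |P.q r| := by
    rw [← integral_const_mul]
    refine setIntegral_mono_on ((hq.mono_set (Ioi_subset_Ioi hb)).const_mul _)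
      (hw.mono_set (Ioi_subset_Ioi hb)) measurableSet_Ioi fun r hr => ?_
    have : b < r := hr
    gcongr; linarith
  have h6 : ∫ r in x..b, (r - x) * |P.q r| ≤ ∫ r in Ioc x b, (1 + r) * |P.q r| := by
    rw [← intervalIntegral.integral_of_le hb]
    refine intervalIntegral.integral_mono_on hb hM ?_ fun r hr => ?_
    · rw [intervalIntegrable_iff_integrableOn_Ioc_of_le hb]
      exact hw.mono_set Ioc_subset_Ioi_self
    · gcongr; linarith
  rw [h4, ← Ioc_union_Ioi_eq_Ioi hb, setIntegral_union
      (Ioc_disjoint_Ioi le_rfl) measurableSet_Ioi (hw.mono_set Ioc_subset_Ioi_self)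
      (hw.mono_set (Ioi_subset_Ioi hb))]
  linarith

/-- c - jm(x) is the integral of jn over (x, ∞); `norm_jn_le` and `integral_tail_le` bound it. -/
lemma Sol.norm_jm_sub_le (h : P.Sol z y y') (hz : 0 ≤ z.im) {c : ℂ}
    (hc : Tendsto (jm z y) atTop (𝓝 c)) {x M : ℝ} (hx : P.a ≤ x)
    (hM : ∀ r, x ≤ r → ‖jm z y r‖ ≤ M) :
    ‖jm z y x - c‖ ≤ M * ∫ r in Ioi x, (1 + r) * |P.q r| := by
  have hM0 : 0 ≤ M := (norm_nonneg _).trans (hM x le_rfl)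
  rw [norm_sub_rev]
  refine le_of_tendsto (hc.sub_const (jm z y x)).norm ?_
  filter_upwards [eventually_ge_atTop x] with b hb
  obtain ⟨i1, i2⟩ := integral_tail_le hP (hP.a_pos.le.trans hx) hb
  rw [(h.prim_jm hP hx hb).sub_eq (x := x) (y := b) ⟨le_rfl, hb⟩ ⟨hb, le_rfl⟩]
  refine (intervalIntegral.norm_integral_le_of_norm_le hb (.of_forall fun r hr => ?_)
    (i1.const_mul M)).trans ?_
  · have hra : P.a ≤ r := hx.trans hr.1.le
    refine (h.norm_jn_le hP hz hc hra).trans ?_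
    have hq : IntegrableOn (fun r => |P.q r|) (Ioi r) :=
      (hP.integrableOn_q.mono_set (Ioi_subset_Ioi (hP.a_pos.le.trans hra))).norm
    rw [← integral_const_mul]
    refine setIntegral_mono_on ?_ (hq.const_mul M) measurableSet_Ioi fun t ht => ?_
    · have : IntegrableOn (fun t => ‖(P.q t : ℂ) * jm z y t‖) (Ioi r) :=
        (h.integrableOn_q_jm hP hc hra).norm
      refine this.congr_fun (fun t _ => ?_) measurableSet_Ioi
      simp
    · rw [mul_comm]
      gcongr
      exact hM t (hr.1.le.trans (le_of_lt ht))
  · rw [intervalIntegral.integral_const_mul]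
    gcongr

end Jost

end SLProblem

end

/-! ### Uniqueness and Wronskian identities for the Jost solution -/

noncomputable section

namespace SLProblem

variable {P : SLProblem}

lemma Admissible.exists_tail_small (hP : P.Admissible) :
    ∃ X, P.a ≤ X ∧ ∫ r in Ioi X, (1 + r) * |P.q r| ≤ 1 / 4 := by
  have hI := hP.integrableOn_mul_q
  have h1 := intervalIntegral_tendsto_integral_Ioi 0 hI tendsto_id
  have h2 := (h1.const_sub (∫ r in Ioi 0, (1 + r) * |P.q r|)).eventually
    (gt_mem_nhds (show _ < (1 / 4 : ℝ) by rw [sub_self]; norm_num))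
  obtain ⟨X, hX1, hX2⟩ := (h2.and (eventually_ge_atTop P.a)).exists
  refine ⟨X, hX2, ?_⟩
  have hX0 : 0 ≤ X := hP.a_pos.le.trans hX2
  have : ∫ r in Ioi 0, (1 + r) * |P.q r| = (∫ r in (0 : ℝ)..X, (1 + r) * |P.q r|) +
      ∫ r in Ioi X, (1 + r) * |P.q r| := by
    rw [intervalIntegral.integral_of_le hX0, ← setIntegral_union
      (Ioc_disjoint_Ioi le_rfl) measurableSet_Ioi (hI.mono_set Ioc_subset_Ioi_self)
      (hI.mono_set (Ioi_subset_Ioi hX0)), Ioc_union_Ioi_eq_Ioi hX0]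
  simp only [id_eq] at hX1
  linarith

/-- If M is the supremum of |jm| on [X, ∞), then |jm - c| ≤ M/4 there, so M ≤ |c| + M/4, that is, M
≤ 4|c|/3. -/
lemma Sol.norm_jm_sub_le_third (hP : P.Admissible) {z : ℂ} {y y' : ℝ → ℂ} (h : P.Sol z y y')
    (hz : 0 ≤ z.im) {c : ℂ} (hc : Tendsto (jm z y) atTop (𝓝 c)) {X : ℝ} (hX : P.a ≤ X)
    (hσ : ∫ r in Ioi X, (1 + r) * |P.q r| ≤ 1 / 4) {x : ℝ} (hx : X ≤ x) :
    ‖jm z y x - c‖ ≤ ‖c‖ / 3 := by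
  obtain ⟨M₀, hM₀⟩ := exists_bound_of_tendsto
    ((h.continuousOn_jm hP).mono (Ici_subset_Ici.2 hX)) hc
  set T := (fun r => ‖jm z y r‖) '' Ici X
  have hbdd : BddAbove T := ⟨M₀, by rintro _ ⟨r, hr, rfl⟩; exact hM₀ r hr⟩
  have hne : T.Nonempty := ⟨_, X, self_mem_Ici, rfl⟩
  set M := sSup T with hMdef
  have hM : ∀ r, X ≤ r → ‖jm z y r‖ ≤ M := fun r hr => le_csSup hbdd ⟨r, hr, rfl⟩
  have hM0 : 0 ≤ M := (norm_nonneg _).trans (hM X le_rfl)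
  have key : ∀ r, X ≤ r → ‖jm z y r - c‖ ≤ M * (1 / 4) := fun r hr => by
    refine (h.norm_jm_sub_le hP hz hc (hX.trans hr) fun s hs => hM s (hr.trans hs)).trans ?_
    gcongr
    refine le_trans ?_ hσ
    have hX0 : 0 ≤ X := hP.a_pos.le.trans hX
    refine setIntegral_mono_set (hP.integrableOn_mul_q.mono_set (Ioi_subset_Ioi hX0)) ?_
      (Ioi_subset_Ioi hr).eventuallyLE
    refine (ae_restrict_iff' measurableSet_Ioi).2 (.of_forall fun t ht => ?_)
    have : X < t := ht
    have : 0 ≤ 1 + t := by linarith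
    simp only [Pi.zero_apply]
    positivity
  have hM2 : M ≤ ‖c‖ + M * (1 / 4) := by
    refine csSup_le hne ?_
    rintro _ ⟨r, hr, rfl⟩
    have := norm_le_norm_add_norm_sub' (jm z y r) c
    have := key r hr
    simp only
    linarith
  have := key x hx
  linarith

/-- The solutions `c`, `σ` with initial values `(1, 0)` and `(0, 1)`. -/
structure IsFundamental (P : SLProblem) (b : ℝ) (c c' σ σ' : ℂ → ℝ → ℂ) : Prop where
  cos : ∀ z, IsPrim (c z) (c' z) 0 b ∧
    IsPrim (c' z) (fun x => ((P.q x : ℂ) - z ^ 2 * (P.ρ x : ℂ)) * c z x) 0 b ∧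
    c z 0 = 1 ∧ c' z 0 = 0
  sin : ∀ z, IsPrim (σ z) (σ' z) 0 b ∧
    IsPrim (σ' z) (fun x => ((P.q x : ℂ) - z ^ 2 * (P.ρ x : ℂ)) * σ z x) 0 b ∧
    σ z 0 = 0 ∧ σ' z 0 = 1
  cos_diff : ∀ x ∈ Icc 0 b, Differentiable ℂ fun z => c z x
  sin_diff : ∀ x ∈ Icc 0 b, Differentiable ℂ fun z => σ z x
  bound : ∀ R : ℝ, ∃ C, ∀ z, ‖z‖ ≤ R → ∀ x ∈ Icc 0 b, ‖c z x‖ ≤ C ∧ ‖σ z x‖ ≤ C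

lemma Admissible.exists_fundamental (hP : P.Admissible) {b : ℝ} (hb : 0 < b) :
    ∃ c c' σ σ', IsFundamental P b c c' σ σ' := by
  obtain ⟨c, c', h1, h2, h3⟩ := exists_initial_value hb (hP.intInt_q le_rfl hb.le)
    (intInt_ρ P 0 b) 1 0
  obtain ⟨σ, σ', k1, k2, k3⟩ := exists_initial_value hb (hP.intInt_q le_rfl hb.le)
    (intInt_ρ P 0 b) 0 1
  refine ⟨fun z => c (z ^ 2), fun z => c' (z ^ 2), fun z => σ (z ^ 2), fun z => σ' (z ^ 2),
    fun z => h1 _, fun z => k1 _, fun x hx => (h2 x hx).comp (differentiable_id.pow 2),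
    fun x hx => (k2 x hx).comp (differentiable_id.pow 2), fun R => ?_⟩
  obtain ⟨C, hC⟩ := h3 (R ^ 2)
  obtain ⟨D, hD⟩ := k3 (R ^ 2)
  refine ⟨max C D, fun z hz x hx => ?_⟩
  have : ‖z ^ 2‖ ≤ R ^ 2 := by rw [norm_pow]; gcongr
  exact ⟨(hC _ this x hx).trans (le_max_left _ _), (hD _ this x hx).trans (le_max_right _ _)⟩

lemma IsFundamental.eq_combination {b : ℝ} {c c' σ σ' : ℂ → ℝ → ℂ}
    (hF : IsFundamental P b c c' σ σ') {z : ℂ} {y y' : ℝ → ℂ} (h : P.Sol z y y') {x : ℝ}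
    (hx : x ∈ Icc 0 b) :
    y x = y 0 * c z x + y' 0 * σ z x ∧ y' x = y 0 * c' z x + y' 0 * σ' z x := by
  have hb : 0 ≤ b := hx.1.trans hx.2
  obtain ⟨h1, h2, h3, h4⟩ := hF.cos z
  obtain ⟨k1, k2, k3, k4⟩ := hF.sin z
  exact _root_.eq_combination hb (h b hb).1 (h b hb).2 h1 h2 k1 k2 h3 h4 k3 k4 hx

/-- With limit 0 the bound by |c|/3 annihilates the solution beyond X. Constant Wronskians with the
fundamental system carry the vanishing Cauchy data from X back to 0. -/
lemma Sol.eq_zero (hP : P.Admissible) {z : ℂ} {y y' : ℝ → ℂ} (h : P.Sol z y y')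
    (hz : 0 ≤ z.im) (hc : Tendsto (jm z y) atTop (𝓝 0)) {x : ℝ} (hx : 0 ≤ x) :
    y x = 0 ∧ y' x = 0 := by
  obtain ⟨X, hX, hσ⟩ := hP.exists_tail_small
  have hX0 : 0 ≤ X := hP.a_pos.le.trans hX
  have hm : ∀ r, X ≤ r → jm z y r = 0 := fun r hr => by
    have := h.norm_jm_sub_le_third hP hz hc hX hσ hr
    simpa using this
  have hn : jn z y y' X = 0 := by
    have h1 := h.norm_jn_le hP hz hc hX
    rw [setIntegral_congr_fun measurableSet_Ioi (g := fun _ => (0 : ℝ))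
      (fun r hr => by simp only [hm r (le_of_lt hr), norm_zero, mul_zero])] at h1
    simpa using h1
  have hyX : y X = 0 := by
    have := hm X le_rfl
    rw [jm, mul_eq_zero] at this
    exact this.resolve_left (Complex.exp_ne_zero _)
  have hyX' : y' X = 0 := by
    rw [jn, mul_eq_zero, hyX, mul_zero, sub_zero] at hn
    exact hn.resolve_left (Complex.exp_ne_zero _)
  obtain ⟨c, c', σ, σ', hF⟩ := hP.exists_fundamental (b := X + x + 1) (by linarith)
  have hb : 0 ≤ X + x + 1 := by linarith
  obtain ⟨h1, h2, h3, h4⟩ := hF.cos z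
  obtain ⟨k1, k2, k3, k4⟩ := hF.sin z
  have hXm : X ∈ Icc 0 (X + x + 1) := ⟨hX0, by linarith⟩
  have w1 := wronskian_const hb (h _ hb).1 (h _ hb).2 h1 h2 hXm
  have w2 := wronskian_const hb (h _ hb).1 (h _ hb).2 k1 k2 hXm
  rw [hyX, hyX', h3, h4] at w1
  rw [hyX, hyX', k3, k4] at w2
  have z1 : y' 0 = 0 := by simpa using w1.symm
  have z2 : y 0 = 0 := by simpa using w2.symm
  have := hF.eq_combination h (x := x) ⟨hx, by linarith⟩
  simpa [z1, z2] using this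

section Jost

variable {e : ℝ → ℂ → ℂ}

/-- The derivative in `x` of the Jost solution. -/
def ed (e : ℝ → ℂ → ℂ) (x : ℝ) (z : ℂ) : ℂ := derivWithin (fun x => e x z) (Ici 0) x

lemma IsJostSolution.sol (hP : P.Admissible) (he : P.IsJostSolution e) {z : ℂ} (hz : 0 ≤ z.im) :
    P.Sol z (fun x => e x z) (fun x => ed e x z) := (he.isSolution z hz).sol hP

lemma IsJostSolution.tendsto_jm (he : P.IsJostSolution e) {z : ℂ} (hz : 0 ≤ z.im) :
    Tendsto (jm z (fun x => e x z)) atTop (𝓝 1) := he.asymptotic z hz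

lemma exp_mul_jm (z : ℂ) (y : ℝ → ℂ) (x : ℝ) :
    y x = Complex.exp (Complex.I * z * (x : ℂ)) * jm z y x := by
  rw [jm, ← mul_assoc, ← Complex.exp_add]; simp

lemma exp_mul_jn (z : ℂ) (y y' : ℝ → ℂ) (x : ℝ) :
    y' x = Complex.exp (Complex.I * z * (x : ℂ)) * (jn z y y' x + Complex.I * z * jm z y x) := by
  rw [jm, jn, mul_left_comm (Complex.I * z), ← mul_add, ← mul_assoc, ← Complex.exp_add]; simp

lemma im_neg_conj (z : ℂ) : (-conj z).im = z.im := by simp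

/-- Both sides solve the equation with parameter -conj z and have the same normalisation at
infinity, so uniqueness applies to their difference. For real z it identifies the conjugate of e(x,
z) with e(x, -z). -/
lemma IsJostSolution.conj_eq (hP : P.Admissible) (he : P.IsJostSolution e) {z : ℂ}
    (hz : 0 ≤ z.im) {x : ℝ} (hx : 0 ≤ x) :
    conj (e x z) = e x (-conj z) ∧ conj (ed e x z) = ed e x (-conj z) := by
  have hz' : 0 ≤ (-conj z).im := by rwa [im_neg_conj]
  have h1 := (he.sol hP hz).conj.sub (he.sol hP hz')
  have h2 : Tendsto (jm (-conj z) fun x => conj (e x z) - e x (-conj z)) atTop (𝓝 0) := by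
    have t1 := (Complex.continuous_conj.tendsto _).comp (he.tendsto_jm hz)
    have t2 := t1.sub (he.tendsto_jm hz')
    rw [map_one, sub_self] at t2
    refine t2.congr fun r => ?_
    simp only [jm, Function.comp_apply, map_mul, mul_sub, ← Complex.exp_conj]
    simp
  have := h1.eq_zero hP hz' h2 hx
  exact ⟨sub_eq_zero.1 this.1, sub_eq_zero.1 this.2⟩

/-- The Wronskian is constant in x and is read off at infinity, where the exponentials cancel. -/
lemma IsJostSolution.wronskian_real (hP : P.Admissible) (he : P.IsJostSolution e) (l : ℝ) :
    ed e 0 l * e 0 (-l) - e 0 l * ed e 0 (-l) = 2 * Complex.I * l := by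
  have hl : 0 ≤ (l : ℂ).im := by simp
  have hl' : 0 ≤ (-(l : ℂ)).im := by simp
  have h1 := he.sol hP hl
  have h2 := (he.sol hP hl').of_sq_eq (w := (l : ℂ)) (by ring)
  have hconst : ∀ b, 0 ≤ b → ed e b l * e b (-l) - e b l * ed e b (-l) =
      ed e 0 l * e 0 (-l) - e 0 l * ed e 0 (-l) := fun b hb =>
    wronskian_const hb (h1 b hb).1 (h1 b hb).2 (h2 b hb).1 (h2 b hb).2 ⟨hb, le_rfl⟩
  have hform : ∀ b : ℝ, ed e b l * e b (-l) - e b l * ed e b (-l) =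
      (jn l (fun x => e x l) (fun x => ed e x l) b + Complex.I * l * jm l (fun x => e x l) b) *
        jm (-l) (fun x => e x (-l)) b - jm l (fun x => e x l) b *
        (jn (-l) (fun x => e x (-l)) (fun x => ed e x (-l)) b +
          Complex.I * (-l) * jm (-l) (fun x => e x (-l)) b) := fun b => by
    have ee : Complex.exp (Complex.I * (l : ℂ) * (b : ℂ)) *
        Complex.exp (Complex.I * (-(l : ℂ)) * (b : ℂ)) = 1 := by
      rw [← Complex.exp_add]; ring_nf; simp
    have a1 := exp_mul_jm l (fun x => e x l) b
    have a2 := exp_mul_jm (-l) (fun x => e x (-l)) b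
    have a3 := exp_mul_jn l (fun x => e x l) (fun x => ed e x l) b
    have a4 := exp_mul_jn (-l) (fun x => e x (-l)) (fun x => ed e x (-l)) b
    rw [a1, a2, a3, a4]
    linear_combination ((jn l (fun x => e x l) (fun x => ed e x l) b +
      Complex.I * l * jm l (fun x => e x l) b) * jm (-l) (fun x => e x (-l)) b -
      jm l (fun x => e x l) b * (jn (-l) (fun x => e x (-l)) (fun x => ed e x (-l)) b +
          Complex.I * (-l) * jm (-l) (fun x => e x (-l)) b)) * ee
  have m1 := he.tendsto_jm hl
  have m2 := he.tendsto_jm hl'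
  have n1 := h1.tendsto_jn hP m1
  have n2 := (he.sol hP hl').tendsto_jn hP m2
  have t := ((n1.add (m1.const_mul (Complex.I * l))).mul m2).sub
    (m1.mul (n2.add (m2.const_mul (Complex.I * (-l)))))
  have t2 : Tendsto (fun b : ℝ => ed e b l * e b (-l) - e b l * ed e b (-l)) atTop
      (𝓝 (ed e 0 l * e 0 (-l) - e 0 l * ed e 0 (-l))) :=
    tendsto_const_nhds.congr' (by
      filter_upwards [eventually_ge_atTop (0 : ℝ)] with b hb using (hconst b hb).symm)
  have := tendsto_nhds_unique t2 (t.congr fun b => (hform b).symm)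
  rw [this]; ring

lemma IsJostSolution.exists_decay (hP : P.Admissible) (he : P.IsJostSolution e) {z : ℂ}
    (hz : 0 ≤ z.im) : ∃ C, ∀ x, 0 ≤ x → ‖e x z‖ ≤ C * Real.exp (-(z.im * x)) := by
  have h1 : ContinuousOn (jm z fun x => e x z) (Ici 0) := by
    unfold jm
    exact ContinuousOn.mul (Continuous.continuousOn (by fun_prop)) (he.sol hP hz).continuousOn
  obtain ⟨C, hC⟩ := exists_bound_of_tendsto h1 (he.tendsto_jm hz)
  refine ⟨C, fun x hx => ?_⟩
  have := exp_mul_jm z (fun x => e x z) x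
  rw [this, norm_mul, norm_exp_I_mul, mul_comm]
  gcongr
  exact hC x hx

lemma ρ_nonneg (x : ℝ) : 0 ≤ P.ρ x := by
  rw [ρ]; split_ifs <;> positivity

lemma norm_ρ_le (x : ℝ) : ‖(P.ρ x : ℂ)‖ ≤ max (P.α ^ 2) 1 := by
  rw [Complex.norm_real, Real.norm_eq_abs, abs_of_nonneg (ρ_nonneg x), ρ]
  split_ifs
  · exact le_max_left _ _
  · exact le_max_right _ _

lemma integrableOn_exp_neg {k : ℝ} (hk : 0 < k) (s : ℝ) :
    IntegrableOn (fun x => Real.exp (-(k * x))) (Ioi s) := by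
  have := integrableOn_exp_mul_Ioi (neg_lt_zero.2 hk) s
  simpa only [neg_mul] using this

lemma integral_exp_neg {k : ℝ} (hk : 0 < k) (s : ℝ) :
    ∫ x in Ioi s, Real.exp (-(k * x)) = Real.exp (-(k * s)) / k := by
  have := integral_exp_mul_Ioi (neg_lt_zero.2 hk) s
  simp only [neg_mul] at this
  rw [this]; field_simp

lemma IsJostSolution.integrableOn_mul (hP : P.Admissible) (he : P.IsJostSolution e) {z w : ℂ}
    (hz : 0 ≤ z.im) (hw : 0 ≤ w.im) (hzw : 0 < z.im + w.im) :
    IntegrableOn (fun x => (P.ρ x : ℂ) * (e x z * e x w)) (Ioi 0) := by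
  obtain ⟨C, hC⟩ := he.exists_decay hP hz
  obtain ⟨D, hD⟩ := he.exists_decay hP hw
  have hmeas : AEStronglyMeasurable (fun x => e x z * e x w) (volume.restrict (Ioi 0)) :=
    (((he.sol hP hz).continuousOn.mul (he.sol hP hw).continuousOn).mono
      Ioi_subset_Ici_self).aestronglyMeasurable measurableSet_Ioi
  have hint : IntegrableOn (fun x => e x z * e x w) (Ioi 0) := by
    refine ((integrableOn_exp_neg hzw 0).const_mul (C * D)).mono' hmeas ?_
    refine (ae_restrict_iff' measurableSet_Ioi).2 (.of_forall fun x hx => ?_)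
    have hx' : (0 : ℝ) ≤ x := le_of_lt hx
    rw [norm_mul]
    refine (mul_le_mul (hC x hx') (hD x hx') (norm_nonneg _)
      ((norm_nonneg _).trans (hC x hx'))).trans (le_of_eq ?_)
    rw [mul_mul_mul_comm, ← Real.exp_add]; ring_nf
  refine Integrable.bdd_mul (c := max (P.α ^ 2) 1) hint ?_ (.of_forall norm_ρ_le)
  have := measurable_ρ (P := P)
  exact Measurable.aestronglyMeasurable (by fun_prop)

/-- Lagrange's identity for Jost solutions. -/
lemma IsJostSolution.wronskian_eq (hP : P.Admissible) (he : P.IsJostSolution e) {z w : ℂ}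
    (hz : 0 ≤ z.im) (hw : 0 ≤ w.im) (hzw : 0 < z.im + w.im) :
    ed e 0 z * e 0 w - e 0 z * ed e 0 w =
      (z ^ 2 - w ^ 2) * ∫ x in Ioi 0, (P.ρ x : ℂ) * (e x z * e x w) := by
  have h1 := he.sol hP hz
  have h2 := he.sol hP hw
  have hI := he.integrableOn_mul hP hz hw hzw
  have hsub : ∀ b, 0 ≤ b → (ed e b z * e b w - e b z * ed e b w) -
      (ed e 0 z * e 0 w - e 0 z * ed e 0 w) =
      -(z ^ 2 - w ^ 2) * ∫ x in (0 : ℝ)..b, (P.ρ x : ℂ) * (e x z * e x w) := fun b hb => by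
    rw [wronskian_sub hb (h1 b hb).1 (h1 b hb).2 (h2 b hb).1 (h2 b hb).2 ⟨hb, le_rfl⟩,
      ← intervalIntegral.integral_const_mul]
    refine intervalIntegral.integral_congr fun x _ => ?_
    ring
  have t1 := (intervalIntegral_tendsto_integral_Ioi 0 hI tendsto_id).const_mul (-(z ^ 2 - w ^ 2))
  have t2 : Tendsto (fun b : ℝ => ed e b z * e b w - e b z * ed e b w) atTop (𝓝 0) := by
    have m1 := he.tendsto_jm hz
    have m2 := he.tendsto_jm hw
    have n1 := h1.tendsto_jn hP m1
    have n2 := h2.tendsto_jn hP m2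
    have t := ((n1.add (m1.const_mul (Complex.I * z))).mul m2).sub
      (m1.mul (n2.add (m2.const_mul (Complex.I * w))))
    have t0 : Tendsto (fun b : ℝ => Complex.exp (Complex.I * (z + w) * (b : ℂ))) atTop (𝓝 0) := by
      rw [tendsto_zero_iff_norm_tendsto_zero]
      simp only [norm_exp_I_mul, Complex.add_im]
      exact Real.tendsto_exp_neg_atTop_nhds_zero.comp (tendsto_id.const_mul_atTop hzw)
    have t' := t0.mul t
    rw [zero_mul] at t'
    refine t'.congr fun b => ?_
    have a1 := exp_mul_jm z (fun x => e x z) b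
    have a2 := exp_mul_jm w (fun x => e x w) b
    have a3 := exp_mul_jn z (fun x => e x z) (fun x => ed e x z) b
    have a4 := exp_mul_jn w (fun x => e x w) (fun x => ed e x w) b
    have ee : Complex.exp (Complex.I * (z + w) * (b : ℂ)) =
        Complex.exp (Complex.I * z * (b : ℂ)) * Complex.exp (Complex.I * w * (b : ℂ)) := by
      rw [← Complex.exp_add]; ring_nf
    rw [a3, a4, ee]
    conv_rhs => rw [a1, a2]
    ring
  have t3 := (t2.sub_const (ed e 0 z * e 0 w - e 0 z * ed e 0 w)).congr'
    (by filter_upwards [eventually_ge_atTop (0 : ℝ)] with b hb using hsub b hb)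
  have := tendsto_nhds_unique t3 t1
  linear_combination -this

/-- Supplies |e(x, z)| ≥ (2/3) exp(-Im z x) beyond a point X that does not depend on z. -/
lemma IsJostSolution.norm_sq_lower (hP : P.Admissible) (he : P.IsJostSolution e) {X : ℝ}
    (hX : P.a ≤ X) (hσ : ∫ r in Ioi X, (1 + r) * |P.q r| ≤ 1 / 4) {z : ℂ} (hz : 0 ≤ z.im)
    {x : ℝ} (hx : X ≤ x) :
    ‖e x z - Complex.exp (Complex.I * z * (x : ℂ))‖ ≤ Real.exp (-(z.im * x)) / 3 := by
  have h := (he.sol hP hz).norm_jm_sub_le_third hP hz (he.tendsto_jm hz) hX hσ hx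
  have := exp_mul_jm z (fun x => e x z) x
  have e1 : e x z - Complex.exp (Complex.I * z * (x : ℂ)) =
      Complex.exp (Complex.I * z * (x : ℂ)) * (jm z (fun x => e x z) x - 1) := by
    rw [mul_sub, ← this, mul_one]
  rw [e1, norm_mul, norm_exp_I_mul]
  rw [norm_one] at h
  have := Real.exp_pos (-(z.im * x))
  nlinarith

end Jost

end SLProblem

end

/-! ### Continuity and holomorphy in z -/

noncomputable section

section Laplace

variable {f : ℝ → ℂ} {c : ℝ}

lemma norm_exp_shift_le {z : ℂ} (hz : 0 ≤ z.im) {t : ℝ} (ht : c < t) :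
    ‖Complex.exp (Complex.I * z * ((t - c : ℝ) : ℂ))‖ ≤ 1 := by
  rw [norm_exp_I_mul, Real.exp_le_one_iff]
  have := mul_nonneg hz (sub_nonneg.2 ht.le)
  linarith

/-- With exp(izc) taken out, the remaining exponential has modulus at most 1 in the closed
half-plane, so ‖f‖ dominates for all such z at once. -/
lemma laplace_shift (f : ℝ → ℂ) (c : ℝ) (z : ℂ) :
    ∫ t in Ioi c, f t * Complex.exp (Complex.I * z * (t : ℂ)) =
      Complex.exp (Complex.I * z * (c : ℂ)) *
        ∫ t in Ioi c, f t * Complex.exp (Complex.I * z * ((t - c : ℝ) : ℂ)) := by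
  rw [← integral_const_mul]
  refine integral_congr_ae (.of_forall fun t => ?_)
  simp only
  rw [mul_left_comm, ← Complex.exp_add]
  push_cast; ring_nf

lemma integrableOn_mul_exp (hf : IntegrableOn f (Ioi c)) {z : ℂ} (hz : 0 ≤ z.im) :
    IntegrableOn (fun t => f t * Complex.exp (Complex.I * z * (t : ℂ))) (Ioi c) := by
  refine Integrable.mul_bdd (c := Real.exp (-(z.im * c))) hf
    (Continuous.aestronglyMeasurable (by fun_prop)) ?_
  refine (ae_restrict_iff' measurableSet_Ioi).2 (.of_forall fun t ht => ?_)
  have : c < t := ht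
  rw [norm_exp_I_mul]
  gcongr

lemma norm_laplace_le (hf : IntegrableOn f (Ioi c)) {z : ℂ} (hz : 0 ≤ z.im) :
    ‖∫ t in Ioi c, f t * Complex.exp (Complex.I * z * (t : ℂ))‖ ≤
      (∫ t in Ioi c, ‖f t‖) * Real.exp (-(z.im * c)) := by
  rw [laplace_shift, norm_mul, norm_exp_I_mul, mul_comm]
  gcongr
  refine (norm_integral_le_integral_norm _).trans (integral_mono_of_nonneg
    (.of_forall fun _ => norm_nonneg _) hf.norm ?_)
  refine (ae_restrict_iff' measurableSet_Ioi).2 (.of_forall fun t ht => ?_)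
  simp only [norm_mul]
  exact mul_le_of_le_one_right (norm_nonneg _) (norm_exp_shift_le hz ht)

lemma continuousOn_laplace (hf : IntegrableOn f (Ioi c)) :
    ContinuousOn (fun z => ∫ t in Ioi c, f t * Complex.exp (Complex.I * z * (t : ℂ)))
      {z | 0 ≤ z.im} := by
  simp_rw [laplace_shift f c]
  refine ContinuousOn.mul (Continuous.continuousOn (by fun_prop)) ?_
  refine continuousOn_of_dominated (bound := fun t => ‖f t‖)
    (fun z _ => hf.1.mul (Continuous.aestronglyMeasurable (by fun_prop))) (fun z hz => ?_) hf.norm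
    (.of_forall fun t => Continuous.continuousOn (by fun_prop))
  refine (ae_restrict_iff' measurableSet_Ioi).2 (.of_forall fun t ht => ?_)
  rw [norm_mul]
  exact mul_le_of_le_one_right (norm_nonneg _) (norm_exp_shift_le hz ht)

lemma mul_exp_neg_le {k : ℝ} (hk : 0 < k) (x : ℝ) : x * Real.exp (-(k * x)) ≤ 1 / k := by
  have h1 := Real.add_one_le_exp (k * x)
  rw [Real.exp_neg, ← div_eq_mul_inv, div_le_div_iff₀ (Real.exp_pos _) hk]
  nlinarith

/-- Differentiation under the integral sign. The bound (t - c) exp(-k(t - c)) ≤ 1/k, with k = Im z₀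
/ 2, makes a moment condition on f superfluous. -/
lemma differentiableOn_laplace (hf : IntegrableOn f (Ioi c)) :
    DifferentiableOn ℂ (fun z => ∫ t in Ioi c, f t * Complex.exp (Complex.I * z * (t : ℂ)))
      {z | 0 < z.im} := by
  simp_rw [laplace_shift f c]
  intro z₀ hz₀
  have hz₀' : 0 < z₀.im := hz₀
  refine DifferentiableAt.differentiableWithinAt (DifferentiableAt.mul (by fun_prop) ?_)
  have hball : ∀ z ∈ Metric.ball z₀ (z₀.im / 2), z₀.im / 2 ≤ z.im := fun z hz => by
    have h1 := Complex.abs_im_le_norm (z - z₀)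
    rw [Metric.mem_ball, dist_eq_norm] at hz
    rw [Complex.sub_im] at h1
    have := neg_abs_le (z.im - z₀.im)
    linarith
  refine (hasDerivAt_integral_of_dominated_loc_of_deriv_le (μ := volume.restrict (Ioi c))
    (F := fun z t => f t * Complex.exp (Complex.I * z * ((t - c : ℝ) : ℂ)))
    (F' := fun z t => f t * (Complex.exp (Complex.I * z * ((t - c : ℝ) : ℂ)) *
      (Complex.I * ((t - c : ℝ) : ℂ))))
    (bound := fun t => ‖f t‖ * (1 / (z₀.im / 2)))
    (Metric.ball_mem_nhds z₀ (half_pos hz₀')) (.of_forall fun z => ?_) ?_ ?_ ?_ ?_ ?_).2.differentiableAt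
  · exact hf.1.mul (Continuous.aestronglyMeasurable (by fun_prop))
  · refine hf.norm.mono' (hf.1.mul (Continuous.aestronglyMeasurable (by fun_prop))) ?_
    refine (ae_restrict_iff' measurableSet_Ioi).2 (.of_forall fun t ht => ?_)
    rw [norm_mul]
    exact mul_le_of_le_one_right (norm_nonneg _) (norm_exp_shift_le hz₀'.le ht)
  · exact hf.1.mul (Continuous.aestronglyMeasurable (by fun_prop))
  · refine (ae_restrict_iff' measurableSet_Ioi).2 (.of_forall fun t ht z hz => ?_)
    have ht' : 0 ≤ t - c := sub_nonneg.2 (le_of_lt ht)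
    rw [norm_mul, norm_mul, norm_exp_I_mul, norm_mul, Complex.norm_I, one_mul, Complex.norm_real,
      Real.norm_eq_abs, abs_of_nonneg ht', mul_comm (Real.exp _)]
    gcongr
    refine le_trans ?_ (mul_exp_neg_le (half_pos hz₀') (t - c))
    gcongr
    exact hball z hz
  · exact hf.norm.mul_const _
  · refine .of_forall fun t z _ => ?_
    refine HasDerivAt.const_mul _ ?_
    have : HasDerivAt (fun z : ℂ => Complex.I * z * ((t - c : ℝ) : ℂ))
        (Complex.I * ((t - c : ℝ) : ℂ)) z := by
      have := ((hasDerivAt_id z).const_mul Complex.I).mul_const ((t - c : ℝ) : ℂ)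
      simpa using this
    exact this.cexp

end Laplace

namespace SLProblem

variable {P : SLProblem} {e : ℝ → ℂ → ℂ} {K : ℝ → ℝ → ℂ}

lemma differentiable_e₀ (P : SLProblem) (x : ℝ) : Differentiable ℂ (P.e₀ x) := by
  unfold e₀; fun_prop

lemma IsJostKernel.continuousOn (hK : P.IsJostKernel e K) {x : ℝ} (hx : 0 ≤ x) :
    ContinuousOn (e x) {z | 0 ≤ z.im} :=
  ((P.differentiable_e₀ x).continuous.continuousOn.add
    (continuousOn_laplace (hK.integrable x hx))).congr fun z hz => hK.representation x hx z hz

lemma IsJostKernel.differentiableOn (hK : P.IsJostKernel e K) {x : ℝ} (hx : 0 ≤ x) :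
    DifferentiableOn ℂ (e x) {z | 0 < z.im} :=
  ((P.differentiable_e₀ x).differentiableOn.add
    (differentiableOn_laplace (hK.integrable x hx))).congr fun z hz =>
      hK.representation x hx z (le_of_lt hz)

/-- If σ vanished on the whole interval, so would its derivative at almost every point, against the
Wronskian σ'c - σc' = 1. -/
lemma IsFundamental.exists_sin_ne_zero {b : ℝ} (hb : 0 < b) {c c' σ σ' : ℂ → ℝ → ℂ}
    (hF : IsFundamental P b c c' σ σ') (z : ℂ) : ∃ x ∈ Icc 0 b, σ z x ≠ 0 := by
  by_contra! h0
  obtain ⟨h1, h2, h3, h4⟩ := hF.cos z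
  obtain ⟨k1, k2, k3, k4⟩ := hF.sin z
  have hne : (ae (volume.restrict (Ioo (0 : ℝ) b))).NeBot := by
    rw [ae_neBot, Ne, Measure.restrict_eq_zero]; simp [hb]
  have := (ae_restrict_mem (μ := volume) (measurableSet_Ioo (a := (0 : ℝ)) (b := b)))
  obtain ⟨x, hx, hxm⟩ := (((ae_restrict_iff' measurableSet_Ioo).2
    (k1.ae_hasDerivAt hb.le)).and this).exists
  have hz : HasDerivAt (σ z) 0 x := by
    refine (hasDerivAt_const x (0 : ℂ)).congr_of_eventuallyEq ?_
    filter_upwards [Ioo_mem_nhds hxm.1 hxm.2] with r hr using h0 r (Ioo_subset_Icc_self hr)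
  have hs := hx.unique hz
  have w := wronskian_const hb.le k1 k2 h1 h2 (Ioo_subset_Icc_self hxm)
  rw [hs, h0 x (Ioo_subset_Icc_self hxm), k4, k3, h3] at w
  simp at w

/-- The kernel representation gives no access to the x-derivative of e. Solving e(x) = e(0) c +
e'(0) σ for e'(0), at a point x where σ does not vanish, expresses it through values of e, whose
regularity in z is known. -/
lemma IsJostSolution.ed_local (hP : P.Admissible) (he : P.IsJostSolution e)
    (z₀ : ℂ) : ∃ (x : ℝ) (c s : ℂ → ℂ), 0 ≤ x ∧ Differentiable ℂ c ∧ Differentiable ℂ s ∧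
      s z₀ ≠ 0 ∧ ∀ z, 0 ≤ z.im → s z ≠ 0 → ed e 0 z = (e x z - e 0 z * c z) / s z := by
  obtain ⟨c, c', σ, σ', hF⟩ := hP.exists_fundamental one_pos
  obtain ⟨x, hx, hs⟩ := hF.exists_sin_ne_zero one_pos z₀
  refine ⟨x, fun z => c z x, fun z => σ z x, hx.1, hF.cos_diff x hx, hF.sin_diff x hx, hs,
    fun z hz hne => ?_⟩
  have := (hF.eq_combination (he.sol hP hz) hx).1
  rw [eq_div_iff hne, this]; ring

lemma IsJostKernel.continuousOn_ed (hP : P.Admissible) (he : P.IsJostSolution e)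
    (hK : P.IsJostKernel e K) : ContinuousOn (ed e 0) {z | 0 ≤ z.im} := by
  intro z₀ hz₀
  obtain ⟨x, c, s, hx, hc, hs, hs0, heq⟩ := he.ed_local hP z₀
  have h1 : ContinuousWithinAt (fun z => (e x z - e 0 z * c z) / s z) {z | 0 ≤ z.im} z₀ :=
    (((hK.continuousOn hx) z₀ hz₀).sub (((hK.continuousOn le_rfl) z₀ hz₀).mul
      hc.continuous.continuousWithinAt)).div hs.continuous.continuousWithinAt hs0
  refine h1.congr_of_eventuallyEq ?_ (heq z₀ hz₀ hs0)
  filter_upwards [self_mem_nhdsWithin,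
    (hs.continuous.continuousWithinAt (s := {z : ℂ | 0 ≤ z.im}) (x := z₀)).eventually_ne hs0]
    with z hz hne using heq z hz hne

lemma isOpen_upper : IsOpen {z : ℂ | 0 < z.im} := isOpen_lt continuous_const Complex.continuous_im

lemma isClosed_upper : IsClosed {z : ℂ | 0 ≤ z.im} :=
  isClosed_le continuous_const Complex.continuous_im

lemma IsJostKernel.differentiableOn_ed (hP : P.Admissible) (he : P.IsJostSolution e)
    (hK : P.IsJostKernel e K) : DifferentiableOn ℂ (ed e 0) {z | 0 < z.im} := by
  intro z₀ hz₀
  obtain ⟨x, c, s, hx, hc, hs, hs0, heq⟩ := he.ed_local hP z₀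
  have h1 : DifferentiableWithinAt ℂ (fun z => (e x z - e 0 z * c z) / s z) {z | 0 < z.im} z₀ :=
    (((hK.differentiableOn hx) z₀ hz₀).sub (((hK.differentiableOn le_rfl) z₀ hz₀).mul
      (hc z₀).differentiableWithinAt)).div (hs z₀).differentiableWithinAt hs0
  refine h1.congr_of_eventuallyEq ?_ (heq z₀ (le_of_lt hz₀) hs0)
  filter_upwards [self_mem_nhdsWithin,
    (hs.continuous.continuousWithinAt (s := {z : ℂ | 0 < z.im}) (x := z₀)).eventually_ne hs0]
    with z hz hne using heq z (le_of_lt hz) hne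

lemma E_eq (P : SLProblem) (e : ℝ → ℂ → ℂ) (z : ℂ) :
    P.E e z = P.bcβ z * ed e 0 z + P.bcα z * e 0 z := rfl

lemma differentiable_bcβ (P : SLProblem) : Differentiable ℂ P.bcβ := by unfold bcβ; fun_prop

lemma differentiable_bcα (P : SLProblem) : Differentiable ℂ P.bcα := by unfold bcα; fun_prop

lemma IsJostKernel.continuousOn_E (hP : P.Admissible) (he : P.IsJostSolution e)
    (hK : P.IsJostKernel e K) : ContinuousOn (P.E e) {z | 0 ≤ z.im} :=
  (P.differentiable_bcβ.continuous.continuousOn.mul (hK.continuousOn_ed hP he)).add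
    (P.differentiable_bcα.continuous.continuousOn.mul (hK.continuousOn le_rfl))

lemma IsJostKernel.differentiableOn_E (hP : P.Admissible) (he : P.IsJostSolution e)
    (hK : P.IsJostKernel e K) : DifferentiableOn ℂ (P.E e) {z | 0 < z.im} :=
  (P.differentiable_bcβ.differentiableOn.mul (hK.differentiableOn_ed hP he)).add
    (P.differentiable_bcα.differentiableOn.mul (hK.differentiableOn le_rfl))

lemma IsJostKernel.exists_bound (hP : P.Admissible) (he : P.IsJostSolution e)
    (hK : P.IsJostKernel e K) (R : ℝ) : ∃ C, 0 ≤ C ∧ ∀ z : ℂ, 0 ≤ z.im → ‖z‖ ≤ R →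
      ‖e 0 z‖ ≤ C ∧ ‖ed e 0 z‖ ≤ C := by
  have hc : IsCompact (Metric.closedBall (0 : ℂ) R ∩ {z | 0 ≤ z.im}) :=
    (isCompact_closedBall _ _).inter_right isClosed_upper
  obtain ⟨C, hC⟩ := hc.exists_bound_of_continuousOn
    ((hK.continuousOn le_rfl).mono inter_subset_right)
  obtain ⟨D, hD⟩ := hc.exists_bound_of_continuousOn
    ((hK.continuousOn_ed hP he).mono inter_subset_right)
  refine ⟨max 0 (max C D), le_max_left _ _, fun z hz hR => ?_⟩
  have hm : z ∈ Metric.closedBall (0 : ℂ) R ∩ {z | 0 ≤ z.im} := ⟨by simpa using hR, hz⟩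
  exact ⟨(hC z hm).trans ((le_max_left _ _).trans (le_max_right _ _)),
    (hD z hm).trans ((le_max_right _ _).trans (le_max_right _ _))⟩

lemma IsJostKernel.exists_bound_Icc (hP : P.Admissible) (he : P.IsJostSolution e)
    (hK : P.IsJostKernel e K) (R : ℝ) {b : ℝ} (hb : 0 < b) :
    ∃ C, 0 ≤ C ∧ ∀ z : ℂ, 0 ≤ z.im → ‖z‖ ≤ R → ∀ x ∈ Icc 0 b, ‖e x z‖ ≤ C := by
  obtain ⟨c, c', σ, σ', hF⟩ := hP.exists_fundamental hb
  obtain ⟨C, hC0, hC⟩ := hK.exists_bound hP he R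
  obtain ⟨D, hD⟩ := hF.bound R
  refine ⟨C * |D| + C * |D|, by positivity, fun z hz hR x hx => ?_⟩
  obtain ⟨a1, a2⟩ := hC z hz hR
  obtain ⟨b1, b2⟩ := hD z hR x hx
  have h := (hF.eq_combination (he.sol hP hz) hx).1
  rw [h]
  refine (norm_add_le _ _).trans (add_le_add ?_ ?_)
  · rw [norm_mul]; gcongr; exact b1.trans (le_abs_self _)
  · rw [norm_mul]; gcongr; exact b2.trans (le_abs_self _)

end SLProblem

end

/-! ### The Jost solution for large |z| -/

noncomputable section

namespace SLProblem

variable {P : SLProblem} {e : ℝ → ℂ → ℂ} {K : ℝ → ℝ → ℂ}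

lemma Admissible.sqrt_ρ_of_lt (hP : P.Admissible) {x : ℝ} (h : x < P.a) : √(P.ρ x) = P.α := by
  rw [ρ_of_lt h, Real.sqrt_sq hP.α_pos.le]

lemma sqrt_ρ_of_ge {x : ℝ} (h : P.a ≤ x) : √(P.ρ x) = 1 := by
  rw [ρ_of_ge h, Real.sqrt_one]

lemma Admissible.μp_of_le (hP : P.Admissible) {x : ℝ} (h : x ≤ P.a) :
    P.μp x = P.α * x + P.a * (1 - P.α) := by
  rcases h.lt_or_eq with h | rfl
  · rw [μp, hP.sqrt_ρ_of_lt h]; ring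
  · rw [μp, sqrt_ρ_of_ge le_rfl]; ring

lemma μp_of_ge {x : ℝ} (h : P.a ≤ x) : P.μp x = x := by
  rw [μp, sqrt_ρ_of_ge h]; ring

lemma Admissible.μm_of_lt (hP : P.Admissible) {x : ℝ} (h : x < P.a) :
    P.μm x = -(P.α * x) + P.a * (1 + P.α) := by
  rw [μm, hP.sqrt_ρ_of_lt h]; ring

lemma Admissible.μp_zero (hP : P.Admissible) : P.μp 0 = P.a * (1 - P.α) := by
  rw [hP.μp_of_le hP.a_pos.le]; ring

lemma Admissible.μp_zero_le (hP : P.Admissible) {x : ℝ} (hx : 0 ≤ x) : P.μp 0 ≤ P.μp x := by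
  have := mul_nonneg hP.α_pos.le hx
  have := mul_pos hP.a_pos hP.α_pos
  rw [hP.μp_zero]
  rcases le_total x P.a with h | h
  · rw [hP.μp_of_le h]; linarith
  · rw [μp_of_ge h]; nlinarith

lemma inner_of_prim {z : ℂ} {y y' : ℝ → ℂ} {b s : ℝ} (hs0 : 0 ≤ s)
    (hs : s ≤ P.a) (hb : P.a ≤ b)
    (h1 : IsPrim y y' 0 b)
    (h2 : IsPrim y' (fun x => ((P.q x : ℂ) - z ^ 2 * (P.ρ x : ℂ)) * y x) 0 b) :
    IsPrim y y' 0 s ∧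
      IsPrim y' (fun x => ((P.q x : ℂ) - z ^ 2 * (P.α : ℂ) ^ 2) * y x) 0 s := by
  have m1 : (0 : ℝ) ∈ Icc 0 b := ⟨le_rfl, hs0.trans (hs.trans hb)⟩
  have m2 : s ∈ Icc 0 b := ⟨hs0, hs.trans hb⟩
  refine ⟨h1.mono m1 m2, (h2.mono m1 m2).congr_right hs0 ?_⟩
  have e2 : ∀ᵐ x : ℝ, x ≠ P.a := by simp [ae_iff, measure_singleton]
  filter_upwards [e2] with x hx hxs
  rw [ρ_of_lt (lt_of_le_of_ne (hxs.2.trans hs) hx)]; simp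

lemma outer_of_prim (hP : P.Admissible) {z : ℂ} {y y' : ℝ → ℂ} {b s : ℝ} (hs : P.a ≤ s)
    (hb : s ≤ b) (h1 : IsPrim y y' 0 b)
    (h2 : IsPrim y' (fun x => ((P.q x : ℂ) - z ^ 2 * (P.ρ x : ℂ)) * y x) 0 b) :
    IsPrim y y' P.a s ∧ IsPrim y' (fun x => ((P.q x : ℂ) - z ^ 2 * ((1 : ℝ) : ℂ) ^ 2) * y x)
      P.a s := by
  have m1 : P.a ∈ Icc 0 b := ⟨hP.a_pos.le, hs.trans hb⟩
  have m2 : s ∈ Icc 0 b := ⟨hP.a_pos.le.trans hs, hb⟩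
  refine ⟨h1.mono m1 m2, (h2.mono m1 m2).congr_right hs (.of_forall fun x hx => ?_)⟩
  rw [ρ_of_ge hx.1.le]; simp

/-- Growth of solutions of the initial value problem for large `z`. -/
lemma Admissible.exists_growth (hP : P.Admissible) {x : ℝ} (hx : 0 ≤ x) :
    ∃ G : ℝ, 0 ≤ G ∧ ∀ z : ℂ, 0 ≤ z.im → 1 ≤ ‖z‖ → ∀ (y y' : ℝ → ℂ) (b : ℝ), x ≤ b → P.a ≤ b →
      IsPrim y y' 0 b →
      IsPrim y' (fun x => ((P.q x : ℂ) - z ^ 2 * (P.ρ x : ℂ)) * y x) 0 b →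
      ‖z‖ * ‖y x‖ + ‖y' x‖ ≤
        G * Real.exp (z.im * (P.μp x - P.μp 0)) * (‖z‖ * ‖y 0‖ + ‖y' 0‖) := by
  obtain ⟨G, hG, hg⟩ := exists_propagation hP.a_pos.le hP.α_pos
    (hP.intInt_q le_rfl hP.a_pos.le)
  rcases le_total x P.a with h | h
  · refine ⟨G, hG, fun z hz hz1 y y' b hb hab h1 h2 => ?_⟩
    obtain ⟨k1, k2⟩ := inner_of_prim hP.a_pos.le le_rfl hab h1 h2
    have := hg z hz hz1 y y' k1 k2 x ⟨hx, h⟩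
    rwa [show z.im * P.α * (x - 0) = z.im * (P.μp x - P.μp 0) by
      rw [hP.μp_of_le h, hP.μp_zero]; ring] at this
  · obtain ⟨H, hH, hh⟩ := exists_propagation h one_pos (hP.intInt_q hP.a_pos.le hx)
    refine ⟨H * G, mul_nonneg hH hG, fun z hz hz1 y y' b hb hab h1 h2 => ?_⟩
    obtain ⟨k1, k2⟩ := inner_of_prim hP.a_pos.le le_rfl hab h1 h2
    obtain ⟨l1, l2⟩ := outer_of_prim hP h hb h1 h2
    have a1 := hg z hz hz1 y y' k1 k2 P.a ⟨hP.a_pos.le, le_rfl⟩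
    have a2 := hh z hz hz1 y y' l1 l2 x ⟨h, le_rfl⟩
    refine a2.trans ?_
    refine (mul_le_mul_of_nonneg_left a1 (by positivity)).trans (le_of_eq ?_)
    have ee : Real.exp (z.im * (P.μp x - P.μp 0)) =
        Real.exp (z.im * 1 * (x - P.a)) * Real.exp (z.im * P.α * (P.a - 0)) := by
      rw [← Real.exp_add, μp_of_ge h, hP.μp_zero]; ring_nf
    rw [ee]; ring

/-- Beyond X the small tail of q bounds jm. On [a, X] the bound is propagated backwards from X,
uniformly in |z| ≥ 1. -/
lemma IsJostSolution.exists_bound_outer (hP : P.Admissible) (he : P.IsJostSolution e) :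
    ∃ C : ℝ, 0 ≤ C ∧ ∀ z : ℂ, 0 ≤ z.im → 1 ≤ ‖z‖ → ∀ x, P.a ≤ x →
      ‖jm z (fun x => e x z) x‖ ≤ C := by
  obtain ⟨X, hX, hσ⟩ := hP.exists_tail_small
  have hX0 : 0 ≤ X := hP.a_pos.le.trans hX
  obtain ⟨G, hG, hg⟩ := exists_propagation_back hX one_pos (hP.intInt_q hP.a_pos.le hX0)
  set Q := ∫ r in Ioi X, |P.q r| with hQ
  have hQ0 : 0 ≤ Q := integral_nonneg fun _ => abs_nonneg _
  have hm : ∀ z : ℂ, 0 ≤ z.im → ∀ x, X ≤ x → ‖jm z (fun x => e x z) x‖ ≤ 2 := fun z hz x hx => by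
    have h := (he.sol hP hz).norm_jm_sub_le_third hP hz (he.tendsto_jm hz) hX hσ hx
    have := norm_le_norm_add_norm_sub' (jm z (fun x => e x z) x) 1
    rw [norm_one] at h this
    linarith
  refine ⟨max 2 (G * (4 + Q * 2)), by positivity, fun z hz hz1 x hx => ?_⟩
  rcases le_total X x with h | h
  · exact (hm z hz x h).trans (le_max_left _ _)
  refine le_trans ?_ (le_max_right _ _)
  have hz0 : 0 < ‖z‖ := by linarith
  have hsol := he.sol hP hz
  obtain ⟨l1, l2⟩ := outer_of_prim hP hX le_rfl (hsol X hX0).1 (hsol X hX0).2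
  have a1 := hg z hz hz1 _ _ l1 l2 x ⟨hx, h⟩
  have hn : ‖jn z (fun x => e x z) (fun x => ed e x z) X‖ ≤ Q * 2 := by
    refine (hsol.norm_jn_le hP hz (he.tendsto_jm hz) hX).trans ?_
    have hq : IntegrableOn (fun r => |P.q r|) (Ioi X) :=
      (hP.integrableOn_q.mono_set (Ioi_subset_Ioi hX0)).norm
    rw [hQ, ← integral_mul_const]
    refine integral_mono_of_nonneg (.of_forall fun _ => by positivity) (hq.mul_const 2) ?_
    refine (ae_restrict_iff' measurableSet_Ioi).2 (.of_forall fun t ht => ?_)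
    have := hm z hz t (le_of_lt ht)
    simp only
    gcongr
  have b1 : ‖e X z‖ ≤ Real.exp (-(z.im * X)) * 2 := by
    have := exp_mul_jm z (fun x => e x z) X
    rw [this, norm_mul, norm_exp_I_mul]
    gcongr
    exact hm z hz X le_rfl
  have b2 : ‖ed e X z‖ ≤ Real.exp (-(z.im * X)) * (Q * 2 + ‖z‖ * 2) := by
    have := exp_mul_jn z (fun x => e x z) (fun x => ed e x z) X
    rw [this, norm_mul, norm_exp_I_mul]
    gcongr
    refine (norm_add_le _ _).trans (add_le_add hn ?_)
    rw [norm_mul, norm_mul, Complex.norm_I, one_mul]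
    gcongr
    exact hm z hz X le_rfl
  have b3 : ‖z‖ * ‖e X z‖ + ‖ed e X z‖ ≤ ‖z‖ * (Real.exp (-(z.im * X)) * (4 + Q * 2)) := by
    have e0 := Real.exp_pos (-(z.im * X))
    have : Q * 2 ≤ ‖z‖ * (Q * 2) := le_mul_of_one_le_left (by positivity) hz1
    nlinarith [mul_le_mul_of_nonneg_left b1 hz0.le]
  have b4 : ‖z‖ * ‖e x z‖ ≤ ‖z‖ * (G * (4 + Q * 2) * Real.exp (-(z.im * x))) := by
    have h1 : ‖z‖ * ‖e x z‖ ≤ G * Real.exp (z.im * 1 * (X - x)) *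
      (‖z‖ * (Real.exp (-(z.im * X)) * (4 + Q * 2))) :=
      (le_add_of_nonneg_right (norm_nonneg _)).trans (a1.trans (by gcongr))
    refine h1.trans (le_of_eq ?_)
    have ee : Real.exp (-(z.im * x)) =
      Real.exp (z.im * 1 * (X - x)) * Real.exp (-(z.im * X)) := by
      rw [← Real.exp_add]; ring_nf
    rw [ee]; ring
  have b5 := le_of_mul_le_mul_left b4 hz0
  rw [jm, norm_mul]
  have en : ‖Complex.exp (-(Complex.I * z * (x : ℂ)))‖ = Real.exp (z.im * x) := by
    rw [Complex.norm_exp]; simp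
  rw [en]
  calc Real.exp (z.im * x) * ‖e x z‖ ≤
      Real.exp (z.im * x) * (G * (4 + Q * 2) * Real.exp (-(z.im * x))) := by gcongr
    _ = G * (4 + Q * 2) * (Real.exp (z.im * x) * Real.exp (-(z.im * x))) := by ring
    _ = _ := by rw [← Real.exp_add]; simp

/-- At a, both jn and jn + 2iz(jm - 1) are bounded uniformly in z, hence so is z(jm - 1). -/
lemma IsJostSolution.asymptotic_at_a (hP : P.Admissible) (he : P.IsJostSolution e) :
    ∃ C : ℝ, 0 ≤ C ∧ ∀ z : ℂ, 0 ≤ z.im → 1 ≤ ‖z‖ →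
      ‖z‖ * ‖e P.a z - Complex.exp (Complex.I * z * (P.a : ℂ))‖ ≤ C * Real.exp (-(z.im * P.a)) ∧
      ‖ed e P.a z - Complex.I * z * Complex.exp (Complex.I * z * (P.a : ℂ))‖ ≤
        C * Real.exp (-(z.im * P.a)) := by
  obtain ⟨C, hC, hm⟩ := he.exists_bound_outer hP
  set J := ∫ r in Ioi P.a, |P.q r| * C with hJ
  have hJ0 : 0 ≤ J := integral_nonneg fun _ => by positivity
  refine ⟨J + J, by positivity, fun z hz hz1 => ?_⟩
  have hz0 : 0 < ‖z‖ := by linarith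
  have hsol := he.sol hP hz
  have hle : ∫ r in Ioi P.a, |P.q r| * ‖jm z (fun x => e x z) r‖ ≤ J := by
    have hq : IntegrableOn (fun r => |P.q r|) (Ioi P.a) :=
      (hP.integrableOn_q.mono_set (Ioi_subset_Ioi hP.a_pos.le)).norm
    refine integral_mono_of_nonneg (.of_forall fun _ => by positivity) (hq.mul_const C) ?_
    refine (ae_restrict_iff' measurableSet_Ioi).2 (.of_forall fun t ht => ?_)
    have := hm z hz hz1 t (le_of_lt ht)
    simp only
    gcongr
  have h1 := (hsol.norm_jn_le hP hz (he.tendsto_jm hz) le_rfl).trans hle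
  have h2 := (hsol.norm_jn_add_le hP (he.tendsto_jm hz) le_rfl).trans hle
  set m := jm z (fun x => e x z) P.a with hmd
  set n := jn z (fun x => e x z) (fun x => ed e x z) P.a with hnd
  have h3 : ‖Complex.I * z * (m - 1)‖ ≤ J := by
    have : 2 * (Complex.I * z * (m - 1)) = (n + 2 * Complex.I * z * (m - 1)) - n := by ring
    have h := congrArg norm this
    rw [norm_mul, Complex.norm_ofNat] at h
    have := norm_sub_le (n + 2 * Complex.I * z * (m - 1)) n
    linarith
  have e1 : e P.a z = _ := exp_mul_jm z (fun x => e x z) P.a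
  have e2 : ed e P.a z = _ := exp_mul_jn z (fun x => e x z) (fun x => ed e x z) P.a
  rw [← hmd] at e1 e2
  rw [← hnd] at e2
  have e0 := Real.exp_pos (-(z.im * P.a))
  constructor
  · have : ‖z‖ * ‖e P.a z - Complex.exp (Complex.I * z * (P.a : ℂ))‖ =
        Real.exp (-(z.im * P.a)) * ‖Complex.I * z * (m - 1)‖ := by
      have : e P.a z - Complex.exp (Complex.I * z * (P.a : ℂ)) =
        Complex.exp (Complex.I * z * (P.a : ℂ)) * (m - 1) := by rw [e1]; ring
      rw [this, norm_mul, norm_exp_I_mul, norm_mul, norm_mul, Complex.norm_I]; ring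
    rw [this]
    nlinarith
  · have : ed e P.a z - Complex.I * z * Complex.exp (Complex.I * z * (P.a : ℂ)) =
        Complex.exp (Complex.I * z * (P.a : ℂ)) * (n + Complex.I * z * (m - 1)) := by
      rw [e2]; ring
    rw [this, norm_mul, norm_exp_I_mul]
    have := norm_add_le n (Complex.I * z * (m - 1))
    nlinarith

/-- `e₀` and its derivative on `[0, a]`. -/
def e₀in (P : SLProblem) (z : ℂ) (x : ℝ) : ℂ :=
  ((1 / 2 * (1 + 1 / P.α) : ℝ) : ℂ) * (Complex.exp (Complex.I * z * (P.a : ℂ)) *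
    Complex.exp (Complex.I * z * P.α * ((x - P.a : ℝ) : ℂ))) +
  ((1 / 2 * (1 - 1 / P.α) : ℝ) : ℂ) * (Complex.exp (Complex.I * z * (P.a : ℂ)) *
    Complex.exp (-(Complex.I * z * P.α) * ((x - P.a : ℝ) : ℂ)))

def e₀in' (P : SLProblem) (z : ℂ) (x : ℝ) : ℂ :=
  ((1 / 2 * (1 + 1 / P.α) : ℝ) : ℂ) * (Complex.exp (Complex.I * z * (P.a : ℂ)) *
    ((Complex.I * z * P.α) * Complex.exp (Complex.I * z * P.α * ((x - P.a : ℝ) : ℂ)))) +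
  ((1 / 2 * (1 - 1 / P.α) : ℝ) : ℂ) * (Complex.exp (Complex.I * z * (P.a : ℂ)) *
    (-(Complex.I * z * P.α) * Complex.exp (-(Complex.I * z * P.α) * ((x - P.a : ℝ) : ℂ))))

lemma isPrim_e₀in (P : SLProblem) (z : ℂ) (s t : ℝ) :
    IsPrim (P.e₀in z) (P.e₀in' z) s t :=
  (((isPrim_exp (Complex.I * z * P.α) P.a s t).const_mul _).const_mul _).add
    (((isPrim_exp (-(Complex.I * z * P.α)) P.a s t).const_mul _).const_mul _)

lemma isPrim_e₀in' (P : SLProblem) (z : ℂ) {s t : ℝ} (hst : s ≤ t) :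
    IsPrim (P.e₀in' z) (fun x => - z ^ 2 * (P.α : ℂ) ^ 2 * P.e₀in z x) s t := by
  refine (((((isPrim_exp (Complex.I * z * P.α) P.a s t).const_mul _).const_mul _).const_mul _).add
    ((((isPrim_exp (-(Complex.I * z * P.α)) P.a s t).const_mul _).const_mul _).const_mul
      _)).congr_right hst (.of_forall fun x _ => ?_)
  rw [e₀in]
  linear_combination (z ^ 2 * (P.α : ℂ) ^ 2 * (((1 / 2 * (1 + 1 / P.α) : ℝ) : ℂ) *
    (Complex.exp (Complex.I * z * (P.a : ℂ)) *
    Complex.exp (Complex.I * z * P.α * ((x - P.a : ℝ) : ℂ))) +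
    ((1 / 2 * (1 - 1 / P.α) : ℝ) : ℂ) * (Complex.exp (Complex.I * z * (P.a : ℂ)) *
    Complex.exp (-(Complex.I * z * P.α) * ((x - P.a : ℝ) : ℂ))))) * Complex.I_sq

/-- The Jost solution at `0` is asymptotic to the unperturbed one. -/
lemma IsJostSolution.asymptotic_at_zero (hP : P.Admissible) (he : P.IsJostSolution e) :
    ∃ C : ℝ, 0 ≤ C ∧ ∀ z : ℂ, 0 ≤ z.im → 1 ≤ ‖z‖ →
      ‖z‖ * ‖e 0 z - P.e₀in z 0‖ ≤ C * Real.exp (-(z.im * P.μp 0)) ∧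
      ‖ed e 0 z - P.e₀in' z 0‖ ≤ C * Real.exp (-(z.im * P.μp 0)) := by
  obtain ⟨C, hC, hc⟩ := he.asymptotic_at_a hP
  have ha := hP.a_pos.le
  have hα := hP.α_pos
  have hq := hP.intInt_q le_rfl ha
  obtain ⟨G, hG, hg⟩ := exists_propagation_back ha hα hq
  set Q := ∫ r in (0 : ℝ)..P.a, ‖(P.q r : ℂ)‖ with hQ
  have hQ0 : 0 ≤ Q := intervalIntegral.integral_nonneg ha fun _ _ => norm_nonneg _
  set T := (C + P.α * C) + Q * (G * (2 + C + C)) with hT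
  have hT0 : 0 ≤ T := by positivity
  refine ⟨T + T / P.α, by positivity, fun z hz hz1 => ?_⟩
  obtain ⟨c1, c2⟩ := hc z hz hz1
  have hz0 : 0 < ‖z‖ := by linarith
  have e0 := Real.exp_pos (-(z.im * P.a))
  have hsol := he.sol hP hz
  obtain ⟨l1, l2⟩ := hsol.prim_inner hP
  have hNa : ‖z‖ * ‖e P.a z‖ + ‖ed e P.a z‖ ≤ ‖z‖ * ((2 + C + C) * Real.exp (-(z.im * P.a))) := by
    have n1 : ‖Complex.exp (Complex.I * z * (P.a : ℂ))‖ = Real.exp (-(z.im * P.a)) :=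
      norm_exp_I_mul z P.a
    have n2 := norm_le_norm_add_norm_sub' (e P.a z) (Complex.exp (Complex.I * z * (P.a : ℂ)))
    have n3 := norm_le_norm_add_norm_sub' (ed e P.a z)
      (Complex.I * z * Complex.exp (Complex.I * z * (P.a : ℂ)))
    rw [norm_mul, norm_mul, Complex.norm_I, one_mul, n1] at n3
    rw [n1] at n2
    have : C * Real.exp (-(z.im * P.a)) ≤ ‖z‖ * (C * Real.exp (-(z.im * P.a))) :=
      le_mul_of_one_le_left (by positivity) hz1
    nlinarith [mul_le_mul_of_nonneg_left n2 hz0.le]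
  have hex : ∀ x ∈ Icc 0 P.a, Real.exp (-(z.im * P.α * (P.a - x))) * ‖e x z‖ ≤
      G * (2 + C + C) * Real.exp (-(z.im * P.a)) := fun x hx => by
    have h1 := hg z hz hz1 _ _ l1 l2 x hx
    have h2 : ‖z‖ * ‖e x z‖ ≤ ‖z‖ * (Real.exp (z.im * P.α * (P.a - x)) *
        (G * (2 + C + C) * Real.exp (-(z.im * P.a)))) :=
      (le_add_of_nonneg_right (norm_nonneg _)).trans (h1.trans
        ((mul_le_mul_of_nonneg_left hNa (by positivity)).trans (le_of_eq (by ring))))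
    rw [Real.exp_neg, inv_mul_le_iff₀ (Real.exp_pos _)]
    exact le_of_mul_le_mul_left h2 hz0
  -- The difference of e and `e₀in` solves the free equation with forcing q e, which `hex` controls.
  have d1 := l1.sub (isPrim_e₀in P z 0 P.a)
  have d2 : IsPrim (fun x => ed e x z - P.e₀in' z x) (fun x => (P.q x : ℂ) * e x z -
      z ^ 2 * (P.α : ℂ) ^ 2 * (e x z - P.e₀in z x)) 0 P.a :=
    (l2.sub (isPrim_e₀in' P z ha)).congr_right ha (.of_forall fun x _ => by ring)
  have hF : IntervalIntegrable (fun x => (P.q x : ℂ) * e x z) volume 0 P.a := by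
    refine hq.mul_continuousOn ?_
    rw [uIcc_of_le ha]; exact l1.continuousOn
  obtain ⟨f1, f2⟩ := free_bound_back ha hα.le hz hF d1 d2
  have hint : ∫ r in (0 : ℝ)..P.a, Real.exp (-(z.im * P.α * (P.a - r))) * ‖(P.q r : ℂ) * e r z‖ ≤
      Q * (G * (2 + C + C)) * Real.exp (-(z.im * P.a)) := by
    rw [hQ, mul_assoc, ← intervalIntegral.integral_mul_const]
    refine intervalIntegral.integral_mono_on ha
      (hF.norm.continuousOn_mul (Continuous.continuousOn (by fun_prop))) (hq.norm.mul_const _)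
      fun r hr => ?_
    rw [norm_mul, mul_left_comm]
    exact mul_le_mul_of_nonneg_left (hex r hr) (norm_nonneg _)
  have ia : P.e₀in z P.a = Complex.exp (Complex.I * z * (P.a : ℂ)) := by
    rw [e₀in]; simp; ring
  have ia' : P.e₀in' z P.a = Complex.I * z * Complex.exp (Complex.I * z * (P.a : ℂ)) := by
    have : (P.α : ℂ) ≠ 0 := by exact_mod_cast hα.ne'
    rw [e₀in']; simp; field_simp; ring
  have hH : ‖ed e P.a z - P.e₀in' z P.a‖ + P.α * ‖z‖ * ‖e P.a z - P.e₀in z P.a‖ +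
      ∫ r in (0 : ℝ)..P.a, Real.exp (-(z.im * P.α * (P.a - r))) * ‖(P.q r : ℂ) * e r z‖ ≤
      T * Real.exp (-(z.im * P.a)) := by
    rw [ia, ia', hT]
    nlinarith [mul_le_mul_of_nonneg_left c1 hα.le]
  have g1 := f1.trans hH
  have g2 := f2.trans hH
  rw [Real.exp_neg (z.im * P.α * _), inv_mul_le_iff₀ (Real.exp_pos _)] at g1 g2
  have ee : Real.exp (-(z.im * P.μp 0)) =
      Real.exp (z.im * P.α * (P.a - 0)) * Real.exp (-(z.im * P.a)) := by
    rw [← Real.exp_add, hP.μp_zero]; ring_nf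
  have eep := Real.exp_pos (-(z.im * P.μp 0))
  constructor
  · have : P.α * (‖z‖ * ‖e 0 z - P.e₀in z 0‖) ≤ T * Real.exp (-(z.im * P.μp 0)) := by
      rw [ee]; linarith
    rw [← le_div_iff₀' hα] at this
    refine this.trans (le_of_eq_of_le (div_mul_eq_mul_div T P.α _).symm ?_)
    gcongr
    linarith
  · have h1 : ‖ed e 0 z - P.e₀in' z 0‖ ≤ T * Real.exp (-(z.im * P.μp 0)) := by
      rw [ee]; linarith
    refine h1.trans ?_
    gcongr
    have : 0 ≤ T / P.α := by positivity
    linarith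

end SLProblem

end

/-! ### Leading terms of E and S at infinity -/

noncomputable section

/-- `f` grows at most like `z ^ d`. -/
def PolyLe (d : ℕ) (f : ℂ → ℂ) : Prop :=
  ∃ C : ℝ, 0 ≤ C ∧ ∀ z : ℂ, 1 ≤ ‖z‖ → ‖f z‖ ≤ C * ‖z‖ ^ d

lemma polyLe_of_cubic {d : ℕ} {f : ℂ → ℂ} (c₀ c₁ c₂ c₃ : ℂ)
    (hf : ∀ z, f z = c₀ + c₁ * z + c₂ * z ^ 2 + c₃ * z ^ 3) (h₁ : d < 1 → c₁ = 0)
    (h₂ : d < 2 → c₂ = 0) (h₃ : d < 3 → c₃ = 0) : PolyLe d f := by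
  refine ⟨‖c₀‖ + ‖c₁‖ + ‖c₂‖ + ‖c₃‖, by positivity, fun z hz => ?_⟩
  have key : ∀ (c : ℂ) (j : ℕ), (d < j → c = 0) → ‖c * z ^ j‖ ≤ ‖c‖ * ‖z‖ ^ d := fun c j h => by
    rcases lt_or_ge d j with hj | hj
    · simp [h hj]
    · rw [norm_mul, norm_pow]
      gcongr
  have k0 := key c₀ 0 (fun h => absurd h (Nat.not_lt_zero d))
  have k1 := key c₁ 1 h₁
  have k2 := key c₂ 2 h₂
  have k3 := key c₃ 3 h₃
  rw [pow_zero, mul_one] at k0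
  rw [pow_one] at k1
  rw [hf]
  have := norm_add₄_le (a := c₀) (b := c₁ * z) (c := c₂ * z ^ 2) (d := c₃ * z ^ 3)
  linarith

namespace SLProblem

variable {P : SLProblem} {e : ℝ → ℂ → ℂ} {K : ℝ → ℝ → ℂ}

/-- Leading terms of the combinations of boundary coefficients that govern `E` at infinity. -/
structure IsLeading (P : SLProblem) (d : ℕ) (p : ℂ) (r : ℝ) : Prop where
  ne_zero : p ≠ 0
  abs_le : |r| ≤ 1
  plus : PolyLe d fun z => z * (P.bcα z + Complex.I * P.α * z * P.bcβ z - p * z ^ d)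
  minus : PolyLe d fun z => z * (P.bcα z - Complex.I * P.α * z * P.bcβ z - r * p * z ^ d)
  bcβ_le : PolyLe d fun z => z * P.bcβ z
  bcα_le : PolyLe d P.bcα

lemma abs_div_le_one_of {x y : ℝ} (h : 0 ≤ x * y) : |(x - y) / (x + y)| ≤ 1 := by
  rw [abs_div]
  refine div_le_one_of_le₀ (abs_le_abs_of_sq_le_sq ?_) (abs_nonneg _)
  nlinarith
where
  abs_le_abs_of_sq_le_sq {u v : ℝ} (h : u ^ 2 ≤ v ^ 2) : |u| ≤ |v| := sq_le_sq.1 h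

lemma add_ne_zero_of_mul_nonneg {x y : ℝ} (h : 0 ≤ x * y) (hxy : ¬(x = 0 ∧ y = 0)) :
    x + y ≠ 0 := by
  intro h0
  have : y = -x := by linarith
  subst this
  have : x = 0 := by nlinarith
  simp_all

/-- Up to a common factor, e(0, z) and e'(0, z) behave like 1 + τw and iαz(1 - τw) with w =
exp(2izaα), so E is governed by A + iαzB and A - iαzB, with leading coefficients p and rp. If β₂ =
0, the sign conditions prevent the top coefficients of A and iαzB from cancelling, hence p ≠ 0 and
|r| ≤ 1. The factor z in the fields of `IsLeading` records errors one order below z^d without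
negative powers. -/
lemma Admissible.exists_leading (hP : P.Admissible)
    (hne : ¬(P.α₀ = 0 ∧ P.α₁ = 0 ∧ P.α₂ = 0 ∧ P.β₀ = 0 ∧ P.β₁ = 0 ∧ P.β₂ = 0)) :
    ∃ d p r, P.IsLeading d p r := by
  have hα := hP.α_pos
  have hαc : (P.α : ℂ) ≠ 0 := by exact_mod_cast hα.ne'
  have d1 := hP.δ₁_nonpos
  have d3 := hP.δ₃_nonneg
  rw [δ₁] at d1
  rw [δ₃] at d3
  have I2 := Complex.I_sq
  by_cases hb2 : P.β₂ = 0
  swap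
  -- Here iαzB has degree 3 and outweighs A, which forces r = -1.
  · refine ⟨3, Complex.I * P.α * P.β₂, -1, ?_, by simp, ?_, ?_, ?_, ?_⟩
    · simp [hb2, hα.ne']
    · refine polyLe_of_cubic 0 P.α₀ (Complex.I * P.α₁ + Complex.I * P.α * P.β₀)
        (P.α₂ - P.α * P.β₁) (fun z => ?_) (by norm_num) (by norm_num) (by norm_num)
      rw [bcα, bcβ]; linear_combination (P.α * P.β₁ * z ^ 3) * I2
    · refine polyLe_of_cubic 0 P.α₀ (Complex.I * P.α₁ - Complex.I * P.α * P.β₀)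
        (P.α₂ + P.α * P.β₁) (fun z => ?_) (by norm_num) (by norm_num) (by norm_num)
      rw [bcα, bcβ]; push_cast; linear_combination -(P.α * P.β₁ * z ^ 3) * I2
    · exact polyLe_of_cubic 0 P.β₀ (Complex.I * P.β₁) P.β₂ (fun z => by rw [bcβ]; ring)
        (by norm_num) (by norm_num) (by norm_num)
    · exact polyLe_of_cubic P.α₀ (Complex.I * P.α₁) P.α₂ 0 (fun z => by rw [bcα]; ring)
        (by norm_num) (by norm_num) (by norm_num)
  rw [hb2] at d3
  by_cases h2 : P.α₂ = 0 ∧ P.β₁ = 0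
  swap
  -- With β₂ = 0 the condition on δ₃ says α₂β₁ ≤ 0.
  · have hs : 0 ≤ P.α₂ * -(P.α * P.β₁) := by nlinarith
    have hs0 := add_ne_zero_of_mul_nonneg hs (fun h => h2 ⟨h.1, by simpa [hα.ne'] using h.2⟩)
    have hc : (P.α₂ : ℂ) - P.α * P.β₁ ≠ 0 := by exact_mod_cast (by simpa [sub_eq_add_neg] using hs0)
    refine ⟨2, P.α₂ - P.α * P.β₁, _, hc, abs_div_le_one_of hs, ?_, ?_, ?_, ?_⟩
    · refine polyLe_of_cubic 0 P.α₀ (Complex.I * P.α₁ + Complex.I * P.α * P.β₀) 0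
        (fun z => ?_) (by norm_num) (by norm_num) (by norm_num)
      rw [bcα, bcβ, hb2]; push_cast; linear_combination (P.α * P.β₁ * z ^ 3) * I2
    · refine polyLe_of_cubic 0 P.α₀ (Complex.I * P.α₁ - Complex.I * P.α * P.β₀) 0
        (fun z => ?_) (by norm_num) (by norm_num) (by norm_num)
      have : (((P.α₂ - -(P.α * P.β₁)) / (P.α₂ + -(P.α * P.β₁)) : ℝ) : ℂ) *
          (P.α₂ - P.α * P.β₁) = P.α₂ + P.α * P.β₁ := by
        push_cast
        rw [← sub_eq_add_neg, div_mul_cancel₀ _ hc]; ring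
      rw [this, bcα, bcβ, hb2]; push_cast; linear_combination -(P.α * P.β₁ * z ^ 3) * I2
    · exact polyLe_of_cubic 0 P.β₀ (Complex.I * P.β₁) 0 (fun z => by rw [bcβ, hb2]; simp; ring)
        (by norm_num) (by norm_num) (by norm_num)
    · exact polyLe_of_cubic P.α₀ (Complex.I * P.α₁) P.α₂ 0 (fun z => by rw [bcα]; ring)
        (by norm_num) (by norm_num) (by norm_num)
  obtain ⟨ha2, hb1⟩ := h2
  rw [hb1] at d1
  by_cases h1 : P.α₁ = 0 ∧ P.β₀ = 0
  swap
  -- With β₁ = 0 the condition on δ₁ says α₁β₀ ≥ 0.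
  · have hs : 0 ≤ P.α₁ * (P.α * P.β₀) := by nlinarith
    have hs0 := add_ne_zero_of_mul_nonneg hs (fun h => h1 ⟨h.1, by simpa [hα.ne'] using h.2⟩)
    have hc : (P.α₁ : ℂ) + P.α * P.β₀ ≠ 0 := by exact_mod_cast hs0
    refine ⟨1, Complex.I * (P.α₁ + P.α * P.β₀), _, mul_ne_zero Complex.I_ne_zero hc,
      abs_div_le_one_of hs, ?_, ?_, ?_, ?_⟩
    · refine polyLe_of_cubic 0 P.α₀ 0 0
        (fun z => ?_) (by norm_num) (by norm_num) (by norm_num)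
      rw [bcα, bcβ, hb2, ha2, hb1]; push_cast; ring
    · refine polyLe_of_cubic 0 P.α₀ 0 0
        (fun z => ?_) (by norm_num) (by norm_num) (by norm_num)
      have : (((P.α₁ - P.α * P.β₀) / (P.α₁ + P.α * P.β₀) : ℝ) : ℂ) *
          (Complex.I * (P.α₁ + P.α * P.β₀)) = Complex.I * (P.α₁ - P.α * P.β₀) := by
        push_cast
        rw [mul_left_comm, div_mul_cancel₀ _ hc]
      rw [this, bcα, bcβ, hb2, ha2, hb1]; push_cast; ring
    · exact polyLe_of_cubic 0 P.β₀ 0 0 (fun z => by rw [bcβ, hb2, hb1]; simp; ring)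
        (by norm_num) (by norm_num) (by norm_num)
    · exact polyLe_of_cubic P.α₀ (Complex.I * P.α₁) 0 0 (fun z => by rw [bcα, ha2]; simp)
        (by norm_num) (by norm_num) (by norm_num)
  obtain ⟨ha1, hb0⟩ := h1
  have h0 : P.α₀ ≠ 0 := fun h => hne ⟨h, ha1, ha2, hb0, hb1, hb2⟩
  refine ⟨0, P.α₀, 1, by exact_mod_cast h0, by simp, ?_, ?_, ?_, ?_⟩
  · exact polyLe_of_cubic 0 0 0 0 (fun z => by rw [bcα, bcβ, hb2, ha2, hb1, ha1, hb0]; simp)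
      (by norm_num) (by norm_num) (by norm_num)
  · exact polyLe_of_cubic 0 0 0 0 (fun z => by rw [bcα, bcβ, hb2, ha2, hb1, ha1, hb0]; simp)
      (by norm_num) (by norm_num) (by norm_num)
  · exact polyLe_of_cubic 0 0 0 0 (fun z => by rw [bcβ, hb2, hb1, hb0]; simp)
      (by norm_num) (by norm_num) (by norm_num)
  · exact polyLe_of_cubic P.α₀ 0 0 0 (fun z => by rw [bcα, ha1, ha2]; simp)
      (by norm_num) (by norm_num) (by norm_num)

/-- `e^{2 i z a α}` -/
def wexp (P : SLProblem) (z : ℂ) : ℂ := Complex.exp (2 * Complex.I * z * P.a * P.α)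

lemma Admissible.e₀in_zero (hP : P.Admissible) (z : ℂ) :
    P.e₀in z 0 = ((P.α + 1) / (2 * P.α) : ℝ) * Complex.exp (Complex.I * z * (P.μp 0 : ℂ)) *
      (1 + P.τ * P.wexp z) ∧
    P.e₀in' z 0 = ((P.α + 1) / (2 * P.α) : ℝ) * Complex.exp (Complex.I * z * (P.μp 0 : ℂ)) *
      (Complex.I * P.α * z * (1 - P.τ * P.wexp z)) := by
  have hα : (P.α : ℂ) ≠ 0 := by exact_mod_cast hP.α_pos.ne'
  have hα1 : (P.α : ℂ) + 1 ≠ 0 := by exact_mod_cast (by linarith [hP.α_pos] : P.α + 1 ≠ 0)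
  have e1 : Complex.exp (Complex.I * z * (P.a : ℂ)) *
      Complex.exp (Complex.I * z * P.α * ((0 - P.a : ℝ) : ℂ)) =
      Complex.exp (Complex.I * z * (P.μp 0 : ℂ)) := by
    rw [← Complex.exp_add, hP.μp_zero]; congr 1; push_cast; ring
  have e2 : Complex.exp (Complex.I * z * (P.a : ℂ)) *
      Complex.exp (-(Complex.I * z * P.α) * ((0 - P.a : ℝ) : ℂ)) =
      Complex.exp (Complex.I * z * (P.μp 0 : ℂ)) * P.wexp z := by
    rw [← Complex.exp_add, hP.μp_zero, wexp, ← Complex.exp_add]; congr 1; push_cast; ring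
  constructor
  · rw [e₀in, e1, e2, τ]; push_cast; field_simp
  · rw [e₀in', mul_left_comm (Complex.exp _), mul_left_comm (Complex.exp _), e1, e2, τ]
    push_cast; field_simp; ring

lemma norm_wexp (P : SLProblem) (z : ℂ) :
    ‖P.wexp z‖ = Real.exp (-(z.im * (2 * (P.a * P.α)))) := by
  rw [← norm_exp_I_mul, wexp]; congr 2; push_cast; ring

lemma Admissible.norm_wexp_le (hP : P.Admissible) {z : ℂ} (hz : 0 ≤ z.im) : ‖P.wexp z‖ ≤ 1 := by
  rw [norm_wexp, Real.exp_le_one_iff]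
  have := mul_nonneg hz (mul_pos hP.a_pos hP.α_pos).le
  linarith

lemma Admissible.abs_τ_lt (hP : P.Admissible) : |P.τ| < 1 := by
  have := hP.α_pos
  rw [τ, abs_div, div_lt_one (abs_pos.2 (by linarith)), abs_of_pos (by linarith : 0 < P.α + 1),
    abs_lt]
  constructor <;> linarith

/-- Asymptotics of a boundary form applied to the Jost solution. -/
lemma IsJostSolution.asymptotic_form (hP : P.Admissible) (he : P.IsJostSolution e) :
    ∃ C : ℝ, 0 ≤ C ∧ ∀ z B A : ℂ, 0 ≤ z.im → 1 ≤ ‖z‖ →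
      ‖z * (B * ed e 0 z + A * e 0 z - ((P.α + 1) / (2 * P.α) : ℝ) *
        Complex.exp (Complex.I * z * (P.μp 0 : ℂ)) * ((A + Complex.I * P.α * z * B) +
          P.τ * P.wexp z * (A - Complex.I * P.α * z * B)))‖ ≤
        C * (‖z * B‖ + ‖A‖) * Real.exp (-(z.im * P.μp 0)) := by
  obtain ⟨C, hC, h⟩ := he.asymptotic_at_zero hP
  refine ⟨C, hC, fun z B A hz hz1 => ?_⟩
  obtain ⟨h1, h2⟩ := h z hz hz1
  obtain ⟨k1, k2⟩ := hP.e₀in_zero z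
  have : z * (B * ed e 0 z + A * e 0 z - ((P.α + 1) / (2 * P.α) : ℝ) *
        Complex.exp (Complex.I * z * (P.μp 0 : ℂ)) * ((A + Complex.I * P.α * z * B) +
          P.τ * P.wexp z * (A - Complex.I * P.α * z * B))) =
      z * B * (ed e 0 z - P.e₀in' z 0) + A * (z * (e 0 z - P.e₀in z 0)) := by
    rw [k1, k2]; ring
  rw [this]
  refine (norm_add_le _ _).trans ?_
  rw [norm_mul, norm_mul A, norm_mul z (_ - _)]
  have := mul_le_mul_of_nonneg_left h1 (norm_nonneg A)
  have := mul_le_mul_of_nonneg_left h2 (norm_nonneg (z * B))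
  linarith

/-- The numerator of the scattering function. -/
def Nm (P : SLProblem) (e : ℝ → ℂ → ℂ) (l : ℝ) : ℂ :=
  P.bcβ l * ed e 0 (-l) + P.bcα l * e 0 (-l)

lemma IsJostSolution.S_eq (hP : P.Admissible) (he : P.IsJostSolution e) (l : ℝ) :
    P.S e l = P.Nm e l / P.E e l := by
  obtain ⟨h1, h2⟩ := he.conj_eq hP (z := (l : ℂ)) (by simp) le_rfl
  rw [Complex.conj_ofReal] at h1 h2
  rw [S, h1, Nm, ← h2]; rfl

/-- Leading part of `E`. -/
def Elead (P : SLProblem) (d : ℕ) (p : ℂ) (r : ℝ) (z : ℂ) : ℂ :=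
  ((P.α + 1) / (2 * P.α) : ℝ) * Complex.exp (Complex.I * z * (P.μp 0 : ℂ)) *
    (p * z ^ d * (1 + P.τ * r * P.wexp z))

def Nlead (P : SLProblem) (d : ℕ) (p : ℂ) (r : ℝ) (z : ℂ) : ℂ :=
  ((P.α + 1) / (2 * P.α) : ℝ) * Complex.exp (Complex.I * (-z) * (P.μp 0 : ℂ)) *
    (p * z ^ d * (r + P.τ * P.wexp (-z)))

lemma IsLeading.E_sub_le (hP : P.Admissible) (he : P.IsJostSolution e) {d : ℕ} {p : ℂ} {r : ℝ}
    (hL : P.IsLeading d p r) : ∃ C : ℝ, 0 ≤ C ∧ ∀ z : ℂ, 0 ≤ z.im → 1 ≤ ‖z‖ →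
      ‖z * (P.E e z - P.Elead d p r z)‖ ≤ C * ‖z‖ ^ d * Real.exp (-(z.im * P.μp 0)) := by
  obtain ⟨C, hC, h⟩ := he.asymptotic_form hP
  obtain ⟨C1, h1, k1⟩ := hL.plus
  obtain ⟨C2, h2, k2⟩ := hL.minus
  obtain ⟨C3, h3, k3⟩ := hL.bcβ_le
  obtain ⟨C4, h4, k4⟩ := hL.bcα_le
  set κ : ℝ := (P.α + 1) / (2 * P.α) with hκ
  have hκ0 : 0 ≤ κ := by have := hP.α_pos; positivity
  refine ⟨C * (C3 + C4) + κ * (C1 + C2), by positivity, fun z hz hz1 => ?_⟩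
  have a := h z (P.bcβ z) (P.bcα z) hz hz1
  set Ex := Complex.exp (Complex.I * z * (P.μp 0 : ℂ)) with hEx
  have hExn : ‖Ex‖ = Real.exp (-(z.im * P.μp 0)) := norm_exp_I_mul z (P.μp 0)
  have hdec : z * (P.E e z - P.Elead d p r z) =
      z * (P.bcβ z * ed e 0 z + P.bcα z * e 0 z - (κ : ℝ) * Ex *
        ((P.bcα z + Complex.I * P.α * z * P.bcβ z) +
          P.τ * P.wexp z * (P.bcα z - Complex.I * P.α * z * P.bcβ z))) +
      κ * Ex * (z * (P.bcα z + Complex.I * P.α * z * P.bcβ z - p * z ^ d) + P.τ * P.wexp z *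
        (z * (P.bcα z - Complex.I * P.α * z * P.bcβ z - r * p * z ^ d))) := by
    rw [E_eq, Elead]; ring
  have hw : ‖(P.τ : ℂ) * P.wexp z‖ ≤ 1 := by
    rw [norm_mul, Complex.norm_real]
    exact mul_le_one₀ hP.abs_τ_lt.le (norm_nonneg _) (hP.norm_wexp_le hz)
  rw [hdec]
  refine (norm_add_le _ _).trans ?_
  have b : ‖κ * Ex * (z * (P.bcα z + Complex.I * P.α * z * P.bcβ z - p * z ^ d) + P.τ * P.wexp z *
        (z * (P.bcα z - Complex.I * P.α * z * P.bcβ z - r * p * z ^ d)))‖ ≤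
      κ * Real.exp (-(z.im * P.μp 0)) * (C1 * ‖z‖ ^ d + 1 * (C2 * ‖z‖ ^ d)) := by
    rw [norm_mul, norm_mul, hExn, Complex.norm_real, Real.norm_of_nonneg hκ0]
    gcongr
    refine (norm_add_le _ _).trans ?_
    rw [norm_mul (_ * _)]
    gcongr
    · exact k1 z hz1
    · exact k2 z hz1
  have c : C * (‖z * P.bcβ z‖ + ‖P.bcα z‖) * Real.exp (-(z.im * P.μp 0)) ≤
      C * (C3 * ‖z‖ ^ d + C4 * ‖z‖ ^ d) * Real.exp (-(z.im * P.μp 0)) := by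
    gcongr
    · exact k3 z hz1
    · exact k4 z hz1
  refine (add_le_add (a.trans c) b).trans (le_of_eq (by ring))

lemma IsLeading.N_sub_le (hP : P.Admissible) (he : P.IsJostSolution e) {d : ℕ} {p : ℂ} {r : ℝ}
    (hL : P.IsLeading d p r) : ∃ C : ℝ, 0 ≤ C ∧ ∀ l : ℝ, 1 ≤ |l| →
      |l| * ‖P.Nm e l - P.Nlead d p r l‖ ≤ C * |l| ^ d := by
  obtain ⟨C, hC, h⟩ := he.asymptotic_form hP
  obtain ⟨C1, h1, k1⟩ := hL.plus
  obtain ⟨C2, h2, k2⟩ := hL.minus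
  obtain ⟨C3, h3, k3⟩ := hL.bcβ_le
  obtain ⟨C4, h4, k4⟩ := hL.bcα_le
  set κ : ℝ := (P.α + 1) / (2 * P.α) with hκ
  have hκ0 : 0 ≤ κ := by have := hP.α_pos; positivity
  refine ⟨C * (C3 + C4) + κ * (C2 + C1), by positivity, fun l hl => ?_⟩
  have hl1 : 1 ≤ ‖(l : ℂ)‖ := by simpa using hl
  have hn : ‖(l : ℂ)‖ = |l| := by simp
  -- The solution is taken at -l but the boundary coefficients at l, so A + iαlB and A - iαlB trade
  -- places compared with E.
  have a := h (-l) (P.bcβ l) (P.bcα l) (by simp) (by simpa using hl)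
  set Ex := Complex.exp (Complex.I * (-(l : ℂ)) * (P.μp 0 : ℂ)) with hEx
  have hExn : ‖Ex‖ = 1 := by
    rw [hEx, norm_exp_I_mul]; simp
  have hdec : -(l : ℂ) * (P.Nm e l - P.Nlead d p r l) =
      -l * (P.bcβ l * ed e 0 (-l) + P.bcα l * e 0 (-l) - (κ : ℝ) * Ex *
        ((P.bcα l + Complex.I * P.α * (-l) * P.bcβ l) +
          P.τ * P.wexp (-l) * (P.bcα l - Complex.I * P.α * (-l) * P.bcβ l))) -
      κ * Ex * (l * (P.bcα l - Complex.I * P.α * l * P.bcβ l - r * p * l ^ d) + P.τ * P.wexp (-l) *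
        (l * (P.bcα l + Complex.I * P.α * l * P.bcβ l - p * l ^ d))) := by
    rw [Nm, Nlead]; ring
  have hw : ‖(P.τ : ℂ) * P.wexp (-l)‖ ≤ 1 := by
    rw [norm_mul, Complex.norm_real]
    exact mul_le_one₀ hP.abs_τ_lt.le (norm_nonneg _) (hP.norm_wexp_le (by simp))
  have hlhs : |l| * ‖P.Nm e l - P.Nlead d p r l‖ = ‖-(l : ℂ) * (P.Nm e l - P.Nlead d p r l)‖ := by
    rw [norm_mul, norm_neg, hn]
  rw [hlhs, hdec]
  refine (norm_sub_le _ _).trans ?_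
  have b : ‖κ * Ex * (l * (P.bcα l - Complex.I * P.α * l * P.bcβ l - r * p * l ^ d) +
        P.τ * P.wexp (-l) * (l * (P.bcα l + Complex.I * P.α * l * P.bcβ l - p * l ^ d)))‖ ≤
      κ * 1 * (C2 * |l| ^ d + 1 * (C1 * |l| ^ d)) := by
    rw [norm_mul, norm_mul, hExn, Complex.norm_real, Real.norm_of_nonneg hκ0]
    gcongr
    refine (norm_add_le _ _).trans ?_
    rw [norm_mul (_ * _), ← hn]
    gcongr
    · exact k2 l hl1
    · exact k1 l hl1
  rw [neg_mul, norm_neg, neg_mul, norm_neg] at a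
  have c : C * (‖l * P.bcβ l‖ + ‖P.bcα l‖) * Real.exp (-((-(l : ℂ)).im * P.μp 0)) ≤
      C * (C3 * |l| ^ d + C4 * |l| ^ d) := by
    simp only [Complex.neg_im, Complex.ofReal_im, neg_zero, zero_mul, Real.exp_zero, mul_one]
    rw [← hn]
    gcongr
    · exact k3 l hl1
    · exact k4 l hl1
  rw [neg_mul, norm_neg]
  refine (add_le_add (a.trans c) b).trans (le_of_eq (by ring))

lemma Admissible.norm_den_ge (hP : P.Admissible) {r : ℝ} (hr : |r| ≤ 1) {z : ℂ} (hz : 0 ≤ z.im) :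
    1 - |P.τ| ≤ ‖1 + P.τ * r * P.wexp z‖ := by
  have h1 : ‖(P.τ : ℂ) * r * P.wexp z‖ ≤ |P.τ| := by
    rw [norm_mul, norm_mul, Complex.norm_real, Complex.norm_real]
    have := mul_le_one₀ hr (norm_nonneg _) (hP.norm_wexp_le hz)
    rw [mul_assoc]
    exact mul_le_of_le_one_right (abs_nonneg _) this
  have := norm_sub_norm_le (1 : ℂ) (-(P.τ * r * P.wexp z))
  rw [norm_neg, norm_one, sub_neg_eq_add] at this
  linarith

/-- Since |τ r w| ≤ |τ| < 1, the factor 1 + τrw stays away from 0 and the leading term dominates the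
error, which is one order lower. -/
lemma IsLeading.exists_lower (hP : P.Admissible) (he : P.IsJostSolution e) {d : ℕ} {p : ℂ}
    {r : ℝ} (hL : P.IsLeading d p r) : ∃ c R : ℝ, 0 < c ∧ 1 ≤ R ∧ ∀ z : ℂ, 0 ≤ z.im → R ≤ ‖z‖ →
      c * ‖z‖ ^ d * Real.exp (-(z.im * P.μp 0)) ≤ ‖P.E e z‖ := by
  obtain ⟨C, hC, h⟩ := hL.E_sub_le hP he
  set κ : ℝ := (P.α + 1) / (2 * P.α) with hκ
  have hκ0 : 0 < κ := by have := hP.α_pos; positivity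
  have hτ := hP.abs_τ_lt
  set c := κ * ‖p‖ * (1 - |P.τ|) with hc
  have hc0 : 0 < c := mul_pos (mul_pos hκ0 (norm_pos_iff.2 hL.ne_zero)) (by linarith)
  refine ⟨c / 2, max 1 (2 * C / c), by positivity, le_max_left _ _, fun z hz hR => ?_⟩
  have hz1 : 1 ≤ ‖z‖ := (le_max_left _ _).trans hR
  have hz2 : 2 * C / c ≤ ‖z‖ := (le_max_right _ _).trans hR
  have hz0 : 0 < ‖z‖ := by linarith
  have a := h z hz hz1
  set ε := Real.exp (-(z.im * P.μp 0)) with hε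
  have hε0 : 0 < ε := Real.exp_pos _
  have hlead : c * ‖z‖ ^ d * ε ≤ ‖P.Elead d p r z‖ := by
    rw [Elead, norm_mul, norm_mul, norm_mul, norm_mul, norm_exp_I_mul, Complex.norm_real,
      Real.norm_of_nonneg hκ0.le, norm_pow, hc]
    have := mul_le_mul_of_nonneg_left (hP.norm_den_ge hL.abs_le hz)
      (by positivity : 0 ≤ κ * ε * (‖p‖ * ‖z‖ ^ d))
    refine le_trans (le_of_eq ?_) (this.trans (le_of_eq ?_)) <;> ring
  have herr : ‖P.E e z - P.Elead d p r z‖ ≤ c / 2 * ‖z‖ ^ d * ε := by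
    rw [norm_mul] at a
    refine le_of_mul_le_mul_left (a.trans ?_) hz0
    rw [div_le_iff₀ hc0] at hz2
    have : C ≤ ‖z‖ * (c / 2) := by linarith
    calc C * ‖z‖ ^ d * ε ≤ (‖z‖ * (c / 2)) * ‖z‖ ^ d * ε := by gcongr
      _ = _ := by ring
  have := norm_sub_norm_le (P.Elead d p r z) (P.Elead d p r z - P.E e z)
  rw [sub_sub_cancel, norm_sub_rev] at this
  linarith

/-- The leading part of `S`. -/
def Sap (P : SLProblem) (r : ℝ) (l : ℝ) : ℂ :=
  Complex.exp (-(2 * Complex.I * l * P.μp 0)) * (r + P.τ * P.wexp (-l)) / (1 + P.τ * r * P.wexp l)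

lemma Admissible.norm_Sap_le (hP : P.Admissible) {r : ℝ} (hr : |r| ≤ 1) (l : ℝ) :
    ‖P.Sap r l‖ ≤ 2 / (1 - |P.τ|) := by
  have hτ := hP.abs_τ_lt
  have hden := hP.norm_den_ge hr (z := l) (by simp)
  rw [Sap, norm_div, norm_mul]
  have e1 : ‖Complex.exp (-(2 * Complex.I * l * P.μp 0))‖ = 1 := by
    rw [show -(2 * Complex.I * l * P.μp 0) = ((-(2 * l * P.μp 0) : ℝ) : ℂ) * Complex.I by
      push_cast; ring, Complex.norm_exp_ofReal_mul_I]
  have e2 : ‖(r : ℂ) + P.τ * P.wexp (-l)‖ ≤ 2 := by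
    refine (norm_add_le _ _).trans ?_
    rw [norm_mul, Complex.norm_real, Complex.norm_real]
    have := mul_le_one₀ hτ.le (norm_nonneg _) (hP.norm_wexp_le (z := -l) (by simp))
    simp only [Real.norm_eq_abs]
    linarith
  rw [e1, one_mul]
  exact div_le_div₀ zero_le_two e2 (by linarith) hden

/-- As Nlead = Sap · Elead, the numerator of S - Sap consists of the two lower-order errors. The
rate 1/|l| is what makes the difference square integrable. -/
lemma IsLeading.exists_S_sub_le (hP : P.Admissible) (he : P.IsJostSolution e) {d : ℕ} {p : ℂ}
    {r : ℝ} (hL : P.IsLeading d p r) : ∃ C R : ℝ, 0 ≤ C ∧ 1 ≤ R ∧ ∀ l : ℝ, R ≤ |l| →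
      ‖P.S e l - P.Sap r l‖ ≤ C / |l| := by
  obtain ⟨C1, hC1, h1⟩ := hL.E_sub_le hP he
  obtain ⟨C2, hC2, h2⟩ := hL.N_sub_le hP he
  obtain ⟨c, R, hc, hR, hl⟩ := hL.exists_lower hP he
  have hτ := hP.abs_τ_lt
  set s := 2 / (1 - |P.τ|) with hs
  have hs0 : 0 < s := div_pos two_pos (by linarith)
  refine ⟨(C2 + s * C1) / c, R, by positivity, hR, fun l hRl => ?_⟩
  have hn : ‖(l : ℂ)‖ = |l| := by simp
  have hl1 : 1 ≤ |l| := hR.trans hRl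
  have hl0 : 0 < |l| := by linarith
  have a1 := h1 l (by simp) (by rwa [hn])
  have a2 := h2 l hl1
  have a3 := hl l (by simp) (by rwa [hn])
  simp only [Complex.ofReal_im, zero_mul, neg_zero, Real.exp_zero, mul_one, hn] at a1 a3
  rw [norm_mul, hn] at a1
  have hd : 0 < |l| ^ d := by positivity
  have hE : P.E e l ≠ 0 := norm_pos_iff.1 (lt_of_lt_of_le (by positivity) a3)
  have hden := hP.norm_den_ge hL.abs_le (z := l) (by simp)
  have hden0 : 1 + P.τ * r * P.wexp l ≠ 0 := norm_pos_iff.1 (by linarith)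
  have hSap : ‖P.Sap r l‖ ≤ s := hP.norm_Sap_le hL.abs_le l
  have hrel : P.Nlead d p r l = P.Sap r l * P.Elead d p r l := by
    rw [Nlead, Sap, Elead]
    have : Complex.exp (Complex.I * (-(l : ℂ)) * (P.μp 0 : ℂ)) =
      Complex.exp (-(2 * Complex.I * l * P.μp 0)) *
        Complex.exp (Complex.I * l * (P.μp 0 : ℂ)) := by
      rw [← Complex.exp_add]; congr 1; ring
    rw [this, div_mul_eq_mul_div, eq_div_iff hden0]; ring
  have hdec : P.S e l - P.Sap r l = ((P.Nm e l - P.Nlead d p r l) -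
      P.Sap r l * (P.E e l - P.Elead d p r l)) / P.E e l := by
    rw [he.S_eq hP, eq_div_iff hE, sub_mul, div_mul_cancel₀ _ hE, hrel]; ring
  rw [hdec, norm_div, div_le_iff₀ (norm_pos_iff.2 hE)]
  have hnum : |l| * ‖(P.Nm e l - P.Nlead d p r l) - P.Sap r l * (P.E e l - P.Elead d p r l)‖ ≤
      (C2 + s * C1) * |l| ^ d := by
    refine (mul_le_mul_of_nonneg_left (norm_sub_le _ _) hl0.le).trans ?_
    rw [norm_mul]
    have : ‖P.Sap r l‖ * (|l| * ‖P.E e l - P.Elead d p r l‖) ≤ s * (C1 * |l| ^ d) := by gcongr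
    linarith
  refine le_of_mul_le_mul_left (hnum.trans ?_) hl0
  have : (C2 + s * C1) / c * (c * |l| ^ d) ≤ (C2 + s * C1) / c * ‖P.E e l‖ := by gcongr
  calc (C2 + s * C1) * |l| ^ d = (C2 + s * C1) / c * (c * |l| ^ d) := by field_simp
    _ ≤ _ := this
    _ = _ := by field_simp

end SLProblem

end

/-! ### Consequences of the sign conditions -/

noncomputable section

namespace SLProblem

variable {P : SLProblem} {e : ℝ → ℂ → ℂ} {K : ℝ → ℝ → ℂ}

/-- The sign conditions act through the bracket on the right, which is nonpositive in the closed
upper half-plane (`disc_nonpos`). -/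
lemma im_bcβ_mul_conj (P : SLProblem) (z : ℂ) : (P.bcβ z * conj (P.bcα z)).im =
    z.re * (P.δ₁ + 2 * P.δ₂ * z.im - P.δ₃ * (z.re ^ 2 + z.im ^ 2)) := by
  simp only [bcβ, bcα, δ₁, δ₂, δ₃, pow_two, Complex.mul_im, Complex.mul_re, Complex.add_re,
    Complex.add_im, Complex.conj_re, Complex.conj_im, Complex.I_re, Complex.I_im,
    Complex.ofReal_re, Complex.ofReal_im]
  ring

lemma Admissible.disc_nonpos (hP : P.Admissible) {z : ℂ} (hz : 0 ≤ z.im) :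
    P.δ₁ + 2 * P.δ₂ * z.im - P.δ₃ * (z.re ^ 2 + z.im ^ 2) ≤ 0 := by
  have h1 := hP.δ₁_nonpos
  have h2 := mul_nonneg (neg_nonneg.2 hP.δ₂_nonpos) hz
  have h3 := mul_nonneg hP.δ₃_nonneg (by positivity : 0 ≤ z.re ^ 2 + z.im ^ 2)
  linarith

/-- By the Wronskian, |E|² - |N|² = -4l Im(B conj A) = -4l²(δ₁ - δ₃l²) ≥ 0. -/
lemma IsJostSolution.norm_N_le (hP : P.Admissible) (he : P.IsJostSolution e) (l : ℝ) :
    ‖P.Nm e l‖ ≤ ‖P.E e l‖ := by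
  have hW := he.wronskian_real hP l
  obtain ⟨h1, h2⟩ := he.conj_eq hP (z := (l : ℂ)) (by simp) le_rfl
  rw [Complex.conj_ofReal] at h1 h2
  rw [← h1, ← h2] at hW
  have hD := hP.disc_nonpos (z := (l : ℂ)) (by simp)
  have him := P.im_bcβ_mul_conj l
  rw [Nm, E_eq, ← h1, ← h2]
  set B := P.bcβ l
  set A := P.bcα l
  set u := e 0 l
  set v := ed e 0 l
  rw [← sq_le_sq₀ (norm_nonneg _) (norm_nonneg _), ← Complex.normSq_eq_norm_sq,
    ← Complex.normSq_eq_norm_sq]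
  have hre := congrArg Complex.im hW
  simp only [Complex.sub_im, Complex.mul_im, Complex.conj_re, Complex.conj_im, Complex.re_ofNat,
    Complex.im_ofNat, Complex.I_re, Complex.I_im, Complex.ofReal_re, Complex.ofReal_im,
    Complex.mul_re] at hre
  simp only [Complex.mul_im, Complex.conj_re, Complex.conj_im, Complex.ofReal_re,
    Complex.ofReal_im] at him hD
  simp only [Complex.normSq_apply, Complex.add_re, Complex.add_im, Complex.mul_re, Complex.mul_im,
    Complex.conj_re, Complex.conj_im]
  have key : -4 * l * (B.re * -A.im + B.im * A.re) =
    (B.re * v.re - B.im * v.im + (A.re * u.re - A.im * u.im)) *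
      (B.re * v.re - B.im * v.im + (A.re * u.re - A.im * u.im)) +
    (B.re * v.im + B.im * v.re + (A.re * u.im + A.im * u.re)) *
      (B.re * v.im + B.im * v.re + (A.re * u.im + A.im * u.re)) -
    ((B.re * v.re - B.im * -v.im + (A.re * u.re - A.im * -u.im)) *
      (B.re * v.re - B.im * -v.im + (A.re * u.re - A.im * -u.im)) +
    (B.re * -v.im + B.im * v.re + (A.re * -u.im + A.im * u.re)) *
      (B.re * -v.im + B.im * v.re + (A.re * -u.im + A.im * u.re))) := by
    linear_combination (-2 * (B.re * A.im - B.im * A.re)) * hre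
  have h4 : 0 ≤ -4 * l * (B.re * -A.im + B.im * A.re) := by
    rw [him]
    nlinarith [mul_nonneg (sq_nonneg l) (neg_nonneg.2 hD)]
  linarith

lemma IsJostSolution.norm_S_le (hP : P.Admissible) (he : P.IsJostSolution e) (l : ℝ) :
    ‖P.S e l‖ ≤ 1 := by
  rw [he.S_eq hP, norm_div]
  -- Where E(l) = 0 the quotient has the value 0, so the bound holds there as well.
  exact div_le_one_of_le₀ (he.norm_N_le hP l) (norm_nonneg _)

/-- Both boundary coefficients vanish for at most finitely many real `l`. -/
lemma finite_bc_zero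
    (hne : ¬(P.α₀ = 0 ∧ P.α₁ = 0 ∧ P.α₂ = 0 ∧ P.β₀ = 0 ∧ P.β₁ = 0 ∧ P.β₂ = 0)) :
    {l : ℝ | l ≠ 0 ∧ P.bcβ l = 0 ∧ P.bcα l = 0}.Finite := by
  have key : ∀ l ∈ {l : ℝ | l ≠ 0 ∧ P.bcβ l = 0 ∧ P.bcα l = 0}, P.β₁ = 0 ∧ P.α₁ = 0 ∧
      P.β₀ + P.β₂ * l ^ 2 = 0 ∧ P.α₀ + P.α₂ * l ^ 2 = 0 := by
    rintro l ⟨h0, hb, ha⟩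
    have b1 := congrArg Complex.re hb
    have b2 := congrArg Complex.im hb
    have a1 := congrArg Complex.re ha
    have a2 := congrArg Complex.im ha
    simp [bcβ, bcα, pow_two, h0] at b1 b2 a1 a2
    exact ⟨b2, a2, by rw [pow_two]; exact b1, by rw [pow_two]; exact a1⟩
  by_cases hex : ∃ l₀, l₀ ∈ {l : ℝ | l ≠ 0 ∧ P.bcβ l = 0 ∧ P.bcα l = 0}
  · obtain ⟨l₀, hl₀⟩ := hex
    refine (Set.toFinite {l₀, -l₀}).subset fun l hl => ?_
    obtain ⟨p1, p2, p3, p4⟩ := key _ hl₀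
    obtain ⟨q1, q2, q3, q4⟩ := key _ hl
    by_contra hnot
    have hsq : l ^ 2 - l₀ ^ 2 ≠ 0 := fun h => hnot (by
      have := sq_eq_sq_iff_eq_or_eq_neg.1 (sub_eq_zero.1 h)
      simpa using this)
    have hb : P.β₂ = 0 := by
      have : P.β₂ * (l ^ 2 - l₀ ^ 2) = 0 := by linarith
      exact (mul_eq_zero.1 this).resolve_right hsq
    have ha : P.α₂ = 0 := by
      have : P.α₂ * (l ^ 2 - l₀ ^ 2) = 0 := by linarith
      exact (mul_eq_zero.1 this).resolve_right hsq
    rw [hb] at p3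
    rw [ha] at p4
    exact hne ⟨by linarith, p2, ha, by linarith, p1, hb⟩
  · push Not at hex
    convert Set.finite_empty
    ext l; simpa using hex l

/-- A real zero of E is a zero of N by `norm_N_le`. At l ≠ 0 the Wronskian 2il makes the two linear
equations independent, so A and B both vanish, which happens for finitely many l only. -/
lemma IsJostSolution.ae_E_ne_zero (hP : P.Admissible) (he : P.IsJostSolution e)
    (hne : ¬(P.α₀ = 0 ∧ P.α₁ = 0 ∧ P.α₂ = 0 ∧ P.β₀ = 0 ∧ P.β₁ = 0 ∧ P.β₂ = 0)) :
    ∀ᵐ l : ℝ, P.E e l ≠ 0 := by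
  have h1 : ∀ᵐ l : ℝ, l ∉ {l : ℝ | l ≠ 0 ∧ P.bcβ l = 0 ∧ P.bcα l = 0} :=
    measure_eq_zero_iff_ae_notMem.1 ((finite_bc_zero hne).measure_zero _)
  have h2 : ∀ᵐ l : ℝ, l ≠ 0 := by simp [ae_iff, measure_singleton]
  filter_upwards [h1, h2] with l hl hl0 hE
  refine hl ⟨hl0, ?_⟩
  have hN : P.Nm e l = 0 := by
    have := he.norm_N_le hP l
    rw [hE, norm_zero] at this
    exact norm_le_zero_iff.1 this
  have hW := he.wronskian_real hP l
  rw [E_eq] at hE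
  rw [Nm] at hN
  have hlc : (2 * Complex.I * l : ℂ) ≠ 0 := by simp [hl0]
  constructor
  · have : P.bcβ l * (2 * Complex.I * l) = 0 := by
      rw [← hW]; linear_combination e 0 (-l) * hE - e 0 l * hN
    exact (mul_eq_zero.1 this).resolve_right hlc
  · have : P.bcα l * (2 * Complex.I * l) = 0 := by
      rw [← hW]; linear_combination ed e 0 l * hN - ed e 0 (-l) * hE
    exact (mul_eq_zero.1 this).resolve_right hlc

lemma IsJostKernel.continuous_real (hK : P.IsJostKernel e K) {x : ℝ} (hx : 0 ≤ x) :
    Continuous fun l : ℝ => e x l :=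
  (hK.continuousOn hx).comp_continuous (by fun_prop) (by simp)

lemma IsJostKernel.continuous_real_neg (hK : P.IsJostKernel e K) {x : ℝ} (hx : 0 ≤ x) :
    Continuous fun l : ℝ => e x (-l) :=
  (hK.continuousOn hx).comp_continuous (by fun_prop) (by simp)

lemma IsJostKernel.measurable_S (hP : P.Admissible) (he : P.IsJostSolution e)
    (hK : P.IsJostKernel e K) : Measurable (P.S e) := by
  have h1 : P.S e = fun l : ℝ => P.Nm e l / P.E e l := funext (he.S_eq hP)
  have h2 : Continuous fun l : ℝ => ed e 0 (-l) :=
    (hK.continuousOn_ed hP he).comp_continuous (by fun_prop) (by simp)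
  have h3 : Continuous fun l : ℝ => P.E e l :=
    (hK.continuousOn_E hP he).comp_continuous (by fun_prop) (by simp)
  have h4 : Continuous fun l : ℝ => P.Nm e l :=
    ((P.differentiable_bcβ.continuous.comp Complex.continuous_ofReal).mul h2).add
      ((P.differentiable_bcα.continuous.comp Complex.continuous_ofReal).mul
        (hK.continuous_real_neg le_rfl))
  rw [h1]
  exact h4.measurable.div h3.measurable

lemma measurable_Sap (P : SLProblem) (r : ℝ) : Measurable (P.Sap r) := by
  unfold Sap wexp; fun_prop

/-- S₀ has the extreme values r = ±1, whereas the leading part of S may have another r.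
`IsLeading.exists_isF₀s` shows that the discrepancy is harmless. -/
lemma Admissible.S₀_eq (hP : P.Admissible) :
    P.S₀ = P.Sap (if P.β₂ = 0 then 1 else -1) := by
  funext l
  have hw : P.wexp l * Complex.exp (-(2 * Complex.I * l * P.α * P.a)) = 1 := by
    rw [wexp, ← Complex.exp_add, ← Complex.exp_zero]; congr 1; ring
  have hw' : P.wexp (-l) = Complex.exp (-(2 * Complex.I * l * P.α * P.a)) := by
    rw [wexp]; congr 1; ring
  have he : Complex.exp (-(2 * Complex.I * l * P.a)) * P.wexp l =
      Complex.exp (-(2 * Complex.I * l * P.μp 0)) := by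
    rw [wexp, ← Complex.exp_add, hP.μp_zero]; congr 1; push_cast; ring
  have hwn : P.wexp l ≠ 0 := Complex.exp_ne_zero _
  rw [S₀, Sap, ← he, hw']
  set v := Complex.exp (-(2 * Complex.I * l * P.α * P.a))
  have hv : v ≠ 0 := Complex.exp_ne_zero _
  have hwv : P.wexp l = v⁻¹ := eq_inv_of_mul_eq_one_left hw
  split_ifs with hb
  · have hden := hP.norm_den_ge (r := 1) (by simp) (z := l) (by simp)
    have hd : 1 + P.τ * v⁻¹ ≠ 0 := by
      rw [← hwv]
      refine norm_pos_iff.1 ?_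
      have := hP.abs_τ_lt
      simp at hden
      linarith
    have hd' : v + P.τ ≠ 0 := fun h => hd (by field_simp; simpa using h)
    rw [hwv, Complex.ofReal_one, mul_one]
    field_simp
  · have hden := hP.norm_den_ge (r := -1) (by simp) (z := l) (by simp)
    have hd : 1 - P.τ * v⁻¹ ≠ 0 := by
      rw [← hwv]
      refine norm_pos_iff.1 ?_
      have := hP.abs_τ_lt
      simp [← sub_eq_add_neg] at hden
      linarith
    have hd' : v - P.τ ≠ 0 := fun h => hd (by field_simp; simpa using h)
    rw [hwv, Complex.ofReal_neg, Complex.ofReal_one, mul_neg_one, neg_mul, ← sub_eq_add_neg]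
    field_simp
    ring

lemma Admissible.norm_S₀_le (hP : P.Admissible) (l : ℝ) : ‖P.S₀ l‖ ≤ 2 / (1 - |P.τ|) := by
  rw [hP.S₀_eq]
  exact hP.norm_Sap_le (by split_ifs <;> simp) l

lemma IsJostKernel.memLp_S₀_sub_S (hP : P.Admissible) (he : P.IsJostSolution e)
    (hK : P.IsJostKernel e K) : MemLp (fun l => P.S₀ l - P.S e l) ⊤ volume := by
  refine memLp_top_of_bound (Measurable.aestronglyMeasurable ?_) (2 / (1 - |P.τ|) + 1)
    (.of_forall fun l => (norm_sub_le _ _).trans (add_le_add (hP.norm_S₀_le l) (he.norm_S_le hP l)))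
  rw [hP.S₀_eq]
  exact (P.measurable_Sap _).sub (hK.measurable_S hP he)

/-- The squared norm of the Jost solution. -/
def nrm (P : SLProblem) (e : ℝ → ℂ → ℂ) (z : ℂ) : ℝ := ∫ x in Ioi (0 : ℝ), ‖e x z‖ ^ 2 * P.ρ x

/-- As a product of two Jost solutions, |e|² becomes accessible to Lagrange's identity. -/
lemma IsJostSolution.normSq_eq (hP : P.Admissible) (he : P.IsJostSolution e) {z : ℂ}
    (hz : 0 ≤ z.im) {x : ℝ} (hx : 0 ≤ x) :
    ((‖e x z‖ ^ 2 * P.ρ x : ℝ) : ℂ) = P.ρ x * (e x z * e x (-conj z)) := by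
  rw [← (he.conj_eq hP hz hx).1, Complex.mul_conj, Complex.normSq_eq_norm_sq]
  push_cast; ring

lemma IsJostSolution.integrable_normSq (hP : P.Admissible) (he : P.IsJostSolution e) {z : ℂ}
    (hz : 0 < z.im) : IntegrableOn (fun x => ‖e x z‖ ^ 2 * P.ρ x) (Ioi 0) := by
  have h := he.integrableOn_mul hP hz.le (w := -conj z) (by rw [im_neg_conj]; exact hz.le)
    (by rw [im_neg_conj]; linarith)
  have h2 : IntegrableOn (fun x => ((‖e x z‖ ^ 2 * P.ρ x : ℝ) : ℂ)) (Ioi 0) :=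
    h.congr_fun (fun x hx => (he.normSq_eq hP hz.le (le_of_lt hx)).symm) measurableSet_Ioi
  exact h2.re.congr (.of_forall fun x => RCLike.ofReal_re _)

lemma IsJostSolution.nrm_eq (hP : P.Admissible) (he : P.IsJostSolution e) {z : ℂ}
    (hz : 0 < z.im) :
    (P.nrm e z : ℂ) = ∫ x in Ioi 0, (P.ρ x : ℂ) * (e x z * e x (-conj z)) := by
  rw [nrm, ← integral_complex_ofReal]
  exact setIntegral_congr_fun measurableSet_Ioi fun x hx => he.normSq_eq hP hz.le (le_of_lt hx)

lemma IsJostSolution.im_mul_conj (hP : P.Admissible) (he : P.IsJostSolution e) {z : ℂ}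
    (hz : 0 < z.im) : (ed e 0 z * conj (e 0 z)).im = 2 * z.re * z.im * P.nrm e z := by
  have h := he.wronskian_eq hP hz.le (w := -conj z) (by rw [im_neg_conj]; exact hz.le)
    (by rw [im_neg_conj]; linarith)
  obtain ⟨c1, c2⟩ := he.conj_eq hP hz.le le_rfl
  rw [← he.nrm_eq hP hz, ← c1, ← c2] at h
  have := congrArg Complex.im h
  simp [pow_two] at this
  simp
  linarith

/-- Beyond X one has ρ = 1 and |e|² ≥ (4/9) exp(-2 Im z x). The squared norm therefore blows up like
1/Im z, and its product with Im z stays away from 0 up to the real axis. -/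
lemma IsJostSolution.nrm_lower (hP : P.Admissible) (he : P.IsJostSolution e) :
    ∃ X : ℝ, 0 ≤ X ∧ ∀ z : ℂ, 0 < z.im →
      2 / 9 * Real.exp (-(2 * z.im * X)) ≤ z.im * P.nrm e z := by
  obtain ⟨X, hX, hσ⟩ := hP.exists_tail_small
  have hX0 : 0 ≤ X := hP.a_pos.le.trans hX
  refine ⟨X, hX0, fun z hz => ?_⟩
  have h1 : ∫ x in Ioi X, 4 / 9 * Real.exp (-(2 * z.im * x)) ≤ P.nrm e z := by
    have i0 := he.integrable_normSq hP hz
    have i1 : IntegrableOn (fun x => 4 / 9 * Real.exp (-(2 * z.im * x))) (Ioi X) :=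
      (integrableOn_exp_neg (by linarith) X).const_mul _
    have i2 : IntegrableOn (fun x => ‖e x z‖ ^ 2 * P.ρ x) (Ioi X) :=
      i0.mono_set (Ioi_subset_Ioi hX0)
    refine (setIntegral_mono_on i1 i2 measurableSet_Ioi fun x hx => ?_).trans
      (setIntegral_mono_set i0 (.of_forall fun x => mul_nonneg (sq_nonneg _) (ρ_nonneg x))
        (Ioi_subset_Ioi hX0).eventuallyLE)
    have hx' : X ≤ x := le_of_lt hx
    rw [ρ_of_ge (hX.trans hx'), mul_one]
    have h := he.norm_sq_lower hP hX hσ hz.le hx'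
    have h2 := norm_sub_norm_le (Complex.exp (Complex.I * z * (x : ℂ)))
      (Complex.exp (Complex.I * z * (x : ℂ)) - e x z)
    rw [sub_sub_cancel, norm_sub_rev, norm_exp_I_mul] at h2
    have h3 : 2 / 3 * Real.exp (-(z.im * x)) ≤ ‖e x z‖ := by linarith
    calc 4 / 9 * Real.exp (-(2 * z.im * x)) = (2 / 3 * Real.exp (-(z.im * x))) ^ 2 := by
          rw [mul_pow, ← Real.exp_nat_mul]; norm_num; ring_nf
      _ ≤ _ := by gcongr
  rw [integral_const_mul, integral_exp_neg (by linarith)] at h1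
  have := mul_le_mul_of_nonneg_left h1 hz.le
  refine le_trans (le_of_eq ?_) this
  field_simp; norm_num

lemma IsJostSolution.nrm_pos (hP : P.Admissible) (he : P.IsJostSolution e) {z : ℂ}
    (hz : 0 < z.im) : 0 < P.nrm e z := by
  obtain ⟨X, -, h⟩ := he.nrm_lower hP
  have := lt_of_lt_of_le (by positivity) (h z hz)
  exact pos_of_mul_pos_right this hz.le

lemma IsJostSolution.normInvSq_pos (hP : P.Admissible) (he : P.IsJostSolution e) {κ : ℝ}
    (hκ : 0 < κ) : 0 < P.normInvSq e κ := by
  have h1 := he.nrm_pos hP (z := Complex.I * κ) (by simpa using hκ)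
  have h2 := hP.disc_nonpos (z := Complex.I * κ) (by simpa using hκ.le)
  simp at h2
  rw [normInvSq]
  have h3 : ‖e 0 (Complex.I * κ)‖ ^ 2 * (P.δ₁ + 2 * P.δ₂ * κ - P.δ₃ * κ ^ 2) /
      (2 * κ * (P.β₀ - P.β₁ * κ - P.β₂ * κ ^ 2) ^ 2) ≤ 0 :=
    div_nonpos_of_nonpos_of_nonneg
      (mul_nonpos_of_nonneg_of_nonpos (sq_nonneg _) (by linarith)) (by positivity)
  rw [nrm] at h1
  linarith

/-- Multiply E by the conjugates of B e and of A e'. Each product has imaginary part ±Re z times a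
sum of two nonnegative terms, by `im_mul_conj` and `disc_nonpos`, so nothing cancels. In particular,
off the imaginary axis E vanishes only where A and B both do. -/
lemma IsJostSolution.lower_E (hP : P.Admissible) (he : P.IsJostSolution e) {z : ℂ}
    (hz : 0 < z.im) : 2 * |z.re| * (z.im * P.nrm e z) * (‖P.bcα z‖ + ‖P.bcβ z‖) ≤
      ‖P.E e z‖ * (‖e 0 z‖ + ‖ed e 0 z‖) := by
  have hI := he.im_mul_conj hP hz
  have hn := he.nrm_pos hP hz
  have hD := hP.disc_nonpos hz.le
  have him := P.im_bcβ_mul_conj z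
  set D := P.δ₁ + 2 * P.δ₂ * z.im - P.δ₃ * (z.re ^ 2 + z.im ^ 2)
  rw [E_eq]
  set B := P.bcβ z
  set A := P.bcα z
  set u := e 0 z
  set v := ed e 0 z
  set n := P.nrm e z
  have hzn : 0 < z.im * n := mul_pos hz hn
  have n1 : 2 * |z.re| * (z.im * n) * ‖B‖ ^ 2 ≤ ‖B * v + A * u‖ * (‖B‖ * ‖u‖) := by
    have e1 : ((B * v + A * u) * conj (B * u)).im =
        z.re * (2 * (z.im * n) * ‖B‖ ^ 2 - D * ‖u‖ ^ 2) := by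
      have : (B * v + A * u) * conj (B * u) = ((‖B‖ ^ 2 : ℝ) : ℂ) * (v * conj u) +
          ((‖u‖ ^ 2 : ℝ) : ℂ) * conj (B * conj A) := by
        rw [← Complex.normSq_eq_norm_sq, ← Complex.normSq_eq_norm_sq, ← Complex.mul_conj,
          ← Complex.mul_conj]
        simp; ring
      rw [this, Complex.add_im, Complex.im_ofReal_mul, Complex.im_ofReal_mul, Complex.conj_im,
        him, hI]; ring
    have e2 := Complex.abs_im_le_norm ((B * v + A * u) * conj (B * u))
    rw [e1, abs_mul, norm_mul, Complex.norm_conj, norm_mul] at e2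
    refine le_trans ?_ e2
    have : 0 ≤ -D * ‖u‖ ^ 2 := mul_nonneg (by linarith) (sq_nonneg _)
    have h2 := le_abs_self (2 * (z.im * n) * ‖B‖ ^ 2 - D * ‖u‖ ^ 2)
    calc 2 * |z.re| * (z.im * n) * ‖B‖ ^ 2 = |z.re| * (2 * (z.im * n) * ‖B‖ ^ 2) := by ring
      _ ≤ _ := mul_le_mul_of_nonneg_left (by linarith) (abs_nonneg _)
  have n2 : 2 * |z.re| * (z.im * n) * ‖A‖ ^ 2 ≤ ‖B * v + A * u‖ * (‖A‖ * ‖v‖) := by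
    have e1 : ((B * v + A * u) * conj (A * v)).im =
        -(z.re * (2 * (z.im * n) * ‖A‖ ^ 2 - D * ‖v‖ ^ 2)) := by
      have : (B * v + A * u) * conj (A * v) = ((‖A‖ ^ 2 : ℝ) : ℂ) * conj (v * conj u) +
          ((‖v‖ ^ 2 : ℝ) : ℂ) * (B * conj A) := by
        rw [← Complex.normSq_eq_norm_sq, ← Complex.normSq_eq_norm_sq, ← Complex.mul_conj,
          ← Complex.mul_conj]
        simp; ring
      rw [this, Complex.add_im, Complex.im_ofReal_mul, Complex.im_ofReal_mul, Complex.conj_im,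
        him, hI]; ring
    have e2 := Complex.abs_im_le_norm ((B * v + A * u) * conj (A * v))
    rw [e1, abs_neg, abs_mul, norm_mul, Complex.norm_conj, norm_mul] at e2
    refine le_trans ?_ e2
    have : 0 ≤ -D * ‖v‖ ^ 2 := mul_nonneg (by linarith) (sq_nonneg _)
    have h2 := le_abs_self (2 * (z.im * n) * ‖A‖ ^ 2 - D * ‖v‖ ^ 2)
    calc 2 * |z.re| * (z.im * n) * ‖A‖ ^ 2 = |z.re| * (2 * (z.im * n) * ‖A‖ ^ 2) := by ring
      _ ≤ _ := mul_le_mul_of_nonneg_left (by linarith) (abs_nonneg _)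
  -- Removes one factor ‖B‖ or ‖A‖, either of which may be zero.
  have cancel : ∀ {s t b : ℝ}, 0 ≤ b → 0 ≤ t → s * b ^ 2 ≤ t * b → s * b ≤ t := by
    intro s t b hb ht h
    rcases hb.eq_or_lt with h0 | h0
    · rw [← h0]; simpa using ht
    · rw [pow_two, ← mul_assoc] at h; exact le_of_mul_le_mul_right h h0
  have m1 := cancel (norm_nonneg B) (by positivity)
    (n1.trans (le_of_eq (by ring : _ = (‖B * v + A * u‖ * ‖u‖) * ‖B‖)))
  have m2 := cancel (norm_nonneg A) (by positivity)
    (n2.trans (le_of_eq (by ring : _ = (‖B * v + A * u‖ * ‖v‖) * ‖A‖)))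
  rw [mul_add, mul_add]
  linarith

end SLProblem

end

/-! ### Contour integration with weak control near the real axis -/

noncomputable section

/-- A function holomorphic in the upper half-plane and decaying quadratically has vanishing
integrals over horizontal lines. -/
lemma integral_horizontal_eq_zero {f : ℂ → ℂ} (hf : DifferentiableOn ℂ f {z | 0 < z.im}) {C : ℝ}
    (hC : ∀ z : ℂ, 0 < z.im → ‖f z‖ ≤ C / (1 + ‖z‖ ^ 2)) {ε : ℝ} (hε : 0 < ε) :
    Integrable (fun l : ℝ => f (l + ε * Complex.I)) ∧ ∫ l : ℝ, f (l + ε * Complex.I) = 0 := by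
  have him : ∀ l t : ℝ, ((l : ℂ) + t * Complex.I).im = t := fun l t => by simp
  have hre : ∀ l t : ℝ, ((l : ℂ) + t * Complex.I).re = l := fun l t => by simp
  have hsq : ∀ l t : ℝ, ‖(l : ℂ) + t * Complex.I‖ ^ 2 = l ^ 2 + t ^ 2 := fun l t => by
    rw [← Complex.normSq_eq_norm_sq, Complex.normSq_add_mul_I]
  have hC0 : 0 ≤ C := by
    have := (norm_nonneg _).trans (hC Complex.I (by simp))
    by_contra h
    have h2 : C / (1 + ‖Complex.I‖ ^ 2) < 0 := div_neg_of_neg_of_pos (not_le.1 h) (by positivity)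
    linarith
  have hint : ∀ t : ℝ, 0 < t → Integrable (fun l : ℝ => f (l + t * Complex.I)) := fun t ht => by
    refine Integrable.mono' (integrable_inv_one_add_sq.const_mul C)
      (Continuous.aestronglyMeasurable ?_) (.of_forall fun l => ?_)
    · exact hf.continuousOn.comp_continuous (by fun_prop) fun l => by simpa using ht
    · refine (hC _ (by rw [him]; exact ht)).trans ?_
      rw [hsq, div_eq_mul_inv]
      gcongr
      nlinarith
  refine ⟨hint ε hε, ?_⟩
  have hlim : Tendsto (fun n : ℕ => ∫ l in (-(n : ℝ))..n, f (l + ε * Complex.I)) atTop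
      (𝓝 (∫ l : ℝ, f (l + ε * Complex.I))) :=
    intervalIntegral_tendsto_integral (hint ε hε)
      (tendsto_neg_atTop_atBot.comp tendsto_natCast_atTop_atTop) tendsto_natCast_atTop_atTop
  -- In a rectangle of half-width and height n the top contributes at most 2C/n and each vertical
  -- side at most C/n.
  refine tendsto_nhds_unique hlim (squeeze_zero_norm' (a := fun n : ℕ => 4 * C / n) ?_
    (tendsto_const_nhds.div_atTop tendsto_natCast_atTop_atTop))
  filter_upwards [eventually_gt_atTop 0] with n hn
  have hn' : (0 : ℝ) < n := by exact_mod_cast hn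
  have hrect := Complex.integral_boundary_rect_eq_zero_of_differentiableOn f
    (((-(n : ℝ)) : ℝ) + (ε : ℝ) * Complex.I) ((n : ℝ) + ((ε + n : ℝ) : ℂ) * Complex.I)
    (hf.mono fun z hz => by
      have := hz.2
      rw [mem_preimage, him, him, uIcc_of_le (by linarith)] at this
      exact lt_of_lt_of_le hε this.1)
  rw [him, him, hre, hre] at hrect
  have hbd : ∀ l t : ℝ, 0 < t → (n : ℝ) ^ 2 ≤ l ^ 2 + t ^ 2 → ‖f (l + t * Complex.I)‖ ≤ C / n ^ 2 :=
    fun l t ht h => by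
      refine (hC _ (by rw [him]; exact ht)).trans ?_
      rw [hsq]
      gcongr
      linarith
  have b1 : ‖∫ x : ℝ in (-(n : ℝ))..n, f (x + ((ε + n : ℝ) : ℂ) * Complex.I)‖ ≤
      C / n ^ 2 * |n - (-(n : ℝ))| :=
    intervalIntegral.norm_integral_le_of_norm_le_const fun x _ =>
      hbd _ _ (by linarith) (by nlinarith [sq_nonneg x])
  have hside : ∀ s : ℝ, s ^ 2 = n ^ 2 →
      ‖∫ y : ℝ in ε..(ε + n), f (s + y * Complex.I)‖ ≤ C / n ^ 2 * |ε + n - ε| := fun s hs =>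
    intervalIntegral.norm_integral_le_of_norm_le_const fun y hy => by
      rw [uIoc_of_le (by linarith)] at hy
      exact hbd _ _ (by linarith [hy.1]) (by rw [hs]; nlinarith [sq_nonneg y])
  have b2 := hside n rfl
  have b3 := hside (-n) (by ring)
  have a1 : |(n : ℝ) - (-(n : ℝ))| = 2 * n := by rw [abs_of_pos (by linarith)]; ring
  have a2 : |ε + n - ε| = (n : ℝ) := by rw [abs_of_pos (by linarith)]; ring
  rw [a1] at b1
  rw [a2] at b2 b3
  have heq : ∫ l in (-(n : ℝ))..n, f (l + ε * Complex.I) =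
      (∫ x : ℝ in (-(n : ℝ))..n, f (x + ((ε + n : ℝ) : ℂ) * Complex.I)) -
      Complex.I * (∫ y : ℝ in ε..(ε + n), f ((n : ℝ) + y * Complex.I)) +
      Complex.I * (∫ y : ℝ in ε..(ε + n), f (((-n : ℝ) : ℂ) + y * Complex.I)) := by
    rw [smul_eq_mul, smul_eq_mul] at hrect
    linear_combination hrect
  rw [heq]
  refine (norm_add_le _ _).trans ((add_le_add_left (norm_sub_le _ _) _).trans ?_)
  rw [norm_mul, norm_mul, Complex.norm_I, one_mul, one_mul]
  have : 4 * C / n = C / n ^ 2 * (2 * n) + C / n ^ 2 * n + C / n ^ 2 * n := by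
    field_simp; ring
  rw [this]
  linarith

/-- A bound of the form `|Re z| ‖f z‖ ≤ C ‖z‖` in the upper half-plane implies boundedness. -/
lemma norm_le_of_abs_re_mul_le {f : ℂ → ℂ} (hf : DifferentiableOn ℂ f {z | 0 < z.im}) {C R : ℝ}
    (hC : ∀ z : ℂ, 0 < z.im → ‖z‖ ≤ 2 * R → |z.re| * ‖f z‖ ≤ C * ‖z‖) {z : ℂ} (hz : 0 < z.im)
    (hR : ‖z‖ ≤ R) : ‖f z‖ ≤ 8 * C := by
  have hk : z.im ≤ ‖z‖ := Complex.im_le_norm z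
  have hz0 : 0 < ‖z‖ := hz.trans_le hk
  have hC0 : 0 ≤ C := by
    by_contra h
    have h1 := hC z hz (by linarith)
    have h2 : C * ‖z‖ < 0 := mul_neg_of_neg_of_pos (not_le.1 h) hz0
    have h3 : 0 ≤ |z.re| * ‖f z‖ := by positivity
    linarith
  set k := z.im with hkd
  -- Away from the imaginary axis |z| ≤ 5|Re z|, and the hypothesis alone suffices.
  rcases lt_or_ge (k / 4) |z.re| with h | h
  · have h1 := hC z hz (by linarith)
    have h2 : ‖z‖ ≤ 5 * |z.re| := by
      have := Complex.norm_le_abs_re_add_abs_im z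
      rw [← hkd, abs_of_pos hz] at this
      linarith
    have h3 : 0 < |z.re| := lt_trans (by positivity) h
    refine le_of_mul_le_mul_left (h1.trans ?_) h3
    nlinarith [mul_le_mul_of_nonneg_left h2 hC0, mul_nonneg hC0 h3.le]
  -- Near the axis the maximum principle is applied on the disc of radius k/2 about ik, to f times
  -- (w - c)² + k²/4. On the circle this factor has modulus k|Re w|, so it vanishes exactly where
  -- the circle meets the axis and compensates the singular bound on f. At z it is at least k²/4.
  set c : ℂ := k * Complex.I with hc
  have hcim : ∀ w ∈ Metric.closedBall c (k / 2), k / 2 ≤ w.im ∧ ‖w‖ ≤ 3 / 2 * k := fun w hw => by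
    rw [Metric.mem_closedBall, dist_eq_norm] at hw
    have h1 := Complex.abs_im_le_norm (w - c)
    have h2 : (w - c).im = w.im - k := by simp [hc]
    rw [h2, abs_le] at h1
    have h3 := norm_le_norm_add_norm_sub' w c
    have h4 : ‖c‖ = k := by simp [hc, abs_of_pos hz]
    rw [h4] at h3
    exact ⟨by linarith [h1.1], by linarith⟩
  have hd : DiffContOnCl ℂ (fun w => f w * ((w - c) ^ 2 + k ^ 2 / 4)) (Metric.ball c (k / 2)) := by
    refine DifferentiableOn.diffContOnCl ?_
    rw [closure_ball _ (by positivity)]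
    refine DifferentiableOn.mul (hf.mono fun w hw => ?_) (Differentiable.differentiableOn (by fun_prop))
    have := (hcim w hw).1
    exact lt_of_lt_of_le (by positivity) this
  have hfr : ∀ w ∈ frontier (Metric.ball c (k / 2)),
      ‖f w * ((w - c) ^ 2 + k ^ 2 / 4)‖ ≤ 3 / 2 * C * k ^ 2 := fun w hw => by
    rw [frontier_ball _ (by positivity), mem_sphere_iff_norm] at hw
    obtain ⟨i1, i2⟩ := hcim w (by rw [Metric.mem_closedBall, dist_eq_norm, hw])
    have hfac : ‖(w - c) ^ 2 + (k : ℂ) ^ 2 / 4‖ = k * |w.re| := by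
      have hsq : (w - c).re ^ 2 + (w - c).im ^ 2 = (k / 2) ^ 2 := by
        rw [← hw, ← Complex.normSq_eq_norm_sq, Complex.normSq_apply]; ring
      have hr : (w - c).re = w.re := by simp [hc]
      have key : (w - c) ^ 2 + (k : ℂ) ^ 2 / 4 = (2 * w.re : ℝ) * (w - c) := by
        apply Complex.ext
        · rw [Complex.re_ofReal_mul, hr]
          have e1 : ((w - c) ^ 2 + (k : ℂ) ^ 2 / 4).re =
              (w - c).re ^ 2 - (w - c).im ^ 2 + k ^ 2 / 4 := by
            have : ((k : ℂ) ^ 2 / 4) = ((k ^ 2 / 4 : ℝ) : ℂ) := by push_cast; ring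
            rw [this, Complex.add_re, Complex.ofReal_re, pow_two (w - c), Complex.mul_re]; ring
          rw [e1, hr]
          rw [hr] at hsq
          linarith
        · rw [Complex.im_ofReal_mul]
          have e1 : ((w - c) ^ 2 + (k : ℂ) ^ 2 / 4).im = 2 * (w - c).re * (w - c).im := by
            have : ((k : ℂ) ^ 2 / 4) = ((k ^ 2 / 4 : ℝ) : ℂ) := by push_cast; ring
            rw [this, Complex.add_im, Complex.ofReal_im, pow_two (w - c), Complex.mul_im]; ring
          rw [e1, hr]
      rw [key, norm_mul, hw, Complex.norm_real, Real.norm_eq_abs, abs_mul, abs_two]; ring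
    have h1 := hC w (lt_of_lt_of_le (by positivity) i1) (by linarith)
    rw [norm_mul, hfac]
    have h2 := mul_le_mul_of_nonneg_left h1 hz.le
    have h3 := mul_le_mul_of_nonneg_left i2 (mul_nonneg hz.le hC0)
    nlinarith
  have hzc : z - c = z.re := by
    apply Complex.ext <;> simp [hc, hkd]
  have hmem : z ∈ closure (Metric.ball c (k / 2)) := by
    rw [closure_ball _ (by positivity), mem_closedBall_iff_norm, hzc, Complex.norm_real,
      Real.norm_eq_abs]
    linarith
  have hmax := Complex.norm_le_of_forall_mem_frontier_norm_le Metric.isBounded_ball hd hfr hmem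
  rw [norm_mul, hzc] at hmax
  have hval : ‖(z.re : ℂ) ^ 2 + (k : ℂ) ^ 2 / 4‖ = z.re ^ 2 + k ^ 2 / 4 := by
    rw [show (z.re : ℂ) ^ 2 + (k : ℂ) ^ 2 / 4 = ((z.re ^ 2 + k ^ 2 / 4 : ℝ) : ℂ) by push_cast; ring,
      Complex.norm_real, Real.norm_of_nonneg (by positivity)]
  rw [hval] at hmax
  have hk2 : 0 < k ^ 2 / 4 := by positivity
  refine le_of_mul_le_mul_right (a := k ^ 2 / 4) ?_ hk2
  have := mul_nonneg (norm_nonneg (f z)) (sq_nonneg z.re)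
  nlinarith

/-- Integrals over the real line of boundary values of functions that are holomorphic in the upper
half-plane up to removable singularities. -/
theorem integral_boundary_eq_zero {f : ℂ → ℂ} {g : ℝ → ℂ}
    (hd : ∀ z₀ : ℂ, 0 < z₀.im → ∀ᶠ z in 𝓝[≠] z₀, DifferentiableAt ℂ f z)
    (ho : ∀ z₀ : ℂ, 0 < z₀.im → Tendsto (fun z => (z - z₀) * f z) (𝓝[≠] z₀) (𝓝 0))
    {C R : ℝ} (hfar : ∀ z : ℂ, 0 < z.im → R ≤ ‖z‖ → ‖f z‖ ≤ C / (1 + ‖z‖ ^ 2))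
    (hnear : ∀ R : ℝ, ∃ C : ℝ, ∀ z : ℂ, 0 < z.im → ‖z‖ ≤ R → |z.re| * ‖f z‖ ≤ C * ‖z‖)
    (hg : ∀ᵐ l : ℝ, (∀ᶠ ε : ℝ in 𝓝[>] 0, DifferentiableAt ℂ f (l + ε * Complex.I)) ∧
      Tendsto (fun ε : ℝ => f (l + ε * Complex.I)) (𝓝[>] 0) (𝓝 (g l))) :
    ∫ l, g l = 0 := by
  -- f with its removable singularities filled in. The estimates for f pass to h by taking limits
  -- through nearby points.
  set h : ℂ → ℂ := fun z => limUnder (𝓝[≠] z) f with hh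
  have hlim : ∀ z : ℂ, 0 < z.im → Tendsto f (𝓝[≠] z) (𝓝 (h z)) := fun z hz => by
    refine Complex.tendsto_limUnder_of_differentiable_on_punctured_nhds_of_isLittleO (hd z hz) ?_
    rw [Asymptotics.isLittleO_iff_tendsto' (by
      filter_upwards [self_mem_nhdsWithin] with w hw h0
      exact absurd (inv_eq_zero.1 h0) (sub_ne_zero.2 hw))]
    have t1 : Tendsto (fun w => (w - z) * f z) (𝓝[≠] z) (𝓝 0) := by
      have : Tendsto (fun w => (w - z) * f z) (𝓝 z) (𝓝 ((z - z) * f z)) :=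
        Continuous.tendsto (by fun_prop) z
      rw [sub_self, zero_mul] at this
      exact this.mono_left nhdsWithin_le_nhds
    have t2 := (ho z hz).sub t1
    rw [sub_zero] at t2
    refine t2.congr fun w => ?_
    rw [div_inv_eq_mul]; ring
  have heq : ∀ z : ℂ, DifferentiableAt ℂ f z → h z = f z := fun z hz =>
    (hz.continuousAt.tendsto.mono_left nhdsWithin_le_nhds).limUnder_eq
  have hdiff : DifferentiableOn ℂ h {z | 0 < z.im} := fun z hz => by
    have hev := hd z hz
    rw [eventually_nhdsWithin_iff] at hev
    have H : ContinuousAt (Function.update f z (h z)) z := continuousAt_update_same.2 (hlim z hz)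
    have H2 : DifferentiableAt ℂ (Function.update f z (h z)) z := by
      refine (Complex.analyticAt_of_differentiable_on_punctured_nhds_of_continuousAt ?_
        H).differentiableAt
      filter_upwards [hd z hz, self_mem_nhdsWithin] with w hw hwz
      refine hw.congr_of_eventuallyEq ?_
      filter_upwards [isOpen_ne.mem_nhds hwz] with v hv
      exact Function.update_of_ne hv _ _
    refine (H2.congr_of_eventuallyEq ?_).differentiableWithinAt
    filter_upwards [hev] with w hw
    rcases eq_or_ne w z with rfl | hne
    · simp
    · rw [Function.update_of_ne hne, heq w (hw hne)]
  have hupper : ∀ z : ℂ, 0 < z.im → ∀ᶠ w in 𝓝[≠] z, 0 < w.im := fun z hz =>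
    nhdsWithin_le_nhds (isOpen_lt continuous_const Complex.continuous_im |>.mem_nhds hz)
  have hfar' : ∀ z : ℂ, 0 < z.im → R < ‖z‖ → ‖h z‖ ≤ C / (1 + ‖z‖ ^ 2) := fun z hz hR => by
    have c1 : Tendsto (fun w : ℂ => C / (1 + ‖w‖ ^ 2)) (𝓝[≠] z) (𝓝 (C / (1 + ‖z‖ ^ 2))) := by
      refine Tendsto.mono_left (ContinuousAt.tendsto ?_) nhdsWithin_le_nhds
      have : (1 + ‖z‖ ^ 2) ≠ 0 := by positivity
      fun_prop (disch := assumption)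
    refine le_of_tendsto_of_tendsto (hlim z hz).norm c1 ?_
    have c2 : ∀ᶠ w in 𝓝[≠] z, R < ‖w‖ :=
      nhdsWithin_le_nhds ((isOpen_lt continuous_const continuous_norm).mem_nhds hR)
    filter_upwards [hupper z hz, c2] with w h1 h2
    exact hfar w h1 h2.le
  -- The radius exceeds the one needed by 1, so that punctured neighbourhoods of boundary points
  -- stay in range.
  obtain ⟨D, hD⟩ := hnear (2 * (|R| + 1) + 1)
  have hnear' : ∀ z : ℂ, 0 < z.im → ‖z‖ ≤ 2 * (|R| + 1) → |z.re| * ‖h z‖ ≤ D * ‖z‖ :=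
    fun z hz hR => by
      have c1 : Tendsto (fun w : ℂ => |w.re| * ‖f w‖) (𝓝[≠] z) (𝓝 (|z.re| * ‖h z‖)) :=
        (((Complex.continuous_re.abs).tendsto z).mono_left nhdsWithin_le_nhds).mul (hlim z hz).norm
      have c2 : Tendsto (fun w : ℂ => D * ‖w‖) (𝓝[≠] z) (𝓝 (D * ‖z‖)) :=
        ((continuous_norm.const_mul D).tendsto z).mono_left nhdsWithin_le_nhds
      refine le_of_tendsto_of_tendsto c1 c2 ?_
      have c3 : ∀ᶠ w in 𝓝[≠] z, ‖w‖ < 2 * (|R| + 1) + 1 :=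
        nhdsWithin_le_nhds ((isOpen_lt continuous_norm continuous_const).mem_nhds
          (show ‖z‖ < _ by linarith))
      filter_upwards [hupper z hz, c3] with w h1 h2
      exact hD w h1 h2.le
  -- One majorant for all heights: it annihilates the horizontal integrals and dominates the passage
  -- ε → 0.
  have hbd : ∀ z : ℂ, 0 < z.im →
      ‖h z‖ ≤ max C (8 * D * (1 + (|R| + 1) ^ 2)) / (1 + ‖z‖ ^ 2) := fun z hz => by
    rcases le_or_gt ‖z‖ (|R| + 1) with hR | hR
    · have := norm_le_of_abs_re_mul_le hdiff hnear' hz hR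
      rw [le_div_iff₀ (by positivity)]
      refine le_trans ?_ (le_max_right _ _)
      have h8 : 0 ≤ 8 * D := (norm_nonneg _).trans this
      gcongr
    · refine (hfar' z hz (lt_of_le_of_lt ((le_abs_self R).trans (by linarith)) hR)).trans ?_
      gcongr
      exact le_max_left _ _
  set M := max C (8 * D * (1 + (|R| + 1) ^ 2)) with hM
  have hM0 : 0 ≤ M := by
    have h1 := (norm_nonneg _).trans (hbd Complex.I (by simp))
    by_contra hneg
    have h2 : M / (1 + ‖Complex.I‖ ^ 2) < 0 :=
      div_neg_of_neg_of_pos (not_le.1 hneg) (by positivity)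
    linarith
  have hz0 : ∀ᶠ ε : ℝ in 𝓝[>] 0, ∫ l : ℝ, h (l + ε * Complex.I) = 0 := by
    filter_upwards [self_mem_nhdsWithin] with ε hε
    exact (integral_horizontal_eq_zero hdiff hbd hε).2
  have ht : Tendsto (fun ε : ℝ => ∫ l : ℝ, h (l + ε * Complex.I)) (𝓝[>] 0) (𝓝 (∫ l, g l)) := by
    refine tendsto_integral_filter_of_dominated_convergence (fun l => M * (1 + l ^ 2)⁻¹) ?_ ?_
      (integrable_inv_one_add_sq.const_mul M) ?_
    · filter_upwards [self_mem_nhdsWithin] with ε hε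
      exact (integral_horizontal_eq_zero hdiff hbd hε).1.1
    · filter_upwards [self_mem_nhdsWithin] with ε hε
      refine .of_forall fun l => (hbd _ (by simpa using hε)).trans ?_
      rw [← Complex.normSq_eq_norm_sq, Complex.normSq_add_mul_I, div_eq_mul_inv]
      gcongr
      nlinarith
    · filter_upwards [hg] with l hl
      refine hl.2.congr' ?_
      filter_upwards [hl.1] with ε hε
      exact (heq _ hε).symm
  exact tendsto_nhds_unique ht (tendsto_const_nhds.congr' (hz0.mono fun _ h => h.symm))

end

/-! ### The zeros of E on the imaginary axis -/

noncomputable section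

namespace SLProblem

variable {P : SLProblem} {e : ℝ → ℂ → ℂ} {K : ℝ → ℝ → ℂ}

lemma IsJostKernel.exists_bound_uniform (hP : P.Admissible) (he : P.IsJostSolution e)
    (hK : P.IsJostKernel e K) (R : ℝ) :
    ∃ C, 0 ≤ C ∧ ∀ z : ℂ, 0 ≤ z.im → ‖z‖ ≤ R → ∀ x, 0 ≤ x → ‖e x z‖ ≤ C := by
  obtain ⟨X, hX, hσ⟩ := hP.exists_tail_small
  have hX0 : 0 < X := hP.a_pos.trans_le hX
  obtain ⟨C, hC, h⟩ := hK.exists_bound_Icc hP he R hX0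
  refine ⟨max C 2, by positivity, fun z hz hR x hx => ?_⟩
  rcases le_total x X with hxX | hxX
  · exact (h z hz hR x ⟨hx, hxX⟩).trans (le_max_left _ _)
  · refine le_trans ?_ (le_max_right _ _)
    have h1 := he.norm_sq_lower hP hX hσ hz hxX
    have h2 := norm_le_norm_add_norm_sub' (e x z) (Complex.exp (Complex.I * z * (x : ℂ)))
    rw [norm_exp_I_mul] at h2
    have h3 : Real.exp (-(z.im * x)) ≤ 1 := by
      rw [Real.exp_le_one_iff]; have := mul_nonneg hz hx; linarith
    linarith

/-- Dominated convergence: the decay of e(·, w) suffices, and e(·, z) is needed only to be bounded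
uniformly for z near w. -/
lemma IsJostKernel.tendsto_integral (hP : P.Admissible) (he : P.IsJostSolution e)
    (hK : P.IsJostKernel e K) {w : ℂ} (hw : 0 < w.im) :
    Tendsto (fun z => ∫ x in Ioi 0, (P.ρ x : ℂ) * (e x z * e x w)) (𝓝 w)
      (𝓝 (∫ x in Ioi 0, (P.ρ x : ℂ) * (e x w * e x w))) := by
  obtain ⟨C, hC, hb⟩ := hK.exists_bound_uniform hP he (‖w‖ + 1)
  obtain ⟨D, hD⟩ := he.exists_decay hP hw.le
  have hup : ∀ᶠ z in 𝓝 w, 0 < z.im := isOpen_upper.mem_nhds hw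
  have hball : ∀ᶠ z in 𝓝 w, ‖z‖ < ‖w‖ + 1 :=
    (isOpen_lt continuous_norm continuous_const).mem_nhds (show ‖w‖ < _ by linarith)
  refine tendsto_integral_filter_of_dominated_convergence
    (fun x => max (P.α ^ 2) 1 * (C * (D * Real.exp (-(w.im * x))))) ?_ ?_
    (((integrableOn_exp_neg hw 0).const_mul D).const_mul C |>.const_mul _) ?_
  · filter_upwards [hup] with z hz
    exact (he.integrableOn_mul hP hz.le hw.le (by linarith)).1
  · filter_upwards [hup, hball] with z hz hzb
    refine (ae_restrict_iff' measurableSet_Ioi).2 (.of_forall fun x hx => ?_)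
    rw [norm_mul, norm_mul]
    have h1 := hb z hz.le hzb.le x (le_of_lt hx)
    have h2 := hD x (le_of_lt hx)
    gcongr
    exact norm_ρ_le x
  · refine (ae_restrict_iff' measurableSet_Ioi).2 (.of_forall fun x hx => ?_)
    have : ContinuousAt (e x) w :=
      ((hK.differentiableOn (le_of_lt hx)).differentiableAt (isOpen_upper.mem_nhds hw)).continuousAt
    exact (this.tendsto.mul_const _).const_mul _

/-- Zero Cauchy data force e = 0 on the half-line, against the positivity of its norm. -/
lemma IsJostSolution.ne_zero (hP : P.Admissible) (he : P.IsJostSolution e) {z : ℂ}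
    (hz : 0 < z.im) : ¬(e 0 z = 0 ∧ ed e 0 z = 0) := by
  rintro ⟨h1, h2⟩
  have h0 : P.nrm e z = 0 := by
    refine setIntegral_eq_zero_of_forall_eq_zero fun x hx => ?_
    have hx' : (0 : ℝ) < x := hx
    obtain ⟨c, c', σ, σ', hF⟩ := hP.exists_fundamental hx'
    have := (hF.eq_combination (he.sol hP hz.le) ⟨hx'.le, le_rfl⟩).1
    rw [h1, h2, zero_mul, zero_mul, add_zero] at this
    rw [this]; simp
  exact (he.nrm_pos hP hz).ne' h0

lemma bcβ_I_mul (P : SLProblem) (κ : ℝ) :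
    P.bcβ (Complex.I * κ) = ((P.β₀ - P.β₁ * κ - P.β₂ * κ ^ 2 : ℝ) : ℂ) := by
  rw [bcβ]; push_cast; linear_combination (P.β₁ * κ + P.β₂ * κ ^ 2) * Complex.I_sq

lemma bcα_I_mul (P : SLProblem) (κ : ℝ) :
    P.bcα (Complex.I * κ) = ((P.α₀ - P.α₁ * κ - P.α₂ * κ ^ 2 : ℝ) : ℂ) := by
  rw [bcα]; push_cast; linear_combination (P.α₁ * κ + P.α₂ * κ ^ 2) * Complex.I_sq

lemma neg_conj_I_mul (κ : ℝ) : -conj (Complex.I * κ) = Complex.I * κ := by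
  simp

lemma IsJostSolution.ofReal_re (hP : P.Admissible) (he : P.IsJostSolution e) {κ : ℝ}
    (hκ : 0 ≤ κ) {x : ℝ} (hx : 0 ≤ x) :
    ((e x (Complex.I * κ)).re : ℂ) = e x (Complex.I * κ) := by
  have h := (he.conj_eq hP (z := Complex.I * κ) (by simpa using hκ) hx).1
  rw [neg_conj_I_mul] at h
  exact Complex.conj_eq_iff_re.1 h

/-- The difference quotient of `E` at an eigenvalue. -/
lemma IsJostKernel.tendsto_E_div (hP : P.Admissible) (he : P.IsJostSolution e)
    (hK : P.IsJostKernel e K) {κ : ℝ} (hκ : κ ∈ P.eigenvalues e)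
    (hβ : P.β₀ - P.β₁ * κ - P.β₂ * κ ^ 2 ≠ 0) :
    e 0 (Complex.I * κ) ≠ 0 ∧
    Tendsto (fun z => P.E e z / (z - Complex.I * κ)) (𝓝[≠] (Complex.I * κ))
      (𝓝 (2 * Complex.I * κ * P.bcβ (Complex.I * κ) * P.normInvSq e κ / e 0 (Complex.I * κ))) := by
  obtain ⟨hκ0, hE⟩ := hκ
  have hre := he.ofReal_re hP hκ0.le le_rfl
  have hB := P.bcβ_I_mul κ
  have hA := P.bcα_I_mul κ
  set w := Complex.I * (κ : ℂ) with hw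
  have hwim : 0 < w.im := by simpa [hw] using hκ0
  have hBw : P.bcβ w ≠ 0 := by rw [hB]; exact_mod_cast hβ
  rw [E_eq] at hE
  have hed : ed e 0 w = -(P.bcα w / P.bcβ w) * e 0 w := by
    field_simp; linear_combination hE
  have hu : e 0 w ≠ 0 := fun h => he.ne_zero hP hwim ⟨h, by rw [hed, h, mul_zero]⟩
  refine ⟨hu, ?_⟩
  have hnrm : ∫ x in Ioi 0, (P.ρ x : ℂ) * (e x w * e x w) = P.nrm e w := by
    rw [he.nrm_eq hP hwim, hw, neg_conj_I_mul]
  have hint := hK.tendsto_integral hP he hwim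
  rw [hnrm] at hint
  set J : ℂ → ℂ := fun z => ∫ x in Ioi 0, (P.ρ x : ℂ) * (e x z * e x w) with hJ
  have hue : Tendsto (e 0) (𝓝 w) (𝓝 (e 0 w)) :=
    ((hK.differentiableOn le_rfl).differentiableAt (isOpen_upper.mem_nhds hwim)).continuousAt
  -- The divided difference of the boundary coefficients: A(z)B(w) - B(z)A(w) = (z - w) q(z). Its
  -- value at w yields the second term of m_k⁻².
  set q : ℂ → ℂ := fun z => (Complex.I * P.α₁ + P.α₂ * (z + w)) * P.bcβ w -
    (Complex.I * P.β₁ + P.β₂ * (z + w)) * P.bcα w with hq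
  have hlim : Tendsto (fun z => (P.bcβ z * (z + w) * J z + e 0 z * e 0 w * q z / P.bcβ w) / e 0 w)
      (𝓝[≠] w) (𝓝 ((P.bcβ w * (w + w) * P.nrm e w + e 0 w * e 0 w * q w / P.bcβ w) / e 0 w)) := by
    refine Tendsto.mono_left ?_ nhdsWithin_le_nhds
    have t1 : Tendsto (fun z => P.bcβ z * (z + w)) (𝓝 w) (𝓝 (P.bcβ w * (w + w))) :=
      Continuous.tendsto (P.differentiable_bcβ.continuous.mul (by fun_prop)) w
    have t2 : Tendsto q (𝓝 w) (𝓝 (q w)) := Continuous.tendsto (by fun_prop) w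
    exact ((t1.mul hint).add (((hue.mul_const _).mul t2).div_const _)).div_const _
  have hval : (P.bcβ w * (w + w) * P.nrm e w + e 0 w * e 0 w * q w / P.bcβ w) / e 0 w =
      2 * Complex.I * κ * P.bcβ w * P.normInvSq e κ / e 0 w := by
    congr 1
    have hsq : ((‖e 0 w‖ ^ 2 : ℝ) : ℂ) = e 0 w * e 0 w := by
      rw [← hre, Complex.norm_real, Real.norm_eq_abs, sq_abs]; push_cast; ring
    have hD : q w = -Complex.I * ((P.δ₁ + 2 * P.δ₂ * κ - P.δ₃ * κ ^ 2 : ℝ) : ℂ) := by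
      rw [hq]; beta_reduce
      rw [hA, hB, hw, δ₁, δ₂, δ₃]; push_cast; ring
    have hκc : (κ : ℂ) ≠ 0 := by exact_mod_cast hκ0.ne'
    have hM : (P.normInvSq e κ : ℂ) = P.nrm e w - e 0 w * e 0 w *
        ((P.δ₁ + 2 * P.δ₂ * κ - P.δ₃ * κ ^ 2 : ℝ) : ℂ) / (2 * κ * P.bcβ w ^ 2) := by
      rw [← hsq, hB, normInvSq, nrm]; push_cast; rfl
    rw [hM, hD]
    set D : ℂ := ((P.δ₁ + 2 * P.δ₂ * κ - P.δ₃ * κ ^ 2 : ℝ) : ℂ)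
    rw [hw] at hBw ⊢
    field_simp
    ring
  rw [hval] at hlim
  refine hlim.congr' ?_
  filter_upwards [self_mem_nhdsWithin, nhdsWithin_le_nhds (isOpen_upper.mem_nhds hwim)] with z hz hzu
  have hzw : z - w ≠ 0 := sub_ne_zero.2 hz
  have hzu' : 0 < z.im := hzu
  have hW : ed e 0 z * e 0 w - e 0 z * ed e 0 w = (z ^ 2 - w ^ 2) * J z :=
    he.wronskian_eq hP hzu'.le hwim.le (by linarith)
  rw [hed] at hW
  have hqz : P.bcα z * P.bcβ w - P.bcβ z * P.bcα w = (z - w) * q z := by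
    rw [hq]; beta_reduce; simp only [bcα, bcβ]; ring
  rw [E_eq, div_eq_div_iff hu hzw]
  -- Lagrange's identity and the eigenvalue condition at w exhibit the factor z - w of E(z).
  have h1 : (P.bcβ z * ed e 0 z + P.bcα z * e 0 z) * e 0 w = P.bcβ z * ((z ^ 2 - w ^ 2) * J z) +
      e 0 z * e 0 w * ((z - w) * q z) / P.bcβ w := by
    rw [← hW, ← hqz]; field_simp; ring
  rw [h1]; ring

/-- If all coefficients vanished, E would be identically 0, so 1 would be an eigenvalue at which B
vanishes. -/
lemma coeff_ne_zero (hβ : ∀ κ ∈ P.eigenvalues e, P.β₀ - P.β₁ * κ - P.β₂ * κ ^ 2 ≠ 0) :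
    ¬(P.α₀ = 0 ∧ P.α₁ = 0 ∧ P.α₂ = 0 ∧ P.β₀ = 0 ∧ P.β₁ = 0 ∧ P.β₂ = 0) := by
  rintro ⟨a0, a1, a2, b0, b1, b2⟩
  refine hβ 1 ⟨one_pos, ?_⟩ (by simp [b0, b1, b2])
  simp [E, bcα, bcβ, a0, a1, a2, b0, b1, b2]

/-- The zeros of `E` in the upper half-plane are isolated. -/
lemma IsJostKernel.eventually_E_ne_zero (hP : P.Admissible) (he : P.IsJostSolution e)
    (hK : P.IsJostKernel e K) {d : ℕ} {p : ℂ} {r : ℝ} (hL : P.IsLeading d p r) {z₀ : ℂ}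
    (hz₀ : 0 < z₀.im) : ∀ᶠ z in 𝓝[≠] z₀, P.E e z ≠ 0 := by
  have han : AnalyticOnNhd ℂ (P.E e) {z | 0 < z.im} :=
    (hK.differentiableOn_E hP he).analyticOnNhd isOpen_upper
  refine (han z₀ hz₀).eventually_eq_zero_or_eventually_ne_zero.resolve_left fun h0 => ?_
  obtain ⟨c, R, hc, hR, hl⟩ := hL.exists_lower hP he
  have hpre : IsPreconnected {z : ℂ | 0 < z.im} := (convex_halfSpace_im_gt 0).isPreconnected
  have hz := han.eqOn_zero_of_preconnected_of_eventuallyEq_zero hpre hz₀ h0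
  have hRI : (0 : ℝ) < R := by linarith
  have h1 := hz (show (Complex.I * R) ∈ {z : ℂ | 0 < z.im} by simpa using hRI)
  have h2 := hl (Complex.I * R) (by simpa using hRI.le) (by simp [abs_of_pos hRI])
  rw [h1] at h2
  have hn : 0 < ‖Complex.I * (R : ℂ)‖ := by simp [hRI.ne']
  have : 0 < c * ‖Complex.I * (R : ℂ)‖ ^ d * Real.exp (-((Complex.I * (R : ℂ)).im * P.μp 0)) := by
    positivity
  simp only [Pi.zero_apply, norm_zero] at h2
  linarith

/-- Orthogonality relation between two eigenvalues. -/
lemma IsJostSolution.eigen_relation (hP : P.Admissible) (he : P.IsJostSolution e)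
    (hβ : ∀ κ ∈ P.eigenvalues e, P.β₀ - P.β₁ * κ - P.β₂ * κ ^ 2 ≠ 0) {κ κ' : ℝ}
    (hκ : κ ∈ P.eigenvalues e) (hκ' : κ' ∈ P.eigenvalues e) (hne : κ ≠ κ') :
    (κ + κ') * ∫ x in Ioi 0, P.ρ x * ((e x (Complex.I * κ)).re * (e x (Complex.I * κ')).re) =
      ((e 0 (Complex.I * κ)).re / (P.β₀ - P.β₁ * κ - P.β₂ * κ ^ 2)) *
      ((e 0 (Complex.I * κ')).re / (P.β₀ - P.β₁ * κ' - P.β₂ * κ' ^ 2)) *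
        (P.δ₁ + P.δ₂ * (κ + κ') - P.δ₃ * κ * κ') := by
  have hb := hβ κ hκ
  have hb' := hβ κ' hκ'
  obtain ⟨h0, hE⟩ := hκ
  obtain ⟨h0', hE'⟩ := hκ'
  rw [E_eq, bcβ_I_mul, bcα_I_mul] at hE hE'
  have hW := he.wronskian_eq hP (z := Complex.I * κ) (w := Complex.I * κ') (by simpa using h0.le)
    (by simpa using h0'.le) (by simpa using by linarith)
  have hint : ∫ x in Ioi 0, (P.ρ x : ℂ) * (e x (Complex.I * κ) * e x (Complex.I * κ')) =
      ((∫ x in Ioi 0, P.ρ x * ((e x (Complex.I * κ)).re * (e x (Complex.I * κ')).re) : ℝ) : ℂ) := by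
    rw [← integral_complex_ofReal]
    refine setIntegral_congr_fun measurableSet_Ioi fun x hx => ?_
    rw [← he.ofReal_re hP h0.le (le_of_lt hx), ← he.ofReal_re hP h0'.le (le_of_lt hx)]
    push_cast; simp
  rw [hint] at hW
  set J := ∫ x in Ioi 0, P.ρ x * ((e x (Complex.I * κ)).re * (e x (Complex.I * κ')).re)
  have hr := he.ofReal_re hP h0.le le_rfl
  have hr' := he.ofReal_re hP h0'.le le_rfl
  rw [← hr] at hE hW
  rw [← hr'] at hE' hW
  set u := (e 0 (Complex.I * κ)).re
  set u' := (e 0 (Complex.I * κ')).re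
  set v := ed e 0 (Complex.I * κ)
  set v' := ed e 0 (Complex.I * κ')
  set b := P.β₀ - P.β₁ * κ - P.β₂ * κ ^ 2 with hbd
  set b' := P.β₀ - P.β₁ * κ' - P.β₂ * κ' ^ 2 with hbd'
  have hsub : κ' - κ ≠ 0 := sub_ne_zero.2 hne.symm
  have key : (((κ' - κ) * (b * b' * ((κ + κ') * J)) : ℝ) : ℂ) =
      (((κ' - κ) * (u * u' * (P.δ₁ + P.δ₂ * (κ + κ') - P.δ₃ * κ * κ')) : ℝ) : ℂ) := by
    have hpoly : b * (P.α₀ - P.α₁ * κ' - P.α₂ * κ' ^ 2) - b' * (P.α₀ - P.α₁ * κ - P.α₂ * κ ^ 2) =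
        (κ' - κ) * (P.δ₁ + P.δ₂ * (κ + κ') - P.δ₃ * κ * κ') := by
      rw [hbd, hbd', δ₁, δ₂, δ₃]; ring
    have hpc := congrArg (fun t : ℝ => (t : ℂ)) hpoly
    push_cast at hpc
    push_cast
    have hI : (Complex.I * (κ : ℂ)) ^ 2 - (Complex.I * (κ' : ℂ)) ^ 2 =
        (κ' - κ) * (κ + κ') := by
      linear_combination ((κ : ℂ) ^ 2 - κ' ^ 2) * Complex.I_sq
    rw [hI] at hW
    push_cast at hE hE'
    linear_combination (-(b : ℂ) * b') * hW + (b' : ℂ) * u' * hE - (b : ℂ) * u * hE' +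
      (u : ℂ) * u' * hpc
  have key2 : b * b' * ((κ + κ') * J) = u * u' * (P.δ₁ + P.δ₂ * (κ + κ') - P.δ₃ * κ * κ') :=
    mul_left_cancel₀ hsub (by exact_mod_cast key)
  field_simp
  linarith

/-- With s = κ + κ', the part over [X, ∞) is at least (4/9) exp(-sX)/s, which tends to infinity as s
→ 0, while the part over [0, X] is bounded uniformly in κ and κ'. -/
lemma IsJostKernel.exists_overlap_pos (hP : P.Admissible) (he : P.IsJostSolution e)
    (hK : P.IsJostKernel e K) : ∃ η : ℝ, 0 < η ∧ ∀ κ κ' : ℝ, 0 < κ → κ < η → 0 < κ' → κ' < η →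
      0 < ∫ x in Ioi 0, P.ρ x * ((e x (Complex.I * κ)).re * (e x (Complex.I * κ')).re) := by
  obtain ⟨X, hX, hσ⟩ := hP.exists_tail_small
  have hX0 : 0 < X := hP.a_pos.trans_le hX
  obtain ⟨C, hC, hb⟩ := hK.exists_bound_uniform hP he 1
  set m := max (P.α ^ 2) 1 with hm
  have hm1 : 1 ≤ m := le_max_right _ _
  have hlim : Tendsto (fun s : ℝ => 4 / 9 * Real.exp (-(s * X)) - s * (m * C ^ 2 * X)) (𝓝 0)
      (𝓝 (4 / 9 * Real.exp (-(0 * X)) - 0 * (m * C ^ 2 * X))) := Continuous.tendsto (by fun_prop) 0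
  have hev := hlim.eventually (lt_mem_nhds (show (0 : ℝ) < _ by simp))
  obtain ⟨η, hη, hball⟩ := Metric.eventually_nhds_iff.1 hev
  refine ⟨min (η / 2) 1, by positivity, fun κ κ' h0 h1 h0' h1' => ?_⟩
  have k1 := h1.trans_le (min_le_left _ _)
  have k2 := h1.trans_le (min_le_right _ _)
  have k1' := h1'.trans_le (min_le_left _ _)
  have k2' := h1'.trans_le (min_le_right _ _)
  have hpos := hball (y := κ + κ') (by
    rw [Real.dist_eq, sub_zero, abs_of_pos (by linarith)]; linarith)
  set s := κ + κ' with hs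
  have hs0 : 0 < s := by linarith
  set f : ℝ → ℝ := fun x => P.ρ x * ((e x (Complex.I * κ)).re * (e x (Complex.I * κ')).re) with hf
  have hfi : IntegrableOn f (Ioi 0) := by
    have h := he.integrableOn_mul hP (z := Complex.I * κ) (w := Complex.I * κ')
      (by simpa using h0.le) (by simpa using h0'.le) (by simpa using hs0)
    have h2 : IntegrableOn (fun x => ((f x : ℝ) : ℂ)) (Ioi 0) := h.congr_fun (fun x hx => by
      beta_reduce
      rw [← he.ofReal_re hP h0.le (le_of_lt hx), ← he.ofReal_re hP h0'.le (le_of_lt hx), hf]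
      push_cast; simp) measurableSet_Ioi
    exact h2.re.congr (.of_forall fun x => RCLike.ofReal_re _)
  have hsplit : ∫ x in Ioi 0, f x = (∫ x in (0 : ℝ)..X, f x) + ∫ x in Ioi X, f x :=
    (intervalIntegral.integral_interval_add_Ioi hfi (hfi.mono_set (Ioi_subset_Ioi hX0.le))).symm
  have hA : -(m * C ^ 2 * X) ≤ ∫ x in (0 : ℝ)..X, f x := by
    have : ‖∫ x in (0 : ℝ)..X, f x‖ ≤ m * C ^ 2 * |X - 0| := by
      refine intervalIntegral.norm_integral_le_of_norm_le_const fun x hx => ?_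
      rw [uIoc_of_le hX0.le] at hx
      have c1 : |(e x (Complex.I * κ)).re| ≤ C := (Complex.abs_re_le_norm _).trans
        (hb _ (by simpa using h0.le) (by simp [abs_of_pos h0, k2.le]) x hx.1.le)
      have c2 : |(e x (Complex.I * κ')).re| ≤ C := (Complex.abs_re_le_norm _).trans
        (hb _ (by simpa using h0'.le) (by simp [abs_of_pos h0', k2'.le]) x hx.1.le)
      have c3 := norm_ρ_le (P := P) x
      rw [Complex.norm_real] at c3
      rw [hf, pow_two]
      simp only [norm_mul, Real.norm_eq_abs] at c3 ⊢
      gcongr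
    rw [sub_zero, abs_of_pos hX0, Real.norm_eq_abs] at this
    linarith [neg_abs_le (∫ x in (0 : ℝ)..X, f x)]
  have hre : ∀ k x : ℝ, 0 < k → X ≤ x →
      2 / 3 * Real.exp (-(k * x)) ≤ (e x (Complex.I * k)).re := fun k x hk hx => by
    have h := he.norm_sq_lower hP hX hσ (z := Complex.I * k) (by simpa using hk.le) hx
    have h2 := (Complex.abs_re_le_norm _).trans h
    have h3 : Complex.exp (Complex.I * (Complex.I * k) * (x : ℂ)) =
        ((Real.exp (-(k * x)) : ℝ) : ℂ) := by
      rw [← mul_assoc, Complex.I_mul_I]; push_cast; congr 1; ring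
    rw [h3, Complex.sub_re, Complex.ofReal_re] at h2
    have h4 : (Complex.I * (k : ℂ)).im = k := by simp
    rw [h4] at h2
    linarith [(abs_le.1 h2).1]
  have hB : 4 / 9 * (Real.exp (-(s * X)) / s) ≤ ∫ x in Ioi X, f x := by
    rw [← integral_exp_neg hs0, ← integral_const_mul]
    refine setIntegral_mono_on ((integrableOn_exp_neg hs0 X).const_mul _)
      (hfi.mono_set (Ioi_subset_Ioi hX0.le)) measurableSet_Ioi fun x hx => ?_
    have hx' : X ≤ x := le_of_lt hx
    have g1 := hre κ x h0 hx'
    have g2 := hre κ' x h0' hx'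
    rw [hf]; beta_reduce
    rw [ρ_of_ge (hX.trans hx'), one_mul]
    calc 4 / 9 * Real.exp (-(s * x)) =
        (2 / 3 * Real.exp (-(κ * x))) * (2 / 3 * Real.exp (-(κ' * x))) := by
          rw [mul_mul_mul_comm, ← Real.exp_add, hs]; norm_num; ring_nf
      _ ≤ _ := by
        have := le_trans (by positivity) g1
        gcongr
  rw [hsplit]
  have hfin : 0 < 4 / 9 * (Real.exp (-(s * X)) / s) - m * C ^ 2 * X := by
    have : 4 / 9 * (Real.exp (-(s * X)) / s) - m * C ^ 2 * X =
      (4 / 9 * Real.exp (-(s * X)) - s * (m * C ^ 2 * X)) / s := by field_simp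
    rw [this]; exact div_pos hpos hs0
  linarith

/-- The lower bound for E at infinity bounds the eigenvalues, and isolation of zeros excludes
accumulation at positive numbers. Accumulation at 0 is excluded by `eigen_relation` together with
`exists_overlap_pos`. -/
theorem IsJostKernel.finite_eigenvalues (hP : P.Admissible) (he : P.IsJostSolution e)
    (hK : P.IsJostKernel e K)
    (hβ : ∀ κ ∈ P.eigenvalues e, P.β₀ - P.β₁ * κ - P.β₂ * κ ^ 2 ≠ 0) :
    (P.eigenvalues e).Finite := by
  obtain ⟨d, p, r, hL⟩ := hP.exists_leading (coeff_ne_zero hβ)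
  obtain ⟨c, R, hc, hR, hl⟩ := hL.exists_lower hP he
  obtain ⟨η, hη, hpos⟩ := hK.exists_overlap_pos hP he
  have hbd : ∀ κ ∈ P.eigenvalues e, κ < R := fun κ hκ => by
    by_contra! hge
    have h2 := hl (Complex.I * κ) (by simpa using hκ.1.le) (by simpa [abs_of_pos hκ.1] using hge)
    rw [hκ.2, norm_zero] at h2
    have hn : 0 < ‖Complex.I * (κ : ℂ)‖ := by simp [hκ.1.ne']
    have : 0 < c * ‖Complex.I * (κ : ℂ)‖ ^ d * Real.exp (-((Complex.I * (κ : ℂ)).im * P.μp 0)) := by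
      positivity
    linarith
  have hsmall : (P.eigenvalues e ∩ Iio η).Finite := by
    set v : ℝ → ℝ := fun κ => (e 0 (Complex.I * κ)).re / (P.β₀ - P.β₁ * κ - P.β₂ * κ ^ 2) with hv
    -- If v had the same sign at two small eigenvalues, `eigen_relation` would equate a positive
    -- number with a nonpositive one. Hence the sign of v separates small eigenvalues, and there are
    -- at most two.
    have hinj : InjOn (fun κ => 0 ≤ v κ) (P.eigenvalues e ∩ Iio η) := fun κ hκ κ' hκ' heq => by
      by_contra hne
      have hrel := he.eigen_relation hP hβ hκ.1 hκ'.1 hne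
      have h1 := hpos κ κ' hκ.1.1 hκ.2 hκ'.1.1 hκ'.2
      have h2 : 0 ≤ v κ * v κ' := by
        have heq' : 0 ≤ v κ ↔ 0 ≤ v κ' := iff_of_eq heq
        by_cases h : 0 ≤ v κ
        · exact mul_nonneg h (heq'.1 h)
        · have h' : ¬ 0 ≤ v κ' := fun h' => h (heq'.2 h')
          exact mul_nonneg_of_nonpos_of_nonpos (not_le.1 h).le (not_le.1 h').le
      have h3 : P.δ₁ + P.δ₂ * (κ + κ') - P.δ₃ * κ * κ' ≤ 0 := by
        have := mul_nonneg (neg_nonneg.2 hP.δ₂_nonpos) (add_pos hκ.1.1 hκ'.1.1).le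
        have := mul_nonneg (mul_nonneg hP.δ₃_nonneg hκ.1.1.le) hκ'.1.1.le
        have := hP.δ₁_nonpos
        linarith
      have h4 := mul_nonpos_of_nonneg_of_nonpos h2 h3
      have h5 := mul_pos (add_pos hκ.1.1 hκ'.1.1) h1
      rw [hrel] at h5
      exact absurd h4 (not_le.2 h5)
    exact (Set.toFinite _).of_finite_image hinj
  have hlarge : (P.eigenvalues e ∩ Ici η).Finite := by
    by_contra hinf
    obtain ⟨κ, hκI, hacc⟩ := Set.Infinite.exists_accPt_of_subset_isCompact hinf
      (isCompact_Icc (a := η) (b := R)) fun κ hκ => ⟨hκ.2, (hbd κ hκ.1).le⟩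
    have hκ0 : 0 < κ := hη.trans_le hκI.1
    have hfr : ∃ᶠ t in 𝓝[≠] κ, t ∈ P.eigenvalues e :=
      (accPt_iff_frequently_nhdsNE.1 hacc).mono fun t ht => ht.1
    have hiso := hK.eventually_E_ne_zero hP he hL (z₀ := Complex.I * κ) (by simpa using hκ0)
    have ht : Tendsto (fun t : ℝ => Complex.I * (t : ℂ)) (𝓝[≠] κ) (𝓝[≠] (Complex.I * κ)) := by
      refine tendsto_nhdsWithin_iff.2 ⟨(Continuous.tendsto (by fun_prop) κ).mono_left
        nhdsWithin_le_nhds, ?_⟩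
      filter_upwards [self_mem_nhdsWithin] with t ht h
      have h1 : (t : ℂ) = κ := mul_left_cancel₀ Complex.I_ne_zero h
      exact ht (by exact_mod_cast h1)
    obtain ⟨t, ht1, ht2⟩ := (hfr.and_eventually (ht.eventually hiso)).exists
    exact ht2 ht1.2
  refine (hsmall.union hlarge).subset fun κ hκ => ?_
  rcases lt_or_ge κ η with h | h
  · exact Or.inl ⟨hκ, h⟩
  · exact Or.inr ⟨hκ, h⟩

end SLProblem

end

/-! ### Transforms of test functions, growth conditions and a model pole -/

noncomputable section

/-- The Fourier–Laplace transform of a test function. -/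
def lap (ψ : ℝ → ℂ) (z : ℂ) : ℂ := ∫ y : ℝ, ψ y * Complex.exp (Complex.I * z * (y : ℂ))

/-- Smooth functions with compact support in `(c, ∞)`. -/
structure IsTest (c : ℝ) (ψ : ℝ → ℂ) : Prop where
  smooth : ContDiff ℝ ∞ ψ
  compact : HasCompactSupport ψ
  supp : tsupport ψ ⊆ Ioi c

namespace IsTest

variable {c : ℝ} {ψ : ℝ → ℂ}

lemma deriv (h : IsTest c ψ) : IsTest c (deriv ψ) :=
  ⟨(contDiff_infty_iff_deriv.1 h.smooth).2, h.compact.deriv, tsupport_deriv_subset.trans h.supp⟩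

lemma integrable (h : IsTest c ψ) : Integrable ψ :=
  h.smooth.continuous.integrable_of_hasCompactSupport h.compact

lemma eq_zero (h : IsTest c ψ) {y : ℝ} (hy : y ≤ c) : ψ y = 0 := by
  by_contra h0
  exact absurd (h.supp (subset_tsupport _ h0)) (not_lt.2 hy)

lemma lap_eq (h : IsTest c ψ) (z : ℂ) :
    lap ψ z = ∫ y in Ioi c, ψ y * Complex.exp (Complex.I * z * (y : ℂ)) := by
  rw [lap, ← integral_indicator measurableSet_Ioi]
  congr 1; ext y
  by_cases hy : y ∈ Ioi c
  · rw [indicator_of_mem hy]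
  · rw [indicator_of_notMem hy, h.eq_zero (not_lt.1 hy), zero_mul]

lemma continuousOn_lap (h : IsTest c ψ) : ContinuousOn (lap ψ) {z | 0 ≤ z.im} :=
  (continuousOn_laplace h.integrable.integrableOn).congr fun z _ => h.lap_eq z

lemma differentiableOn_lap (h : IsTest c ψ) : DifferentiableOn ℂ (lap ψ) {z | 0 < z.im} :=
  (differentiableOn_laplace h.integrable.integrableOn).congr fun z _ => h.lap_eq z

lemma norm_lap_le (h : IsTest c ψ) {z : ℂ} (hz : 0 ≤ z.im) :
    ‖lap ψ z‖ ≤ (∫ y in Ioi c, ‖ψ y‖) * Real.exp (-(z.im * c)) := by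
  rw [h.lap_eq]; exact norm_laplace_le h.integrable.integrableOn hz

lemma lap_deriv (h : IsTest c ψ) (z : ℂ) : lap (_root_.deriv ψ) z = -(Complex.I * z * lap ψ z) := by
  have hint : ∀ φ : ℝ → ℂ, IsTest c φ →
      Integrable fun y : ℝ => φ y * Complex.exp (Complex.I * z * (y : ℂ)) := fun φ hφ =>
    (hφ.smooth.continuous.mul (by fun_prop)).integrable_of_hasCompactSupport hφ.compact.mul_right
  have hv : ∀ y : ℝ, HasDerivAt (fun y : ℝ => Complex.exp (Complex.I * z * (y : ℂ)))
      (Complex.exp (Complex.I * z * (y : ℂ)) * (Complex.I * z)) y := fun y => by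
    have h1 : HasDerivAt (fun y : ℝ => Complex.I * z * (y : ℂ)) (Complex.I * z * 1) y :=
      (Complex.ofRealCLM.hasDerivAt (x := y)).const_mul (Complex.I * z)
    rw [mul_one] at h1
    exact h1.cexp
  have hu : ∀ y : ℝ, HasDerivAt ψ (_root_.deriv ψ y) y := fun y =>
    ((h.smooth.differentiable (by simp)) y).hasDerivAt
  have i1 := hint ψ h
  have := integral_mul_deriv_eq_deriv_mul_of_integrable (fun y _ => hu y) (fun y _ => hv y)
    ((i1.mul_const (Complex.I * z)).congr (.of_forall fun y => by simp; ring)) (hint _ h.deriv) i1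
  rw [lap, lap, ← integral_const_mul, ← neg_eq_iff_eq_neg, ← this]
  congr 1; ext y; ring

/-- Two integrations by parts: the constant is the sum of the L¹ norms of ψ and ψ''. -/
lemma exists_lap_bound (h : IsTest c ψ) : ∃ C : ℝ, 0 ≤ C ∧ ∀ z : ℂ, 0 ≤ z.im →
    ‖lap ψ z‖ ≤ C * Real.exp (-(z.im * c)) / (1 + ‖z‖ ^ 2) := by
  refine ⟨(∫ y in Ioi c, ‖ψ y‖) + ∫ y in Ioi c, ‖_root_.deriv (_root_.deriv ψ) y‖,
    add_nonneg (integral_nonneg fun _ => norm_nonneg _) (integral_nonneg fun _ => norm_nonneg _),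
    fun z hz => ?_⟩
  rw [le_div_iff₀ (by positivity)]
  have h1 := h.norm_lap_le hz
  have h2 := h.deriv.deriv.norm_lap_le hz
  rw [h.deriv.lap_deriv, h.lap_deriv, norm_neg, norm_mul, norm_neg, norm_mul, norm_mul,
    norm_mul, Complex.norm_I, one_mul] at h2
  nlinarith

lemma exists_lap_bound_real (h : IsTest c ψ) : ∃ C : ℝ, 0 ≤ C ∧ ∀ l : ℝ,
    ‖lap ψ l‖ ≤ C * (1 + l ^ 2)⁻¹ := by
  obtain ⟨C, hC, hb⟩ := h.exists_lap_bound
  refine ⟨C, hC, fun l => ?_⟩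
  have := hb l (by simp)
  simpa [div_eq_mul_inv] using this

lemma continuous_lap_real (h : IsTest c ψ) : Continuous fun l : ℝ => lap ψ l :=
  h.continuousOn_lap.comp_continuous (by fun_prop) (by simp)

lemma integrable_mul_lap (h : IsTest c ψ) {g : ℝ → ℂ} (hg : AEStronglyMeasurable g) {C : ℝ}
    (hC : ∀ l, ‖g l‖ ≤ C) : Integrable fun l : ℝ => g l * lap ψ l := by
  obtain ⟨D, hD, hb⟩ := h.exists_lap_bound_real
  have : Integrable fun l : ℝ => lap ψ l := Integrable.mono' (integrable_inv_one_add_sq.const_mul D)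
    h.continuous_lap_real.aestronglyMeasurable (.of_forall hb)
  exact this.bdd_mul hg (.of_forall hC)

/-- Boundary values of functions of exponential type in the upper half-plane have no Fourier
transform on a half-line. -/
lemma integral_mul_lap_eq_zero (h : IsTest c ψ) {F : ℂ → ℂ}
    (hF : DifferentiableOn ℂ F {z | 0 < z.im}) (hF' : ContinuousOn F {z | 0 ≤ z.im}) {C : ℝ}
    (hC : ∀ z : ℂ, 0 < z.im → ‖F z‖ ≤ C * Real.exp (z.im * c)) :
    ∫ l : ℝ, F l * lap ψ l = 0 := by
  obtain ⟨D, hD, hb⟩ := h.exists_lap_bound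
  have hbd : ∀ z : ℂ, 0 < z.im → ‖F z * lap ψ z‖ ≤ C * D / (1 + ‖z‖ ^ 2) := fun z hz => by
    rw [norm_mul]
    have h1 := hC z hz
    have h2 := hb z hz.le
    refine (mul_le_mul h1 h2 (norm_nonneg _) ((norm_nonneg _).trans h1)).trans (le_of_eq ?_)
    have : Real.exp (z.im * c) * Real.exp (-(z.im * c)) = 1 := by rw [← Real.exp_add]; simp
    rw [← mul_div_assoc]
    congr 1
    linear_combination (C * D) * this
  have hd : ∀ z : ℂ, 0 < z.im → DifferentiableAt ℂ (fun z => F z * lap ψ z) z := fun z hz =>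
    (hF.mul h.differentiableOn_lap).differentiableAt (SLProblem.isOpen_upper.mem_nhds hz)
  refine integral_boundary_eq_zero (f := fun z => F z * lap ψ z)
    (fun z hz => nhdsWithin_le_nhds ?_) (fun z hz => ?_) (C := C * D) (R := 0)
    (fun z hz _ => hbd z hz) (fun R => ⟨|C * D|, fun z hz _ => ?_⟩) (.of_forall fun l => ⟨?_, ?_⟩)
  · filter_upwards [SLProblem.isOpen_upper.mem_nhds hz] with w hw using hd w hw
  · have : Tendsto (fun w => (w - z) * (F w * lap ψ w)) (𝓝 z) (𝓝 ((z - z) * (F z * lap ψ z))) :=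
      ((continuous_id.sub continuous_const).tendsto z).mul (hd z hz).continuousAt
    rw [sub_self, zero_mul] at this
    exact this.mono_left nhdsWithin_le_nhds
  · have h1 : ‖F z * lap ψ z‖ ≤ |C * D| := (hbd z hz).trans (div_le_of_le_mul₀ (by positivity)
      (abs_nonneg _) ((le_abs_self _).trans (le_mul_of_one_le_right (abs_nonneg _)
        (by nlinarith [sq_nonneg ‖z‖]))))
    rw [mul_comm]
    exact mul_le_mul h1 (Complex.abs_re_le_norm z) (abs_nonneg _) (abs_nonneg _)
  · filter_upwards [self_mem_nhdsWithin] with ε hε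
    exact hd _ (by simpa using hε)
  · have hc := (hF'.mul h.continuousOn_lap) l (by simp)
    refine hc.tendsto.comp (tendsto_nhdsWithin_iff.2 ⟨?_, ?_⟩)
    · have : Tendsto (fun ε : ℝ => (l : ℂ) + ε * Complex.I) (𝓝 0) (𝓝 (l + (0 : ℝ) * Complex.I)) :=
        Continuous.tendsto (by fun_prop) 0
      simp only [Complex.ofReal_zero, zero_mul, add_zero] at this
      exact this.mono_left nhdsWithin_le_nhds
    · filter_upwards [self_mem_nhdsWithin] with ε hε
      have : (0 : ℝ) < ε := hε
      simpa using this.le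

end IsTest

/-- The growth conditions in `integral_boundary_eq_zero`. -/
def HardyBound (f : ℂ → ℂ) : Prop :=
  (∃ C R : ℝ, ∀ z : ℂ, 0 < z.im → R ≤ ‖z‖ → ‖f z‖ ≤ C / (1 + ‖z‖ ^ 2)) ∧
  ∀ R : ℝ, ∃ C : ℝ, ∀ z : ℂ, 0 < z.im → ‖z‖ ≤ R → |z.re| * ‖f z‖ ≤ C * ‖z‖

namespace HardyBound

lemma zero : HardyBound fun _ => 0 :=
  ⟨⟨0, 0, fun z _ _ => by simp⟩, fun R => ⟨0, fun z _ _ => by simp⟩⟩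

lemma add {f g : ℂ → ℂ} (hf : HardyBound f) (hg : HardyBound g) :
    HardyBound fun z => f z + g z := by
  obtain ⟨⟨C, R, h1⟩, h2⟩ := hf
  obtain ⟨⟨D, S, k1⟩, k2⟩ := hg
  refine ⟨⟨C + D, max R S, fun z hz hR => ?_⟩, fun T => ?_⟩
  · rw [add_div]
    exact (norm_add_le _ _).trans (add_le_add (h1 z hz ((le_max_left _ _).trans hR))
      (k1 z hz ((le_max_right _ _).trans hR)))
  · obtain ⟨A, hA⟩ := h2 T
    obtain ⟨B, hB⟩ := k2 T
    refine ⟨A + B, fun z hz hT => ?_⟩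
    have := mul_le_mul_of_nonneg_left (norm_add_le (f z) (g z)) (abs_nonneg z.re)
    linarith [hA z hz hT, hB z hz hT]

lemma const_mul {f : ℂ → ℂ} (hf : HardyBound f) (a : ℂ) : HardyBound fun z => a * f z := by
  obtain ⟨⟨C, R, h1⟩, h2⟩ := hf
  refine ⟨⟨‖a‖ * C, R, fun z hz hR => ?_⟩, fun T => ?_⟩
  · rw [norm_mul, mul_div_assoc]
    exact mul_le_mul_of_nonneg_left (h1 z hz hR) (norm_nonneg _)
  · obtain ⟨A, hA⟩ := h2 T
    refine ⟨‖a‖ * A, fun z hz hT => ?_⟩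
    have := mul_le_mul_of_nonneg_left (hA z hz hT) (norm_nonneg a)
    rw [norm_mul]
    linarith

lemma sum {ι : Type*} {f : ι → ℂ → ℂ} (s : Finset ι) (h : ∀ i ∈ s, HardyBound (f i)) :
    HardyBound fun z => ∑ i ∈ s, f i z := by
  classical
  induction s using Finset.induction_on with
  | empty => simpa using zero
  | insert i s hi ih =>
    simp only [Finset.sum_insert hi]
    exact (h i (by simp)).add (ih fun j hj => h j (by simp [hj]))

end HardyBound

/-- A function with a simple pole at `i κ` that decays quadratically. -/
def poleFn (κ : ℝ) (z : ℂ) : ℂ := 2 * Complex.I * κ / (z ^ 2 + (κ : ℂ) ^ 2)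

lemma sq_add_sq_eq (κ : ℝ) (z : ℂ) :
    z ^ 2 + (κ : ℂ) ^ 2 = (z - Complex.I * κ) * (z + Complex.I * κ) := by
  linear_combination (κ : ℂ) ^ 2 * Complex.I_sq

lemma le_norm_add (κ : ℝ) {z : ℂ} (hz : 0 ≤ z.im) : κ ≤ ‖z + Complex.I * κ‖ := by
  have := (le_abs_self _).trans (Complex.abs_im_le_norm (z + Complex.I * κ))
  simp at this
  linarith

/-- Near the pole, κ ≤ |z| + |z - iκ| and |Re z| ≤ min(|z|, |z - iκ|) give κ|Re z| ≤ 2|z||z - iκ|;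
the other linear factor has modulus at least κ. -/
lemma hardyBound_poleFn {κ : ℝ} (hκ : 0 < κ) : HardyBound (poleFn κ) := by
  have hn : ‖2 * Complex.I * (κ : ℂ)‖ = 2 * κ := by simp [abs_of_pos hκ]
  refine ⟨⟨4 * κ, 2 * κ + 1, fun z hz hR => ?_⟩, fun R => ⟨4 / κ, fun z hz _ => ?_⟩⟩
  · rw [poleFn, norm_div, hn]
    have h1 := norm_sub_norm_le (z ^ 2) (-(κ : ℂ) ^ 2)
    rw [sub_neg_eq_add, norm_neg, norm_pow, norm_pow, Complex.norm_real, Real.norm_of_nonneg hκ.le]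
      at h1
    have h2 : (1 + ‖z‖ ^ 2) / 2 ≤ ‖z ^ 2 + (κ : ℂ) ^ 2‖ := by nlinarith
    calc 2 * κ / ‖z ^ 2 + (κ : ℂ) ^ 2‖ ≤ 2 * κ / ((1 + ‖z‖ ^ 2) / 2) := by gcongr
      _ = _ := by field_simp; ring
  · rw [poleFn, norm_div, hn, sq_add_sq_eq, norm_mul]
    have h1 := le_norm_add κ hz.le
    have h2 : |z.re| ≤ ‖z - Complex.I * κ‖ := by
      have := Complex.abs_re_le_norm (z - Complex.I * κ)
      simpa using this
    have h3 : |z.re| ≤ ‖z‖ := Complex.abs_re_le_norm z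
    have h4 : κ ≤ ‖z‖ + ‖z - Complex.I * κ‖ := by
      have := norm_sub_le z (z - Complex.I * κ)
      rw [sub_sub_cancel] at this
      simpa [abs_of_pos hκ] using this
    set m := ‖z - Complex.I * κ‖
    set n := ‖z + Complex.I * κ‖
    have hn0 : 0 < n := hκ.trans_le h1
    rcases (norm_nonneg (z - Complex.I * κ)).eq_or_lt with h0 | h0
    · have : m = 0 := h0.symm
      rw [this]; simp; positivity
    have hm0 : 0 < m := h0
    rw [← mul_div_assoc, div_le_iff₀ (by positivity)]
    have h5 : κ * |z.re| ≤ 2 * (‖z‖ * m) := by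
      nlinarith [abs_nonneg z.re, norm_nonneg z,
        mul_le_mul_of_nonneg_left h2 (norm_nonneg z), mul_le_mul_of_nonneg_right h3 hm0.le]
    have h6 : 4 / κ * ‖z‖ * (m * n) ≥ 4 / κ * ‖z‖ * (m * κ) := by gcongr
    have h7 : 4 / κ * ‖z‖ * (m * κ) = 4 * (‖z‖ * m) := by field_simp
    linarith

lemma integral_poleFn {κ : ℝ} (hκ : 0 < κ) :
    Integrable (fun l : ℝ => poleFn κ l) ∧
      ∫ l : ℝ, poleFn κ l = 2 * Real.pi * Complex.I := by
  have h0 : ∀ l : ℝ, poleFn κ l =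
      (2 * Complex.I / κ) * (((1 + (l / κ) ^ 2)⁻¹ : ℝ) : ℂ) := fun l => by
    have hκc : (κ : ℂ) ≠ 0 := by exact_mod_cast hκ.ne'
    have h1 : (l : ℂ) ^ 2 + (κ : ℂ) ^ 2 ≠ 0 := by
      have : l ^ 2 + κ ^ 2 ≠ 0 := by positivity
      exact_mod_cast this
    have h2 : 1 + ((l : ℂ) / κ) ^ 2 = (l ^ 2 + κ ^ 2) / κ ^ 2 := by field_simp; ring
    rw [poleFn]; push_cast
    rw [h2]; field_simp
  have hI : Integrable fun l : ℝ => (1 + (l / κ) ^ 2)⁻¹ :=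
    integrable_inv_one_add_sq.comp_div hκ.ne'
  simp_rw [h0]
  refine ⟨hI.ofReal.const_mul _, ?_⟩
  rw [integral_const_mul, integral_complex_ofReal,
    Measure.integral_comp_div (fun l : ℝ => (1 + l ^ 2)⁻¹), integral_univ_inv_one_add_sq,
    abs_of_pos hκ]
  have hκc : (κ : ℂ) ≠ 0 := by exact_mod_cast hκ.ne'
  push_cast [smul_eq_mul]
  field_simp

end

/-! ### The boundary solution and the contour identity -/

noncomputable section

namespace SLProblem

variable {P : SLProblem} {e : ℝ → ℂ → ℂ} {K : ℝ → ℝ → ℂ}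

/-- For fixed `x`, the solution `φ` that satisfies the boundary condition is
`B c - A σ`; its growth and its relation to the Jost solution. -/
structure IsBdry (P : SLProblem) (e : ℝ → ℂ → ℂ) (x : ℝ) (φ : ℂ → ℂ) : Prop where
  diff : Differentiable ℂ φ
  real : ∀ l : ℝ, e x (-l) * P.E e l - P.Nm e l * e x l = 2 * Complex.I * l * φ l
  eigen : ∀ z : ℂ, 0 ≤ z.im → P.E e z = 0 → φ z * e 0 z = P.bcβ z * e x z
  near : ∀ R : ℝ, ∃ C : ℝ, 0 ≤ C ∧ ∀ z : ℂ, ‖z‖ ≤ R → ‖φ z‖ ≤ C * (‖P.bcα z‖ + ‖P.bcβ z‖)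
  far : ∃ G : ℝ, 0 ≤ G ∧ ∀ z : ℂ, 0 ≤ z.im → 1 ≤ ‖z‖ →
    ‖z * φ z‖ ≤ G * Real.exp (z.im * (P.μp x - P.μp 0)) * (‖z * P.bcβ z‖ + ‖P.bcα z‖)

/-- Insert e = e(0) c + e'(0) σ. On the real line the Wronskian 2il appears as the determinant; at
zeros of E the two sides of `eigen` differ by -σE. -/
lemma IsJostSolution.exists_isBdry (hP : P.Admissible) (he : P.IsJostSolution e) {x : ℝ}
    (hx : 0 ≤ x) : ∃ φ, P.IsBdry e x φ := by
  have hb : 0 < x + P.a := by have := hP.a_pos; linarith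
  obtain ⟨c, c', σ, σ', hF⟩ := hP.exists_fundamental hb
  have hxb : x ∈ Icc 0 (x + P.a) := ⟨hx, by linarith [hP.a_pos]⟩
  have hcomb : ∀ z : ℂ, 0 ≤ z.im → ∀ w : ℂ, w ^ 2 = z ^ 2 → 0 ≤ w.im →
      e x w = e 0 w * c z x + ed e 0 w * σ z x := fun z hz w hw hw' =>
    (hF.eq_combination ((he.sol hP hw').of_sq_eq hw.symm) hxb).1
  refine ⟨fun z => P.bcβ z * c z x - P.bcα z * σ z x, ?_, fun l => ?_, fun z hz hE => ?_,
    fun R => ?_, ?_⟩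
  · exact (P.differentiable_bcβ.mul (hF.cos_diff x hxb)).sub
      (P.differentiable_bcα.mul (hF.sin_diff x hxb))
  · have hW := he.wronskian_real hP l
    rw [hcomb l (by simp) l rfl (by simp), hcomb l (by simp) (-l) (by ring) (by simp), E_eq, Nm]
    linear_combination (P.bcβ l * c l x - P.bcα l * σ l x) * hW
  · rw [hcomb z hz z rfl hz]
    rw [E_eq] at hE
    linear_combination -σ z x * hE
  · obtain ⟨C, hC⟩ := hF.bound R
    refine ⟨|C|, abs_nonneg C, fun z hz => ?_⟩
    obtain ⟨h1, h2⟩ := hC z hz x hxb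
    refine (norm_sub_le _ _).trans ?_
    rw [norm_mul, norm_mul, mul_add, add_comm, mul_comm (‖P.bcα z‖), mul_comm (‖P.bcβ z‖)]
    have := le_abs_self C
    gcongr
    · exact h2.trans this
    · exact h1.trans this
  · obtain ⟨G, hG, hg⟩ := hP.exists_growth hx
    refine ⟨G, hG, fun z hz hz1 => ?_⟩
    obtain ⟨h1, h2, h3, h4⟩ := hF.cos z
    obtain ⟨k1, k2, k3, k4⟩ := hF.sin z
    have a1 := hg z hz hz1 _ _ (x + P.a) hxb.2 (by linarith) h1 h2
    have a2 := hg z hz hz1 _ _ (x + P.a) hxb.2 (by linarith) k1 k2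
    rw [h3, h4, norm_one, norm_zero, mul_one, add_zero] at a1
    rw [k3, k4, norm_one, norm_zero, mul_zero, zero_add, mul_one] at a2
    set X := G * Real.exp (z.im * (P.μp x - P.μp 0)) with hX
    have b1 : ‖c z x‖ ≤ X := by
      have : ‖z‖ * ‖c z x‖ ≤ ‖z‖ * X := by linarith [norm_nonneg (c' z x)]
      exact le_of_mul_le_mul_left this (by linarith)
    have b2 : ‖z‖ * ‖σ z x‖ ≤ X := by linarith [norm_nonneg (σ' z x)]
    have : z * (P.bcβ z * c z x - P.bcα z * σ z x) =
      z * P.bcβ z * c z x - P.bcα z * (z * σ z x) := by ring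
    rw [this]
    refine (norm_sub_le _ _).trans ?_
    rw [norm_mul (z * _), norm_mul (P.bcα z), norm_mul z (σ z x)]
    have c1 := mul_le_mul_of_nonneg_left b1 (norm_nonneg (z * P.bcβ z))
    have c2 := mul_le_mul_of_nonneg_left b2 (norm_nonneg (P.bcα z))
    linarith

/-- The function `2 i z φ ψ^ / E` satisfies the growth conditions of the contour argument. -/
lemma IsBdry.hardyBound (hP : P.Admissible) (he : P.IsJostSolution e) (hK : P.IsJostKernel e K)
    {x : ℝ} {φ : ℂ → ℂ} (hφ : P.IsBdry e x φ)
    {d : ℕ} {p : ℂ} {r : ℝ} (hL : P.IsLeading d p r) {ψ : ℝ → ℂ} (hψ : IsTest (P.μp x) ψ) :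
    HardyBound fun z => 2 * Complex.I * z * φ z / P.E e z * lap ψ z := by
  obtain ⟨D, hD, hlap⟩ := hψ.exists_lap_bound
  constructor
  · obtain ⟨G, hG, hg⟩ := hφ.far
    obtain ⟨c, R, hc, hR, hl⟩ := hL.exists_lower hP he
    obtain ⟨C1, h1, k1⟩ := hL.bcβ_le
    obtain ⟨C2, h2, k2⟩ := hL.bcα_le
    refine ⟨2 * G * (C1 + C2) / c * D, R, fun z hz hzR => ?_⟩
    have hz1 : 1 ≤ ‖z‖ := hR.trans hzR
    have hz0 : 0 < ‖z‖ := by linarith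
    have a1 := hg z hz.le hz1
    have a2 := hl z hz.le hzR
    have a3 := hlap z hz.le
    have a4 := k1 z hz1
    have a5 := k2 z hz1
    beta_reduce at a4
    have hEpos : 0 < c * ‖z‖ ^ d * Real.exp (-(z.im * P.μp 0)) := by positivity
    have hnum : ‖2 * Complex.I * z * φ z‖ ≤
        2 * (G * Real.exp (z.im * (P.μp x - P.μp 0)) * ((C1 + C2) * ‖z‖ ^ d)) := by
      have : 2 * Complex.I * z * φ z = 2 * Complex.I * (z * φ z) := by ring
      rw [this, norm_mul, norm_mul, Complex.norm_ofNat, Complex.norm_I, mul_one]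
      refine mul_le_mul_of_nonneg_left (a1.trans ?_) zero_le_two
      refine mul_le_mul_of_nonneg_left ?_ (by positivity)
      linarith
    -- The factors exp(-Im z μ⁺(0)) of φ and E cancel. What remains is exp(Im z μ⁺(x)), which the
    -- decay of `lap ψ` compensates exactly.
    have hq : ‖2 * Complex.I * z * φ z / P.E e z‖ ≤
        2 * G * (C1 + C2) / c * Real.exp (z.im * P.μp x) := by
      rw [norm_div]
      refine (div_le_div₀ (by positivity) hnum hEpos a2).trans (le_of_eq ?_)
      have hexp : Real.exp (z.im * (P.μp x - P.μp 0)) =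
          Real.exp (z.im * P.μp x) * Real.exp (-(z.im * P.μp 0)) := by
        rw [← Real.exp_add]; ring_nf
      rw [hexp]; field_simp
    rw [norm_mul]
    refine (mul_le_mul hq a3 (norm_nonneg _) (by positivity)).trans (le_of_eq ?_)
    have : Real.exp (z.im * P.μp x) * Real.exp (-(z.im * P.μp x)) = 1 := by
      rw [← Real.exp_add]; simp
    rw [← mul_div_assoc]
    congr 1
    linear_combination (2 * G * (C1 + C2) / c * D) * this
  · intro R
    obtain ⟨M, hM, hm⟩ := hφ.near R
    obtain ⟨B, hB, hb⟩ := hK.exists_bound hP he R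
    obtain ⟨X, hX, hx⟩ := he.nrm_lower hP
    set ε := 2 / 9 * Real.exp (-(2 * R * X)) with hε
    have hε0 : 0 < ε := by positivity
    set D' := D * Real.exp (|R| * |P.μp x|) with hD'
    refine ⟨2 * (M * (2 * B) / (2 * ε)) * D', fun z hz hzR => ?_⟩
    have h1 := he.lower_E hP hz
    have h2 := hx z hz
    have him := Complex.im_le_norm z
    have h3 : ε ≤ z.im * P.nrm e z := by
      refine le_trans ?_ h2
      rw [hε]
      gcongr
      exact him.trans hzR
    obtain ⟨b1, b2⟩ := hb z hz.le hzR
    have h4 := hm z hzR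
    set A := ‖P.bcα z‖ + ‖P.bcβ z‖ with hA
    have hA0 : 0 ≤ A := by positivity
    -- Both φ and the lower bound for E contain the factor ‖A‖ + ‖B‖, so common zeros of A and B do
    -- no harm.
    have h5 : |z.re| * ‖φ z‖ ≤ M * (2 * B) / (2 * ε) * ‖P.E e z‖ := by
      have h6 : 2 * |z.re| * ε * A ≤ ‖P.E e z‖ * (2 * B) := by
        have : 2 * |z.re| * ε * A ≤ 2 * |z.re| * (z.im * P.nrm e z) * A := by gcongr
        refine this.trans (h1.trans ?_)
        gcongr
        linarith
      have h7 : |z.re| * ‖φ z‖ ≤ |z.re| * (M * A) := by gcongr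
      have h8 := mul_le_mul_of_nonneg_left h6 hM
      rw [div_mul_eq_mul_div, le_div_iff₀ (by positivity)]
      calc |z.re| * ‖φ z‖ * (2 * ε) ≤ |z.re| * (M * A) * (2 * ε) := by gcongr
        _ = M * (2 * |z.re| * ε * A) := by ring
        _ ≤ _ := h8
        _ = _ := by ring
    have h9 : |z.re| * ‖φ z / P.E e z‖ ≤ M * (2 * B) / (2 * ε) := by
      rw [norm_div, ← mul_div_assoc]
      exact div_le_of_le_mul₀ (norm_nonneg _) (by positivity) h5
    have h10 : ‖lap ψ z‖ ≤ D' := by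
      refine (hlap z hz.le).trans ((div_le_self (by positivity) (by nlinarith [sq_nonneg ‖z‖])).trans
        ?_)
      rw [hD']
      gcongr
      have : z.im * |P.μp x| ≤ |R| * |P.μp x| := by
        gcongr
        exact (him.trans hzR).trans (le_abs_self R)
      nlinarith [mul_le_mul_of_nonneg_left (neg_abs_le (P.μp x)) hz.le]
    have : 2 * Complex.I * z * φ z / P.E e z * lap ψ z =
      2 * Complex.I * z * (φ z / P.E e z) * lap ψ z := by ring
    beta_reduce
    rw [this, norm_mul, norm_mul, norm_mul, norm_mul, Complex.norm_ofNat, Complex.norm_I, mul_one]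
    calc |z.re| * (2 * ‖z‖ * ‖φ z / P.E e z‖ * ‖lap ψ z‖) =
        2 * (|z.re| * ‖φ z / P.E e z‖) * ‖lap ψ z‖ * ‖z‖ := by ring
      _ ≤ 2 * (M * (2 * B) / (2 * ε)) * D' * ‖z‖ := by gcongr

lemma IsJostKernel.exists_bound_real (hK : P.IsJostKernel e K) {x : ℝ} (hx : 0 ≤ x) :
    ∃ C, ∀ l : ℝ, ‖e x l‖ ≤ C := by
  refine ⟨|1 / 2 * (1 + 1 / √(P.ρ x))| + |1 / 2 * (1 - 1 / √(P.ρ x))| +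
    ∫ t in Ioi (P.μp x), ‖K x t‖, fun l => ?_⟩
  rw [hK.representation x hx l (by simp)]
  refine (norm_add_le _ _).trans (add_le_add ?_ ?_)
  · rw [e₀]
    refine (norm_add_le _ _).trans (le_of_eq ?_)
    rw [norm_mul, norm_mul, norm_exp_I_mul, norm_exp_I_mul, Complex.norm_real, Complex.norm_real]
    simp
  · have := norm_laplace_le (hK.integrable x hx) (z := (l : ℂ)) (by simp)
    simpa using this

/-- The contour identity. -/
theorem IsJostKernel.contour (hP : P.Admissible) (he : P.IsJostSolution e)
    (hK : P.IsJostKernel e K)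
    (hβ : ∀ κ ∈ P.eigenvalues e, P.β₀ - P.β₁ * κ - P.β₂ * κ ^ 2 ≠ 0)
    {x : ℝ} (hx : 0 ≤ x) {ψ : ℝ → ℂ} (hψ : IsTest (P.μp x) ψ) :
    Integrable (fun l : ℝ => (e x (-l) - P.S e l * e x l) * lap ψ l) ∧
    ∫ l : ℝ, (e x (-l) - P.S e l * e x l) * lap ψ l =
      -(2 * Real.pi) * ∑ᶠ κ ∈ P.eigenvalues e,
        (P.normSq e κ : ℂ) * e x (Complex.I * κ) * lap ψ (Complex.I * κ) := by
  have hne := coeff_ne_zero hβ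
  obtain ⟨d, p, r, hL⟩ := hP.exists_leading hne
  obtain ⟨φ, hφ⟩ := he.exists_isBdry hP hx
  have hfin := hK.finite_eigenvalues hP he hβ
  have hEd := hK.differentiableOn_E hP he
  have hEc := hK.continuousOn_E hP he
  set T := hfin.toFinset with hT
  have hmem : ∀ κ ∈ T, κ ∈ P.eigenvalues e := fun κ hκ => by simpa [hT] using hκ
  -- The residues of G at iκ. Since `poleFn κ` has residue 1 there, f below has no poles left.
  set ρs : ℝ → ℂ := fun κ => Complex.I * P.normSq e κ * e x (Complex.I * κ) *
    lap ψ (Complex.I * κ) with hρs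
  set G : ℂ → ℂ := fun z => 2 * Complex.I * z * φ z / P.E e z * lap ψ z with hG
  set f : ℂ → ℂ := fun z => G z + (-1) * ∑ κ ∈ T, ρs κ * poleFn κ z with hf
  have hbound : HardyBound f :=
    (hφ.hardyBound hP he hK hL hψ).add
      ((HardyBound.sum T fun κ hκ => (hardyBound_poleFn (hmem κ hκ).1).const_mul _).const_mul _)
  have hpole_ne : ∀ κ ∈ T, ∀ z : ℂ, 0 < z.im → z ≠ Complex.I * κ → z ^ 2 + (κ : ℂ) ^ 2 ≠ 0 :=
    fun κ hκ z hz hzk => by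
      rw [sq_add_sq_eq]
      refine mul_ne_zero (sub_ne_zero.2 hzk) (norm_pos_iff.1 ?_)
      exact (hmem κ hκ).1.trans_le (le_norm_add κ hz.le)
  have hGd : ∀ z : ℂ, 0 < z.im → P.E e z ≠ 0 → DifferentiableAt ℂ G z := fun z hz hE => by
    have h1 := hEd.differentiableAt (isOpen_upper.mem_nhds hz)
    have h2 := hψ.differentiableOn_lap.differentiableAt (isOpen_upper.mem_nhds hz)
    have h3 := hφ.diff z
    exact (((by fun_prop : DifferentiableAt ℂ (fun z => 2 * Complex.I * z) z).mul h3).div h1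
      hE).mul h2
  have hpd : ∀ κ ∈ T, ∀ z : ℂ, 0 < z.im → z ≠ Complex.I * κ → DifferentiableAt ℂ (poleFn κ) z :=
    fun κ hκ z hz hzk => by
      have := hpole_ne κ hκ z hz hzk
      unfold poleFn
      fun_prop (disch := assumption)
  have hfd : ∀ z : ℂ, 0 < z.im → P.E e z ≠ 0 → DifferentiableAt ℂ f z := fun z hz hE => by
    refine (hGd z hz hE).add (DifferentiableAt.const_mul (DifferentiableAt.fun_sum fun κ hκ =>
      (hpd κ hκ z hz ?_).const_mul _) _)
    rintro rfl
    exact hE (hmem κ hκ).2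
  have hd : ∀ z₀ : ℂ, 0 < z₀.im → ∀ᶠ z in 𝓝[≠] z₀, DifferentiableAt ℂ f z := fun z₀ hz₀ => by
    filter_upwards [hK.eventually_E_ne_zero hP he hL hz₀,
      nhdsWithin_le_nhds (isOpen_upper.mem_nhds hz₀)] with z h1 h2
    exact hfd z h2 h1
  have hzero : ∀ (z₀ : ℂ) (F : ℂ → ℂ), DifferentiableAt ℂ F z₀ →
      Tendsto (fun z => (z - z₀) * F z) (𝓝[≠] z₀) (𝓝 0) := fun z₀ F hF => by
    have : Tendsto (fun z => (z - z₀) * F z) (𝓝 z₀) (𝓝 ((z₀ - z₀) * F z₀)) :=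
      ((continuous_id.sub continuous_const).tendsto z₀).mul hF.continuousAt
    rw [sub_self, zero_mul] at this
    exact this.mono_left nhdsWithin_le_nhds
  have ho : ∀ z₀ : ℂ, 0 < z₀.im → Tendsto (fun z => (z - z₀) * f z) (𝓝[≠] z₀) (𝓝 0) :=
    fun z₀ hz₀ => by
      by_cases hE : P.E e z₀ = 0
      swap
      · exact hzero z₀ f (hfd z₀ hz₀ hE)
      -- Off the imaginary axis the growth condition keeps f bounded near z₀, so the singularity is
      -- removable. On the axis z₀ belongs to an eigenvalue and the residues have to be compared.
      by_cases hre : z₀.re = 0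
      swap
      · obtain ⟨C, hC⟩ := hbound.2 (‖z₀‖ + 1)
        have hlim : Tendsto (fun z : ℂ => ‖z - z₀‖ * (C * ‖z‖ / |z.re|)) (𝓝[≠] z₀) (𝓝 0) := by
          have hne' : |z₀.re| ≠ 0 := abs_ne_zero.2 hre
          have : ContinuousAt (fun z : ℂ => ‖z - z₀‖ * (C * ‖z‖ / |z.re|)) z₀ := by
            refine ContinuousAt.mul (by fun_prop) (ContinuousAt.div (by fun_prop) ?_ hne')
            exact Complex.continuous_re.abs.continuousAt
          have h2 := this.tendsto
          simp only [sub_self, norm_zero, zero_mul] at h2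
          exact h2.mono_left nhdsWithin_le_nhds
        refine squeeze_zero_norm' ?_ hlim
        have c1 : ∀ᶠ z in 𝓝[≠] z₀, 0 < z.im := nhdsWithin_le_nhds (isOpen_upper.mem_nhds hz₀)
        have c2 : ∀ᶠ z in 𝓝[≠] z₀, ‖z‖ < ‖z₀‖ + 1 := nhdsWithin_le_nhds
          ((isOpen_lt continuous_norm continuous_const).mem_nhds (show ‖z₀‖ < _ by linarith))
        have c3 : ∀ᶠ z in 𝓝[≠] z₀, z.re ≠ 0 := nhdsWithin_le_nhds
          ((isOpen_ne_fun Complex.continuous_re continuous_const).mem_nhds hre)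
        filter_upwards [c1, c2, c3] with z h1 h2 h3
        rw [norm_mul]
        gcongr
        rw [le_div_iff₀ (abs_pos.2 h3), mul_comm]
        exact hC z h1 h2.le
      obtain ⟨κ₀, hκ₀, rfl⟩ : ∃ κ₀ : ℝ, 0 < κ₀ ∧ z₀ = Complex.I * κ₀ :=
        ⟨z₀.im, hz₀, by apply Complex.ext <;> simp [hre]⟩
      have hk : κ₀ ∈ P.eigenvalues e := ⟨hκ₀, hE⟩
      have hkT : κ₀ ∈ T := by simpa [hT] using hk
      obtain ⟨hu, ht⟩ := hK.tendsto_E_div hP he hk (hβ κ₀ hk)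
      have hκc : (κ₀ : ℂ) ≠ 0 := by exact_mod_cast hκ₀.ne'
      have hM : (P.normInvSq e κ₀ : ℂ) ≠ 0 := by exact_mod_cast (he.normInvSq_pos hP hκ₀).ne'
      have hB : P.bcβ (Complex.I * κ₀) ≠ 0 := by rw [bcβ_I_mul]; exact_mod_cast hβ κ₀ hk
      have hne1 : 2 * Complex.I * κ₀ * P.bcβ (Complex.I * κ₀) * P.normInvSq e κ₀ /
          e 0 (Complex.I * κ₀) ≠ 0 :=
        div_ne_zero (mul_ne_zero (mul_ne_zero (mul_ne_zero (mul_ne_zero two_ne_zero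
          Complex.I_ne_zero) hκc) hB) hM) hu
      have heig := hφ.eigen _ hz₀.le hE
      -- The residue combines the limit of E(z)/(z - iκ₀) with φ e(0) = B e(x); the factor B
      -- cancels, which uses that it is nonzero at iκ₀.
      have hG0 : Tendsto (fun z => (z - Complex.I * κ₀) * G z) (𝓝[≠] (Complex.I * κ₀))
          (𝓝 (ρs κ₀)) := by
        have n1 : Tendsto (fun z => 2 * Complex.I * z * φ z * lap ψ z) (𝓝[≠] (Complex.I * κ₀))
            (𝓝 (2 * Complex.I * (Complex.I * κ₀) * φ (Complex.I * κ₀) *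
              lap ψ (Complex.I * κ₀))) := by
          refine Tendsto.mono_left ?_ nhdsWithin_le_nhds
          have h2 := (hψ.differentiableOn_lap.differentiableAt
            (isOpen_upper.mem_nhds hz₀)).continuousAt.tendsto
          exact (Continuous.tendsto ((by fun_prop : Continuous fun z : ℂ => 2 * Complex.I * z).mul
            hφ.diff.continuous) _).mul h2
        have n2 := n1.div ht hne1
        have hval : 2 * Complex.I * (Complex.I * κ₀) * φ (Complex.I * κ₀) *
              lap ψ (Complex.I * κ₀) / (2 * Complex.I * κ₀ * P.bcβ (Complex.I * κ₀) *
              P.normInvSq e κ₀ / e 0 (Complex.I * κ₀)) = ρs κ₀ := by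
          rw [hρs]; beta_reduce
          rw [normSq, div_div_eq_mul_div, div_eq_iff (mul_ne_zero (mul_ne_zero (mul_ne_zero
            (mul_ne_zero two_ne_zero Complex.I_ne_zero) hκc) hB) hM)]
          push_cast
          have : 2 * Complex.I * (Complex.I * κ₀) * φ (Complex.I * κ₀) * lap ψ (Complex.I * κ₀) *
              e 0 (Complex.I * κ₀) = 2 * Complex.I * (Complex.I * κ₀) *
                (P.bcβ (Complex.I * κ₀) * e x (Complex.I * κ₀)) * lap ψ (Complex.I * κ₀) := by
            rw [← heig]; ring
          rw [this]
          field_simp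
        rw [hval] at n2
        refine n2.congr' ?_
        filter_upwards [self_mem_nhdsWithin, hK.eventually_E_ne_zero hP he hL hz₀] with z hz hEz
        have hzk : z - Complex.I * κ₀ ≠ 0 := sub_ne_zero.2 hz
        rw [hG]; beta_reduce
        simp only [Pi.div_apply]
        field_simp
      have hsum : Tendsto (fun z => ∑ κ ∈ T, (z - Complex.I * κ₀) * (ρs κ * poleFn κ z))
          (𝓝[≠] (Complex.I * κ₀)) (𝓝 (∑ κ ∈ T, if κ = κ₀ then ρs κ₀ else 0)) := by
        refine tendsto_finsetSum _ fun κ hκ => ?_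
        split_ifs with hkk
        · subst hkk
          have hne2 : Complex.I * κ + Complex.I * κ ≠ 0 := by
            rw [← two_mul]; exact mul_ne_zero two_ne_zero (mul_ne_zero Complex.I_ne_zero hκc)
          have h1 : Tendsto (fun z : ℂ => ρs κ * (2 * Complex.I * κ / (z + Complex.I * κ)))
              (𝓝[≠] (Complex.I * κ))
              (𝓝 (ρs κ * (2 * Complex.I * κ / (Complex.I * κ + Complex.I * κ)))) := by
            refine Tendsto.mono_left (ContinuousAt.tendsto (f := fun z : ℂ =>
              ρs κ * (2 * Complex.I * κ / (z + Complex.I * κ))) ?_) nhdsWithin_le_nhds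
            exact continuousAt_const.mul (continuousAt_const.div (by fun_prop) hne2)
          have h2 : 2 * Complex.I * κ / (Complex.I * κ + Complex.I * κ) = 1 := by
            rw [div_eq_one_iff_eq hne2]; ring
          rw [h2, mul_one] at h1
          refine h1.congr' ?_
          filter_upwards [self_mem_nhdsWithin] with z hz
          have hzk : z - Complex.I * κ ≠ 0 := sub_ne_zero.2 hz
          rw [poleFn, sq_add_sq_eq]
          rw [mul_left_comm, ← mul_div_assoc (z - _), mul_div_mul_left _ _ hzk]
        · refine hzero _ _ ((hpd κ hκ _ hz₀ fun h => hkk ?_).const_mul _)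
          have := mul_left_cancel₀ Complex.I_ne_zero h
          exact_mod_cast this.symm
      rw [Finset.sum_ite_eq' T κ₀ (fun _ => ρs κ₀), if_pos hkT] at hsum
      have hfinal := hG0.sub hsum
      rw [sub_self] at hfinal
      refine hfinal.congr fun z => ?_
      rw [hf]; beta_reduce
      rw [← Finset.mul_sum]; ring
  have hEae := he.ae_E_ne_zero hP hne
  have hrealpole : ∀ κ ∈ T, ∀ l : ℝ, (l : ℂ) ^ 2 + (κ : ℂ) ^ 2 ≠ 0 := fun κ hκ l => by
    have := (hmem κ hκ).1
    have : l ^ 2 + κ ^ 2 ≠ 0 := by positivity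
    exact_mod_cast this
  obtain ⟨⟨C, R, hfar⟩, hnear⟩ := hbound
  have hmain : ∫ l : ℝ, f l = 0 := by
    refine integral_boundary_eq_zero hd ho hfar hnear ?_
    filter_upwards [hEae] with l hl
    have hline : Tendsto (fun ε : ℝ => (l : ℂ) + ε * Complex.I) (𝓝[>] 0)
        (𝓝[{z : ℂ | 0 ≤ z.im}] (l : ℂ)) := by
      refine tendsto_nhdsWithin_iff.2 ⟨?_, ?_⟩
      · have : Tendsto (fun ε : ℝ => (l : ℂ) + ε * Complex.I) (𝓝 0)
            (𝓝 (l + (0 : ℝ) * Complex.I)) := Continuous.tendsto (by fun_prop) 0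
        simp only [Complex.ofReal_zero, zero_mul, add_zero] at this
        exact this.mono_left nhdsWithin_le_nhds
      · filter_upwards [self_mem_nhdsWithin] with ε hε
        have : (0 : ℝ) < ε := hε
        simpa using this.le
    have hlmem : (l : ℂ) ∈ {z : ℂ | 0 ≤ z.im} := by simp
    constructor
    · filter_upwards [self_mem_nhdsWithin, hline.eventually
        ((hEc l hlmem).eventually_ne hl)] with ε hε hE
      have : (0 : ℝ) < ε := hε
      exact hfd _ (by simpa using this) hE
    · have hc : ContinuousWithinAt f {z : ℂ | 0 ≤ z.im} l := by
        refine ContinuousWithinAt.add ?_ ?_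
        · refine ContinuousWithinAt.mul (ContinuousWithinAt.div ?_ (hEc l hlmem) hl)
            (hψ.continuousOn_lap l hlmem)
          exact Continuous.continuousWithinAt ((by fun_prop : Continuous fun z : ℂ =>
            2 * Complex.I * z).mul hφ.diff.continuous)
        · refine ContinuousAt.continuousWithinAt (DifferentiableAt.continuousAt (𝕜 := ℂ) ?_)
          refine DifferentiableAt.const_mul (DifferentiableAt.fun_sum fun κ hκ =>
            DifferentiableAt.const_mul ?_ _) _
          have := hrealpole κ hκ l
          unfold poleFn
          fun_prop (disch := assumption)
      exact hc.tendsto.comp hline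
  -- By the field `real` of `IsBdry`, wherever E does not vanish.
  have hreal : ∀ᵐ l : ℝ, (e x (-l) - P.S e l * e x l) * lap ψ l = G l := by
    filter_upwards [hEae] with l hl
    rw [hG]; beta_reduce
    rw [← hφ.real l, he.S_eq hP]
    field_simp
  obtain ⟨B, hB⟩ := hK.exists_bound_real hx
  have hint : Integrable (fun l : ℝ => (e x (-l) - P.S e l * e x l) * lap ψ l) := by
    refine hψ.integrable_mul_lap (C := B + 1 * B) (Measurable.aestronglyMeasurable ?_) fun l => ?_
    · exact (hK.continuous_real_neg hx).measurable.sub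
        ((hK.measurable_S hP he).mul (hK.continuous_real hx).measurable)
    · refine (norm_sub_le _ _).trans (add_le_add ?_ ?_)
      · have := hB (-l)
        push_cast at this
        exact this
      · rw [norm_mul]
        exact mul_le_mul (he.norm_S_le hP l) (hB l) (norm_nonneg _) zero_le_one
  refine ⟨hint, ?_⟩
  have hGint : Integrable fun l : ℝ => G l := hint.congr hreal
  have hsint : Integrable fun l : ℝ => ∑ κ ∈ T, ρs κ * poleFn κ l :=
    integrable_finsetSum _ fun κ hκ => (integral_poleFn (hmem κ hκ).1).1.const_mul _
  have h0 : ∫ l : ℝ, f l = (∫ l : ℝ, G l) + (-1) * ∑ κ ∈ T, ρs κ * (2 * Real.pi * Complex.I) := by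
    rw [hf]
    beta_reduce
    rw [integral_add hGint (hsint.const_mul _), integral_const_mul,
      integral_finsetSum _ fun κ hκ => (integral_poleFn (hmem κ hκ).1).1.const_mul _]
    congr 2
    refine Finset.sum_congr rfl fun κ hκ => ?_
    rw [integral_const_mul, (integral_poleFn (hmem κ hκ).1).2]
  rw [hmain] at h0
  rw [integral_congr_ae hreal, finsum_mem_eq_finite_toFinset_sum _ hfin, Finset.mul_sum]
  have h1 : ∫ l : ℝ, G l = ∑ κ ∈ T, ρs κ * (2 * Real.pi * Complex.I) := by
    linear_combination -h0
  rw [h1]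
  refine Finset.sum_congr rfl fun κ hκ => ?_
  rw [hρs]; beta_reduce
  linear_combination (2 * Real.pi * P.normSq e κ * e x (Complex.I * κ) *
    lap ψ (Complex.I * κ)) * Complex.I_sq

end SLProblem

end

/-! ### Fourier inversion, square integrable functions and convolutions -/

noncomputable section

open scoped FourierTransform SchwartzMap

/-- Passes between the exponential exp(ily) used here and the normalisation exp(2πiξy) of `𝓕⁻`. -/
lemma lap_two_pi_mul (ψ : ℝ → ℂ) (ξ : ℝ) : lap ψ ((2 * Real.pi * ξ : ℝ) : ℂ) = 𝓕⁻ ψ ξ := by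
  rw [Real.fourierInv_eq', lap]
  congr 1; ext y
  rw [smul_eq_mul, mul_comm]
  congr 2
  simp
  ring

namespace IsTest

variable {c : ℝ} {ψ : ℝ → ℂ}

/-- Fourier inversion for test functions. -/
lemma inversion (h : IsTest c ψ) (s : ℝ) :
    ∫ l : ℝ, Complex.exp (-(Complex.I * l * s)) * lap ψ l = 2 * Real.pi * ψ s := by
  set Ψ : 𝓢(ℝ, ℂ) := h.compact.toSchwartzMap h.smooth with hΨ
  have hcoe : (Ψ : ℝ → ℂ) = ψ := rfl
  have h1 : 𝓕 (𝓕⁻ Ψ) = Ψ := FourierTransform.fourier_fourierInv_eq Ψ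
  have h2 : 𝓕 (𝓕⁻ ψ) s = ψ s := by
    have := congrArg (fun F : 𝓢(ℝ, ℂ) => F s) h1
    beta_reduce at this
    rw [SchwartzMap.fourier_coe, SchwartzMap.fourierInv_coe, hcoe] at this
    exact this
  rw [Real.fourier_eq'] at h2
  have h3 := Measure.integral_comp_mul_left
    (fun l : ℝ => Complex.exp (-(Complex.I * l * s)) * lap ψ l) (2 * Real.pi)
  have h4 : (fun ξ : ℝ => Complex.exp (-(Complex.I * ((2 * Real.pi * ξ : ℝ) : ℂ) * s)) *
      lap ψ ((2 * Real.pi * ξ : ℝ) : ℂ)) =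
      fun v : ℝ => Complex.exp (((-2 * Real.pi * inner ℝ v s : ℝ) : ℂ) * Complex.I) • 𝓕⁻ ψ v := by
    ext ξ
    rw [lap_two_pi_mul, smul_eq_mul]
    congr 2
    simp
    ring
  rw [h4, h2, abs_of_pos (by positivity)] at h3
  have hπ : (2 * Real.pi : ℂ) ≠ 0 := by
    exact mul_ne_zero two_ne_zero (by exact_mod_cast Real.pi_ne_zero)
  rw [h3, Complex.real_smul]
  push_cast
  rw [← mul_assoc, mul_inv_cancel₀ hπ, one_mul]

lemma shift (h : IsTest c ψ) (s : ℝ) : IsTest (c + s) (fun y => ψ (y - s)) := by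
  refine ⟨h.smooth.comp (contDiff_id.sub contDiff_const), ?_, ?_⟩
  · exact h.compact.comp_homeomorph (Homeomorph.subRight s)
  · have h1 : tsupport (fun y => ψ (y - s)) = (fun y => y - s) ⁻¹' tsupport ψ :=
      tsupport_comp_eq_preimage ψ (Homeomorph.subRight s)
    rw [h1]
    intro y hy
    have : c < y - s := h.supp hy
    show c + s < y
    linarith

lemma lap_shift (ψ : ℝ → ℂ) (s : ℝ) (z : ℂ) :
    lap (fun y => ψ (y - s)) z = Complex.exp (Complex.I * z * s) * lap ψ z := by
  rw [lap, lap, ← integral_const_mul,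
    ← integral_sub_right_eq_self (fun y : ℝ => Complex.exp (Complex.I * z * s) *
      (ψ y * Complex.exp (Complex.I * z * (y : ℂ)))) s]
  congr 1; ext y
  rw [mul_left_comm, ← Complex.exp_add]
  congr 2
  push_cast; ring

end IsTest

/-- The inverse Fourier transform of a square integrable function. -/
lemma exists_inverse_fourier {g : ℝ → ℂ} (hg : MemLp g 2) :
    ∃ f : ℝ → ℂ, StronglyMeasurable f ∧ MemLp f 2 ∧ ∀ (c : ℝ) (ψ : ℝ → ℂ), IsTest c ψ →
      ∀ s : ℝ, ∫ l : ℝ, g l * (Complex.exp (Complex.I * l * s) * lap ψ l) =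
        2 * Real.pi * ∫ y : ℝ, f (y + s) * ψ y := by
  have hπ : (2 * Real.pi : ℝ) ≠ 0 := by positivity
  have hg' : MemLp (fun ξ : ℝ => g (2 * Real.pi * ξ)) 2 := by
    have hm : Measure.map (fun ξ : ℝ => 2 * Real.pi * ξ) volume =
        ENNReal.ofReal |(2 * Real.pi)⁻¹| • volume := Real.map_volume_mul_left hπ
    have : MemLp g 2 (Measure.map (fun ξ : ℝ => 2 * Real.pi * ξ) volume) := by
      rw [hm]; exact hg.smul_measure ENNReal.ofReal_ne_top
    exact this.comp_of_map (by fun_prop)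
  set G : Lp ℂ 2 (volume : Measure ℝ) := hg'.toLp _ with hG
  have key : ∀ (c : ℝ) (ψ : ℝ → ℂ), IsTest c ψ →
      ∫ l : ℝ, g l * lap ψ l = 2 * Real.pi * ∫ y : ℝ, (𝓕⁻ G : Lp ℂ 2 (volume : Measure ℝ)) y * ψ y := by
    intro c ψ h
    set Ψ : 𝓢(ℝ, ℂ) := h.compact.toSchwartzMap h.smooth with hΨ
    have hcoe : (Ψ : ℝ → ℂ) = ψ := rfl
    -- The L² transform is paired with a Schwartz function by moving the transform onto that
    -- function.
    have h1 := congrArg (fun T : 𝓢'(ℝ, ℂ) => T Ψ) (Lp.fourierInv_toTemperedDistribution_eq G)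
    beta_reduce at h1
    rw [TemperedDistribution.fourierInv_apply, Lp.toTemperedDistribution_apply,
      Lp.toTemperedDistribution_apply, SchwartzMap.fourierInv_coe, hcoe] at h1
    have h2 : ∫ ξ : ℝ, 𝓕⁻ ψ ξ • (G : ℝ → ℂ) ξ =
        ∫ ξ : ℝ, g (2 * Real.pi * ξ) * lap ψ ((2 * Real.pi * ξ : ℝ) : ℂ) := by
      refine integral_congr_ae ?_
      filter_upwards [hg'.coeFn_toLp] with ξ hξ
      rw [hG, hξ, lap_two_pi_mul, smul_eq_mul, mul_comm]
    rw [h2, Measure.integral_comp_mul_left (fun l : ℝ => g l * lap ψ l), abs_of_pos (by positivity),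
      Complex.real_smul] at h1
    have h3 : ∫ y : ℝ, (𝓕⁻ G : Lp ℂ 2 (volume : Measure ℝ)) y * ψ y =
        ∫ y : ℝ, ψ y • (𝓕⁻ G : Lp ℂ 2 (volume : Measure ℝ)) y := by
      congr 1; ext y; rw [smul_eq_mul, mul_comm]
    rw [h3, ← h1]
    have : (Real.pi : ℂ) ≠ 0 := by exact_mod_cast Real.pi_ne_zero
    push_cast
    field_simp
  refine ⟨(𝓕⁻ G : Lp ℂ 2 (volume : Measure ℝ)), Lp.stronglyMeasurable _, Lp.memLp _,
    fun c ψ h s => ?_⟩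
  have := key _ _ (h.shift s)
  simp_rw [IsTest.lap_shift ψ s] at this
  rw [this, ← integral_sub_right_eq_self
    (fun y : ℝ => (𝓕⁻ G : Lp ℂ 2 (volume : Measure ℝ)) (y + s) * ψ y) s]
  simp

/-- Interchange of the integrations in a Fourier integral. -/
lemma integral_mul_fourier {g k : ℝ → ℂ} (hg : Integrable g) (hk : Integrable k) (σ : ℝ) :
    Integrable (fun l : ℝ => (∫ t : ℝ, k t * Complex.exp (Complex.I * (σ * l : ℝ) * t)) * g l) ∧
    ∫ l : ℝ, (∫ t : ℝ, k t * Complex.exp (Complex.I * (σ * l : ℝ) * t)) * g l =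
      ∫ t : ℝ, k t * ∫ l : ℝ, Complex.exp (Complex.I * l * (σ * t : ℝ)) * g l := by
  have h1 : Integrable (fun p : ℝ × ℝ =>
      Complex.exp (Complex.I * (σ * p.1 : ℝ) * p.2) * (g p.1 * k p.2))
      (volume.prod volume) := by
    refine (hg.mul_prod hk).bdd_mul (c := 1) (Continuous.aestronglyMeasurable (by fun_prop))
      (.of_forall fun p => ?_)
    have : Complex.I * ((σ * p.1 : ℝ) : ℂ) * (p.2 : ℂ) = ((σ * p.1 * p.2 : ℝ) : ℂ) * Complex.I := by
      push_cast; ring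
    rw [this, Complex.norm_exp_ofReal_mul_I]
  have h2 : ∀ l : ℝ, ∫ t : ℝ, Complex.exp (Complex.I * (σ * l : ℝ) * t) * (g l * k t) =
      (∫ t : ℝ, k t * Complex.exp (Complex.I * (σ * l : ℝ) * t)) * g l := fun l => by
    rw [← integral_mul_const]
    congr 1; ext t; ring
  refine ⟨h1.integral_prod_left.congr (.of_forall h2), ?_⟩
  have h3 := integral_integral_swap (f := fun l t : ℝ =>
    Complex.exp (Complex.I * (σ * l : ℝ) * t) * (g l * k t)) h1
  simp_rw [h2] at h3
  rw [h3]
  congr 1; ext t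
  rw [← integral_const_mul]
  congr 1; ext l
  rw [show Complex.I * ((σ * l : ℝ) : ℂ) * (t : ℂ) = Complex.I * l * ((σ * t : ℝ) : ℂ) by
    push_cast; ring]
  ring

/-- The product is dominated by the sum of the squares, and translation invariance makes the bound
independent of t, as Fubini's theorem requires below. -/
lemma integrable_shift_mul {f w : ℝ → ℂ} (hf : StronglyMeasurable f) (hf2 : MemLp f 2)
    (hw : StronglyMeasurable w) (hw2 : MemLp w 2) (t : ℝ) :
    Integrable (fun y => w y * f (t + y)) ∧
      ∫ y, ‖w y * f (t + y)‖ ≤ (∫ y, ‖w y‖ ^ 2) + ∫ y, ‖f y‖ ^ 2 := by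
  have i1 : Integrable fun y => ‖w y‖ ^ 2 := hw2.integrable_norm_pow (by norm_num)
  have i2 : Integrable fun y => ‖f y‖ ^ 2 := hf2.integrable_norm_pow (by norm_num)
  have i3 : Integrable fun y => ‖f (t + y)‖ ^ 2 := i2.comp_add_left t
  have hb : ∀ y, ‖w y * f (t + y)‖ ≤ ‖w y‖ ^ 2 + ‖f (t + y)‖ ^ 2 := fun y => by
    rw [norm_mul]
    nlinarith [sq_nonneg (‖w y‖ - ‖f (t + y)‖), sq_nonneg ‖w y‖, sq_nonneg ‖f (t + y)‖]
  have i4 : Integrable (fun y => w y * f (t + y)) := (i1.add i3).mono'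
    (hw.mul (hf.comp_measurable (measurable_const_add t))).aestronglyMeasurable (.of_forall hb)
  refine ⟨i4, (integral_mono i4.norm (i1.add i3) hb).trans (le_of_eq ?_)⟩
  rw [Pi.add_def, integral_add i1 i3, integral_add_left_eq_self (fun y => ‖f y‖ ^ 2) t]

/-- Integrability of the integrand of a convolution of an integrable and a square integrable
function against a square integrable weight. -/
lemma integrable_conv {f w k : ℝ → ℂ} (hf : StronglyMeasurable f) (hf2 : MemLp f 2)
    (hw : StronglyMeasurable w) (hw2 : MemLp w 2) (hk : Integrable k) :
    Integrable (fun p : ℝ × ℝ => w p.1 * (k p.2 * f (p.2 + p.1))) (volume.prod volume) := by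
  have hmeas : AEStronglyMeasurable (fun p : ℝ × ℝ => w p.1 * (k p.2 * f (p.2 + p.1)))
      (volume.prod volume) :=
    (hw.comp_measurable measurable_fst).aestronglyMeasurable.mul
      (hk.1.comp_snd.mul (hf.comp_measurable
        (measurable_snd.add measurable_fst)).aestronglyMeasurable)
  have heq : ∀ t y : ℝ, w y * (k t * f (t + y)) = k t * (w y * f (t + y)) := fun t y => by ring
  rw [integrable_prod_iff' hmeas]
  constructor
  · refine .of_forall fun t => ?_
    simp_rw [heq]
    exact (integrable_shift_mul hf hf2 hw hw2 t).1.const_mul _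
  · refine (hk.norm.mul_const ((∫ y, ‖w y‖ ^ 2) + ∫ y, ‖f y‖ ^ 2)).mono'
      hmeas.norm.prod_swap.integral_prod_right' (.of_forall fun t => ?_)
    rw [Real.norm_of_nonneg (integral_nonneg fun _ => norm_nonneg _)]
    simp_rw [heq, norm_mul (k t)]
    rw [integral_const_mul]
    exact mul_le_mul_of_nonneg_left (integrable_shift_mul hf hf2 hw hw2 t).2 (norm_nonneg _)

end

/-! ### Splitting the leading part of S, and the representative of F₀s -/

noncomputable section

/-- `F` is integrable on the line with integral `v`. -/
def HasInt (F : ℝ → ℂ) (v : ℂ) : Prop := Integrable F ∧ ∫ l, F l = v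

namespace HasInt

variable {F G : ℝ → ℂ} {u v : ℂ}

lemma add (hF : HasInt F u) (hG : HasInt G v) : HasInt (fun l => F l + G l) (u + v) :=
  ⟨hF.1.add hG.1, by rw [integral_add hF.1 hG.1, hF.2, hG.2]⟩

lemma sub (hF : HasInt F u) (hG : HasInt G v) : HasInt (fun l => F l - G l) (u - v) :=
  ⟨hF.1.sub hG.1, by rw [integral_sub hF.1 hG.1, hF.2, hG.2]⟩

lemma const_mul (hF : HasInt F u) (a : ℂ) : HasInt (fun l => a * F l) (a * u) :=
  ⟨hF.1.const_mul a, by rw [integral_const_mul, hF.2]⟩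

lemma sum {ι : Type*} {F : ι → ℝ → ℂ} {u : ι → ℂ} {s : Finset ι} (h : ∀ i ∈ s, HasInt (F i) (u i)) :
    HasInt (fun l => ∑ i ∈ s, F i l) (∑ i ∈ s, u i) :=
  ⟨integrable_finsetSum _ fun i hi => (h i hi).1, by
    rw [integral_finsetSum _ fun i hi => (h i hi).1]
    exact Finset.sum_congr rfl fun i hi => (h i hi).2⟩

lemma congr (hF : HasInt F u) (h : ∀ l, F l = G l) : HasInt G u := by
  rwa [← funext h]

end HasInt

namespace SLProblem

variable {P : SLProblem} {e : ℝ → ℂ → ℂ} {K : ℝ → ℝ → ℂ}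

lemma upper_subset : {z : ℂ | 0 < z.im} ⊆ {z | 0 ≤ z.im} := fun z hz => le_of_lt (a := 0) (b := z.im) hz

/-- The difference of `S` and its leading part is square integrable. -/
lemma IsLeading.memLp_sub (hP : P.Admissible) (he : P.IsJostSolution e)
    (hK : P.IsJostKernel e K) {d : ℕ} {p : ℂ} {r : ℝ} (hL : P.IsLeading d p r) :
    MemLp (fun l => P.Sap r l - P.S e l) 2 := by
  have hmeas : AEStronglyMeasurable (fun l => P.Sap r l - P.S e l) :=
    ((P.measurable_Sap r).sub (hK.measurable_S hP he)).aestronglyMeasurable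
  obtain ⟨C, R, hC, hR, h⟩ := hL.exists_S_sub_le hP he
  set M := 2 / (1 - |P.τ|) + 1 with hM
  have hb : ∀ l, ‖P.Sap r l - P.S e l‖ ≤ M := fun l =>
    (norm_sub_le _ _).trans (add_le_add (hP.norm_Sap_le hL.abs_le l) (he.norm_S_le hP l))
  rw [memLp_two_iff_integrable_sq_norm hmeas]
  refine Integrable.mono' (integrable_inv_one_add_sq.const_mul (M ^ 2 * (1 + R ^ 2) + 2 * C ^ 2))
    (hmeas.norm.pow 2) (.of_forall fun l => ?_)
  rw [Real.norm_of_nonneg (by positivity), ← div_eq_mul_inv, le_div_iff₀ (by positivity)]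
  rcases lt_or_ge |l| R with hl | hl
  · have h1 : ‖P.Sap r l - P.S e l‖ ^ 2 ≤ M ^ 2 := by gcongr; exact hb l
    have h2 : l ^ 2 ≤ R ^ 2 := by rw [← sq_abs]; gcongr
    have h3 : ‖P.Sap r l - P.S e l‖ ^ 2 * (1 + l ^ 2) ≤ M ^ 2 * (1 + R ^ 2) := by gcongr
    nlinarith [sq_nonneg C]
  · have hl1 : 1 ≤ |l| := hR.trans hl
    have h1 : ‖P.Sap r l - P.S e l‖ * |l| ≤ C := by
      have := h l hl
      rwa [le_div_iff₀ (by linarith), norm_sub_rev] at this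
    have h2 : ‖P.Sap r l - P.S e l‖ ^ 2 * l ^ 2 ≤ C ^ 2 := by
      rw [← sq_abs l, ← mul_pow]; gcongr
    have h3 : 1 ≤ l ^ 2 := by rw [← sq_abs]; nlinarith
    have h4 : ‖P.Sap r l - P.S e l‖ ^ 2 * 1 ≤ ‖P.Sap r l - P.S e l‖ ^ 2 * l ^ 2 := by gcongr
    nlinarith [sq_nonneg M, sq_nonneg R, mul_nonneg (sq_nonneg M) (sq_nonneg R)]

/-- The part of the leading term that extends to the upper half-plane. -/
def Hp (P : SLProblem) (r : ℝ) (z : ℂ) : ℂ :=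
  Complex.exp (Complex.I * z * ((-(2 * P.μp 0) : ℝ) : ℂ)) *
    (r * (1 - P.τ ^ 2) / (1 + P.τ * r * P.wexp z))

lemma Admissible.den_ne_zero (hP : P.Admissible) {r : ℝ} (hr : |r| ≤ 1) {z : ℂ} (hz : 0 ≤ z.im) :
    1 + P.τ * r * P.wexp z ≠ 0 :=
  norm_pos_iff.1 ((sub_pos.2 hP.abs_τ_lt).trans_le (hP.norm_den_ge hr hz))

/-- Divide r + τ/w by 1 + τrw. The quotient τ/w gives the exponential behind the term τ K(x, 2a -
y); the remainder r(1 - τ²) gives a function holomorphic in the upper half-plane. -/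
lemma Admissible.Sap_eq (hP : P.Admissible) {r : ℝ} (hr : |r| ≤ 1) (l : ℝ) :
    P.Sap r l = P.τ * Complex.exp (Complex.I * l * ((-(2 * P.a) : ℝ) : ℂ)) + P.Hp r l := by
  have hden := hP.den_ne_zero hr (z := l) (by simp)
  have h1 : P.wexp l * P.wexp (-l) = 1 := by
    rw [wexp, wexp, ← Complex.exp_add, ← Complex.exp_zero]; congr 1; ring
  have h2 : Complex.exp (Complex.I * l * ((-(2 * P.a) : ℝ) : ℂ)) =
      Complex.exp (-(2 * Complex.I * l * P.μp 0)) * P.wexp (-l) := by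
    rw [wexp, ← Complex.exp_add, hP.μp_zero]; congr 1; push_cast; ring
  have h3 : Complex.exp (Complex.I * l * ((-(2 * P.μp 0) : ℝ) : ℂ)) =
      Complex.exp (-(2 * Complex.I * l * P.μp 0)) := by
    congr 1; push_cast; ring
  rw [Sap, Hp, h2, h3, div_eq_iff hden, add_mul, mul_assoc _ (_ / _) (1 + _),
    div_mul_cancel₀ _ hden]
  linear_combination (-(P.τ : ℂ) ^ 2 * r * Complex.exp (-(2 * Complex.I * l * P.μp 0))) * h1

lemma Admissible.differentiableOn_Hp (hP : P.Admissible) {r : ℝ} (hr : |r| ≤ 1) :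
    DifferentiableOn ℂ (P.Hp r) {z | 0 ≤ z.im} := by
  intro z hz
  have := hP.den_ne_zero hr hz
  unfold wexp at this
  unfold Hp wexp
  exact DifferentiableAt.differentiableWithinAt (by fun_prop (disch := assumption))

lemma Admissible.norm_Hp_le (hP : P.Admissible) {r : ℝ} (hr : |r| ≤ 1) {z : ℂ} (hz : 0 ≤ z.im) :
    ‖P.Hp r z‖ ≤ 2 / (1 - |P.τ|) * Real.exp (z.im * (2 * P.μp 0)) := by
  have hτ := hP.abs_τ_lt
  rw [Hp, norm_mul, norm_exp_I_mul, mul_neg, neg_neg, mul_comm, norm_div]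
  refine mul_le_mul_of_nonneg_right ?_ (Real.exp_pos _).le
  refine div_le_div₀ zero_le_two ?_ (by linarith) (hP.norm_den_ge hr hz)
  rw [norm_mul, Complex.norm_real, Real.norm_eq_abs]
  have h1 : ‖(1 : ℂ) - (P.τ : ℂ) ^ 2‖ ≤ 2 := by
    refine (norm_sub_le _ _).trans ?_
    rw [norm_one, norm_pow, Complex.norm_real, Real.norm_eq_abs]
    nlinarith [abs_nonneg P.τ]
  nlinarith [norm_nonneg ((1 : ℂ) - (P.τ : ℂ) ^ 2), abs_nonneg r]

lemma Admissible.measurable_Hp (hP : P.Admissible) {r : ℝ} (hr : |r| ≤ 1) :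
    Continuous fun l : ℝ => P.Hp r l :=
  (hP.differentiableOn_Hp hr).continuousOn.comp_continuous (by fun_prop) (by simp)

/-- `Hp` grows at most like exp(2μ⁺(0) Im z), so it has no Fourier content to the right of 2μ⁺(0).
This singles out the half-line on which F_{0s} is considered. -/
lemma Admissible.hasInt_Hp (hP : P.Admissible) {r : ℝ} (hr : |r| ≤ 1) {ψ : ℝ → ℂ}
    (hψ : IsTest (2 * P.μp 0) ψ) : HasInt (fun l : ℝ => P.Hp r l * lap ψ l) 0 := by
  refine ⟨hψ.integrable_mul_lap (C := 2 / (1 - |P.τ|)) (hP.measurable_Hp hr).aestronglyMeasurable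
    fun l => ?_, hψ.integral_mul_lap_eq_zero ((hP.differentiableOn_Hp hr).mono
      upper_subset) (hP.differentiableOn_Hp hr).continuousOn fun z hz => hP.norm_Hp_le hr hz.le⟩
  have := hP.norm_Hp_le hr (z := (l : ℂ)) (by simp)
  simpa using this

/-- A locally integrable function is determined almost everywhere by its pairing with test
functions. Hence the main equation for one representative of F_{0s} gives it for all. -/
lemma isInverseFourierOn_unique {g : ℝ → ℂ} {U : Set ℝ} (hU : IsOpen U) {f₁ f₂ : ℝ → ℂ}
    (h₁ : IsInverseFourierOn g U f₁) (h₂ : IsInverseFourierOn g U f₂) :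
    ∀ᵐ x, x ∈ U → f₁ x = f₂ x := by
  have hint : ∀ (f : ℝ → ℂ), LocallyIntegrableOn f U → ∀ φ : ℝ → ℝ, ContDiff ℝ ∞ φ →
      HasCompactSupport φ → tsupport φ ⊆ U → Integrable fun x => φ x • f x := by
    intro f hf φ h1 h2 h3
    have hK : IntegrableOn f (tsupport φ) := hf.integrableOn_compact_subset h3 h2
    rw [← integrableOn_iff_integrable_of_support_subset (s := tsupport φ)]
    · exact hK.continuousOn_smul h1.continuous.continuousOn h2
    · intro x hx
      refine subset_tsupport _ fun h0 => hx ?_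
      simp [h0]
  have := hU.ae_eq_zero_of_integral_contDiff_smul_eq_zero (f := fun x => f₁ x - f₂ x)
    (h₁.1.sub h₂.1) fun φ h1 h2 h3 => by
      have hφ1 : ContDiff ℝ ∞ fun x => (φ x : ℂ) := Complex.ofRealCLM.contDiff.comp h1
      have hφ2 : HasCompactSupport fun x => (φ x : ℂ) := h2.comp_left (g := fun t : ℝ => (t : ℂ))
        Complex.ofReal_zero
      have hφ3 : tsupport (fun x => (φ x : ℂ)) ⊆ U :=
        (tsupport_comp_subset (g := fun t : ℝ => (t : ℂ)) Complex.ofReal_zero φ).trans h3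
      simp_rw [smul_sub]
      rw [integral_sub (hint f₁ h₁.1 φ h1 h2 h3) (hint f₂ h₂.1 φ h1 h2 h3), sub_eq_zero]
      have e1 := h₁.2 _ hφ1 hφ2 hφ3
      rw [← h₂.2 _ hφ1 hφ2 hφ3] at e1
      simpa only [Complex.real_smul, mul_comm] using e1
  filter_upwards [this] with x hx hxU using sub_eq_zero.1 (hx hxU)

/-- The square integrable function that represents `F_{0s}`. -/
lemma IsLeading.exists_isF₀s (hP : P.Admissible) (he : P.IsJostSolution e)
    (hK : P.IsJostKernel e K) {d : ℕ} {p : ℂ} {r : ℝ} (hL : P.IsLeading d p r) :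
    ∃ f : ℝ → ℂ, StronglyMeasurable f ∧ MemLp f 2 ∧ (∀ (c : ℝ) (ψ : ℝ → ℂ), IsTest c ψ →
      ∀ s : ℝ, ∫ l : ℝ, (P.Sap r l - P.S e l) * (Complex.exp (Complex.I * l * s) * lap ψ l) =
        2 * Real.pi * ∫ y : ℝ, f (y + s) * ψ y) ∧ P.IsF₀s e f := by
  obtain ⟨f, hf, hf2, h⟩ := exists_inverse_fourier (hL.memLp_sub hP he hK)
  refine ⟨f, hf, hf2, h, (hf2.locallyIntegrable one_le_two).locallyIntegrableOn _,
    fun φ h1 h2 h3 => ?_⟩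
  have hφ : IsTest (2 * P.μp 0) φ := ⟨h1, h2, h3⟩
  set s : ℝ := if P.β₂ = 0 then 1 else -1 with hs
  have hs1 : |s| ≤ 1 := by rw [hs]; split_ifs <;> simp
  have hR : HasInt (fun l : ℝ => (P.Sap r l - P.S e l) * lap φ l)
      (2 * Real.pi * ∫ y : ℝ, f y * φ y) := by
    have h0 := h _ φ hφ 0
    simp only [Complex.ofReal_zero, mul_zero, Complex.exp_zero, one_mul, add_zero] at h0
    exact ⟨hφ.integrable_mul_lap (C := 2 / (1 - |P.τ|) + 1)
      ((P.measurable_Sap r).sub (hK.measurable_S hP he)).aestronglyMeasurable fun l =>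
        (norm_sub_le _ _).trans (add_le_add (hP.norm_Sap_le hL.abs_le l) (he.norm_S_le hP l)), h0⟩
  have htot : HasInt (fun l : ℝ => (P.S₀ l - P.S e l) * lap φ l)
      (0 - 0 + 2 * Real.pi * ∫ y : ℝ, f y * φ y) := by
    -- S₀ and `Sap r` share the term τ exp(-2ial); they differ by `Hp` terms, which vanish against
    -- φ.
    refine (((hP.hasInt_Hp hs1 hφ).sub (hP.hasInt_Hp hL.abs_le hφ)).add hR).congr fun l => ?_
    rw [hP.S₀_eq, ← hs, hP.Sap_eq hs1, hP.Sap_eq hL.abs_le]; ring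
  have := htot.2
  rw [sub_zero, zero_add] at this
  rw [show ∫ l : ℝ, (P.S₀ l - P.S e l) * ∫ x : ℝ, φ x * Complex.exp (Complex.I * l * x) =
    ∫ l : ℝ, (P.S₀ l - P.S e l) * lap φ l from rfl, this]
  have hπ : (Real.pi : ℂ) ≠ 0 := by exact_mod_cast Real.pi_ne_zero
  push_cast
  field_simp

/-- The coefficients in the definition of `e₀`. -/
def cp (P : SLProblem) (x : ℝ) : ℝ := 1 / 2 * (1 + 1 / √(P.ρ x))

def cm (P : SLProblem) (x : ℝ) : ℝ := 1 / 2 * (1 - 1 / √(P.ρ x))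

lemma e₀_eq (P : SLProblem) (x : ℝ) (z : ℂ) :
    P.e₀ x z = P.cp x * Complex.exp (Complex.I * z * (P.μp x : ℂ)) +
      P.cm x * Complex.exp (Complex.I * z * (P.μm x : ℂ)) := rfl

lemma μp_add_μm (P : SLProblem) (x : ℝ) : P.μp x + P.μm x = 2 * P.a := by
  rw [μp, μm]; ring

/-- For x < a the coefficients of e₀ have ratio τ, and y ↦ 2a - y exchanges μ⁺(x) and μ⁻(x); this
cancels the point masses in the main equation. For x ≥ a they lie outside the support of the test
functions. -/
lemma Admissible.coef_cases (hP : P.Admissible) (x : ℝ) :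
    (P.cm x = P.τ * P.cp x ∧ P.μp x ≤ P.μm x) ∨ (P.cm x = 0 ∧ P.a ≤ P.μp x) := by
  rcases lt_or_ge x P.a with h | h
  · refine Or.inl ⟨?_, ?_⟩
    · have h1 := hP.α_pos
      have h2 : P.α + 1 ≠ 0 := by linarith
      rw [cm, cp, τ, hP.sqrt_ρ_of_lt h]
      field_simp
    · rw [hP.μp_of_le h.le, hP.μm_of_lt h]
      nlinarith [hP.α_pos]
  · exact Or.inr ⟨by rw [cm, sqrt_ρ_of_ge h]; norm_num, by rw [μp_of_ge h]; exact h⟩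

/-- The kernel, extended by zero. -/
def Kz (P : SLProblem) (K : ℝ → ℝ → ℂ) (x : ℝ) : ℝ → ℂ := (Ioi (P.μp x)).indicator (K x)

lemma IsJostKernel.integrable_Kz (hK : P.IsJostKernel e K) {x : ℝ} (hx : 0 ≤ x) :
    Integrable (P.Kz K x) := (hK.integrable x hx).integrable_indicator measurableSet_Ioi

lemma Kz_mul (P : SLProblem) (K : ℝ → ℝ → ℂ) (x : ℝ) (g : ℝ → ℂ) :
    (fun t => P.Kz K x t * g t) = (Ioi (P.μp x)).indicator fun t => K x t * g t := by
  ext t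
  by_cases h : t ∈ Ioi (P.μp x) <;> simp [Kz, h]

lemma integral_Kz_mul (P : SLProblem) (K : ℝ → ℝ → ℂ) (x : ℝ) (g : ℝ → ℂ) :
    ∫ t, P.Kz K x t * g t = ∫ t in Ioi (P.μp x), K x t * g t := by
  rw [Kz_mul, integral_indicator measurableSet_Ioi]

lemma IsJostKernel.eq_add (hK : P.IsJostKernel e K) {x : ℝ} (hx : 0 ≤ x) {z : ℂ} (hz : 0 ≤ z.im) :
    e x z = P.cp x * Complex.exp (Complex.I * z * (P.μp x : ℂ)) +
      P.cm x * Complex.exp (Complex.I * z * (P.μm x : ℂ)) +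
      ∫ t, P.Kz K x t * Complex.exp (Complex.I * z * (t : ℂ)) := by
  rw [hK.representation x hx z hz, e₀_eq, integral_Kz_mul]

/-- The product grows at most like exp(Im z (2μ⁺(0) - μ⁺(x))), and μ⁺(0) ≤ μ⁺(x) turns this into the
admissible exp(Im z μ⁺(x)). -/
lemma IsJostKernel.hasInt_Hp_mul (hP : P.Admissible) (hK : P.IsJostKernel e K) {r : ℝ}
    (hr : |r| ≤ 1) {x : ℝ} (hx : 0 ≤ x) {ψ : ℝ → ℂ} (hψ : IsTest (P.μp x) ψ) :
    HasInt (fun l : ℝ => P.Hp r l * e x l * lap ψ l) 0 := by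
  obtain ⟨C, hC⟩ := hK.exists_bound_real hx
  constructor
  · refine hψ.integrable_mul_lap (C := 2 / (1 - |P.τ|) * C)
      ((hP.measurable_Hp hr).mul (hK.continuous_real hx)).aestronglyMeasurable fun l => ?_
    have := hP.norm_Hp_le hr (z := (l : ℂ)) (by simp)
    simp only [Complex.ofReal_im, zero_mul, Real.exp_zero, mul_one] at this
    rw [norm_mul]
    exact mul_le_mul this (hC l) (norm_nonneg _) ((norm_nonneg _).trans this)
  · refine hψ.integral_mul_lap_eq_zero (F := fun z => P.Hp r z * e x z)
      (C := 2 / (1 - |P.τ|) * (|P.cp x| + |P.cm x| + ∫ t in Ioi (P.μp x), ‖K x t‖))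
      (((hP.differentiableOn_Hp hr).mono upper_subset).mul (hK.differentiableOn hx))
      ((hP.differentiableOn_Hp hr).continuousOn.mul (hK.continuousOn hx)) fun z hz => ?_
    have h1 := hP.norm_Hp_le hr hz.le
    have h2 : ‖e x z‖ ≤ (|P.cp x| + |P.cm x| + ∫ t in Ioi (P.μp x), ‖K x t‖) *
        Real.exp (-(z.im * P.μp x)) := by
      rw [hK.representation x hx z hz.le, e₀_eq]
      have a1 := norm_laplace_le (hK.integrable x hx) hz.le
      have a2 : ‖(P.cp x : ℂ) * Complex.exp (Complex.I * z * (P.μp x : ℂ))‖ =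
          |P.cp x| * Real.exp (-(z.im * P.μp x)) := by
        rw [norm_mul, norm_exp_I_mul, Complex.norm_real, Real.norm_eq_abs]
      have a3 : ‖(P.cm x : ℂ) * Complex.exp (Complex.I * z * (P.μm x : ℂ))‖ ≤
          |P.cm x| * Real.exp (-(z.im * P.μp x)) := by
        rw [norm_mul, norm_exp_I_mul, Complex.norm_real, Real.norm_eq_abs]
        rcases hP.coef_cases x with h | h
        · have := h.2
          gcongr
        · rw [h.1]; simp
      refine (norm_add₃_le).trans ?_
      linarith
    have h3 : Real.exp (z.im * (2 * P.μp 0)) * Real.exp (-(z.im * P.μp x)) ≤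
        Real.exp (z.im * P.μp x) := by
      rw [← Real.exp_add, Real.exp_le_exp]
      nlinarith [mul_le_mul_of_nonneg_left (hP.μp_zero_le hx) hz.le]
    rw [norm_mul]
    refine (mul_le_mul h1 h2 (norm_nonneg _) ((norm_nonneg _).trans h1)).trans ?_
    have hB : 0 ≤ 2 / (1 - |P.τ|) * (|P.cp x| + |P.cm x| + ∫ t in Ioi (P.μp x), ‖K x t‖) := by
      have := integral_nonneg (μ := volume.restrict (Ioi (P.μp x))) (f := fun t => ‖K x t‖)
        fun _ => norm_nonneg _
      have := hP.abs_τ_lt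
      exact mul_nonneg (div_nonneg zero_le_two (by linarith)) (by positivity)
    refine le_trans (le_of_eq ?_) (mul_le_mul_of_nonneg_left h3 hB)
    ring

end SLProblem

end

/-! ### The main equation against test functions and almost everywhere -/

noncomputable section

lemma IsTest.hasInt_exp {c : ℝ} {ψ : ℝ → ℂ} (h : IsTest c ψ) (s : ℝ) :
    HasInt (fun l : ℝ => Complex.exp (Complex.I * l * s) * lap ψ l) (2 * Real.pi * ψ (-s)) := by
  refine ⟨h.integrable_mul_lap (C := 1) (Continuous.aestronglyMeasurable (by fun_prop))
    fun l => ?_, ?_⟩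
  · rw [norm_exp_I_mul]; simp
  · rw [← h.inversion]
    congr 1; ext l
    rw [show -(Complex.I * (l : ℂ) * ((-s : ℝ) : ℂ)) = Complex.I * l * s by push_cast; ring]

lemma IsTest.memLp_two {c : ℝ} {ψ : ℝ → ℂ} (h : IsTest c ψ) : MemLp ψ 2 :=
  h.smooth.continuous.memLp_of_hasCompactSupport h.compact

/-- Integrals of a convolution against a weight. -/
lemma hasInt_conv {f w k : ℝ → ℂ} (hf : StronglyMeasurable f) (hf2 : MemLp f 2)
    (hw : StronglyMeasurable w) (hw2 : MemLp w 2) (hk : Integrable k) :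
    HasInt (fun y => (∫ t, k t * f (t + y)) * w y) (∫ t, k t * ∫ y, f (y + t) * w y) := by
  have h1 := integrable_conv hf hf2 hw hw2 hk
  have h2 : ∀ y, ∫ t, w y * (k t * f (t + y)) = (∫ t, k t * f (t + y)) * w y := fun y => by
    rw [integral_const_mul, mul_comm]
  have h3 := integral_integral_swap (f := fun y t => w y * (k t * f (t + y))) h1
  refine ⟨h1.integral_prod_left.congr (.of_forall h2), ?_⟩
  simp_rw [h2] at h3
  rw [h3]
  congr 1; ext t
  rw [← integral_const_mul]
  congr 1; ext y
  rw [add_comm t y]; ring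

namespace SLProblem

variable {P : SLProblem} {e : ℝ → ℂ → ℂ} {K : ℝ → ℝ → ℂ}

/-- The main equation, tested against `ψ`. -/
lemma IsJostKernel.weak_equation (hP : P.Admissible) (he : P.IsJostSolution e)
    (hK : P.IsJostKernel e K)
    (hβ : ∀ κ ∈ P.eigenvalues e, P.β₀ - P.β₁ * κ - P.β₂ * κ ^ 2 ≠ 0)
    {r : ℝ} (hr : |r| ≤ 1) {f : ℝ → ℂ} (hf : StronglyMeasurable f) (hf2 : MemLp f 2)
    (hF : ∀ (c : ℝ) (ψ : ℝ → ℂ), IsTest c ψ →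
      ∀ s : ℝ, ∫ l : ℝ, (P.Sap r l - P.S e l) * (Complex.exp (Complex.I * l * s) * lap ψ l) =
        2 * Real.pi * ∫ y : ℝ, f (y + s) * ψ y)
    {x : ℝ} (hx : 0 ≤ x) {ψ : ℝ → ℂ} (hψ : IsTest (P.μp x) ψ) :
    (P.cp x * ∫ y, f (y + P.μp x) * ψ y) + (P.cm x * ∫ y, f (y + P.μm x) * ψ y) +
      (∫ y, (∫ t, P.Kz K x t * f (t + y)) * ψ y) + (∫ y, P.Kz K x y * ψ y) -
      P.τ * (∫ y, P.Kz K x (2 * P.a - y) * ψ y) +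
      ∑ᶠ κ ∈ P.eigenvalues e, (P.normSq e κ : ℂ) * e x (Complex.I * κ) * lap ψ (Complex.I * κ) =
      0 := by
  have hk := hK.integrable_Kz hx
  set k := P.Kz K x with hkd
  set π2 : ℂ := 2 * Real.pi with hπ2
  have hπ : π2 ≠ 0 := mul_ne_zero two_ne_zero (by exact_mod_cast Real.pi_ne_zero)
  have hlap : Integrable fun l : ℝ => lap ψ l := by
    have := hψ.integrable_mul_lap (g := fun _ => 1) (C := 1) aestronglyMeasurable_const (by simp)
    simpa using this
  have hRmeas : AEStronglyMeasurable (fun l => P.Sap r l - P.S e l) :=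
    ((P.measurable_Sap r).sub (hK.measurable_S hP he)).aestronglyMeasurable
  have hRb : ∀ l, ‖P.Sap r l - P.S e l‖ ≤ 2 / (1 - |P.τ|) + 1 := fun l =>
    (norm_sub_le _ _).trans (add_le_add (hP.norm_Sap_le hr l) (he.norm_S_le hP l))
  -- The term e(x, -l): it gives K(x, y) and the point masses of e₀.
  have hA1 : HasInt (fun l : ℝ => e x (-l) * lap ψ l)
      (P.cp x * (π2 * ψ (P.μp x)) + P.cm x * (π2 * ψ (P.μm x)) + π2 * ∫ t, k t * ψ t) := by
    have h1 := (hψ.hasInt_exp (-P.μp x)).const_mul (P.cp x)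
    have h2 := (hψ.hasInt_exp (-P.μm x)).const_mul (P.cm x)
    rw [neg_neg] at h1 h2
    have h3 : HasInt (fun l : ℝ => (∫ t : ℝ, k t * Complex.exp (Complex.I * ((-1) * l : ℝ) * t)) *
        lap ψ l) (π2 * ∫ t, k t * ψ t) := by
      have h := integral_mul_fourier hlap hk (-1)
      refine ⟨h.1, h.2.trans ?_⟩
      rw [← integral_const_mul]
      congr 1; ext t
      rw [(hψ.hasInt_exp (-1 * t)).2, neg_one_mul, neg_neg]; ring
    refine ((h1.add h2).add h3).congr fun l => ?_
    rw [hK.eq_add hx (z := -(l : ℂ)) (by simp), ← hkd]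
    push_cast
    ring_nf
  -- The exponential part of S: it gives K(x, 2a - y) and the reflected point masses.
  have hA2 : HasInt (fun l : ℝ => Complex.exp (Complex.I * l * ((-(2 * P.a) : ℝ) : ℂ)) * e x l *
      lap ψ l) (P.cp x * (π2 * ψ (2 * P.a - P.μp x)) + P.cm x * (π2 * ψ (2 * P.a - P.μm x)) +
        π2 * ∫ t, k t * ψ (2 * P.a - t)) := by
    have h1 := (hψ.hasInt_exp (P.μp x - 2 * P.a)).const_mul (P.cp x)
    have h2 := (hψ.hasInt_exp (P.μm x - 2 * P.a)).const_mul (P.cm x)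
    rw [neg_sub] at h1 h2
    have h3 : HasInt (fun l : ℝ => (∫ t : ℝ, k t * Complex.exp (Complex.I * (1 * l : ℝ) * t)) *
        (Complex.exp (Complex.I * l * ((-(2 * P.a) : ℝ) : ℂ)) * lap ψ l))
        (π2 * ∫ t, k t * ψ (2 * P.a - t)) := by
      have h := integral_mul_fourier (hψ.hasInt_exp (-(2 * P.a))).1 hk 1
      refine ⟨h.1, h.2.trans ?_⟩
      rw [← integral_const_mul]
      congr 1; ext t
      have h4 := (hψ.hasInt_exp (t - 2 * P.a)).2
      rw [neg_sub] at h4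
      have h5 : ∫ l : ℝ, Complex.exp (Complex.I * l * ((1 * t : ℝ) : ℂ)) *
          (Complex.exp (Complex.I * l * ((-(2 * P.a) : ℝ) : ℂ)) * lap ψ l) =
          π2 * ψ (2 * P.a - t) := by
        rw [← h4]
        congr 1; ext l
        rw [← mul_assoc, ← Complex.exp_add]
        congr 2
        push_cast; ring
      rw [h5]; ring
    refine ((h1.add h2).add h3).congr fun l => ?_
    have e1 : ∀ s : ℝ, Complex.exp (Complex.I * l * ((s - 2 * P.a : ℝ) : ℂ)) =
        Complex.exp (Complex.I * l * ((-(2 * P.a) : ℝ) : ℂ)) * Complex.exp (Complex.I * l * s) :=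
      fun s => by rw [← Complex.exp_add]; congr 1; push_cast; ring
    rw [hK.eq_add hx (z := (l : ℂ)) (by simp), e1, e1, one_mul]
    ring
  -- The square integrable part of S: it gives the terms with f.
  have hA3 : HasInt (fun l : ℝ => (P.Sap r l - P.S e l) * e x l * lap ψ l)
      (P.cp x * (π2 * ∫ y, f (y + P.μp x) * ψ y) + P.cm x * (π2 * ∫ y, f (y + P.μm x) * ψ y) +
        π2 * ∫ y, (∫ t, k t * f (t + y)) * ψ y) := by
    have hs : ∀ s : ℝ, HasInt (fun l : ℝ => (P.Sap r l - P.S e l) *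
        (Complex.exp (Complex.I * l * s) * lap ψ l)) (π2 * ∫ y, f (y + s) * ψ y) := fun s =>
      ⟨(hψ.hasInt_exp s).1.bdd_mul hRmeas (.of_forall hRb), hF _ ψ hψ s⟩
    have h3 : HasInt (fun l : ℝ => (∫ t : ℝ, k t * Complex.exp (Complex.I * (1 * l : ℝ) * t)) *
        ((P.Sap r l - P.S e l) * lap ψ l)) (π2 * ∫ y, (∫ t, k t * f (t + y)) * ψ y) := by
      have h := integral_mul_fourier (hlap.bdd_mul hRmeas (.of_forall hRb)) hk 1
      refine ⟨h.1, h.2.trans ?_⟩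
      rw [(hasInt_conv hf hf2 hψ.smooth.continuous.stronglyMeasurable hψ.memLp_two hk).2,
        ← integral_const_mul]
      congr 1; ext t
      have h5 : ∫ l : ℝ, Complex.exp (Complex.I * l * ((1 * t : ℝ) : ℂ)) *
          ((P.Sap r l - P.S e l) * lap ψ l) = π2 * ∫ y, f (y + t) * ψ y := by
        rw [← (hs t).2, one_mul]
        congr 1; ext l; ring
      rw [h5]; ring
    refine ((((hs (P.μp x)).const_mul (P.cp x)).add ((hs (P.μm x)).const_mul (P.cm x))).add
      h3).congr fun l => ?_
    rw [hK.eq_add hx (z := (l : ℂ)) (by simp), one_mul]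
    ring
  have htot := ((hA1.add hA3).sub (hA2.const_mul P.τ)).sub (hK.hasInt_Hp_mul hP hr hx hψ)
  have hcont := (hK.contour hP he hβ hx hψ).2
  have heq : ∀ l : ℝ, e x (-l) * lap ψ l + (P.Sap r l - P.S e l) * e x l * lap ψ l -
      P.τ * (Complex.exp (Complex.I * l * ((-(2 * P.a) : ℝ) : ℂ)) * e x l * lap ψ l) -
      P.Hp r l * e x l * lap ψ l = (e x (-l) - P.S e l * e x l) * lap ψ l := fun l => by
    rw [hP.Sap_eq hr]; ring
  have hval := (htot.congr heq).2
  rw [hcont] at hval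
  have hrefl : ∫ t, k t * ψ (2 * P.a - t) = ∫ y, k (2 * P.a - y) * ψ y := by
    rw [← integral_sub_left_eq_self _ volume (2 * P.a)]
    simp
  -- All point masses cancel or lie where ψ vanishes.
  have hdelta : (P.cp x : ℂ) * ψ (P.μp x) + P.cm x * ψ (P.μm x) -
      P.τ * (P.cp x * ψ (2 * P.a - P.μp x) + P.cm x * ψ (2 * P.a - P.μm x)) = 0 := by
    have h0 : ψ (P.μp x) = 0 := hψ.eq_zero le_rfl
    have h1 : 2 * P.a - P.μm x = P.μp x := by linarith [P.μp_add_μm x]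
    have h2 : 2 * P.a - P.μp x = P.μm x := by linarith [P.μp_add_μm x]
    rw [h1, h2, h0]
    rcases hP.coef_cases x with h | h
    · rw [h.1]; push_cast; ring
    · have h3 : ψ (P.μm x) = 0 := hψ.eq_zero (by linarith [P.μp_add_μm x, h.2])
      rw [h3]; ring
  rw [hrefl] at hval
  refine (mul_eq_zero.1 (?_ : π2 * _ = 0)).resolve_left hπ
  linear_combination (-1 : ℂ) * hval - π2 * hdelta

/-- The main equation with the square integrable representative of `F_{0s}`. -/
lemma IsJostKernel.ae_equation (hP : P.Admissible) (he : P.IsJostSolution e)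
    (hK : P.IsJostKernel e K)
    (hβ : ∀ κ ∈ P.eigenvalues e, P.β₀ - P.β₁ * κ - P.β₂ * κ ^ 2 ≠ 0)
    {r : ℝ} (hr : |r| ≤ 1) {f : ℝ → ℂ} (hf : StronglyMeasurable f) (hf2 : MemLp f 2)
    (hF : ∀ (c : ℝ) (ψ : ℝ → ℂ), IsTest c ψ →
      ∀ s : ℝ, ∫ l : ℝ, (P.Sap r l - P.S e l) * (Complex.exp (Complex.I * l * s) * lap ψ l) =
        2 * Real.pi * ∫ y : ℝ, f (y + s) * ψ y)
    {x : ℝ} (hx : 0 ≤ x) :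
    (∀ᵐ y : ℝ, Integrable fun t => P.Kz K x t * f (t + y)) ∧
    ∀ᵐ y : ℝ, y ∈ Ioi (P.μp x) →
      P.cp x * f (y + P.μp x) + P.cm x * f (y + P.μm x) + (∫ t, P.Kz K x t * f (t + y)) +
        P.Kz K x y - P.τ * P.Kz K x (2 * P.a - y) +
        ∑ᶠ κ ∈ P.eigenvalues e, (P.normSq e κ : ℂ) * e x (Complex.I * κ) * Real.exp (-(κ * y)) =
      0 := by
  have hk := hK.integrable_Kz hx
  have hfin := hK.finite_eigenvalues hP he hβ
  -- A nowhere vanishing square integrable weight. It gives integrability of the kernel integral for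
  -- almost every y and local integrability of its value in y.
  set w : ℝ → ℂ := fun y => (((1 + y ^ 2)⁻¹ : ℝ) : ℂ) with hw
  have hw0 : ∀ y, w y ≠ 0 := fun y => by
    have : (1 + y ^ 2)⁻¹ ≠ 0 := by positivity
    exact Complex.ofReal_ne_zero.2 this
  have hwc : Continuous w := by
    refine Complex.continuous_ofReal.comp (Continuous.inv₀ (by fun_prop) fun y => ?_)
    positivity
  have hw2 : MemLp w 2 := by
    refine (memLp_two_iff_integrable_sq_norm hwc.aestronglyMeasurable).2 ?_
    refine integrable_inv_one_add_sq.mono' (by fun_prop) (.of_forall fun y => ?_)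
    have h1 : (1 + y ^ 2)⁻¹ ≤ 1 := inv_le_one_of_one_le₀ (by nlinarith [sq_nonneg y])
    have h2 : 0 ≤ (1 + y ^ 2)⁻¹ := by positivity
    rw [Real.norm_of_nonneg (by positivity), hw]
    beta_reduce
    rw [Complex.norm_real, Real.norm_of_nonneg h2]
    nlinarith
  have hconv := integrable_conv hf hf2 hwc.stronglyMeasurable hw2 hk
  refine ⟨?_, ?_⟩
  · filter_upwards [hconv.prod_right_ae] with y hy
    have := hy.const_mul (w y)⁻¹
    refine this.congr (.of_forall fun t => ?_)
    exact inv_mul_cancel_left₀ (hw0 y) _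
  have hfl : ∀ s : ℝ, LocallyIntegrable fun y => f (y + s) := fun s =>
    (hf2.comp_measurePreserving (measurePreserving_add_right volume s)).locallyIntegrable
      one_le_two
  have hcl : LocallyIntegrable fun y => ∫ t, P.Kz K x t * f (t + y) := by
    have h1 := (hasInt_conv hf hf2 hwc.stronglyMeasurable hw2 hk).1.locallyIntegrable
    have h2 : LocallyIntegrable fun y => (w y)⁻¹ * ((∫ t, P.Kz K x t * f (t + y)) * w y) := by
      rw [← locallyIntegrableOn_univ] at h1 ⊢
      exact h1.continuousOn_mul (hwc.inv₀ hw0).continuousOn isOpen_univ.isLocallyClosed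
    refine h2.congr (.of_forall fun y => ?_)
    have := hw0 y
    field_simp
  have hkr : Integrable fun y => P.Kz K x (2 * P.a - y) := hk.comp_sub_left (2 * P.a)
  simp_rw [finsum_mem_eq_finite_toFinset_sum _ hfin]
  set T := hfin.toFinset with hT
  set G : ℝ → ℂ := fun y => ∑ κ ∈ T, (P.normSq e κ : ℂ) * e x (Complex.I * κ) *
    Real.exp (-(κ * y)) with hG
  have hGl : LocallyIntegrable G := Continuous.locallyIntegrable (by fun_prop)
  set H : ℝ → ℂ := fun y => P.cp x * f (y + P.μp x) + P.cm x * f (y + P.μm x) +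
    (∫ t, P.Kz K x t * f (t + y)) + P.Kz K x y - P.τ * P.Kz K x (2 * P.a - y) + G y with hH
  have hHl : LocallyIntegrable H :=
    ((((((hfl (P.μp x)).smul (P.cp x : ℂ)).add ((hfl (P.μm x)).smul (P.cm x : ℂ))).add hcl).add
      hk.locallyIntegrable).sub (hkr.locallyIntegrable.smul (P.τ : ℂ))).add hGl
  refine isOpen_Ioi.ae_eq_zero_of_integral_contDiff_smul_eq_zero (f := H)
    (hHl.locallyIntegrableOn _) fun φ h1 h2 h3 => ?_
  set ψ : ℝ → ℂ := fun y => (φ y : ℂ) with hψd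
  have hψ : IsTest (P.μp x) ψ := ⟨Complex.ofRealCLM.contDiff.comp h1,
    h2.comp_left (g := fun t : ℝ => (t : ℂ)) Complex.ofReal_zero,
    (tsupport_comp_subset (g := fun t : ℝ => (t : ℂ)) Complex.ofReal_zero φ).trans h3⟩
  have hloc : ∀ g : ℝ → ℂ, LocallyIntegrable g → HasInt (fun y => g y * ψ y) (∫ y, g y * ψ y) :=
    fun g hg => by
      refine ⟨?_, rfl⟩
      have := hg.integrable_smul_right_of_hasCompactSupport hψ.smooth.continuous hψ.compact
      exact this
  have hsum : HasInt (fun y => G y * ψ y) (∑ κ ∈ T, (P.normSq e κ : ℂ) * e x (Complex.I * κ) *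
      lap ψ (Complex.I * κ)) := by
    have : ∀ κ ∈ T, HasInt (fun y => (P.normSq e κ : ℂ) * e x (Complex.I * κ) *
        (ψ y * Complex.exp (Complex.I * (Complex.I * κ) * y)))
        ((P.normSq e κ : ℂ) * e x (Complex.I * κ) * lap ψ (Complex.I * κ)) := fun κ _ =>
      HasInt.const_mul ⟨(hψ.smooth.continuous.mul (by fun_prop)).integrable_of_hasCompactSupport
        hψ.compact.mul_right, rfl⟩ _
    refine (HasInt.sum this).congr fun y => ?_
    rw [hG, Finset.sum_mul]
    refine Finset.sum_congr rfl fun κ _ => ?_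
    rw [← mul_assoc Complex.I, Complex.I_mul_I]
    push_cast
    ring_nf
  have htot := ((((((hloc _ (hfl (P.μp x))).const_mul (P.cp x)).add
    ((hloc _ (hfl (P.μm x))).const_mul (P.cm x))).add (hloc _ hcl)).add
    (hloc _ hk.locallyIntegrable)).sub ((hloc _ hkr.locallyIntegrable).const_mul P.τ)).add hsum
  have hweak := hK.weak_equation hP he hβ hr hf hf2 hF hx hψ
  rw [finsum_mem_eq_finite_toFinset_sum _ hfin] at hweak
  have hfinal : HasInt (fun y => φ y • H y) 0 := by
    rw [← hweak]
    refine htot.congr fun y => ?_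
    rw [hH, Complex.real_smul]
    ring
  exact hfinal.2

end SLProblem

end

/-! ### The discrete spectrum and the conclusion -/

noncomputable section

lemma ae_comp_add_right {p : ℝ → Prop} (h : ∀ᵐ x, p x) (s : ℝ) : ∀ᵐ y, p (y + s) :=
  (measurePreserving_add_right volume s).quasiMeasurePreserving.ae h

namespace SLProblem

variable {P : SLProblem} {e : ℝ → ℂ → ℂ} {K : ℝ → ℝ → ℂ}

lemma exp_I_mul_I (κ t : ℝ) :
    Complex.exp (Complex.I * (Complex.I * κ) * (t : ℂ)) = Real.exp (-(κ * t)) := by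
  rw [← mul_assoc, Complex.I_mul_I]
  push_cast
  ring_nf

/-- Contribution of the discrete spectrum to the integral in the main equation. -/
lemma IsJostKernel.hasInt_eigenvalues (hK : P.IsJostKernel e K) {x : ℝ} (hx : 0 ≤ x)
    (T : Finset ℝ) (hT : ∀ κ ∈ T, 0 < κ) (m : ℝ → ℝ) (y : ℝ) :
    IntegrableOn (fun t => K x t * ∑ κ ∈ T, ((m κ * Real.exp (-(κ * (t + y))) : ℝ) : ℂ))
      (Ioi (P.μp x)) ∧
    ∫ t in Ioi (P.μp x), K x t * ∑ κ ∈ T, ((m κ * Real.exp (-(κ * (t + y))) : ℝ) : ℂ) =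
      ∑ κ ∈ T, (m κ : ℂ) * (e x (Complex.I * κ) - P.e₀ x (Complex.I * κ)) *
        Real.exp (-(κ * y)) := by
  have hz : ∀ κ ∈ T, 0 ≤ (Complex.I * (κ : ℂ)).im := fun κ hκ => by simpa using (hT κ hκ).le
  have heq : (fun t => K x t * ∑ κ ∈ T, ((m κ * Real.exp (-(κ * (t + y))) : ℝ) : ℂ)) =
      fun t => ∑ κ ∈ T, ((m κ : ℂ) * Real.exp (-(κ * y))) *
        (K x t * Complex.exp (Complex.I * (Complex.I * κ) * (t : ℂ))) := by
    ext t
    rw [Finset.mul_sum]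
    refine Finset.sum_congr rfl fun κ _ => ?_
    rw [exp_I_mul_I, mul_add, neg_add, Real.exp_add]
    push_cast
    ring
  have hint : ∀ κ ∈ T, IntegrableOn (fun t => ((m κ : ℂ) * Real.exp (-(κ * y))) *
      (K x t * Complex.exp (Complex.I * (Complex.I * κ) * (t : ℂ)))) (Ioi (P.μp x)) :=
    fun κ hκ => (integrableOn_mul_exp (hK.integrable x hx) (hz κ hκ)).const_mul _
  rw [heq]
  refine ⟨integrable_finsetSum _ hint, ?_⟩
  rw [integral_finsetSum _ hint]
  refine Finset.sum_congr rfl fun κ hκ => ?_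
  rw [integral_const_mul, hK.representation x hx _ (hz κ hκ)]
  ring

end SLProblem

theorem mainTheorem1 (P : SLProblem) (hP : P.Admissible)
    (e : ℝ → ℂ → ℂ) (he : P.IsJostSolution e)
    (K : ℝ → ℝ → ℂ) (hK : P.IsJostKernel e K)
    (hβ : ∀ κ ∈ P.eigenvalues e, P.β₀ - P.β₁ * κ - P.β₂ * κ ^ 2 ≠ 0) :
    (P.eigenvalues e).Finite ∧
    (∀ κ ∈ P.eigenvalues e,
      IntegrableOn (fun x => ‖e x (Complex.I * κ)‖ ^ 2 * P.ρ x) (Ioi 0) ∧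
        0 < P.normInvSq e κ) ∧
    MemLp (fun l => P.S₀ l - P.S e l) ⊤ volume ∧
    (∃ F₀s : ℝ → ℂ, P.IsF₀s e F₀s) ∧
    ∀ F₀s : ℝ → ℂ, P.IsF₀s e F₀s →
      ∀ x : ℝ, 0 ≤ x → ∀ᵐ y ∂(volume.restrict (Ioi (P.μp x))),
        IntegrableOn (fun t => K x t * P.F₀ e F₀s (t + y)) (Ioi (P.μp x)) ∧
        P.F e F₀s x y + K x y + (∫ t in Ioi (P.μp x), K x t * P.F₀ e F₀s (t + y)) -
          (P.τ : ℂ) * (Ioi (P.μp x)).indicator (K x) (2 * P.a - y) = 0 := by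
  obtain ⟨d, p, r, hL⟩ := hP.exists_leading (SLProblem.coeff_ne_zero hβ)
  obtain ⟨f, hf, hf2, hF, hfF⟩ := hL.exists_isF₀s hP he hK
  have hfin := hK.finite_eigenvalues hP he hβ
  refine ⟨hfin, fun κ hκ => ⟨he.integrable_normSq hP (by simpa using hκ.1),
    he.normInvSq_pos hP hκ.1⟩, hK.memLp_S₀_sub_S hP he, ⟨f, hfF⟩, fun F₀s hF₀s x hx => ?_⟩
  obtain ⟨hint, hmain⟩ := hK.ae_equation hP he hβ hL.abs_le hf hf2 hF hx
  have huniq := SLProblem.isInverseFourierOn_unique isOpen_Ioi hF₀s hfF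
  have hμ := hP.μp_zero_le hx
  rw [ae_restrict_iff' measurableSet_Ioi]
  filter_upwards [hint, hmain, ae_comp_add_right huniq (P.μp x),
    ae_comp_add_right huniq (P.μm x)] with y h1 h2 h3 h4 hy
  have hy' : P.μp x < y := hy
  have hFs : P.Fs F₀s x y = P.cp x * f (y + P.μp x) + P.cm x * f (y + P.μm x) := by
    change P.cp x * F₀s (y + P.μp x) + P.cm x * F₀s (y + P.μm x) = _
    rw [h3 (show 2 * P.μp 0 < y + P.μp x by linarith)]
    -- Either μ⁻(x) ≥ μ⁺(x) keeps the second argument in the half-line where F₀s and f agree, or its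
    -- coefficient is 0.
    rcases hP.coef_cases x with h | h
    · rw [h4 (show 2 * P.μp 0 < y + P.μm x by linarith [h.2])]
    · simp [h.1]
  have hT : ∀ κ ∈ hfin.toFinset, 0 < κ := fun κ hκ => (hfin.mem_toFinset.1 hκ).1
  obtain ⟨h5, h6⟩ := hK.hasInt_eigenvalues hx _ hT (P.normSq e) y
  have hKf : IntegrableOn (fun t => K x t * f (t + y)) (Ioi (P.μp x)) := by
    rwa [P.Kz_mul K x fun t => f (t + y), integrable_indicator_iff measurableSet_Ioi] at h1
  have hae : (fun t => K x t * f (t + y) + K x t * ∑ κ ∈ hfin.toFinset,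
      ((P.normSq e κ * Real.exp (-(κ * (t + y))) : ℝ) : ℂ)) =ᵐ[volume.restrict (Ioi (P.μp x))]
      fun t => K x t * P.F₀ e F₀s (t + y) := by
    rw [EventuallyEq, ae_restrict_iff' measurableSet_Ioi]
    filter_upwards [ae_comp_add_right huniq y] with t ht ht'
    have ht'' : P.μp x < t := ht'
    rw [SLProblem.F₀, finsum_mem_eq_finite_toFinset_sum _ hfin,
      ht (show 2 * P.μp 0 < t + y by linarith), mul_add]
  refine ⟨(hKf.add h5).congr hae, ?_⟩
  have h7 := h2 hy
  rw [finsum_mem_eq_finite_toFinset_sum _ hfin, P.integral_Kz_mul K x fun t => f (t + y)] at h7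
  rw [← integral_congr_ae hae, integral_add hKf h5, h6, SLProblem.F, hFs,
    finsum_mem_eq_finite_toFinset_sum _ hfin]
  have h8 : P.Kz K x y = K x y := indicator_of_mem hy _
  have h9 : (Ioi (P.μp x)).indicator (K x) (2 * P.a - y) = P.Kz K x (2 * P.a - y) := rfl
  -- The kernel integral contributes e - e₀ at each eigenvalue and `F` contributes e₀; their sum is
  -- the e of `ae_equation`.
  have h10 : ∑ κ ∈ hfin.toFinset, (P.normSq e κ : ℂ) *
      (e x (Complex.I * κ) - P.e₀ x (Complex.I * κ)) * Real.exp (-(κ * y)) =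
      ∑ κ ∈ hfin.toFinset, (P.normSq e κ : ℂ) * e x (Complex.I * κ) * Real.exp (-(κ * y)) -
      ∑ κ ∈ hfin.toFinset, (P.normSq e κ : ℂ) * P.e₀ x (Complex.I * κ) *
        (Real.exp (-(κ * y)) : ℂ) := by
    rw [← Finset.sum_sub_distrib]
    exact Finset.sum_congr rfl fun κ _ => by ring
  rw [h8] at h7
  rw [h9, h10]
  linear_combination h7

end
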